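/- An instance of the (rooted) prize-collecting Steiner tree problem consists of a finite undirected graph $G=(V,E)$, edge costs $c:E\to\mathbb{R}_{\ge 0}$, a root $r\in V$ and penalties $\pi:V\to\mathbb{R}_{\ge 0}$; the goal is to find a tree $T\subseteq G$ containing $r$ that minimizes $\sum_{e\in E(T)}c(e)+\sum_{v\notin V(T)}\pi(v)$. (1) For every fixed integer $k\ge 0$ there is a polynomial-time algorithm that finds an optimal prize-collecting Steiner tree in every instance whose graph has treewidth at most $k$. (2) For $k\ge 1$ let $b_k$ be the number of partitions of a $k$-element set and $s_k$ the number of subgraphs of the complete graph on $k$ vertices. There is an absolute constant $C$ such that for every $k\ge 1$ there is an algorithm that, given an instance together with a tree decomposition of $G$ of width at most $k-1$ with node set $I$, finds an optimal prize-collecting Steiner tree in at most $C\,b_k^3\,s_k\,(|V|+|I|)$ steps; that is, in time $O(b_k^3 s_k|V|)$ when the decomposition has $O(|V|)$ nodes. Running times are measured on a unit-cost random access machine that handles natural numbers and reals by addition, subtraction and comparison; the graph, and the tree of the decomposition, are given by lists of their edges, and "polynomial" means polynomial in $|V|$. -/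

import Mathlib

open scoped NNReal

/-! ### Tree decompositions and treewidth -/

/-- A tree decomposition of `G` with nodes indexed by `I`. -/
structure TreeDecomposition {V : Type*} (G : SimpleGraph V) (I : Type*) where
  /-- the tree on the nodes -/
  tree : SimpleGraph I
  isTree : tree.IsTree
  /-- the bag of a node -/
  bag : I → Finset V
  exists_mem_bag : ∀ v : V, ∃ i, v ∈ bag i
  exists_edge_bag : ∀ u v : V, G.Adj u v → ∃ i, u ∈ bag i ∧ v ∈ bag i
  connected_nodes : ∀ v : V, (tree.induce {i | v ∈ bag i}).Connected

/-- The width: the size of the largest bag minus one. -/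
def TreeDecomposition.width {V : Type*} {G : SimpleGraph V} {I : Type*} [Fintype I]
    (D : TreeDecomposition G I) : ℕ :=
  (Finset.univ.sup fun i => (D.bag i).card) - 1

/-- The treewidth of a finite graph: the least width of a tree decomposition. (For a finite
graph the set below is never empty, since a single node with bag `V` is a decomposition.) -/
noncomputable def treewidth {V : Type*} [Finite V] (G : SimpleGraph V) : ℕ :=
  sInf {w : ℕ | ∃ (N : ℕ) (D : TreeDecomposition G (Fin N)), D.width = w}

/-- `b_k`: the number of partitions of a `k`-element set. -/
noncomputable def bellNum (k : ℕ) : ℕ :=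
  Nat.card (Finpartition (Finset.univ : Finset (Fin k)))

/-- `s_k`: the largest number of subgraphs of a graph with `k` vertices, i.e. the number of
subgraphs of the complete graph on `k` vertices. -/
noncomputable def subgraphNum (k : ℕ) : ℕ :=
  Nat.card (SimpleGraph.Subgraph (⊤ : SimpleGraph (Fin k)))

/-! ### The prize-collecting Steiner tree problem -/

/-- An instance of (rooted) prize-collecting Steiner tree on the vertex set `{0, …, n-1}`.
Only the values of `cost` on edges of `G` are ever used. -/
structure PCSTInstance where
  n : ℕ
  G : SimpleGraph (Fin n)
  root : Fin n
  cost : Sym2 (Fin n) → ℝ≥0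
  penalty : Fin n → ℝ≥0

namespace PCSTInstance

/-- A feasible solution is a subgraph of `G` that is a tree and contains the root. -/
def IsSolution (P : PCSTInstance) (T : P.G.Subgraph) : Prop :=
  P.root ∈ T.verts ∧ T.coe.IsTree

open Classical in
/-- The objective: the cost of the edges of `T` plus the penalties of the vertices not in `T`. -/
noncomputable def objective (P : PCSTInstance) (T : P.G.Subgraph) : ℝ≥0 :=
  (∑ e : Sym2 (Fin P.n) with e ∈ T.edgeSet, P.cost e) +
    ∑ v : Fin P.n with v ∉ T.verts, P.penalty v

/-- `T` is an optimal prize-collecting Steiner tree. -/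
def IsOptimal (P : PCSTInstance) (T : P.G.Subgraph) : Prop :=
  P.IsSolution T ∧ ∀ T' : P.G.Subgraph, P.IsSolution T' → P.objective T ≤ P.objective T'

end PCSTInstance

/-! ### The machine model

A unit-cost random access machine whose memory consists of natural number registers, arrays of
natural numbers, real registers and arrays of reals, all indexed by `ℕ` (a program mentions only
finitely many registers and arrays; the cells of an array are addressed indirectly through a
register). The programs are structured, with branching and loops instead of jumps. The arithmetic
on both sorts is restricted to addition and subtraction, and reals can otherwise only be
compared: there is no multiplication, no rounding and no conversion between the sorts. So the
numbers that occur after `t` steps have at most `t` bits more than the longest number given to or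
written in the program, and for rational data a polynomial number of steps is polynomial time
also in the bit model. -/

namespace RAM

/-- A memory configuration. -/
structure State where
  /-- natural number registers -/
  nreg : ℕ → ℕ
  /-- real registers -/
  rreg : ℕ → ℝ
  /-- `narr a i` is cell `i` of the natural number array `a` -/
  narr : ℕ → ℕ → ℕ
  /-- `rarr a i` is cell `i` of the real array `a` -/
  rarr : ℕ → ℕ → ℝ

/-- Elementary instructions; every one of them takes one step. -/
inductive Instr where
  /-- `nreg x := c` -/
  | natConst (x c : ℕ)
  /-- `nreg x := nreg y + nreg z` -/
  | natAdd (x y z : ℕ)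
  /-- `nreg x := nreg y - nreg z`, truncated at `0` -/
  | natSub (x y z : ℕ)
  /-- `nreg x := narr a [nreg y]` -/
  | natLoad (x a y : ℕ)
  /-- `narr a [nreg y] := nreg x` -/
  | natStore (a y x : ℕ)
  /-- `rreg x := 0` -/
  | realZero (x : ℕ)
  /-- `rreg x := rreg y + rreg z` -/
  | realAdd (x y z : ℕ)
  /-- `rreg x := rreg y - rreg z` -/
  | realSub (x y z : ℕ)
  /-- `rreg x := rarr a [nreg y]` -/
  | realLoad (x a y : ℕ)
  /-- `rarr a [nreg y] := rreg x` -/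
  | realStore (a y x : ℕ)

/-- The effect of an elementary instruction. -/
noncomputable def Instr.apply : Instr → State → State
  | natConst x c, s => { s with nreg := Function.update s.nreg x c }
  | natAdd x y z, s => { s with nreg := Function.update s.nreg x (s.nreg y + s.nreg z) }
  | natSub x y z, s => { s with nreg := Function.update s.nreg x (s.nreg y - s.nreg z) }
  | natLoad x a y, s => { s with nreg := Function.update s.nreg x (s.narr a (s.nreg y)) }
  | natStore a y x, s => { s with
      narr := Function.update s.narr a (Function.update (s.narr a) (s.nreg y) (s.nreg x)) }
  | realZero x, s => { s with rreg := Function.update s.rreg x 0 }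
  | realAdd x y z, s => { s with rreg := Function.update s.rreg x (s.rreg y + s.rreg z) }
  | realSub x y z, s => { s with rreg := Function.update s.rreg x (s.rreg y - s.rreg z) }
  | realLoad x a y, s => { s with rreg := Function.update s.rreg x (s.rarr a (s.nreg y)) }
  | realStore a y x, s => { s with
      rarr := Function.update s.rarr a (Function.update (s.rarr a) (s.nreg y) (s.rreg x)) }

/-- Tests; every evaluation of a test takes one step. -/
inductive Test where
  /-- `nreg x < nreg y` -/
  | natLt (x y : ℕ)
  /-- `rreg x < rreg y` -/
  | realLt (x y : ℕ)

/-- The truth of a test in a state. -/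
def Test.Holds : Test → State → Prop
  | natLt x y, s => s.nreg x < s.nreg y
  | realLt x y, s => s.rreg x < s.rreg y

/-- Programs. -/
inductive Program where
  | instr (i : Instr)
  | seq (p q : Program)
  | ite (b : Test) (p q : Program)
  | loop (b : Test) (p : Program)

/-- `Exec p s t s'`: started in state `s`, the program `p` halts in state `s'` after exactly
`t` steps. (`loop b p` is "while `b` do `p`".) -/
inductive Exec : Program → State → ℕ → State → Prop where
  | instr (i : Instr) (s : State) : Exec (.instr i) s 1 (i.apply s)
  | seq {p q : Program} {s s' s'' : State} {t t' : ℕ} :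
      Exec p s t s' → Exec q s' t' s'' → Exec (.seq p q) s (t + t') s''
  | ite_true {b : Test} {p q : Program} {s s' : State} {t : ℕ} :
      b.Holds s → Exec p s t s' → Exec (.ite b p q) s (t + 1) s'
  | ite_false {b : Test} {p q : Program} {s s' : State} {t : ℕ} :
      ¬ b.Holds s → Exec q s t s' → Exec (.ite b p q) s (t + 1) s'
  | loop_true {b : Test} {p : Program} {s s' s'' : State} {t t' : ℕ} :
      b.Holds s → Exec p s t s' → Exec (.loop b p) s' t' s'' →
      Exec (.loop b p) s (t + t' + 1) s''
  | loop_false {b : Test} {p : Program} {s : State} :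
      ¬ b.Holds s → Exec (.loop b p) s 1 s

end RAM

/-! ### Input and output -/

/-- `es` lists every edge of `G` exactly once, in any order and each with any orientation. -/
def IsEdgeList {V : Type*} {G : SimpleGraph V} (es : List G.Dart) : Prop :=
  (es.map fun d => d.edge).Nodup ∧ ∀ e ∈ G.edgeSet, ∃ d ∈ es, d.edge = e

/-- `bags` lists, for every node, the elements of its bag without repetition in any order. -/
def IsBagList {V : Type*} [DecidableEq V] {G : SimpleGraph V} {N : ℕ}
    (D : TreeDecomposition G (Fin N)) (bags : Fin N → List V) : Prop :=
  ∀ i, (bags i).Nodup ∧ (bags i).toFinset = D.bag i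

namespace PCSTInstance

/-- The initial memory for an instance whose graph is given by the edge list `es`: registers
`0`, `1`, `2` hold the number of vertices, the number of edges and the root; the natural number
arrays `0`, `1` hold the endpoints of the edges; the real arrays `0`, `1` hold the edge costs
(in the order of `es`) and the penalties. Everything else is `0`. -/
noncomputable def input (P : PCSTInstance) (es : List P.G.Dart) : RAM.State where
  nreg
    | 0 => P.n
    | 1 => es.length
    | 2 => P.root
    | _ => 0
  rreg _ := 0
  narr
    | 0 => fun i => (es.map fun d => (d.fst : ℕ)).getD i 0
    | 1 => fun i => (es.map fun d => (d.snd : ℕ)).getD i 0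
    | _ => fun _ => 0
  rarr
    | 0 => fun i => (es.map fun d => (P.cost d.edge : ℝ)).getD i 0
    | 1 => fun i => (List.ofFn fun v => (P.penalty v : ℝ)).getD i 0
    | _ => fun _ => 0

/-- The initial memory for an instance that comes with a tree decomposition `D`: as in `input`,
and moreover register `3` holds the number of nodes, the natural number arrays `2`, `3` hold the
endpoints of the edges of the tree (listed by `ts`), array `4` holds the sizes of the bags, and
array `5` the elements of all bags, one bag after the other. -/
noncomputable def inputWithDecomposition (P : PCSTInstance) (es : List P.G.Dart) {N : ℕ}
    (D : TreeDecomposition P.G (Fin N)) (ts : List D.tree.Dart)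
    (bags : Fin N → List (Fin P.n)) : RAM.State where
  nreg
    | 3 => N
    | x => (P.input es).nreg x
  rreg := (P.input es).rreg
  narr
    | 2 => fun i => (ts.map fun d => (d.fst : ℕ)).getD i 0
    | 3 => fun i => (ts.map fun d => (d.snd : ℕ)).getD i 0
    | 4 => fun i => (List.ofFn fun j => (bags j).length).getD i 0
    | 5 => fun i => ((List.ofFn bags).flatten.map fun v => (v : ℕ)).getD i 0
    | a => (P.input es).narr a
  rarr := (P.input es).rarr

/-- The memory `s` contains an optimal prize-collecting Steiner tree of `P`: the natural number
arrays `6` and `7` hold the indicators of its vertices and of its edges (in the order of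
`es`). -/
def IsOutput (P : PCSTInstance) (es : List P.G.Dart) (s : RAM.State) : Prop :=
  ∃ T : P.G.Subgraph, P.IsOptimal T ∧
    (∀ v : Fin P.n, (s.narr 6 v = 1 ∧ v ∈ T.verts) ∨ (s.narr 6 v = 0 ∧ v ∉ T.verts)) ∧
    (∀ i : Fin es.length, (s.narr 7 i = 1 ∧ (es.get i).edge ∈ T.edgeSet) ∨
      (s.narr 7 i = 0 ∧ (es.get i).edge ∉ T.edgeSet))

/-- Started in the memory `s`, the program `A` halts after at most `bound` steps and outputs an
optimal prize-collecting Steiner tree of `P`. -/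
def SolvedBy (P : PCSTInstance) (es : List P.G.Dart) (A : RAM.Program) (s : RAM.State)
    (bound : ℕ) : Prop :=
  ∃ (t : ℕ) (s' : RAM.State), RAM.Exec A s t s' ∧ t ≤ bound ∧ P.IsOutput es s'

end PCSTInstance

/-!
Both algorithms run the same dynamic program. It does not work on a tree decomposition but on an
*elimination scheme* (`Scheme`): an order of the vertices, starting with the root, in which every
vertex `v` has a bag of earlier vertices that contains the root and the earlier neighbours of `v`,
and of any two members of which the earlier one is in the bag of the later one; moreover a colouring
with `K` colours that distinguishes `v` and the members of its bag. The vertices are eliminated from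
the last to the first. A vertex hands what is known about it to its parent, the latest member of
its bag.

*The dynamic program.* A state (`St`) is a partial equivalence relation on the colours: its domain
tells which vertices of the bag belong to the solution, its classes which of them are already
connected. To eliminate a vertex one chooses (`Choice`) its state, the edges to its bag that are
taken, and a state of its parent; the parent's new state is the transitive closure, restricted to
the bag. A vertex of the solution that loses contact to its bag is not admissible, so that all
vertices of the solution stay connected to the root, which is in all bags (`run_connected`);
conversely every connected subgraph containing the root has a run (`isRun_stateOf`). Values are
pairs (objective, number of edges) in lexicographic order. Hence the best run yields a connected
subgraph that is optimal and has the least number of edges, so it is a tree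
(`isOptimal_of_value_le`), and cycles need not be excluded by the states. `Complete` and `Sound`
express that the tables bound all runs and record the choices of a best one; `exists_optimal_run`
is the outcome.

*On the machine.* The number of colours is fixed in the program, so everything that depends on
colours, states and choices only is unrolled into straight-line code: the loop over the vertices
dispatches on the local data of the vertex (`switchN`, `switchSet`) to code in which all admissible
choices and their effects are constants. Thus an elimination costs a constant number of
steps per choice, besides `O(K)` steps for the dispatching and for every edge (`solve_runs`).
A loop-free program is analysed by computing its effect (`Program.run`), loops by an invariant
(`Runs.forUp`), and what a program leaves unchanged is read off syntactically (`Agree`).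

*With a tree decomposition of width at most `k - 1`.* The nodes are ordered by stripping leaves
(`orderNodes_runs`). Going through them in reverse, every new member of a bag is placed next, its
bag being the earlier members of the node together with the root (`PlacedUpTo`). A node and the
root have at most `k + 1` vertices, so `k + 1` colours suffice, and a free colour is found greedily.
The number of choices for `k + 1` colours is at most `b_k ^ 2 * 2 ^ (5 * k + 3)`
(`card_Choice_le`); there is room for this and for the factors polynomial in `k`, since
`s_k ≥ 2 ^ (k * (k - 1) / 2)` (`pow_le_subgraphNum`).

*With bounded treewidth only.* A scheme is searched for. Suppose that the vertices in `F` have been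
placed, and that every component of the graph without `F` has at most `2 * q + 1` neighbours
in `F`. If the graph has a scheme with `q` colours, then there are at most `q + 1` further vertices,
at least one of them new, after whose placement this is still true: a vertex of a component, and
those members of a bag and its owner that lie in this component, where the bag is such that it
separates the neighbours of the component into halves (`exists_balanced`, `exists_extension`). As `q` is fixed, all `(q + 1)`-tuples can be tried in polynomial time. The bag
of a vertex that is placed consists of the root and the earlier vertices that can be reached through
vertices not yet placed; it has at most `3 * q + 2` members, so `3 * q + 3` colours suffice
(`search_runs`).
-/

/-! ### Reasoning about programs -/

namespace RAM

/-- Overwrite one natural number register. -/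
def State.setN (s : State) (x v : ℕ) : State := { s with nreg := Function.update s.nreg x v }

@[simp] theorem State.setN_nreg (s : State) (x v y : ℕ) :
    (s.setN x v).nreg y = if y = x then v else s.nreg y := by
  simp [State.setN, Function.update_apply]
@[simp] theorem State.setN_rreg (s : State) (x v : ℕ) : (s.setN x v).rreg = s.rreg := rfl
@[simp] theorem State.setN_narr (s : State) (x v : ℕ) : (s.setN x v).narr = s.narr := rfl
@[simp] theorem State.setN_rarr (s : State) (x v : ℕ) : (s.setN x v).rarr = s.rarr := rfl

/-- The natural number registers written by an instruction. -/
@[simp] def Instr.wN : Instr → ℕ → Prop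
  | natConst x _, y | natAdd x _ _, y | natSub x _ _, y | natLoad x _ _, y => y = x
  | _, _ => False

/-- The real registers written by an instruction. -/
@[simp] def Instr.wR : Instr → ℕ → Prop
  | realZero x, y | realAdd x _ _, y | realSub x _ _, y | realLoad x _ _, y => y = x
  | _, _ => False

/-- The natural number arrays written by an instruction. -/
@[simp] def Instr.wNA : Instr → ℕ → Prop
  | natStore a _ _, b => b = a
  | _, _ => False

/-- The real arrays written by an instruction. -/
@[simp] def Instr.wRA : Instr → ℕ → Prop
  | realStore a _ _, b => b = a
  | _, _ => False

namespace Program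

/-- The natural number registers that a program may write. -/
@[simp] def wN : Program → ℕ → Prop
  | instr i, x => i.wN x
  | seq p q, x | ite _ p q, x => p.wN x ∨ q.wN x
  | loop _ p, x => p.wN x

/-- The real registers that a program may write. -/
@[simp] def wR : Program → ℕ → Prop
  | instr i, x => i.wR x
  | seq p q, x | ite _ p q, x => p.wR x ∨ q.wR x
  | loop _ p, x => p.wR x

/-- The natural number arrays that a program may write. -/
@[simp] def wNA : Program → ℕ → Prop
  | instr i, x => i.wNA x
  | seq p q, x | ite _ p q, x => p.wNA x ∨ q.wNA x
  | loop _ p, x => p.wNA x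

/-- The real arrays that a program may write. -/
@[simp] def wRA : Program → ℕ → Prop
  | instr i, x => i.wRA x
  | seq p q, x | ite _ p q, x => p.wRA x ∨ q.wRA x
  | loop _ p, x => p.wRA x

/-- A program without loops. -/
@[simp] def LoopFree : Program → Prop
  | instr _ => True
  | seq p q | ite _ p q => p.LoopFree ∧ q.LoopFree
  | loop _ _ => False

/-- An upper bound for the number of steps of a loop-free program. -/
@[simp] def len : Program → ℕ
  | instr _ => 1
  | seq p q => p.len + q.len
  | ite _ p q => max p.len q.len + 1
  | loop _ _ => 0

open Classical in
/-- The effect of a loop-free program (the value at a loop is irrelevant). -/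
@[simp] noncomputable def run : Program → State → State
  | instr i, s => i.apply s
  | seq p q, s => q.run (p.run s)
  | ite b p q, s => if b.Holds s then p.run s else q.run s
  | loop _ _, s => s

end Program

/-- `s` and `s'` agree on everything that `p` does not write. -/
structure Agree (p : Program) (s s' : State) : Prop where
  n : ∀ x, ¬ p.wN x → s'.nreg x = s.nreg x
  r : ∀ x, ¬ p.wR x → s'.rreg x = s.rreg x
  na : ∀ x, ¬ p.wNA x → s'.narr x = s.narr x
  ra : ∀ x, ¬ p.wRA x → s'.rarr x = s.rarr x

theorem Agree.refl (p : Program) (s : State) : Agree p s s :=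
  ⟨fun _ _ => rfl, fun _ _ => rfl, fun _ _ => rfl, fun _ _ => rfl⟩

theorem Agree.trans {p : Program} {s s' s'' : State} (h : Agree p s s') (h' : Agree p s' s'') :
    Agree p s s'' :=
  ⟨fun x hx => (h'.n x hx).trans (h.n x hx), fun x hx => (h'.r x hx).trans (h.r x hx),
    fun x hx => (h'.na x hx).trans (h.na x hx), fun x hx => (h'.ra x hx).trans (h.ra x hx)⟩

theorem Agree.mono {p q : Program} {s s' : State} (h : Agree p s s')
    (h₁ : ∀ x, p.wN x → q.wN x) (h₂ : ∀ x, p.wR x → q.wR x) (h₃ : ∀ x, p.wNA x → q.wNA x)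
    (h₄ : ∀ x, p.wRA x → q.wRA x) : Agree q s s' :=
  ⟨fun x hx => h.n x fun h' => hx (h₁ x h'), fun x hx => h.r x fun h' => hx (h₂ x h'),
    fun x hx => h.na x fun h' => hx (h₃ x h'), fun x hx => h.ra x fun h' => hx (h₄ x h')⟩

attribute [simp] Instr.apply

@[simp] theorem Test.holds_natLt {x y : ℕ} {s : State} :
    (natLt x y).Holds s ↔ s.nreg x < s.nreg y := .rfl

theorem agree_apply (i : Instr) (s : State) : Agree (.instr i) s (i.apply s) := by
  constructor <;> intro x hx <;> cases i <;>
    simp_all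

theorem Exec.agree {p : Program} {s s' : State} {t : ℕ} (h : Exec p s t s') : Agree p s s' := by
  induction h with
  | instr i s => exact agree_apply i s
  | seq _ _ ih₁ ih₂ =>
    exact (ih₁.mono (by simp +contextual) (by simp +contextual) (by simp +contextual)
      (by simp +contextual)).trans (ih₂.mono (by simp +contextual) (by simp +contextual)
      (by simp +contextual) (by simp +contextual))
  | ite_true _ _ ih =>
    exact ih.mono (by simp +contextual) (by simp +contextual) (by simp +contextual)
      (by simp +contextual)
  | ite_false _ _ ih =>
    exact ih.mono (by simp +contextual) (by simp +contextual) (by simp +contextual)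
      (by simp +contextual)
  | loop_true _ _ _ ih₁ ih₂ =>
    exact (ih₁.mono (by simp) (by simp) (by simp) (by simp)).trans ih₂
  | loop_false _ => exact Agree.refl _ _

theorem Program.LoopFree.exec {p : Program} (h : p.LoopFree) (s : State) :
    ∃ t ≤ p.len, Exec p s t (p.run s) := by
  induction p generalizing s with
  | instr i => exact ⟨1, le_rfl, Exec.instr i s⟩
  | seq p q ihp ihq =>
    obtain ⟨t, ht, hp⟩ := ihp h.1 s
    obtain ⟨t', ht', hq⟩ := ihq h.2 (p.run s)
    exact ⟨t + t', by simp; omega, Exec.seq hp hq⟩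
  | ite b p q ihp ihq =>
    by_cases hb : b.Holds s
    · obtain ⟨t, ht, hp⟩ := ihp h.1 s
      exact ⟨t + 1, by simp [ht], by simpa [hb] using Exec.ite_true hb hp⟩
    · obtain ⟨t, ht, hp⟩ := ihq h.2 s
      exact ⟨t + 1, by simp [ht], by simpa [hb] using Exec.ite_false hb hp⟩
  | loop b p => exact h.elim

theorem Program.LoopFree.agree {p : Program} (h : p.LoopFree) (s : State) :
    Agree p s (p.run s) :=
  have ⟨_, _, he⟩ := h.exec s
  he.agree

/-- Started in `s`, the program `p` halts after at most `t` steps in a state satisfying `Q`. -/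
def Runs (p : Program) (s : State) (t : ℕ) (Q : State → Prop) : Prop :=
  ∃ (t' : ℕ) (s' : State), Exec p s t' s' ∧ t' ≤ t ∧ Q s'

theorem Runs.mono {p : Program} {s : State} {t t' : ℕ} {Q Q' : State → Prop}
    (h : Runs p s t Q) (ht : t ≤ t') (hQ : ∀ s', Agree p s s' → Q s' → Q' s') :
    Runs p s t' Q' :=
  have ⟨u, s', he, hu, hq⟩ := h
  ⟨u, s', he, hu.trans ht, hQ s' he.agree hq⟩

theorem Runs.agree {p : Program} {s : State} {t : ℕ} {Q : State → Prop} (h : Runs p s t Q) :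
    Runs p s t fun s' => Q s' ∧ Agree p s s' :=
  h.mono le_rfl fun _ ha hq => ⟨hq, ha⟩

theorem Runs.of_run {p : Program} {s : State} {Q : State → Prop} (hp : p.LoopFree)
    (h : Q (p.run s)) : Runs p s p.len Q :=
  have ⟨t, ht, he⟩ := hp.exec s
  ⟨t, _, he, ht, h⟩

theorem Runs.of_run_le {p : Program} {s : State} {t : ℕ} {Q : State → Prop} (hp : p.LoopFree)
    (ht : p.len ≤ t) (h : Q (p.run s)) : Runs p s t Q :=
  (Runs.of_run hp h).mono ht fun _ _ h => h

theorem Runs.seq {p q : Program} {s : State} {t₁ t₂ : ℕ} {Q : State → Prop}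
    (h : Runs p s t₁ fun s' => Agree p s s' → Runs q s' t₂ Q) :
    Runs (.seq p q) s (t₁ + t₂) Q := by
  obtain ⟨t, s', he, ht, t', s'', he', ht', hq⟩ := h.mono le_rfl fun _ ha h => h ha
  exact ⟨t + t', s'', he.seq he', by omega, hq⟩

theorem Runs.ite {b : Test} {p q : Program} {s : State} {t : ℕ} {Q : State → Prop}
    (h₁ : b.Holds s → Runs p s t Q) (h₂ : ¬ b.Holds s → Runs q s t Q) :
    Runs (.ite b p q) s (t + 1) Q := by
  by_cases hb : b.Holds s
  · obtain ⟨t', s', he, ht, hq⟩ := h₁ hb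
    exact ⟨t' + 1, s', .ite_true hb he, by omega, hq⟩
  · obtain ⟨t', s', he, ht, hq⟩ := h₂ hb
    exact ⟨t' + 1, s', .ite_false hb he, by omega, hq⟩

/-! The register `ONE` holds the constant `1`, the register `ZERO` the constant `0`. -/

local notation "ONE" => (4 : ℕ)
local notation "ZERO" => (5 : ℕ)

/-- `for i < nreg b do p`, where the register `ONE` holds `1`. -/
def forUp (i b : ℕ) (p : Program) : Program :=
  .seq (.instr (.natConst i 0)) (.loop (.natLt i b) (.seq p (.instr (.natAdd i i ONE))))

@[simp] theorem forUp_wN {i b : ℕ} {p : Program} {x : ℕ} :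
    (forUp i b p).wN x ↔ x = i ∨ p.wN x := by
  simp only [forUp, Program.wN, Instr.wN]; tauto
@[simp] theorem forUp_wR {i b : ℕ} {p : Program} {x : ℕ} : (forUp i b p).wR x ↔ p.wR x := by
  simp [forUp]
@[simp] theorem forUp_wNA {i b : ℕ} {p : Program} {x : ℕ} : (forUp i b p).wNA x ↔ p.wNA x := by
  simp [forUp]
@[simp] theorem forUp_wRA {i b : ℕ} {p : Program} {x : ℕ} : (forUp i b p).wRA x ↔ p.wRA x := by
  simp [forUp]

/-- The rule for counting loops: `I j` is the invariant before the `j`-th round. What the loop does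
not write is known to be unchanged throughout. -/
theorem Runs.forUp {i b : ℕ} {p : Program} {s : State} (τ : ℕ) (I : ℕ → State → Prop)
    (hi : ¬ p.wN i) (hb : ¬ p.wN b) (h1 : ¬ p.wN ONE) (hib : b ≠ i) (hi1 : ONE ≠ i)
    (hone : s.nreg ONE = 1) (h0 : I 0 (s.setN i 0))
    (hstep : ∀ j s', j < s.nreg b → s'.nreg i = j → Agree (forUp i b p) s s' → I j s' →
      Runs p s' τ fun s'' => I (j + 1) (s''.setN i (j + 1))) :
    Runs (RAM.forUp i b p) s (s.nreg b * (τ + 2) + 2) fun s' => I (s.nreg b) s' := by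
  have key : ∀ d j s', j + d = s.nreg b → s'.nreg i = j → Agree (RAM.forUp i b p) s s' → I j s' →
      Runs (.loop (.natLt i b) (.seq p (.instr (.natAdd i i ONE)))) s' (d * (τ + 2) + 1)
        fun s'' => I (s.nreg b) s'' := by
    intro d
    induction d with
    | zero =>
      intro j s' hj hji ha hI
      refine ⟨1, s', .loop_false ?_, by simp, ?_⟩
      · have := ha.n b (by simp [hib, hb])
        simp only [Test.Holds]; omega
      · simpa [← hj] using hI
    | succ d ih =>
      intro j s' hj hji ha hI
      have hb' := ha.n b (by simp [hib, hb])
      have hone' := ha.n ONE (by simp [hi1, h1])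
      obtain ⟨t, s₁, he, ht, hI'⟩ := hstep j s' (by omega) hji ha hI
      have hs : (Instr.natAdd i i ONE).apply s₁ = s₁.setN i (j + 1) := by
        have e1 := he.agree.n i hi
        have e2 := he.agree.n ONE h1
        simp [State.setN, e1, e2, hji, hone', hone]
      have he' : Exec (.seq p (.instr (.natAdd i i ONE))) s' (t + 1) (s₁.setN i (j + 1)) :=
        he.seq (hs ▸ Exec.instr _ _)
      obtain ⟨t', s₂, he₂, ht', hQ⟩ := ih (j + 1) (s₁.setN i (j + 1)) (by omega) (by simp)
        (ha.trans (he'.agree.mono (fun x hx => by simp at hx; simp; tauto)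
          (fun x hx => by simpa using hx) (fun x hx => by simpa using hx)
          (fun x hx => by simpa using hx))) hI'
      refine ⟨t + 1 + t' + 1, s₂, .loop_true ?_ he' he₂, ?_, hQ⟩
      · simp only [Test.Holds]; omega
      · ring_nf; ring_nf at ht'; omega
  have hs : (Instr.natConst i 0).apply s = s.setN i 0 := rfl
  obtain ⟨t, s', he, ht, hQ⟩ := key (s.nreg b) 0 (s.setN i 0) (by simp) (by simp)
    ⟨fun x hx => by simp at hx; simp [hx], fun _ _ => rfl, fun _ _ => rfl, fun _ _ => rfl⟩ h0
  exact ⟨1 + t, s', .seq (hs ▸ Exec.instr _ _) he, by omega, hQ⟩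

/-! ### Straight-line programs generated from lists, and dispatching -/

/-- A program that does nothing (it only uses the scratch register `6`). -/
def skip : Program := .instr (.natConst 6 0)

/-- Run the programs of a list one after the other. -/
def seqs : List Program → Program
  | [] => skip
  | p :: l => .seq p (seqs l)

@[simp] theorem skip_wN (x : ℕ) : skip.wN x ↔ x = 6 := by simp [skip]
@[simp] theorem skip_wR (x : ℕ) : ¬ skip.wR x := by simp [skip]
@[simp] theorem skip_wNA (x : ℕ) : ¬ skip.wNA x := by simp [skip]
@[simp] theorem skip_wRA (x : ℕ) : ¬ skip.wRA x := by simp [skip]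
@[simp] theorem skip_loopFree : skip.LoopFree := trivial
@[simp] theorem skip_len : skip.len = 1 := rfl
@[simp] theorem skip_run (s : State) : skip.run s = s.setN 6 0 := rfl

@[simp] theorem seqs_wN (l : List Program) (x : ℕ) :
    (seqs l).wN x ↔ x = 6 ∨ ∃ p ∈ l, p.wN x := by
  induction l with
  | nil => simp [seqs]
  | cons p l ih => simp [seqs, ih]; tauto
@[simp] theorem seqs_wR (l : List Program) (x : ℕ) : (seqs l).wR x ↔ ∃ p ∈ l, p.wR x := by
  induction l with
  | nil => simp [seqs]
  | cons p l ih => simp [seqs, ih]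
@[simp] theorem seqs_wNA (l : List Program) (x : ℕ) : (seqs l).wNA x ↔ ∃ p ∈ l, p.wNA x := by
  induction l with
  | nil => simp [seqs]
  | cons p l ih => simp [seqs, ih]
@[simp] theorem seqs_wRA (l : List Program) (x : ℕ) : (seqs l).wRA x ↔ ∃ p ∈ l, p.wRA x := by
  induction l with
  | nil => simp [seqs]
  | cons p l ih => simp [seqs, ih]
@[simp] theorem seqs_loopFree (l : List Program) : (seqs l).LoopFree ↔ ∀ p ∈ l, p.LoopFree := by
  induction l with
  | nil => simp [seqs]
  | cons p l ih => simp [seqs, ih]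

theorem seqs_len_le {l : List Program} {c : ℕ} (h : ∀ p ∈ l, p.len ≤ c) :
    (seqs l).len ≤ l.length * c + 1 := by
  induction l with
  | nil => simp [seqs]
  | cons p l ih =>
    have := ih fun q hq => h q (by simp [hq])
    have := h p (by simp)
    simp only [seqs, Program.len, List.length_cons]
    nlinarith

theorem seqs_map_len_le {α : Type*} {l : List α} {f : α → Program} {c : ℕ}
    (h : ∀ a ∈ l, (f a).len ≤ c) : (seqs (l.map f)).len ≤ l.length * c + 1 := by
  have := seqs_len_le (l := l.map f) (c := c) (by simpa using h)
  simpa using this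

/-- A sequence of instructions. -/
def block (l : List Instr) : Program := seqs (l.map .instr)

@[simp] theorem block_wN (l : List Instr) (x : ℕ) :
    (block l).wN x ↔ x = 6 ∨ ∃ i ∈ l, i.wN x := by simp [block]
@[simp] theorem block_wR (l : List Instr) (x : ℕ) : (block l).wR x ↔ ∃ i ∈ l, i.wR x := by
  simp [block]
@[simp] theorem block_wNA (l : List Instr) (x : ℕ) : (block l).wNA x ↔ ∃ i ∈ l, i.wNA x := by
  simp [block]
@[simp] theorem block_wRA (l : List Instr) (x : ℕ) : (block l).wRA x ↔ ∃ i ∈ l, i.wRA x := by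
  simp [block]
@[simp] theorem block_loopFree (l : List Instr) : (block l).LoopFree := by simp [block]
@[simp] theorem block_len (l : List Instr) : (block l).len = l.length + 1 := by
  induction l with
  | nil => rfl
  | cons i l ih =>
    simp only [block, List.map_cons, seqs, Program.len, List.length_cons] at ih ⊢
    omega
@[simp] theorem block_run_nil (s : State) : (block []).run s = s.setN 6 0 := rfl
@[simp] theorem block_run_cons (i : Instr) (l : List Instr) (s : State) :
    (block (i :: l)).run s = (block l).run (i.apply s) := rfl

/-- The invariant rule for unrolled loops: `I l'` holds after the members of `l'` have been
treated. The scratch register `6` must be irrelevant for `I`. -/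
theorem run_seqs_induction {α : Type*} (l : List α) (f : α → Program)
    (I : List α → State → Prop) (s : State) (h0 : I [] s)
    (hskip : ∀ l' s', I l' s' → I l' (s'.setN 6 0))
    (hstep : ∀ l' a s', a ∈ l → l' ++ [a] <+: l → I l' s' → I (l' ++ [a]) ((f a).run s')) :
    I l ((seqs (l.map f)).run s) := by
  suffices h : ∀ l₂ l₁ s, l₁ ++ l₂ = l → I l₁ s → I l ((seqs (l₂.map f)).run s) from
    h l [] s rfl h0
  intro l₂
  induction l₂ with
  | nil =>
    intro l₁ s hl hI
    simp only [List.append_nil] at hl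
    subst hl
    simpa [seqs] using hskip _ _ hI
  | cons a l₂ ih =>
    intro l₁ s hl hI
    have := ih (l₁ ++ [a]) ((f a).run s) (by simpa using hl)
      (hstep l₁ a s (by simp [← hl]) ⟨l₂, by simpa using hl⟩ hI)
    simpa [seqs] using this

/-- If register `x` holds the constant `c` then `p` else `q`; register `7` is scratch. -/
def ifEq (x c : ℕ) (p q : Program) : Program :=
  .seq (.instr (.natConst 7 c)) (.ite (.natLt x 7) q (.ite (.natLt 7 x) q p))

/-- Run `f j` where `j < m` is the content of register `x`; register `7` is scratch. -/
def switchN (x : ℕ) : ℕ → (ℕ → Program) → Program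
  | 0, _ => skip
  | m + 1, f => ifEq x m (f m) (switchN x m f)

@[simp] theorem ifEq_wN (x c : ℕ) (p q : Program) (y : ℕ) :
    (ifEq x c p q).wN y ↔ y = 7 ∨ p.wN y ∨ q.wN y := by
  simp [ifEq]; tauto
@[simp] theorem ifEq_wNA (x c : ℕ) (p q : Program) (y : ℕ) :
    (ifEq x c p q).wNA y ↔ p.wNA y ∨ q.wNA y := by
  simp [ifEq]; tauto
@[simp] theorem ifEq_wRA (x c : ℕ) (p q : Program) (y : ℕ) :
    (ifEq x c p q).wRA y ↔ p.wRA y ∨ q.wRA y := by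
  simp [ifEq]; tauto
@[simp] theorem ifEq_loopFree (x c : ℕ) (p q : Program) :
    (ifEq x c p q).LoopFree ↔ p.LoopFree ∧ q.LoopFree := by
  simp [ifEq]; tauto
theorem ifEq_len (x c : ℕ) (p q : Program) : (ifEq x c p q).len ≤ max p.len q.len + 3 := by
  simp [ifEq]; omega

theorem ifEq_run (x c : ℕ) (p q : Program) (s : State) (hx : x ≠ 7) :
    (ifEq x c p q).run s =
      if s.nreg x = c then p.run (s.setN 7 c) else q.run (s.setN 7 c) := by
  have hs : (Instr.natConst 7 c).apply s = s.setN 7 c := rfl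
  simp only [ifEq, Program.run, hs, Test.Holds]
  rcases lt_trichotomy (s.nreg x) c with h | h | h
  · simp [hx, h, h.ne]
  · simp [hx, h]
  · simp [hx, h, h.ne']

@[simp] theorem switchN_wN (x m : ℕ) (f : ℕ → Program) (y : ℕ) :
    (switchN x m f).wN y ↔ y = 6 ∨ (0 < m ∧ y = 7) ∨ ∃ j < m, (f j).wN y := by
  induction m with
  | zero => simp [switchN]
  | succ m ih => rw [Nat.exists_lt_succ_right]; simp [switchN, ih]; grind
@[simp] theorem switchN_wNA (x m : ℕ) (f : ℕ → Program) (y : ℕ) :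
    (switchN x m f).wNA y ↔ ∃ j < m, (f j).wNA y := by
  induction m with
  | zero => simp [switchN]
  | succ m ih => rw [Nat.exists_lt_succ_right]; simp [switchN, ih, or_comm]
@[simp] theorem switchN_wRA (x m : ℕ) (f : ℕ → Program) (y : ℕ) :
    (switchN x m f).wRA y ↔ ∃ j < m, (f j).wRA y := by
  induction m with
  | zero => simp [switchN]
  | succ m ih => rw [Nat.exists_lt_succ_right]; simp [switchN, ih, or_comm]
@[simp] theorem switchN_loopFree (x m : ℕ) (f : ℕ → Program) :
    (switchN x m f).LoopFree ↔ ∀ j < m, (f j).LoopFree := by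
  induction m with
  | zero => simp [switchN]
  | succ m ih => rw [Nat.forall_lt_succ_right]; simp [switchN, ih, and_comm]
theorem switchN_len {x m : ℕ} {f : ℕ → Program} {c : ℕ} (h : ∀ j < m, (f j).len ≤ c) :
    (switchN x m f).len ≤ c + 3 * m + 1 := by
  induction m with
  | zero => simp [switchN]
  | succ m ih =>
    have h₁ := ih fun j hj => h j (by omega)
    have h₂ := h m (by omega)
    have h₃ := ifEq_len x m (f m) (switchN x m f)
    simp only [switchN]
    omega

theorem switchN_run {x m : ℕ} (f : ℕ → Program) (s : State) (hx : x ≠ 7) (h : s.nreg x < m) :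
    (switchN x m f).run s = (f (s.nreg x)).run (s.setN 7 (s.nreg x)) := by
  have hset : ∀ (s : State) (a b : ℕ), (s.setN 7 a).setN 7 b = s.setN 7 b := fun s a b => by
    simp [State.setN]
  induction m generalizing s with
  | zero => omega
  | succ m ih =>
    rw [switchN, ifEq_run _ _ _ _ _ hx]
    split_ifs with hm
    · rw [hm]
    · have := ih (s.setN 7 m) (by simp [hx]; omega)
      rw [this]
      simp [hx, hset]

/-- A family of registers or arrays: `fam a c` for varying `c`. The numbers below `64` are left to
individual registers and arrays. -/
def fam (a c : ℕ) : ℕ := 64 + Nat.pair a c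

@[simp] theorem fam_inj {a b c d : ℕ} : fam a b = fam c d ↔ a = c ∧ b = d := by
  simp [fam]
theorem le_fam (a c : ℕ) : 64 ≤ fam a c := by simp [fam]
@[simp] theorem fam_eq_iff {a c x : ℕ} (h : x < 64) : (fam a c = x) = False := by
  have := le_fam a c
  simp; omega
@[simp] theorem eq_fam_iff {a c x : ℕ} (h : x < 64) : (x = fam a c) = False := by
  have := le_fam a c
  simp; omega

/-- Run `f S`, where `S` consists of the members `c` of the list for which the register
`fam b c` is positive. -/
def switchSet {K : ℕ} (b : ℕ) : List (Fin K) → (Finset (Fin K) → Program) → Program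
  | [], f => f ∅
  | c :: l, f => .ite (.natLt ZERO (fam b c)) (switchSet b l fun S => f (insert c S))
      (switchSet b l f)

section switchSet
variable {K : ℕ} {b : ℕ}

theorem switchSet_wN {l : List (Fin K)} {f : Finset (Fin K) → Program} {x : ℕ} :
    (switchSet b l f).wN x → ∃ S, (f S).wN x := by
  induction l generalizing f with
  | nil => exact fun h => ⟨_, h⟩
  | cons c l ih =>
    rintro (h | h)
    · exact (ih h).elim fun S hS => ⟨_, hS⟩
    · exact ih h
theorem switchSet_wNA {l : List (Fin K)} {f : Finset (Fin K) → Program} {x : ℕ} :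
    (switchSet b l f).wNA x → ∃ S, (f S).wNA x := by
  induction l generalizing f with
  | nil => exact fun h => ⟨_, h⟩
  | cons c l ih =>
    rintro (h | h)
    · exact (ih h).elim fun S hS => ⟨_, hS⟩
    · exact ih h
theorem switchSet_wRA {l : List (Fin K)} {f : Finset (Fin K) → Program} {x : ℕ} :
    (switchSet b l f).wRA x → ∃ S, (f S).wRA x := by
  induction l generalizing f with
  | nil => exact fun h => ⟨_, h⟩
  | cons c l ih =>
    rintro (h | h)
    · exact (ih h).elim fun S hS => ⟨_, hS⟩
    · exact ih h
theorem switchSet_loopFree {l : List (Fin K)} {f : Finset (Fin K) → Program}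
    (h : ∀ S, (f S).LoopFree) : (switchSet b l f).LoopFree := by
  induction l generalizing f with
  | nil => exact h _
  | cons c l ih => exact ⟨ih fun S => h _, ih h⟩
theorem switchSet_len {l : List (Fin K)} {f : Finset (Fin K) → Program} {m : ℕ}
    (h : ∀ S, (f S).len ≤ m) : (switchSet b l f).len ≤ m + l.length := by
  induction l generalizing f with
  | nil => exact h _
  | cons c l ih =>
    have h₁ := ih (f := fun S => f (insert c S)) fun S => h _
    have h₂ := ih h
    simp only [switchSet, Program.len, List.length_cons]
    omega

open Classical in
theorem switchSet_run (l : List (Fin K)) (f : Finset (Fin K) → Program) (s : State)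
    (h0 : s.nreg ZERO = 0) :
    (switchSet b l f).run s = (f (l.toFinset.filter fun c => 0 < s.nreg (fam b c))).run s := by
  induction l generalizing f with
  | nil => simp [switchSet]
  | cons c l ih =>
    simp only [switchSet, Program.run, Test.Holds, h0, ih]
    split_ifs with h
    · congr 2
      ext d; simp; grind
    · congr 2
      ext d; simp; grind

end switchSet

end RAM

/-! ### States of the dynamic program and its abstract correctness -/

open Finset (univ mem_filter range mem_univ mem_insert card_le_card mem_range mem_image Ico
  mem_union card_le_univ mem_insert_of_mem sum_insert sum_congr card_insert_le mem_insert_self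
  card_insert_of_notMem card_image_of_injOn subset_union_left mem_singleton)
open Function (update update_of_ne update_apply update_self)
open Relation (TransGen ReflTransGen)

namespace SteinerDP

/-- A state: a symmetric and transitive relation on the colours, i.e. a partition of a set of
colours. Its domain are the colours whose vertices belong to the solution, its classes are the
components of the part of the solution constructed so far. -/
def St (K : ℕ) : Type :=
  {R : Fin K → Fin K → Prop // (∀ a b, R a b → R b a) ∧ ∀ a b c, R a b → R b c → R a c}

variable {K : ℕ}

noncomputable instance : Fintype (St K) :=
  have : Finite (St K) := inferInstanceAs (Finite (Subtype _))
  Fintype.ofFinite _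

noncomputable instance : DecidableEq (St K) := Classical.decEq _

/-- Two colours lie in the same class of a state. -/
def St.Rel (σ : St K) : Fin K → Fin K → Prop := σ.1

theorem St.ext {σ τ : St K} (h : ∀ a b, σ.Rel a b ↔ τ.Rel a b) : σ = τ :=
  Subtype.ext (funext fun a => funext fun b => propext (h a b))

theorem St.symm (σ : St K) {a b : Fin K} (h : σ.Rel a b) : σ.Rel b a := σ.2.1 _ _ h
theorem St.trans (σ : St K) {a b c : Fin K} (h : σ.Rel a b) (h' : σ.Rel b c) : σ.Rel a c :=
  σ.2.2 _ _ _ h h'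

/-- The state in which every colour of `X` forms its own class. -/
def St.disc (X : Set (Fin K)) : St K :=
  ⟨fun a b => a = b ∧ a ∈ X, fun _ _ h => ⟨h.1.symm, h.1 ▸ h.2⟩,
    fun _ _ _ h h' => ⟨h.1.trans h'.1, h.2⟩⟩

@[simp] theorem St.disc_rel {X : Set (Fin K)} {a b : Fin K} :
    (St.disc X).Rel a b ↔ a = b ∧ a ∈ X := Iff.rfl

/-- A state without proper connections. -/
def St.IsDisc (σ : St K) : Prop := ∀ a b, σ.Rel a b → a = b

theorem St.isDisc_disc (X : Set (Fin K)) : (St.disc X).IsDisc := fun _ _ h => h.1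

/-- What the dynamic program has to decide when a vertex is eliminated: the state `σ₁` of its own
table, the set `A` of the colours of the neighbours to which it is joined by an edge, and the state
`σ₂` of the table of its parent. -/
structure Choice (K : ℕ) where
  σ₁ : St K
  A : Finset (Fin K)
  σ₂ : St K

/-- Choices as triples. -/
def Choice.equiv : Choice K ≃ St K × Finset (Fin K) × St K where
  toFun c := (c.σ₁, c.A, c.σ₂)
  invFun t := ⟨t.1, t.2.1, t.2.2⟩
  left_inv _ := rfl
  right_inv _ := rfl

noncomputable instance : Fintype (Choice K) := Fintype.ofEquiv _ Choice.equiv.symm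
/-- The combinatorial data of a vertex: its colour, the colours of its bag and those of its
neighbours in the bag. -/
structure Local (K : ℕ) where
  col : Fin K
  occ : Finset (Fin K)
  edg : Finset (Fin K)

theorem transGen_symm {α : Type*} {r : α → α → Prop} (h : ∀ a b, r a b → r b a) {a b : α}
    (hab : TransGen r a b) : TransGen r b a := by
  induction hab with
  | single h' => exact .single (h _ _ h')
  | tail _ h' ih => exact .head (h _ _ h') ih

/-- The connections after the edges in `c.A` have been added to the state `c.σ₁`. -/
def Local.glue (l : Local K) (c : Choice K) : Fin K → Fin K → Prop :=
  TransGen fun a b =>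
    c.σ₁.Rel a b ∨ (a = l.col ∧ b ∈ c.A) ∨ (b = l.col ∧ a ∈ c.A)

theorem Local.glue_symm {l : Local K} {c : Choice K} {a b : Fin K} (h : l.glue c a b) :
    l.glue c b a := by
  refine transGen_symm ?_ h
  rintro x y (h | h | h)
  · exact .inl (c.σ₁.symm h)
  · exact .inr (.inr h)
  · exact .inr (.inl h)

/-- Admissible choices: edges join vertices of the solution, the two states agree on which vertices
of the bag belong to the solution, and the eliminated vertex stays connected to its bag. -/
structure Local.Valid (l : Local K) (c : Choice K) : Prop where
  sub : c.A ⊆ l.edg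
  dom : ∀ a ∈ c.A, c.σ₁.Rel a a ∧ c.σ₁.Rel l.col l.col
  agree : ∀ a ∈ l.occ, c.σ₁.Rel a a ↔ c.σ₂.Rel a a
  conn : c.σ₁.Rel l.col l.col → ∃ a ∈ l.occ, l.glue c l.col a

/-- The new state of the parent. -/
def Local.target (l : Local K) (c : Choice K) : St K :=
  ⟨TransGen fun a b => c.σ₂.Rel a b ∨ (a ∈ l.occ ∧ b ∈ l.occ ∧ l.glue c a b),
    fun _ _ h => by
      refine transGen_symm ?_ h
      rintro x y (h | h)
      · exact .inl (c.σ₂.symm h)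
      · exact .inr ⟨h.2.1, h.1, Local.glue_symm h.2.2⟩,
    fun _ _ _ h h' => h.trans h'⟩

theorem Local.target_rel {l : Local K} {c : Choice K} {a b : Fin K} :
    (l.target c).Rel a b ↔
      TransGen (fun a b => c.σ₂.Rel a b ∨ (a ∈ l.occ ∧ b ∈ l.occ ∧ l.glue c a b)) a b :=
  Iff.rfl

/-- If both ends of each step of a relation lie in a set then so do the ends of its transitive
closure. -/
theorem transGen_mem {α : Type*} {r : α → α → Prop} {p : α → Prop}
    (h : ∀ a b, r a b → p a ∧ p b) {a b : α} (hab : TransGen r a b) : p a ∧ p b := by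
  induction hab with
  | single h' => exact h _ _ h'
  | tail _ h' ih => exact ⟨ih.1, (h _ _ h').2⟩

theorem Local.Valid.glue_dom {l : Local K} {c : Choice K} (h : l.Valid c) {a b : Fin K}
    (hab : l.glue c a b) : c.σ₁.Rel a a ∧ c.σ₁.Rel b b := by
  refine transGen_mem (p := fun a => c.σ₁.Rel a a) ?_ hab
  rintro a b (h' | ⟨rfl, h'⟩ | ⟨rfl, h'⟩)
  · exact ⟨c.σ₁.trans h' (c.σ₁.symm h'), c.σ₁.trans (c.σ₁.symm h') h'⟩
  · exact ⟨(h.dom _ h').2, (h.dom _ h').1⟩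
  · exact ⟨(h.dom _ h').1, (h.dom _ h').2⟩

/-- Eliminating a vertex does not change which colours belong to the solution. -/
theorem Local.Valid.target_dom {l : Local K} {c : Choice K} (h : l.Valid c) (a : Fin K) :
    (l.target c).Rel a a ↔ c.σ₂.Rel a a := by
  refine ⟨fun h' => ?_, fun h' => .single (.inl h')⟩
  refine (transGen_mem (p := fun a => c.σ₂.Rel a a) ?_ (Local.target_rel.1 h')).1
  rintro a b (h' | ⟨ha, hb, h'⟩)
  · exact ⟨c.σ₂.trans h' (c.σ₂.symm h'), c.σ₂.trans (c.σ₂.symm h') h'⟩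
  · exact ⟨(h.agree a ha).1 (h.glue_dom h').1, (h.agree b hb).1 (h.glue_dom h').2⟩

/-- Values are compared lexicographically: first by cost, then by the number of edges. -/
abbrev Val : Type := ℝ ×ₗ ℕ

/-- A run of the dynamic program from its start (all `n` vertices present, no edges) down to the
moment when only the vertices at positions below `t` remain. Here `sts t u` is the state of
vertex `u` at moment `t` and `C t` the choice made when vertex `t` is eliminated. -/
structure IsRun (n : ℕ) (par : ℕ → ℕ) (loc : ℕ → Local K) (t : ℕ) (sts : ℕ → ℕ → St K)
    (C : ℕ → Choice K) : Prop where
  init : ∀ u < n, (sts n u).IsDisc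
  valid : ∀ i, t ≤ i → i < n → (loc i).Valid (C i)
  fst : ∀ i, t ≤ i → i < n → sts (i + 1) i = (C i).σ₁
  snd : ∀ i, t ≤ i → i < n → sts (i + 1) (par i) = (C i).σ₂
  target : ∀ i, t ≤ i → i < n → sts i (par i) = (loc i).target (C i)
  rest : ∀ i, t ≤ i → i < n → ∀ u < i, u ≠ par i → sts i u = sts (i + 1) u

variable {n : ℕ} {par : ℕ → ℕ} {loc : ℕ → Local K} {wt : ℕ → Choice K → Val}

/-- The tables `T` bound the cost of every run from below. -/
def Complete (n : ℕ) (par : ℕ → ℕ) (loc : ℕ → Local K) (wt : ℕ → Choice K → Val) (t : ℕ)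
    (T : ℕ → St K → Option Val) : Prop :=
  ∀ sts C, IsRun n par loc t sts C → ∃ f : ℕ → Val, (∀ u < t, T u (sts t u) = some (f u)) ∧
    ∑ u ∈ range t, f u ≤ ∑ i ∈ Ico t n, wt i (C i)

/-- Whatever states with entries in the tables `T` are picked for the remaining vertices, the
choices recorded in `ch` are those of a run that leads there at the cost given by `T`. Here
`ch i τ c` means that `c` is recorded as the choice at position `i` that makes `τ` the state of the
parent. -/
def Sound (n : ℕ) (par : ℕ → ℕ) (loc : ℕ → Local K) (wt : ℕ → Choice K → Val) (t : ℕ)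
    (T : ℕ → St K → Option Val) (ch : ℕ → St K → Choice K → Prop) : Prop :=
  ∀ (st : ℕ → St K) (f : ℕ → Val), (∀ u < t, T u (st u) = some (f u)) →
    ∃ sts C, IsRun n par loc t sts C ∧ (∀ u < t, sts t u = st u) ∧
      (∀ i, t ≤ i → i < n → ch i (sts i (par i)) (C i)) ∧
      ∑ u ∈ range t, f u = ∑ i ∈ Ico t n, wt i (C i)

theorem complete_init {T : ℕ → St K → Option Val} (h : ∀ u < n, ∀ σ : St K, σ.IsDisc →
    T u σ = some 0) : Complete n par loc wt n T := fun sts _ hr =>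
  ⟨fun _ => 0, fun u hu => h u hu _ (hr.init u hu), by simp⟩

theorem sound_init {T : ℕ → St K → Option Val} {ch : ℕ → St K → Choice K → Prop}
    (h : ∀ u < n, ∀ σ : St K, ∀ w, T u σ = some w → w = 0 ∧ σ.IsDisc) :
    Sound n par loc wt n T ch := by
  intro st f hf
  refine ⟨fun _ => st, fun _ => ⟨St.disc ∅, ∅, St.disc ∅⟩, ⟨fun u hu => (h u hu _ _ (hf u hu)).2,
    ?_, ?_, ?_, ?_, ?_⟩, fun _ _ => rfl, ?_, ?_⟩
  any_goals intros; omega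
  simpa using Finset.sum_eq_zero fun u hu => (h u (by simpa using hu) _ _
    (hf u (by simpa using hu))).1

theorem complete_step {t : ℕ} {T T' : ℕ → St K → Option Val} (ht : t < n) (hpar : par t < t)
    (hT : Complete n par loc wt (t + 1) T)
    (hbest : ∀ c a b, (loc t).Valid c → T t c.σ₁ = some a → T (par t) c.σ₂ = some b →
      ∃ w, T' (par t) ((loc t).target c) = some w ∧ w ≤ a + b + wt t c)
    (hrest : ∀ u < t, u ≠ par t → T' u = T u) : Complete n par loc wt t T' := by
  intro sts C hr
  obtain ⟨f, hf, hle⟩ := hT sts C ⟨hr.init, fun i hi => hr.valid i (by omega),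
    fun i hi => hr.fst i (by omega), fun i hi => hr.snd i (by omega),
    fun i hi => hr.target i (by omega), fun i hi => hr.rest i (by omega)⟩
  obtain ⟨w, hw, hwle⟩ := hbest (C t) (f t) (f (par t)) (hr.valid t le_rfl ht)
    (by rw [← hr.fst t le_rfl ht]; exact hf t (by omega))
    (by rw [← hr.snd t le_rfl ht]; exact hf _ (by omega))
  refine ⟨update f (par t) w, fun u hu => ?_, ?_⟩
  · by_cases hup : u = par t
    · subst hup
      rw [hr.target t le_rfl ht, hw]; simp
    · rw [hrest u hu hup, hr.rest t le_rfl ht u hu hup, hf u (by omega)]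
      simp [hup]
  · rw [Finset.sum_update_of_mem (by simpa using hpar), Finset.sum_eq_sum_Ico_succ_bot ht]
    rw [Finset.sum_range_succ, ← Finset.add_sum_erase _ _ (mem_range.2 hpar)] at hle
    rw [Finset.sdiff_singleton_eq_erase]
    calc w + ∑ u ∈ (range t).erase (par t), f u
        ≤ f t + f (par t) + wt t (C t) + ∑ u ∈ (range t).erase (par t), f u := by gcongr
      _ = wt t (C t) + (f (par t) + ∑ u ∈ (range t).erase (par t), f u + f t) := by abel
      _ ≤ _ := by gcongr

theorem sound_step {t : ℕ} {T T' : ℕ → St K → Option Val} {ch ch' : ℕ → St K → Choice K → Prop}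
    (ht : t < n) (hpar : ∀ i, t ≤ i → i < n → par i < i)
    (hT : Sound n par loc wt (t + 1) T ch)
    (hbest : ∀ τ w, T' (par t) τ = some w → ∃ c a b, ch' t τ c ∧ (loc t).Valid c ∧
      (loc t).target c = τ ∧ T t c.σ₁ = some a ∧ T (par t) c.σ₂ = some b ∧ w = a + b + wt t c)
    (hrest : ∀ u < t, u ≠ par t → T' u = T u) (hch : ∀ i, t < i → i < n → ch' i = ch i) :
    Sound n par loc wt t T' ch' := by
  intro st f hf
  have hp := hpar t le_rfl ht
  obtain ⟨c, a, b, hc, hv, htg, ha, hb, hw⟩ := hbest _ _ (hf (par t) hp)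
  obtain ⟨sts, C, hr, hst, hC, hsum⟩ := hT
    (update (update st (par t) c.σ₂) t c.σ₁)
    (update (update f (par t) b) t a) (by
      intro u hu
      rcases eq_or_ne u t with rfl | hut
      · simpa using ha
      · rcases eq_or_ne u (par t) with rfl | hup
        · simpa [hut] using hb
        · simp only [update_of_ne hut, update_of_ne hup]
          rw [← hrest u (by omega) hup]
          exact hf u (by omega))
  have hne : par t ≠ t := by omega
  refine ⟨fun i => if t < i then sts i else st, update C t c, ⟨?_, ?_, ?_, ?_, ?_, ?_⟩,
    by simp, ?_, ?_⟩
  · simpa [ht] using hr.init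
  · intro i hi hin
    rcases hi.eq_or_lt with rfl | hi
    · simpa using hv
    · simpa [hi.ne'] using hr.valid i hi hin
  · intro i hi hin
    rcases hi.eq_or_lt with rfl | hi
    · simpa using hst t (by omega)
    · simpa [hi.ne', show t < i + 1 by omega] using hr.fst i hi hin
  · intro i hi hin
    rcases hi.eq_or_lt with rfl | hi
    · simpa [hne] using hst (par t) (by omega)
    · simpa [hi.ne', show t < i + 1 by omega] using hr.snd i hi hin
  · intro i hi hin
    rcases hi.eq_or_lt with rfl | hi
    · simpa using htg.symm
    · simpa [hi.ne', hi] using hr.target i hi hin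
  · intro i hi hin u hu hup
    rcases hi.eq_or_lt with rfl | hi
    · have := hst u (by omega)
      simp [hu.ne, hup] at this
      simp [this]
    · simpa [hi, show t < i + 1 by omega] using hr.rest i hi hin u hu hup
  · intro i hi hin
    rcases hi.eq_or_lt with rfl | hi
    · simpa using hc
    · simpa [hi, hi.ne', hch i hi hin] using hC i hi hin
  · have h1 : ∑ i ∈ Ico t n, wt i (update C t c i) =
        wt t c + ∑ i ∈ Ico (t + 1) n, wt i (C i) := by
      rw [Finset.sum_eq_sum_Ico_succ_bot ht]
      simp only [update_self]
      congr 1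
      refine sum_congr rfl fun i hi => ?_
      rw [update_of_ne]
      simp at hi; omega
    rw [h1, ← hsum, Finset.sum_range_succ, update_self]
    have h2 : ∑ u ∈ range t, update (update f (par t) b) t a u =
        ∑ u ∈ range t, update f (par t) b u :=
      sum_congr rfl fun u hu => update_of_ne (by simp at hu; omega) _ _
    rw [h2, Finset.sum_update_of_mem (by simpa using hp), Finset.sdiff_singleton_eq_erase,
      ← Finset.add_sum_erase _ _ (mem_range.2 hp), hw]
    abel

end SteinerDP

/-! ### Elimination schemes -/

namespace SteinerDP

/-- An elimination scheme of a graph on `n` vertices with `K` colours. The vertices are numbered by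
positions `0, …, n - 1`, the root having position `0`; they will be eliminated from the last to the
first. The bag of a position contains earlier positions only, among them `0` and those of all
adjacent vertices, and is closed: of two positions in a bag, the earlier is in the bag of the later.
The colouring makes the members of a bag and its owner distinguishable. -/
structure Scheme {n : ℕ} (G : SimpleGraph (Fin n)) (r : Fin n) (K : ℕ) where
  vert : ℕ → Fin n
  pos : Fin n → ℕ
  pos_lt : ∀ v, pos v < n
  vert_pos : ∀ v, vert (pos v) = v
  pos_vert : ∀ t < n, pos (vert t) = t
  pos_root : pos r = 0
  bag : ℕ → Finset ℕ
  bag_lt : ∀ t < n, ∀ u ∈ bag t, u < t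
  zero_mem : ∀ t < n, 0 < t → 0 ∈ bag t
  adj : ∀ t < n, ∀ u < t, G.Adj (vert t) (vert u) → u ∈ bag t
  closed : ∀ t < n, ∀ u ∈ bag t, ∀ w ∈ bag t, w < u → w ∈ bag u
  col : ℕ → Fin K
  col_ne : ∀ t < n, ∀ u ∈ bag t, col u ≠ col t

namespace Scheme

variable {n : ℕ} {G : SimpleGraph (Fin n)} {r : Fin n} {K : ℕ} (S : Scheme G r K)

theorem vert_zero (_ : 0 < n) : S.vert 0 = r := by
  rw [← S.pos_root, S.vert_pos]

theorem vert_inj {t u : ℕ} (ht : t < n) (hu : u < n) (h : S.vert t = S.vert u) : t = u := by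
  rw [← S.pos_vert t ht, h, S.pos_vert u hu]

theorem col_inj {t u w : ℕ} (ht : t < n) (hu : u ∈ S.bag t) (hw : w ∈ S.bag t)
    (h : S.col u = S.col w) : u = w := by
  have := S.bag_lt t ht u hu
  have := S.bag_lt t ht w hw
  rcases lt_trichotomy u w with h' | h' | h'
  · exact (S.col_ne w (by omega) u (S.closed t ht w hw u hu h') h).elim
  · exact h'
  · exact (S.col_ne u (by omega) w (S.closed t ht u hu w hw h') h.symm).elim

/-- The parent of a position: the latest position in its bag. -/
def par (t : ℕ) : ℕ := (S.bag t).sup id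

theorem par_mem {t : ℕ} (ht : t < n) (h0 : 0 < t) : S.par t ∈ S.bag t := by
  obtain ⟨u, hu, h⟩ := Finset.exists_mem_eq_sup (S.bag t) ⟨0, S.zero_mem t ht h0⟩ id
  rw [par, h]; exact hu

theorem le_par {t u : ℕ} (hu : u ∈ S.bag t) : u ≤ S.par t := Finset.le_sup (f := id) hu

theorem par_lt {t : ℕ} (ht : t < n) (h0 : 0 < t) : S.par t < t :=
  S.bag_lt t ht _ (S.par_mem ht h0)

theorem mem_bag_par {t u : ℕ} (ht : t < n) (h0 : 0 < t) (hu : u ∈ S.bag t) (h : u ≠ S.par t) :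
    u ∈ S.bag (S.par t) :=
  S.closed t ht _ (S.par_mem ht h0) u hu (lt_of_le_of_ne (S.le_par hu) h)

open Classical in
/-- The position in the bag of `t` that has colour `c` (or `0` if there is none). -/
noncomputable def slot (t : ℕ) (c : Fin K) : ℕ :=
  if h : ∃ u ∈ S.bag t, S.col u = c then h.choose else 0

theorem slot_col {t u : ℕ} (ht : t < n) (hu : u ∈ S.bag t) : S.slot t (S.col u) = u := by
  have h : ∃ w ∈ S.bag t, S.col w = S.col u := ⟨u, hu, rfl⟩
  rw [slot, dif_pos h]
  exact S.col_inj ht h.choose_spec.1 hu h.choose_spec.2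

open Classical in
/-- The local data of a position. -/
noncomputable def loc (t : ℕ) : Local K where
  col := S.col t
  occ := (S.bag t).image S.col
  edg := ((S.bag t).filter fun u => G.Adj (S.vert t) (S.vert u)).image S.col

theorem mem_occ {t : ℕ} {c : Fin K} : c ∈ (S.loc t).occ ↔ ∃ u ∈ S.bag t, S.col u = c := by
  simp [loc]

theorem mem_edg {t : ℕ} {c : Fin K} :
    c ∈ (S.loc t).edg ↔ ∃ u ∈ S.bag t, G.Adj (S.vert t) (S.vert u) ∧ S.col u = c := by
  simp [loc, and_assoc]

/-- The position `x` is `u` or belongs to the bag of `u`, and `c` is its colour. -/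
def At (u : ℕ) (c : Fin K) (x : ℕ) : Prop := (x = u ∨ x ∈ S.bag u) ∧ S.col x = c

variable {S}

theorem At.unique {u : ℕ} {c : Fin K} {x y : ℕ} (hu : u < n) (hx : S.At u c x) (hy : S.At u c y) :
    x = y := by
  obtain ⟨rfl | hx, rfl⟩ := hx <;> obtain ⟨rfl | hy, h⟩ := hy
  · rfl
  · exact (S.col_ne _ hu _ hy h).elim
  · exact (S.col_ne _ hu _ hx h.symm).elim
  · exact S.col_inj hu hx hy h.symm

theorem At.le {u : ℕ} {c : Fin K} {x : ℕ} (hu : u < n) (hx : S.At u c x) : x ≤ u := by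
  obtain ⟨rfl | hx, rfl⟩ := hx
  · exact le_rfl
  · exact (S.bag_lt u hu x hx).le

theorem at_self (u : ℕ) : S.At u (S.col u) u := ⟨.inl rfl, rfl⟩

theorem at_of_mem {u x : ℕ} (h : x ∈ S.bag u) : S.At u (S.col x) x := ⟨.inr h, rfl⟩

theorem at_par {t x : ℕ} (ht : t < n) (h0 : 0 < t) (h : x ∈ S.bag t) :
    S.At (S.par t) (S.col x) x :=
  ⟨or_iff_not_imp_left.2 fun hx => S.mem_bag_par ht h0 h hx, rfl⟩

theorem At.mem_of_occ {t x : ℕ} {c : Fin K} (ht : t < n) (h : S.At t c x)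
    (hc : c ∈ (S.loc t).occ) : x ∈ S.bag t := by
  obtain ⟨u, hu, rfl⟩ := S.mem_occ.1 hc
  rw [h.unique ht (at_of_mem hu)]; exact hu

variable {sts : ℕ → ℕ → St K} {C : ℕ → Choice K}

/-- The colours in the domain of a state never change. -/
theorem run_dom (hr : IsRun n S.par S.loc 1 sts C) {i u : ℕ} (hi : 1 ≤ i) (hin : i ≤ n)
    (hu : u < i) (a : Fin K) : (sts i u).Rel a a ↔ (sts n u).Rel a a := by
  induction hin using Nat.decreasingInduction with
  | self => rfl
  | of_succ i hin ih =>
    rw [← ih (by omega) (by omega)]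
    by_cases h : u = S.par i
    · subst h
      rw [hr.target i hi hin, (hr.valid i hi hin).target_dom, hr.snd i hi hin]
    · rw [hr.rest i hi hin u hu h]

/-- All states agree on whether a vertex belongs to the solution. -/
theorem run_agree (hr : IsRun n S.par S.loc 1 sts C) {t u : ℕ} (ht : t < n)
    (hu : u ∈ S.bag t) :
    (sts n t).Rel (S.col u) (S.col u) ↔ (sts n u).Rel (S.col u) (S.col u) := by
  induction t using Nat.strong_induction_on with
  | _ t ih =>
    have h0 : 0 < t := by have := S.bag_lt t ht u hu; omega
    have hp := S.par_lt ht h0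
    have := (hr.valid t h0 ht).agree (S.col u) (S.mem_occ.2 ⟨u, hu, rfl⟩)
    rw [← hr.fst t h0 ht, ← hr.snd t h0 ht,
      run_dom hr (i := t + 1) (u := t) (by omega) (by omega) (by omega),
      run_dom hr (i := t + 1) (u := S.par t) (by omega) (by omega) (by omega)] at this
    rw [this]
    by_cases hup : u = S.par t
    · rw [hup]
    · exact ih _ hp (by omega) (S.mem_bag_par ht h0 hu hup)

variable (S) in
/-- The subgraph selected by a run. -/
def runSubgraph (sts : ℕ → ℕ → St K) (C : ℕ → Choice K) : G.Subgraph where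
  verts := {v | (sts n (S.pos v)).Rel (S.col (S.pos v)) (S.col (S.pos v))}
  Adj x y := G.Adj x y ∧ (sts n (S.pos x)).Rel (S.col (S.pos x)) (S.col (S.pos x)) ∧
    (sts n (S.pos y)).Rel (S.col (S.pos y)) (S.col (S.pos y)) ∧
    ((S.pos y < S.pos x ∧ S.col (S.pos y) ∈ (C (S.pos x)).A) ∨
      (S.pos x < S.pos y ∧ S.col (S.pos x) ∈ (C (S.pos y)).A))
  adj_sub h := h.1
  edge_vert h := h.2.1
  symm := ⟨fun _ _ h => ⟨h.1.symm, h.2.2.1, h.2.1, h.2.2.2.symm⟩⟩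

theorem runSubgraph_adj (hr : IsRun n S.par S.loc 1 sts C) {t u : ℕ} (ht : t < n)
    (hu : u ∈ S.bag t) (h : S.col u ∈ (C t).A) :
    (S.runSubgraph sts C).Adj (S.vert t) (S.vert u) := by
  have hut := S.bag_lt t ht u hu
  have hv := hr.valid t (by omega) ht
  obtain ⟨w, hw, hadj, hcol⟩ := S.mem_edg.1 (hv.sub h)
  obtain rfl := S.col_inj ht hw hu hcol
  have h1 := hr.fst t (by omega) ht
  have hd := hv.dom _ h
  simp only [loc, ← h1, run_dom hr (i := t + 1) (u := t) (by omega) (by omega) (by omega)] at hd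
  rw [run_agree hr ht hu] at hd
  simp only [runSubgraph, S.pos_vert t ht, S.pos_vert w (by omega)]
  exact ⟨hadj, hd.2, hd.1, .inl ⟨hut, h⟩⟩

/-- The colours `a` and `b` are equal, or they are the colours of two positions in the bag of `u`
(or of `u` itself) that are joined by a path in `T`. -/
def Joined (S : Scheme G r K) (T : G.Subgraph) (u : ℕ) (a b : Fin K) : Prop :=
  a = b ∨ ∃ x y, S.At u a x ∧ S.At u b y ∧
    ReflTransGen (fun x y => T.Adj (S.vert x) (S.vert y)) x y

theorem Joined.trans {T : G.Subgraph} {u : ℕ} {a b c : Fin K} (hu : u < n)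
    (h : S.Joined T u a b) (h' : S.Joined T u b c) : S.Joined T u a c := by
  obtain rfl | ⟨x, y, hx, hy, hxy⟩ := h
  · exact h'
  obtain rfl | ⟨z, w, hz, hw, hzw⟩ := h'
  · exact .inr ⟨x, y, hx, hy, hxy⟩
  · obtain rfl := hy.unique hu hz
    exact .inr ⟨x, w, hx, hw, hxy.trans hzw⟩

theorem Joined.of_transGen {T : G.Subgraph} {u : ℕ} {a b : Fin K} {R : Fin K → Fin K → Prop}
    (hu : u < n) (hR : ∀ a b, R a b → S.Joined T u a b) (h : TransGen R a b) :
    S.Joined T u a b := by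
  induction h with
  | single h => exact hR _ _ h
  | tail _ h ih => exact ih.trans hu (hR _ _ h)

theorem run_glue_joined (hr : IsRun n S.par S.loc 1 sts C) {i : ℕ} (hi : 1 ≤ i) (hin : i < n)
    (hst : ∀ a b, (sts (i + 1) i).Rel a b → S.Joined (S.runSubgraph sts C) i a b)
    {a b : Fin K} (hab : (S.loc i).glue (C i) a b) :
    S.Joined (S.runSubgraph sts C) i a b := by
  have hstep : ∀ a ∈ (C i).A, ∃ x y, S.At i (S.col i) x ∧ S.At i a y ∧
      (S.runSubgraph sts C).Adj (S.vert x) (S.vert y) := by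
    intro a ha
    obtain ⟨w, hw, -, rfl⟩ := S.mem_edg.1 ((hr.valid i hi hin).sub ha)
    exact ⟨i, w, at_self i, at_of_mem hw, runSubgraph_adj hr hin hw ha⟩
  refine .of_transGen hin ?_ hab
  rintro a b (h' | ⟨rfl, h'⟩ | ⟨rfl, h'⟩)
  · rw [← hr.fst i hi hin] at h'
    exact hst _ _ h'
  · obtain ⟨x, y, hx, hy, hxy⟩ := hstep b h'
    exact .inr ⟨x, y, hx, hy, .single hxy⟩
  · obtain ⟨x, y, hx, hy, hxy⟩ := hstep a h'
    exact .inr ⟨y, x, hy, hx, .single hxy.symm⟩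

/-- The classes of the states are connected in the selected subgraph. -/
theorem run_joined (hr : IsRun n S.par S.loc 1 sts C) {i u : ℕ} (hi : 1 ≤ i) (hin : i ≤ n)
    (hu : u < i) {a b : Fin K} (hab : (sts i u).Rel a b) :
    S.Joined (S.runSubgraph sts C) u a b := by
  induction hin using Nat.decreasingInduction generalizing u a b with
  | self => exact .inl (hr.init u hu a b hab)
  | of_succ i hin ih =>
    by_cases h : u = S.par i
    · subst h
      have hpi := S.par_lt hin hi
      rw [hr.target i hi hin, Local.target_rel] at hab
      refine .of_transGen (by omega) ?_ hab
      rintro a b (h' | ⟨ha, hb, h'⟩)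
      · rw [← hr.snd i hi hin] at h'
        exact ih (by omega) (by omega) h'
      · refine (run_glue_joined hr hi hin (fun a b => ih (by omega) (by omega)) h').imp_right ?_
        rintro ⟨x, y, hx, hy, hxy⟩
        exact ⟨x, y, hx.2 ▸ at_par hin hi (hx.mem_of_occ hin ha),
          hy.2 ▸ at_par hin hi (hy.mem_of_occ hin hb), hxy⟩
    · rw [hr.rest i hi hin u hu h] at hab
      exact ih (by omega) (by omega) hab

/-- Every selected vertex is joined to the root. -/
theorem run_reach_root (hr : IsRun n S.par S.loc 1 sts C) {t : ℕ} (ht : t < n)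
    (h : (sts n t).Rel (S.col t) (S.col t)) :
    ReflTransGen
      (fun x y => (S.runSubgraph sts C).Adj (S.vert x) (S.vert y)) t 0 := by
  induction t using Nat.strong_induction_on with
  | _ t ih =>
    rcases Nat.eq_zero_or_pos t with rfl | h0
    · exact .refl
    have hv := hr.valid t h0 ht
    have h' := h
    rw [← run_dom hr (by omega : 1 ≤ t + 1) (by omega) (by omega), hr.fst t h0 ht] at h'
    obtain ⟨a, ha, hg⟩ := hv.conn h'
    obtain ⟨u, hu, rfl⟩ := S.mem_occ.1 ha
    rcases run_glue_joined hr h0 ht (fun a b => run_joined hr (by omega) (by omega) (by omega)) hg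
      with he | ⟨x, y, hx, hy, hxy⟩
    · exact (S.col_ne t ht u hu he.symm).elim
    · obtain rfl := hx.unique ht (at_self t)
      obtain rfl := hy.unique ht (at_of_mem hu)
      have hd := (hv.glue_dom hg).2
      rw [← hr.fst x h0 ht, run_dom hr (by omega) (by omega) (by omega), run_agree hr ht hu] at hd
      have hyx := S.bag_lt x ht y hu
      exact hxy.trans (ih y hyx (by omega) hd)

/-- A subgraph in which every vertex is joined to a fixed one is connected. -/
theorem _root_.SimpleGraph.Subgraph.connected_of_reflTransGen {V : Type*} {G : SimpleGraph V}
    (T : G.Subgraph) {r : V} (hr : r ∈ T.verts)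
    (h : ∀ v ∈ T.verts, ReflTransGen T.Adj v r) : T.coe.Connected := by
  have key : ∀ v (hv : v ∈ T.verts), ReflTransGen T.Adj v r →
      T.coe.Reachable ⟨v, hv⟩ ⟨r, hr⟩ := by
    intro v hv h
    induction h using ReflTransGen.head_induction_on with
    | refl => exact .refl _
    | @head a c hac _ ih =>
      have hc := T.edge_vert hac.symm
      have : T.coe.Adj ⟨a, hv⟩ ⟨c, hc⟩ := hac
      exact this.reachable.trans (ih hc)
  have : Nonempty T.verts := ⟨⟨r, hr⟩⟩
  refine ⟨fun x y => ?_⟩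
  exact (key x x.2 (h x x.2)).trans (key y y.2 (h y y.2)).symm

theorem run_connected (hr : IsRun n S.par S.loc 1 sts C) (hn : 0 < n)
    (hroot : (sts 1 0).Rel (S.col 0) (S.col 0)) :
    r ∈ (S.runSubgraph sts C).verts ∧ (S.runSubgraph sts C).coe.Connected := by
  have hmem : r ∈ (S.runSubgraph sts C).verts := by
    simp only [runSubgraph, Set.mem_ofPred_eq, S.pos_root]
    rwa [← run_dom hr le_rfl (by omega) (by omega)]
  refine ⟨hmem, SimpleGraph.Subgraph.connected_of_reflTransGen _ hmem fun v hv => ?_⟩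
  have h := run_reach_root hr (S.pos_lt v) hv
  have : ReflTransGen (S.runSubgraph sts C).Adj (S.vert (S.pos v)) (S.vert 0) :=
    ReflTransGen.lift S.vert (fun _ _ h => h) _ _ h
  rwa [S.vert_pos, S.vert_zero hn] at this

/-! ### The run of a given connected subgraph -/

variable (S) in
open Classical in
/-- The edges that a subgraph uses at a position. -/
noncomputable def usedColors (T : G.Subgraph) (t : ℕ) : Finset (Fin K) :=
  (S.loc t).edg.filter fun a => T.Adj (S.vert t) (S.vert (S.slot t a))

theorem mem_usedColors {T : G.Subgraph} {t u : ℕ} (ht : t < n) (hu : u ∈ S.bag t) :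
    S.col u ∈ S.usedColors T t ↔ T.Adj (S.vert t) (S.vert u) := by
  simp only [usedColors, mem_filter, S.slot_col ht hu, S.mem_edg, and_iff_right_iff_imp]
  exact fun h => ⟨u, hu, h.adj_sub, rfl⟩

variable (S) in
/-- The states of the run that constructs the subgraph `T`, after `d` eliminations. -/
noncomputable def stateAfter (T : G.Subgraph) : ℕ → ℕ → St K
  | 0, u => St.disc {c | ∃ x, S.At u c x ∧ S.vert x ∈ T.verts}
  | d + 1, u => if u = S.par (n - (d + 1)) then
      (S.loc (n - (d + 1))).target ⟨stateAfter T d (n - (d + 1)),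
        S.usedColors T (n - (d + 1)), stateAfter T d (S.par (n - (d + 1)))⟩
    else stateAfter T d u

variable (S) in
/-- The states of the run that constructs the subgraph `T`, indexed as in `IsRun`. -/
noncomputable def stateOf (T : G.Subgraph) (i u : ℕ) : St K := S.stateAfter T (n - i) u

variable (S) in
/-- The choices of the run that constructs the subgraph `T`. -/
noncomputable def choiceOf (T : G.Subgraph) (i : ℕ) : Choice K :=
  ⟨S.stateOf T (i + 1) i, S.usedColors T i, S.stateOf T (i + 1) (S.par i)⟩

theorem stateOf_eq (T : G.Subgraph) {i : ℕ} (hi : i < n) (u : ℕ) :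
    S.stateOf T i u =
      if u = S.par i then (S.loc i).target (S.choiceOf T i) else S.stateOf T (i + 1) u := by
  obtain ⟨d, hd⟩ : ∃ d, n - i = d + 1 := ⟨n - i - 1, by omega⟩
  have h1 : n - (d + 1) = i := by omega
  have h2 : n - (i + 1) = d := by omega
  simp only [stateOf, hd, stateAfter, h1, choiceOf, h2]

/-- One step in the picture of the run at moment `i`: two remaining positions are joined by an edge
of `T` or by the state of some remaining position. -/
def Link (S : Scheme G r K) (T : G.Subgraph) (i x y : ℕ) : Prop :=
  x < i ∧ y < i ∧ ((∃ u < i, ∃ c d, S.At u c x ∧ S.At u d y ∧ (S.stateOf T i u).Rel c d) ∨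
    T.Adj (S.vert x) (S.vert y))

/-- Two positions are joined while position `i` is eliminated. -/
def GlueLink (S : Scheme G r K) (T : G.Subgraph) (i x y : ℕ) : Prop :=
  ∃ c d, S.At i c x ∧ S.At i d y ∧ (S.loc i).glue (S.choiceOf T i) c d

/-- Each link either survives the elimination of `i` or takes part in it. -/
theorem Link.cases {T : G.Subgraph} {i x y : ℕ} (hi : i < n) (h0 : 0 < i)
    (h : S.Link T (i + 1) x y) :
    S.GlueLink T i x y ∨ (x ≠ i ∧ y ≠ i ∧ S.Link T i x y) := by
  obtain ⟨hx, hy, ⟨u, hu, c, d, hc, hd, h⟩ | h⟩ := h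
  · rcases Nat.lt_succ_iff_lt_or_eq.1 hu with hu | rfl
    · right
      have := hc.le (by omega)
      have := hd.le (by omega)
      refine ⟨by omega, by omega, by omega, by omega, .inl ⟨u, hu, c, d, hc, hd, ?_⟩⟩
      rw [stateOf_eq T hi]
      split_ifs with hup
      · subst hup
        exact .single (.inl h)
      · exact h
    · exact .inl ⟨c, d, hc, hd, .single (.inl h)⟩
  · rcases Nat.lt_succ_iff_lt_or_eq.1 hx with hx | rfl
    · rcases Nat.lt_succ_iff_lt_or_eq.1 hy with hy | rfl
      · exact .inr ⟨by omega, by omega, hx, hy, .inr h⟩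
      · have hb := S.adj y hi x hx h.adj_sub.symm
        exact .inl ⟨_, _, at_of_mem hb, at_self y,
          .single (.inr (.inr ⟨rfl, (mem_usedColors hi hb).2 h.symm⟩))⟩
    · rcases Nat.lt_succ_iff_lt_or_eq.1 hy with hy | rfl
      · have hb := S.adj x hi y hy h.adj_sub
        exact .inl ⟨_, _, at_self x, at_of_mem hb,
          .single (.inr (.inl ⟨rfl, (mem_usedColors hi hb).2 h⟩))⟩
      · exact (h.ne rfl).elim

theorem GlueLink.trans {T : G.Subgraph} {i x y z : ℕ} (h : S.GlueLink T i x y)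
    (h' : S.GlueLink T i y z) : S.GlueLink T i x z := by
  obtain ⟨c, d, hc, hd, h⟩ := h
  obtain ⟨d', e, hd', he, h'⟩ := h'
  obtain rfl : d = d' := hd.2.symm.trans hd'.2
  exact ⟨c, e, hc, he, TransGen.trans h h'⟩

theorem GlueLink.link {T : G.Subgraph} {i x y : ℕ} (hi : i < n) (h0 : 0 < i)
    (h : S.GlueLink T i x y) (hx : x ≠ i) (hy : y ≠ i) : S.Link T i x y := by
  obtain ⟨c, d, ⟨hc, rfl⟩, ⟨hd, rfl⟩, h⟩ := h
  replace hc := hc.resolve_left hx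
  replace hd := hd.resolve_left hy
  refine ⟨S.bag_lt i hi x hc, S.bag_lt i hi y hd, .inl ⟨S.par i, S.par_lt hi h0, _, _,
    at_par hi h0 hc, at_par hi h0 hd, ?_⟩⟩
  rw [stateOf_eq T hi, if_pos rfl]
  exact .single (.inr ⟨S.mem_occ.2 ⟨x, hc, rfl⟩, S.mem_occ.2 ⟨y, hd, rfl⟩, h⟩)

/-- Eliminating a position preserves the connections among the other ones. -/
theorem transGen_link_step {T : G.Subgraph} {i x y : ℕ} (hi : i < n) (h0 : 0 < i) (hx : x ≠ i)
    (h : TransGen (S.Link T (i + 1)) x y) :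
    (y ≠ i → TransGen (S.Link T i) x y) ∧
      (y = i → ∃ z ≠ i, (z = x ∨ TransGen (S.Link T i) x z) ∧ S.GlueLink T i z y) := by
  induction h with
  | single h =>
    rcases h.cases hi h0 with h | ⟨_, hy, h⟩
    · exact ⟨fun hy => .single (h.link hi h0 hx hy), fun _ => ⟨x, hx, .inl rfl, h⟩⟩
    · exact ⟨fun _ => .single h, fun h => (hy h).elim⟩
  | @tail y z _ h ih =>
    rcases h.cases hi h0 with h | ⟨hy, hz, h⟩
    · by_cases hy : y = i
      · obtain ⟨w, hw, hxw, hwy⟩ := ih.2 hy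
        refine ⟨fun hz => ?_, fun _ => ⟨w, hw, hxw, hwy.trans h⟩⟩
        have := (hwy.trans h).link hi h0 hw hz
        rcases hxw with rfl | hxw
        · exact .single this
        · exact hxw.tail this
      · exact ⟨fun hz => (ih.1 hy).tail (h.link hi h0 hy hz),
          fun _ => ⟨y, hy, .inr (ih.1 hy), h⟩⟩
    · exact ⟨fun _ => (ih.1 hy).tail h, fun h => (hz h).elim⟩

/-- The main invariant of the run of a connected subgraph. -/
theorem stateOf_invariant {T : G.Subgraph} (hroot : r ∈ T.verts) (hT : T.coe.Connected) {i : ℕ}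
    (hi : 1 ≤ i) (hin : i ≤ n) :
    (∀ j, i ≤ j → j < n → (S.loc j).Valid (S.choiceOf T j)) ∧
      (∀ u < i, ∀ c, (S.stateOf T i u).Rel c c ↔ ∃ x, S.At u c x ∧ S.vert x ∈ T.verts) ∧
      ∀ x < i, ∀ y < i, S.vert x ∈ T.verts → S.vert y ∈ T.verts →
        TransGen (S.Link T i) x y := by
  induction hin using Nat.decreasingInduction with
  | self =>
    refine ⟨fun j h h' => by omega, fun u hu c => by simp [stateOf, stateAfter], ?_⟩
    have hself : ∀ x < n, S.vert x ∈ T.verts → S.Link T n x x := fun x hx hxT =>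
      ⟨hx, hx, .inl ⟨x, hx, _, _, at_self x, at_self x,
        by simpa [stateOf, stateAfter] using ⟨x, at_self x, hxT⟩⟩⟩
    have key : ∀ a b : T.verts, T.coe.Reachable a b →
        TransGen (S.Link T n) (S.pos a) (S.pos b) := by
      intro a b hab
      rw [SimpleGraph.reachable_iff_reflTransGen] at hab
      induction hab with
      | refl =>
        exact .single (hself _ (S.pos_lt _) (by rw [S.vert_pos]; exact a.2))
      | tail _ h ih =>
        refine ih.tail ⟨S.pos_lt _, S.pos_lt _, .inr ?_⟩
        rw [S.vert_pos, S.vert_pos]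
        exact h
    intro x hx y hy hxT hyT
    have := key ⟨_, hxT⟩ ⟨_, hyT⟩ (hT.preconnected _ _)
    simpa only [S.pos_vert x hx, S.pos_vert y hy] using this
  | of_succ i hin ih =>
    obtain ⟨hvalid, hdom, hlink⟩ := ih (by omega)
    have hpar := S.par_lt hin hi
    have hv : (S.loc i).Valid (S.choiceOf T i) := by
      -- the last condition holds because position `i` is linked to the root
      have hsub : S.usedColors T i ⊆ (S.loc i).edg := by
        classical exact Finset.filter_subset _ _
      refine ⟨hsub, ?_, ?_, ?_⟩
      · intro a ha
        obtain ⟨u, hu, -, rfl⟩ := S.mem_edg.1 (hsub ha)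
        have hadj := (mem_usedColors hin hu).1 ha
        exact ⟨(hdom i (by omega) _).2 ⟨u, at_of_mem hu, T.edge_vert hadj.symm⟩,
          (hdom i (by omega) _).2 ⟨i, at_self i, T.edge_vert hadj⟩⟩
      · intro a ha
        obtain ⟨u, hu, rfl⟩ := S.mem_occ.1 ha
        refine (hdom i (by omega) _).trans (Iff.trans ?_ (hdom (S.par i) (by omega) _).symm)
        constructor
        · rintro ⟨x, hx, hxT⟩
          obtain rfl := hx.unique hin (at_of_mem hu)
          exact ⟨x, at_par hin hi hu, hxT⟩
        · rintro ⟨x, hx, hxT⟩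
          obtain rfl := hx.unique (by omega) (at_par hin hi hu)
          exact ⟨x, at_of_mem hu, hxT⟩
      · intro h
        obtain ⟨x, hx, hxT⟩ := (hdom i (by omega) _).1 h
        obtain rfl := hx.unique hin (at_self i)
        obtain ⟨z, hz, -, c, d, hc, hd, hg⟩ := (transGen_link_step hin hi (by omega)
          (hlink 0 (by omega) x (by omega) (by rwa [S.vert_zero (by omega)]) hxT)).2 rfl
        obtain rfl : S.col x = d := hd.2
        obtain ⟨hc, rfl⟩ := hc
        exact ⟨_, S.mem_occ.2 ⟨z, hc.resolve_left hz, rfl⟩, Local.glue_symm hg⟩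
    refine ⟨fun j hj hjn => ?_, fun u hu c => ?_, fun x hx y hy hxT hyT => ?_⟩
    · rcases hj.eq_or_lt with rfl | hj
      · exact hv
      · exact hvalid j hj hjn
    · rw [stateOf_eq T hin]
      split_ifs with hup
      · subst hup
        rw [hv.target_dom]
        exact hdom _ (by omega) c
      · exact hdom u (by omega) c
    · exact (transGen_link_step hin hi (by omega) (hlink x (by omega) y (by omega) hxT hyT)).1
        (by omega)

theorem isRun_stateOf {T : G.Subgraph} (hroot : r ∈ T.verts) (hT : T.coe.Connected)
    (hn : 0 < n) : IsRun n S.par S.loc 1 (S.stateOf T) (S.choiceOf T) where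
  init u _ := by simpa [stateOf, stateAfter] using St.isDisc_disc _
  valid := (stateOf_invariant hroot hT le_rfl hn).1
  fst _ _ _ := rfl
  snd _ _ _ := rfl
  target i _ hin := by rw [stateOf_eq T hin, if_pos rfl]
  rest i _ hin u _ h := by rw [stateOf_eq T hin, if_neg h]

theorem stateOf_one {T : G.Subgraph} (hroot : r ∈ T.verts) (hT : T.coe.Connected)
    (hn : 0 < n) : S.stateOf T 1 0 = St.disc {S.col 0} := by
  have hdom := (stateOf_invariant (S := S) hroot hT le_rfl hn).2.1 0 (by omega)
  have hat : ∀ c x, S.At 0 c x → c = S.col 0 := by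
    intro c x h
    have := h.le hn
    obtain rfl : x = 0 := by omega
    exact h.2.symm
  have hmem : S.vert 0 ∈ T.verts := by rwa [S.vert_zero hn]
  refine St.ext fun a b => ⟨fun h => ?_, ?_⟩
  · obtain ⟨x, hx, -⟩ := (hdom a).1 (St.trans _ h (St.symm _ h))
    obtain ⟨y, hy, -⟩ := (hdom b).1 (St.trans _ (St.symm _ h) h)
    rw [hat a x hx, hat b y hy]
    simp
  · simp only [St.disc_rel, Set.mem_singleton_iff]
    rintro ⟨rfl, rfl⟩
    exact (hdom _).2 ⟨0, at_self 0, hmem⟩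

theorem stateOf_self_rel {T : G.Subgraph} (hroot : r ∈ T.verts) (hT : T.coe.Connected)
    {i : ℕ} (hi : i < n) :
    (S.choiceOf T i).σ₁.Rel (S.col i) (S.col i) ↔ S.vert i ∈ T.verts := by
  refine ((stateOf_invariant hroot hT (by omega) (by omega : i + 1 ≤ n)).2.1 i (by omega) _).trans
    ⟨?_, fun h => ⟨i, at_self i, h⟩⟩
  rintro ⟨x, hx, h⟩
  obtain rfl := hx.unique hi (at_self i)
  exact h

end Scheme

end SteinerDP

/-! ### Optimal solutions -/

namespace SteinerDP

open PCSTInstance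

variable {P : PCSTInstance} {K : ℕ}

/-- The value of a subgraph: its objective, then its number of edges. -/
noncomputable def value (P : PCSTInstance) (T : P.G.Subgraph) : Val :=
  toLex ((P.objective T : ℝ), T.edgeSet.ncard)

open Classical in
/-- The contribution of the choice made at position `t` to the value of the subgraph. -/
noncomputable def weight (S : Scheme P.G P.root K) (t : ℕ) (c : Choice K) : Val :=
  toLex ((∑ a ∈ c.A, (P.cost s(S.vert t, S.vert (S.slot t a)) : ℝ)) +
    (if c.σ₁.Rel (S.col t) (S.col t) then 0 else (P.penalty (S.vert t) : ℝ)), c.A.card)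

theorem sum_toLex {ι : Type*} (s : Finset ι) (f : ι → ℝ) (g : ι → ℕ) :
    ∑ i ∈ s, (toLex (f i, g i) : Val) = toLex (∑ i ∈ s, f i, ∑ i ∈ s, g i) := by
  classical
  induction s using Finset.induction_on with
  | empty => rfl
  | insert a s ha ih =>
    rw [sum_insert ha, sum_insert ha, sum_insert ha, ih]
    rfl

theorem n_pos (P : PCSTInstance) : 0 < P.n := P.root.pos

theorem value_eq (S : Scheme P.G P.root K) {T : P.G.Subgraph} {C : ℕ → Choice K}
    (hroot : P.root ∈ T.verts)
    (hsub : ∀ t, 1 ≤ t → t < P.n → (C t).A ⊆ (S.loc t).edg)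
    (hadj : ∀ t, 1 ≤ t → t < P.n → ∀ u ∈ S.bag t,
      S.col u ∈ (C t).A ↔ T.Adj (S.vert t) (S.vert u))
    (hmem : ∀ t, 1 ≤ t → t < P.n →
      ((C t).σ₁.Rel (S.col t) (S.col t) ↔ S.vert t ∈ T.verts)) :
    value P T = ∑ t ∈ Ico 1 P.n, weight S t (C t) := by
  classical
  set E : Finset (Σ _ : ℕ, Fin K) := (Ico 1 P.n).sigma fun t => (C t).A with hE
  set g : (Σ _ : ℕ, Fin K) → Sym2 (Fin P.n) := fun x => s(S.vert x.1, S.vert (S.slot x.1 x.2))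
  have hEmem : ∀ x ∈ E, x.1 < P.n ∧ ∃ u ∈ S.bag x.1, u < x.1 ∧ x.2 = S.col u ∧
      S.slot x.1 x.2 = u ∧ T.Adj (S.vert x.1) (S.vert u) := by
    rintro ⟨t, a⟩ hx
    simp only [hE, Finset.mem_sigma, Finset.mem_Ico] at hx
    obtain ⟨u, hu, -, rfl⟩ := S.mem_edg.1 (hsub t hx.1.1 hx.1.2 hx.2)
    exact ⟨hx.1.2, u, hu, S.bag_lt t hx.1.2 u hu, rfl, S.slot_col hx.1.2 hu,
      (hadj t hx.1.1 hx.1.2 u hu).1 hx.2⟩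
  have hinj : Set.InjOn g E := by
    intro x hx y hy h
    obtain ⟨hxn, u, hu, hux, hxu, hsx, -⟩ := hEmem x hx
    obtain ⟨hyn, w, hw, hwy, hyw, hsy, -⟩ := hEmem y hy
    simp only [g, hsx, hsy, Sym2.eq_iff] at h
    rcases h with ⟨h₁, h₂⟩ | ⟨h₁, h₂⟩
    · have e1 := S.vert_inj hxn hyn h₁
      have e2 := S.vert_inj (by omega) (by omega) h₂
      obtain ⟨t, a⟩ := x
      obtain ⟨t', a'⟩ := y
      simp only at e1 hxu hyw
      subst e1 e2 hxu hyw
      rfl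
    · have e1 := S.vert_inj hxn (by omega) h₁
      have e2 := S.vert_inj (by omega) hyn h₂
      omega
  have himg : E.image g = univ.filter fun e => e ∈ T.edgeSet := by
    ext e
    simp only [mem_image, mem_filter, mem_univ, true_and]
    constructor
    · rintro ⟨x, hx, rfl⟩
      obtain ⟨_, u, _, _, _, hs, h⟩ := hEmem x hx
      simpa [g, hs] using h
    · intro h
      have key : ∀ t u, t < P.n → u < t → T.Adj (S.vert t) (S.vert u) →
          ∃ x ∈ E, g x = s(S.vert t, S.vert u) := by
        intro t u ht hut hT
        have hb := S.adj t ht u hut hT.adj_sub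
        refine ⟨⟨t, S.col u⟩, ?_, ?_⟩
        · simp only [hE, Finset.mem_sigma, Finset.mem_Ico]
          exact ⟨⟨by omega, ht⟩, (hadj t (by omega) ht u hb).2 hT⟩
        · simp only [g, S.slot_col ht hb]
      induction e using Sym2.ind with
      | _ x y =>
        rw [SimpleGraph.Subgraph.mem_edgeSet] at h
        rcases lt_trichotomy (S.pos x) (S.pos y) with h' | h' | h'
        · obtain ⟨z, hz, hg⟩ := key _ _ (S.pos_lt y) h' (by simpa only [S.vert_pos] using h.symm)
          exact ⟨z, hz, by rw [hg, S.vert_pos, S.vert_pos, Sym2.eq_swap]⟩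
        · have := congrArg S.vert h'
          rw [S.vert_pos, S.vert_pos] at this
          exact (h.ne this).elim
        · obtain ⟨z, hz, hg⟩ := key _ _ (S.pos_lt x) h' (by simpa only [S.vert_pos] using h)
          exact ⟨z, hz, by rw [hg, S.vert_pos, S.vert_pos]⟩
  have hcard : T.edgeSet.ncard = ∑ t ∈ Ico 1 P.n, (C t).A.card := by
    rw [← Finset.card_sigma, ← card_image_of_injOn hinj, himg, ← Set.ncard_coe_finset]
    congr 1
    ext e; simp
  have hcost : ∑ e : Sym2 (Fin P.n) with e ∈ T.edgeSet, (P.cost e : ℝ) =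
      ∑ t ∈ Ico 1 P.n, ∑ a ∈ (C t).A,
        (P.cost s(S.vert t, S.vert (S.slot t a)) : ℝ) := by
    rw [Finset.sum_sigma', ← himg, Finset.sum_image hinj]
  have hpen : ∑ v : Fin P.n with v ∉ T.verts, (P.penalty v : ℝ) =
      ∑ t ∈ Ico 1 P.n, if (C t).σ₁.Rel (S.col t) (S.col t) then 0
        else (P.penalty (S.vert t) : ℝ) := by
    have h1 : ∑ v : Fin P.n with v ∉ T.verts, (P.penalty v : ℝ) =
        ∑ t ∈ range P.n, if S.vert t ∉ T.verts then (P.penalty (S.vert t) : ℝ) else 0 := by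
      rw [Finset.sum_filter]
      refine Finset.sum_bij (fun v _ => S.pos v) (fun v _ => by simpa using S.pos_lt v)
        (fun v _ w _ h => ?_) (fun t ht => ⟨S.vert t, by simp, S.pos_vert t (by simpa using ht)⟩)
        fun v _ => by rw [S.vert_pos]
      rw [← S.vert_pos v, h, S.vert_pos]
    rw [h1, Finset.range_eq_Ico, Finset.sum_eq_sum_Ico_succ_bot (n_pos P)]
    rw [if_neg (by rw [S.vert_zero (n_pos P)]; simpa using hroot), zero_add]
    refine sum_congr rfl fun t ht => ?_
    simp only [Finset.mem_Ico] at ht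
    simp only [hmem t ht.1 ht.2, ite_not]
  rw [value]
  simp only [weight]
  rw [sum_toLex, Finset.sum_add_distrib, ← hcost, ← hpen, ← hcard]
  simp only [objective, NNReal.coe_add, NNReal.coe_sum]

/-- A connected subgraph containing the root whose value is least is an optimal tree: a spanning
tree of it costs no more and has fewer edges unless it is the whole subgraph. -/
theorem isOptimal_of_value_le {T : P.G.Subgraph} (hroot : P.root ∈ T.verts)
    (hT : T.coe.Connected) (hmin : ∀ T' : P.G.Subgraph, P.root ∈ T'.verts → T'.coe.Connected →
      value P T ≤ value P T') : P.IsOptimal T := by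
  classical
  refine ⟨⟨hroot, ?_⟩, fun T' hT' => ?_⟩
  · -- a spanning tree `T'` of `T` has the same vertices, hence the same penalties
    obtain ⟨F, hF, hFtree⟩ := hT.exists_isTree_le
    let T' : P.G.Subgraph :=
      { verts := T.verts
        Adj := fun x y => ∃ (hx : x ∈ T.verts) (hy : y ∈ T.verts), F.Adj ⟨x, hx⟩ ⟨y, hy⟩
        adj_sub := fun ⟨_, _, h⟩ => T.adj_sub (hF h)
        edge_vert := fun ⟨hx, _, _⟩ => hx
        symm := ⟨fun _ _ ⟨hx, hy, h⟩ => ⟨hy, hx, h.symm⟩⟩ }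
    have hcoe : T'.coe = F := by
      ext x y
      exact ⟨fun ⟨_, _, h⟩ => h, fun h => ⟨x.2, y.2, h⟩⟩
    have hle : T'.edgeSet ⊆ T.edgeSet := by
      intro e
      induction e using Sym2.ind with
      | _ x y =>
        rintro ⟨_, _, h⟩
        exact hF h
    have hobj : P.objective T' ≤ P.objective T := by
      unfold objective
      gcongr
    have hval := hmin T' hroot (hcoe ▸ hFtree.connected)
    have hcard : T.edgeSet.ncard ≤ T'.edgeSet.ncard := by
      rw [value, value, Prod.Lex.toLex_le_toLex] at hval
      rcases hval with h | h
      · exact (not_lt_of_ge hobj (by exact_mod_cast h)).elim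
      · exact h.2
    have heq := Set.eq_of_subset_of_ncard_le hle hcard
    have hTT' : T.coe = F := by
      rw [← hcoe]
      ext x y
      have := Set.ext_iff.1 heq s((x : Fin P.n), (y : Fin P.n))
      exact this.symm
    rw [hTT']; exact hFtree
  · have := hmin T' hT'.1 hT'.2.connected
    rw [value, value, Prod.Lex.toLex_le_toLex] at this
    rcases this with h | h
    · exact_mod_cast h.le
    · exact_mod_cast h.1.le

/-- From tables that are complete and sound, the choices recorded with them reconstruct an optimal
prize-collecting Steiner tree. -/
theorem exists_optimal_run (S : Scheme P.G P.root K) {T : ℕ → St K → Option Val}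
    {ch : ℕ → St K → Choice K → Prop} (hc : Complete P.n S.par S.loc (weight S) 1 T)
    (hs : Sound P.n S.par S.loc (weight S) 1 T ch) :
    ∃ sts C, IsRun P.n S.par S.loc 1 sts C ∧ sts 1 0 = St.disc {S.col 0} ∧
      (∀ i, 1 ≤ i → i < P.n → ch i (sts i (S.par i)) (C i)) ∧
      P.IsOptimal (S.runSubgraph sts C) := by
  classical
  have hn := n_pos P
  -- every connected subgraph containing the root has a run, so the table bounds its value
  have hlower : ∀ T' : P.G.Subgraph, P.root ∈ T'.verts → T'.coe.Connected →
      ∃ w, T 0 (St.disc {S.col 0}) = some w ∧ w ≤ value P T' := by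
    intro T' hr hT'
    obtain ⟨f, hf, hle⟩ := hc _ _ (Scheme.isRun_stateOf (S := S) hr hT' hn)
    refine ⟨f 0, by rw [← Scheme.stateOf_one hr hT' hn]; exact hf 0 (by omega), ?_⟩
    rw [value_eq S (C := S.choiceOf T') hr
      (fun t _ _ => Finset.filter_subset _ _)
      (fun t _ ht u hu => Scheme.mem_usedColors ht hu)
      (fun t _ ht => Scheme.stateOf_self_rel hr hT' ht)]
    simpa using hle
  -- the table has an entry, as the root alone is connected
  have hsingle : P.root ∈ (P.G.singletonSubgraph P.root).verts ∧
      (P.G.singletonSubgraph P.root).coe.Connected :=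
    ⟨rfl, SimpleGraph.Subgraph.connected_of_reflTransGen _ (r := P.root) rfl fun v hv => by
      rw [show v = P.root from hv]⟩
  obtain ⟨w, hw, -⟩ := hlower _ hsingle.1 hsingle.2
  obtain ⟨sts, C, hr, hst, hch, hsum⟩ := hs (fun _ => St.disc {S.col 0}) (fun _ => w)
    (fun u hu => by obtain rfl : u = 0 := by omega
                    exact hw)
  have hone : sts 1 0 = St.disc {S.col 0} := hst 0 (by omega)
  obtain ⟨hroot, hconn⟩ := Scheme.run_connected hr hn (by rw [hone]; simp)
  refine ⟨sts, C, hr, hone, hch, isOptimal_of_value_le hroot hconn fun T' hr' hT' => ?_⟩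
  obtain ⟨w', hw', hle⟩ := hlower T' hr' hT'
  have hval := value_eq S (T := S.runSubgraph sts C) (C := C) hroot
    (fun t ht htn => (hr.valid t ht htn).sub)
    (fun t ht htn u hu => ⟨fun h => Scheme.runSubgraph_adj hr htn hu h, fun h => by
      have hut := S.bag_lt t htn u hu
      simp only [Scheme.runSubgraph, S.pos_vert t htn, S.pos_vert u (by omega)] at h
      rcases h.2.2.2 with h | h
      · exact h.2
      · omega⟩)
    (fun t ht htn => by
      rw [← hr.fst t ht htn, Scheme.run_dom hr (i := t + 1) (by omega) (by omega) (by omega)]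
      simp only [Scheme.runSubgraph, Set.mem_ofPred_eq, S.pos_vert t htn])
  rw [hval, ← hsum]
  simpa [Option.some.inj (hw.symm.trans hw')] using hle

end SteinerDP

open RAM
local notation "ONE" => (4 : ℕ)
local notation "ZERO" => (5 : ℕ)

/-! ### The dynamic program on the machine: preparation -/

namespace SteinerDP

/-! The numbers of arrays (beginning with `a`) and of families of arrays (beginning with `f`). For
each position: its vertex, colour and parent, and the current state in the reconstruction of the
solution; `aPos` is indexed by vertices. The families `fSlot` and `fEdge` describe the members of
the bag and the edges to them, by colour. -/

local notation "aVert" => (8 : ℕ)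
local notation "aPos" => (9 : ℕ)
local notation "aCol" => (10 : ℕ)
local notation "aPar" => (11 : ℕ)
local notation "aCur" => (12 : ℕ)
local notation "fSlot" => (0 : ℕ)
local notation "fEdge" => (1 : ℕ)

variable {P : PCSTInstance} {K : ℕ}

/-- The part of the memory that describes the instance. -/
structure InstanceMem (P : PCSTInstance) (es : List P.G.Dart) (s : State) : Prop where
  n : s.nreg 0 = P.n
  m : s.nreg 1 = es.length
  root : s.nreg 2 = P.root
  one : s.nreg ONE = 1
  zero : s.nreg ZERO = 0
  fst : ∀ i (h : i < es.length), s.narr 0 i = (es[i].fst : ℕ)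
  snd : ∀ i (h : i < es.length), s.narr 1 i = (es[i].snd : ℕ)
  cost : ∀ i (h : i < es.length), s.rarr 0 i = P.cost es[i].edge
  penalty : ∀ v : Fin P.n, s.rarr 1 v = P.penalty v

theorem InstanceMem.of_agree {es : List P.G.Dart} {s s' : State} (h : InstanceMem P es s)
    {p : Program} (ha : Agree p s s') (hn : ∀ x < 6, ¬ p.wN x) (h0 : ¬ p.wNA 0)
    (h1 : ¬ p.wNA 1) (h2 : ¬ p.wRA 0) (h3 : ¬ p.wRA 1) : InstanceMem P es s' where
  n := by rw [ha.n _ (hn _ (by omega)), h.n]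
  m := by rw [ha.n _ (hn _ (by omega)), h.m]
  root := by rw [ha.n _ (hn _ (by omega)), h.root]
  one := by rw [ha.n _ (hn _ (by omega)), h.one]
  zero := by rw [ha.n _ (hn _ (by omega)), h.zero]
  fst := by rw [ha.na _ h0]; exact h.fst
  snd := by rw [ha.na _ h1]; exact h.snd
  cost := by rw [ha.ra _ h2]; exact h.cost
  penalty := by rw [ha.ra _ h3]; exact h.penalty

/-- The memory describes the elimination scheme `S`: the arrays `aVert`, `aPos` (shifted by one) and
`aCol` hold the vertices, positions and colours, and the array `fam fSlot c` holds, for every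
position, the position in its bag that has colour `c`, plus one, or `0` if there is none. -/
structure SchemeMem (S : Scheme P.G P.root K) (s : State) : Prop where
  vert : ∀ t < P.n, s.narr aVert t = S.vert t
  pos : ∀ v : Fin P.n, s.narr aPos v = S.pos v + 1
  col : ∀ t < P.n, s.narr aCol t = S.col t
  slot : ∀ t < P.n, ∀ c : Fin K, ∀ u,
    s.narr (fam fSlot c) t = u + 1 ↔ u ∈ S.bag t ∧ S.col u = c

theorem SchemeMem.of_agree {S : Scheme P.G P.root K} {s s' : State} (h : SchemeMem S s)
    {p : Program} (ha : Agree p s s') (h0 : ¬ p.wNA aVert) (h1 : ¬ p.wNA aPos)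
    (h2 : ¬ p.wNA aCol) (h3 : ∀ c, ¬ p.wNA (fam fSlot c)) : SchemeMem S s' where
  vert := by rw [ha.na _ h0]; exact h.vert
  pos := by rw [ha.na _ h1]; exact h.pos
  col := by rw [ha.na _ h2]; exact h.col
  slot t ht c := by rw [ha.na _ (h3 c)]; exact h.slot t ht c

/-- Treat the edge whose number is in register `8`. -/
@[simp] noncomputable def edgeBody (K : ℕ) : Program :=
  .seq (block [.natLoad 9 0 8, .natLoad 10 1 8, .natLoad 9 aPos 9, .natLoad 10 aPos 10])
    (.seq (.ite (.natLt 9 10) (block [.natSub 11 10 ONE, .natSub 12 9 ONE])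
        (block [.natSub 11 9 ONE, .natSub 12 10 ONE]))
      (.seq (block [.natLoad 13 aCol 12, .natAdd 14 8 ONE])
        (switchN 13 K fun c => .instr (.natStore (fam fEdge c) 11 14))))

/-- Record, for every edge, its number plus one at the later of its endpoints, under the colour of
the earlier one. -/
@[simp] noncomputable def edgeSlots (K : ℕ) : Program := forUp 8 1 (edgeBody K)

theorem edgeBody_loopFree : (edgeBody K).LoopFree := by
  simp [switchN_loopFree]

theorem edgeBody_len : (edgeBody K).len ≤ 3 * K + 20 := by
  have := switchN_len (x := 13) (m := K) (f := fun c => .instr (.natStore (fam fEdge c) 11 14))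
    (c := 1) (by simp)
  simp; omega

/-- The arrays `fam fEdge c` describe the edges among the first `j`. -/
def EdgeMem (S : Scheme P.G P.root K) (es : List P.G.Dart) (j : ℕ) (s : State) : Prop :=
  ∀ t < P.n, ∀ c : Fin K, ∀ e, s.narr (fam fEdge c) t = e + 1 ↔
    e < j ∧ ∃ u ∈ S.bag t, S.col u = c ∧
      (es.map fun d => d.edge)[e]? = some s(S.vert t, S.vert u)

theorem edgeSlots_runs (S : Scheme P.G P.root K) {es : List P.G.Dart} (hes : IsEdgeList es)
    {s : State} (hI : InstanceMem P es s) (hS : SchemeMem S s)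
    (h0 : ∀ c : Fin K, ∀ t, s.narr (fam fEdge c) t = 0) :
    Runs (edgeSlots K) s (es.length * (3 * K + 22) + 2) (EdgeMem S es es.length) := by
  have := Runs.forUp (i := 8) (b := 1) (p := edgeBody K) (s := s) (3 * K + 20) (EdgeMem S es)
    (by simp) (by simp) (by simp) (by decide) (by decide) hI.one
    (by simp [EdgeMem, h0]) ?_
  · rw [hI.m] at this; exact this
  intro j s' hj hj8 ha hE
  rw [hI.m] at hj
  have hS' := hS.of_agree ha (by simp) (by simp) (by simp)
    (by simp)
  have hI' := hI.of_agree ha (by simp; omega) (by simp)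
    (by simp) (by simp) (by simp)
  refine Runs.of_run_le edgeBody_loopFree edgeBody_len ?_
  set x := es[j].fst with hx
  set y := es[j].snd with hy
  have hxy : P.G.Adj x y := es[j].adj
  have hpne : S.pos x ≠ S.pos y := fun h => hxy.ne (by rw [← S.vert_pos x, h, S.vert_pos])
  obtain ⟨t, u, hut, htn, hedge, hrun⟩ : ∃ t u, u < t ∧ t < P.n ∧
      es[j].edge = s(S.vert t, S.vert u) ∧ ∀ c d, ((edgeBody K).run s').narr (fam fEdge c) d =
        if c = S.col u ∧ d = t then j + 1 else s'.narr (fam fEdge c) d := by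
    have e1 : s'.narr 0 j = x := hI'.fst j hj
    have e2 : s'.narr 1 j = y := hI'.snd j hj
    have hedge : es[j].edge = s(x, y) := by
      simp [hx, hy, SimpleGraph.Dart.edge]
    rcases lt_or_gt_of_ne hpne with h | h
    · refine ⟨S.pos y, S.pos x, h, S.pos_lt y, ?_, fun c d => ?_⟩
      · rw [S.vert_pos, S.vert_pos, hedge, Sym2.eq_swap]
      · simp only [edgeBody, Program.run]
        rw [switchN_run _ _ (by decide)]
        · simp [update_apply, hj8, e1, e2, hS'.pos, h, hI'.one,
            hS'.col _ (S.pos_lt x)]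
          split_ifs <;> simp_all
        · simp [hj8, e1, e2, hS'.pos, h, hI'.one,
            hS'.col _ (S.pos_lt x)]
    · refine ⟨S.pos x, S.pos y, h, S.pos_lt x, ?_, fun c d => ?_⟩
      · rw [S.vert_pos, S.vert_pos, hedge]
      · simp only [edgeBody, Program.run]
        rw [switchN_run _ _ (by decide)]
        · simp [update_apply, hj8, e1, e2, hS'.pos, h.not_gt,
            hI'.one, hS'.col _ (S.pos_lt y)]
          split_ifs <;> simp_all
        · simp [hj8, e1, e2, hS'.pos, h.not_gt,
            hI'.one, hS'.col _ (S.pos_lt y)]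
  have hub : u ∈ S.bag t := S.adj t htn u hut (by
    have := es[j].edge_mem
    rwa [hedge] at this)
  have hget : (es.map fun d => d.edge)[j]? = some s(S.vert t, S.vert u) := by
    rw [List.getElem?_map, List.getElem?_eq_getElem hj]
    simp [hedge]
  have huniq : ∀ e, (es.map fun d => d.edge)[e]? = some s(S.vert t, S.vert u) → e = j := by
    intro e he
    exact ((List.getElem?_inj (by simpa using hj) hes.1).1 (hget.trans he.symm)).symm
  intro t' ht' c e
  simp only [State.setN_narr, hrun]
  split_ifs with hc
  · obtain ⟨hc, rfl⟩ := hc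
    have hc : c = S.col u := Fin.ext hc
    constructor
    · intro he
      obtain rfl : e = j := by omega
      exact ⟨by omega, u, hub, hc.symm, hget⟩
    · rintro ⟨-, w, hw, hwc, he⟩
      obtain rfl := S.col_inj ht' hw hub (hwc.trans hc)
      rw [huniq e he]
  · rw [hE t' ht' c e]
    constructor
    · rintro ⟨h1, h2⟩
      exact ⟨by omega, h2⟩
    · rintro ⟨h1, w, hw, hwc, he⟩
      refine ⟨?_, w, hw, hwc, he⟩
      rcases Nat.lt_succ_iff_lt_or_eq.1 h1 with h1 | rfl
      · exact h1
      · rw [hget, Option.some_inj, Sym2.eq_iff] at he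
        have hwt := S.bag_lt t' ht' w hw
        rcases he with ⟨h1, h2⟩ | ⟨h1, h2⟩
        · obtain rfl := S.vert_inj htn ht' h1
          obtain rfl := S.vert_inj (by omega) (by omega) h2
          exact (hc ⟨by rw [← hwc], rfl⟩).elim
        · have := S.vert_inj htn (by omega) h1
          have := S.vert_inj (by omega) ht' h2
          omega

/-! ### The dynamic program on the machine: tables -/

/-! The tables are families with one array for each state: `fFlag` tells whether there is an entry,
the real arrays `fVal` and the arrays `fCount` are the components of its value, and `fChoice` is the
recorded choice. The registers of the same families hold the best candidate found so far. The real
registers `fCost` hold the costs of the edges to the members of the bag, by colour. -/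

local notation "fFlag" => (2 : ℕ)
local notation "fCount" => (3 : ℕ)
local notation "fChoice" => (4 : ℕ)
local notation "fCost" => (0 : ℕ)
local notation "fVal" => (1 : ℕ)

/-- The number of a state. -/
noncomputable def St.code (σ : St K) : ℕ := Fintype.equivFin (St K) σ

theorem St.code_lt (σ : St K) : σ.code < Fintype.card (St K) := (Fintype.equivFin _ σ).2

@[simp] theorem St.code_inj {σ τ : St K} : σ.code = τ.code ↔ σ = τ := by
  simp [St.code, Fin.val_inj]

/-- The number of a choice. -/
noncomputable def Choice.code (c : Choice K) : ℕ := Fintype.equivFin (Choice K) c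

theorem Choice.code_lt (c : Choice K) : c.code < Fintype.card (Choice K) :=
  (Fintype.equivFin _ c).2

/-- The choice with a given number. -/
noncomputable def Choice.ofCode (k : ℕ) : Choice K :=
  if h : k < Fintype.card (Choice K) then (Fintype.equivFin _).symm ⟨k, h⟩
  else ⟨St.disc ∅, ∅, St.disc ∅⟩

@[simp] theorem Choice.ofCode_code (c : Choice K) : Choice.ofCode c.code = c := by
  rw [ofCode, dif_pos c.code_lt]
  exact (Fintype.equivFin _).symm_apply_apply c

/-- The table entry of position `u` at the state `σ`: a flag tells whether there is one. -/
noncomputable def tabOf (s : State) (u : ℕ) (σ : St K) : Option Val :=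
  if 0 < s.narr (fam fFlag σ.code) u then
    some (toLex (s.rarr (fam fVal σ.code) u, s.narr (fam fCount σ.code) u)) else none

/-- The recorded choices. -/
def recorded (s : State) (u : ℕ) (σ : St K) (c : Choice K) : Prop :=
  s.narr (fam fChoice σ.code) u = c.code

/-- The best candidate found so far for the state `σ`, with the number of its choice. -/
noncomputable def accOf (s : State) (σ : St K) : Option (Val × ℕ) :=
  if 0 < s.nreg (fam fFlag σ.code) then
    some (toLex (s.rreg (fam fVal σ.code), s.nreg (fam fCount σ.code)),
      s.nreg (fam fChoice σ.code)) else none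

open Classical in
/-- Compute the value of a choice in the real register `1` and the register `17`. The registers
`9` and `10` hold the position and its parent, the real register `0` the penalty and the real
registers `fam fCost a` the edge costs. -/
noncomputable def candidate (l : Local K) (c : Choice K) : Program :=
  .seq (block [.realLoad 1 (fam fVal c.σ₁.code) 9, .realLoad 2 (fam fVal c.σ₂.code) 10,
      .realAdd 1 1 2, .natLoad 17 (fam fCount c.σ₁.code) 9, .natLoad 18 (fam fCount c.σ₂.code) 10,
      .natAdd 17 17 18, .natConst 18 c.A.card, .natAdd 17 17 18])
    (.seq (seqs (c.A.toList.map fun a : Fin K => .instr (.realAdd 1 1 (fam fCost a))))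
      (if c.σ₁.Rel l.col l.col then skip else .instr (.realAdd 1 1 0)))

/-- Set register `19` to `1` if the candidate is better than what is known for `τ`, otherwise
to `0`. -/
noncomputable def compareWith (τ : St K) : Program :=
  .seq (.instr (.natConst 19 0))
    (.ite (.natLt ZERO (fam fFlag τ.code))
      (.ite (.realLt 1 (fam fVal τ.code)) (.instr (.natConst 19 1))
        (.ite (.realLt (fam fVal τ.code) 1) skip
          (.ite (.natLt 17 (fam fCount τ.code)) (.instr (.natConst 19 1)) skip)))
      (.instr (.natConst 19 1)))

/-- Replace what is known for `τ` by the candidate, whose choice has number `k`. -/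
noncomputable def replaceBy (τ : St K) (k : ℕ) : Program :=
  block [.natConst (fam fFlag τ.code) 1, .natAdd (fam fCount τ.code) 17 ZERO,
    .natConst (fam fChoice τ.code) k, .realAdd (fam fVal τ.code) 1 3]

/-- Take the choice `c` into account. -/
noncomputable def relax (l : Local K) (c : Choice K) : Program :=
  .seq (block [.natLoad 16 (fam fFlag c.σ₁.code) 9, .natLoad 17 (fam fFlag c.σ₂.code) 10])
    (.ite (.natLt ZERO 16) (.ite (.natLt ZERO 17)
      (.seq (candidate l c) (.seq (compareWith (l.target c))
        (.ite (.natLt ZERO 19) (replaceBy (l.target c) c.code) skip))) skip) skip)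

section relax
variable {l : Local K} {c : Choice K}

theorem candidate_loopFree : (candidate l c).LoopFree := by
  simp only [candidate, Program.LoopFree, block_loopFree, true_and, seqs_loopFree]
  refine ⟨by simp, ?_⟩
  split_ifs <;> simp

theorem relax_loopFree : (relax l c).LoopFree := by
  simp [relax, candidate_loopFree, compareWith, replaceBy]

theorem candidate_wN (x : ℕ) (h : (candidate l c).wN x) : x = 6 ∨ x = 17 ∨ x = 18 := by
  unfold candidate at h
  split_ifs at h <;> simp at h <;> tauto
theorem candidate_wR (x : ℕ) (h : (candidate l c).wR x) : x = 1 ∨ x = 2 := by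
  unfold candidate at h
  split_ifs at h <;> simp at h <;> tauto
theorem candidate_wNA (x : ℕ) : ¬ (candidate l c).wNA x := by
  unfold candidate
  split_ifs <;> simp
theorem candidate_wRA (x : ℕ) : ¬ (candidate l c).wRA x := by
  unfold candidate
  split_ifs <;> simp

theorem relax_wN (x : ℕ) (h : (relax l c).wN x) :
    x = 6 ∨ (16 ≤ x ∧ x < 20) ∨ ∃ a σ, 2 ≤ a ∧ a < 5 ∧ x = fam a (St.code (K := K) σ) := by
  simp only [relax, Program.wN, block_wN, compareWith, replaceBy, skip_wN, List.mem_cons,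
    List.not_mem_nil, or_false, exists_eq_or_imp, exists_eq_left, Instr.wN] at h
  have := candidate_wN (l := l) (c := c) x
  by_cases h2 : ∃ a σ, 2 ≤ a ∧ a < 5 ∧ x = fam a (St.code (K := K) σ)
  · exact .inr (.inr h2)
  · push Not at h2
    have e2 := h2 2 (l.target c) (by omega) (by omega)
    have e3 := h2 3 (l.target c) (by omega) (by omega)
    have e4 := h2 4 (l.target c) (by omega) (by omega)
    by_cases hc : (candidate l c).wN x
    · have := this hc; omega
    · simp only [hc, false_or] at h; omega
theorem relax_wR (x : ℕ) (h : (relax l c).wR x) :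
    x = 1 ∨ x = 2 ∨ ∃ σ, x = fam fVal (St.code (K := K) σ) := by
  simp [relax, compareWith, replaceBy] at h
  rcases h with h | h
  · rcases candidate_wR x h with h | h <;> simp [h]
  · exact .inr (.inr ⟨_, h⟩)
theorem relax_wNA (x : ℕ) : ¬ (relax l c).wNA x := by
  simp [relax, compareWith, replaceBy, candidate_wNA]
theorem relax_wRA (x : ℕ) : ¬ (relax l c).wRA x := by
  simp [relax, compareWith, replaceBy, candidate_wRA]

theorem candidate_len : (candidate l c).len ≤ K + 13 := by
  have h := seqs_map_len_le (l := c.A.toList)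
    (f := fun a : Fin K => Program.instr (.realAdd 1 1 (fam fCost a))) (c := 1) (by simp)
  have h' : c.A.toList.length ≤ K := by
    simpa using card_le_univ c.A
  unfold candidate
  simp only [Program.len, block_len, List.length_cons, List.length_nil]
  split_ifs <;> simp <;> omega

theorem relax_len : (relax l c).len ≤ K + 40 := by
  have := candidate_len (l := l) (c := c)
  simp [relax, compareWith, replaceBy]; omega

open Classical in
theorem candidate_run (s : State) :
    ((candidate l c).run s).rreg 1 = s.rarr (fam fVal c.σ₁.code) (s.nreg 9) +
        s.rarr (fam fVal c.σ₂.code) (s.nreg 10) + ((∑ a ∈ c.A, s.rreg (fam fCost a)) +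
          if c.σ₁.Rel l.col l.col then 0 else s.rreg 0) ∧
      ((candidate l c).run s).nreg 17 = s.narr (fam fCount c.σ₁.code) (s.nreg 9) +
        s.narr (fam fCount c.σ₂.code) (s.nreg 10) + c.A.card := by
  have key : ∀ s : State,
      ((seqs (c.A.toList.map fun a : Fin K => .instr (.realAdd 1 1 (fam fCost a)))).run s).rreg 1 =
        s.rreg 1 + ∑ a ∈ c.A, s.rreg (fam fCost a) ∧
      ((seqs (c.A.toList.map fun a : Fin K => .instr (.realAdd 1 1 (fam fCost a)))).run s).nreg 17 =
        s.nreg 17 ∧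
      ((seqs (c.A.toList.map fun a : Fin K => .instr (.realAdd 1 1 (fam fCost a)))).run s).rreg 0 =
        s.rreg 0 := by
    intro s
    have := run_seqs_induction c.A.toList (fun a : Fin K => .instr (.realAdd 1 1 (fam fCost a)))
      (fun l' s' => s'.rreg 1 = s.rreg 1 + (l'.map fun a : Fin K => s.rreg (fam fCost a)).sum ∧
        s'.nreg 17 = s.nreg 17 ∧ s'.rreg 0 = s.rreg 0 ∧
        ∀ a, s'.rreg (fam fCost a) = s.rreg (fam fCost a)) s (by simp) (by simp) (by
        rintro l' a s' - - ⟨h1, h2, h3, h4⟩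
        simp [h1, h2, h3, h4]
        ring)
    refine ⟨?_, this.2.1, this.2.2.1⟩
    rw [this.1, Finset.sum_map_toList]
  simp only [candidate, Program.run]
  set s₁ := (block [.realLoad 1 (fam fVal c.σ₁.code) 9, .realLoad 2 (fam fVal c.σ₂.code) 10,
      .realAdd 1 1 2, .natLoad 17 (fam fCount c.σ₁.code) 9, .natLoad 18 (fam fCount c.σ₂.code) 10,
      .natAdd 17 17 18, .natConst 18 c.A.card, .natAdd 17 17 18]).run s with hs₁
  obtain ⟨k1, k2, k3⟩ := key s₁
  have e1 : s₁.rreg 1 = s.rarr (fam fVal c.σ₁.code) (s.nreg 9) +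
        s.rarr (fam fVal c.σ₂.code) (s.nreg 10) := by
    simp [hs₁]
  have e2 : s₁.nreg 17 = s.narr (fam fCount c.σ₁.code) (s.nreg 9) +
        s.narr (fam fCount c.σ₂.code) (s.nreg 10) + c.A.card := by
    simp [hs₁]
  have e3 : ∀ x, x ≠ 1 → x ≠ 2 → s₁.rreg x = s.rreg x := by
    intro x h1 h2
    simp [hs₁, h1, h2]
  have e4 : ∑ a ∈ c.A, s₁.rreg (fam fCost a) = ∑ a ∈ c.A, s.rreg (fam fCost a) :=
    sum_congr rfl fun a _ => e3 _ (by simp) (by simp)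
  split_ifs with h
  · simp [k1, k2, e1, e2, e4]
  · simp [k1, k2, k3, e1, e2, e3]
    ring

theorem compareWith_run (τ : St K) (s : State) (hz : s.nreg ZERO = 0) :
    (0 < ((compareWith τ).run s).nreg 19 ↔
      ∀ w k, accOf s τ = some (w, k) → toLex (s.rreg 1, s.nreg 17) < w) ∧
    (∀ x, x ≠ 6 → x ≠ 19 → ((compareWith τ).run s).nreg x = s.nreg x) ∧
    ((compareWith τ).run s).rreg = s.rreg := by
  refine ⟨?_, ?_, ?_⟩
  · by_cases hf : 0 < s.nreg (fam fFlag τ.code)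
    · simp only [accOf, hf, if_true, Option.some.injEq, Prod.mk.injEq, and_imp]
      simp only [compareWith, Program.run, Test.Holds, Instr.apply, update_apply]
      simp [hz, hf]
      rcases lt_trichotomy (s.rreg 1) (s.rreg (fam fVal τ.code)) with h | h | h
      · simp [h, Prod.Lex.toLex_lt_toLex]
      · simp [h, Prod.Lex.toLex_lt_toLex]
        split_ifs <;> simp_all
      · simp [h.not_gt, h, Prod.Lex.toLex_le_toLex]
    · simp [accOf, hf]
      simp only [compareWith, Program.run, Test.Holds, Instr.apply, update_apply]
      simp [hz, hf]
  · intro x h6 h19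
    exact (Program.LoopFree.agree (p := compareWith τ) (by simp [compareWith]) s).n x
      (by simp [compareWith, h6, h19])
  · funext x
    exact (Program.LoopFree.agree (p := compareWith τ) (by simp [compareWith]) s).r x
      (by simp [compareWith])

theorem replaceBy_run (τ : St K) (k : ℕ) (s : State) (hz : s.nreg ZERO = 0)
    (hr : s.rreg 3 = 0) (τ' : St K) :
    accOf ((replaceBy τ k).run s) τ' =
      if τ' = τ then some (toLex (s.rreg 1, s.nreg 17), k) else accOf s τ' := by
  by_cases h : τ' = τ
  · subst h
    simp [accOf, replaceBy, hz, hr]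
  · simp [accOf, replaceBy, hz, h]

open Classical in
/-- The weight of a choice as given by the registers. -/
noncomputable def regWeight (l : Local K) (s : State) (c : Choice K) : Val :=
  toLex ((∑ a ∈ c.A, s.rreg (fam fCost a)) +
    (if c.σ₁.Rel l.col l.col then 0 else s.rreg 0), c.A.card)

open Classical in
theorem relax_run (s : State) (hz : s.nreg ZERO = 0) (hr : s.rreg 3 = 0) (τ : St K) :
    accOf ((relax l c).run s) τ =
      (match tabOf s (s.nreg 9) c.σ₁, tabOf s (s.nreg 10) c.σ₂ with
      | some a, some b =>
        let w := a + b + regWeight l s c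
        if τ = l.target c ∧ ∀ w' k, accOf s τ = some (w', k) → w < w' then some (w, c.code)
        else accOf s τ
      | _, _ => accOf s τ) := by
  set s₁ := (block [.natLoad 16 (fam fFlag c.σ₁.code) 9,
    .natLoad 17 (fam fFlag c.σ₂.code) 10]).run s with hs₁
  have e16 : s₁.nreg 16 = s.narr (fam fFlag c.σ₁.code) (s.nreg 9) := by
    simp [hs₁]
  have e17 : s₁.nreg 17 = s.narr (fam fFlag c.σ₂.code) (s.nreg 10) := by
    simp [hs₁]
  have en : ∀ x, x ≠ 6 → x ≠ 16 → x ≠ 17 → s₁.nreg x = s.nreg x := by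
    intro x h1 h2 h3
    simp [hs₁, h1, h2, h3]
  have er : s₁.rreg = s.rreg := by simp [hs₁]
  have ena : s₁.narr = s.narr := by simp [hs₁]
  have era : s₁.rarr = s.rarr := by simp [hs₁]
  have hacc : ∀ s' : State, (∀ x, x ≠ 6 → x < 16 ∨ 20 ≤ x → s'.nreg x = s.nreg x) →
      (∀ x, x ≠ 1 → x ≠ 2 → s'.rreg x = s.rreg x) → ∀ τ : St K, accOf s' τ = accOf s τ := by
    intro s' hn hr τ
    have h64 := fun a => le_fam a τ.code
    have h2 := h64 2; have h3 := h64 3; have h4 := h64 4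
    simp only [accOf]
    rw [hn _ (by simp) (by omega), hn _ (by simp) (by omega), hn _ (by simp) (by omega),
      hr _ (by simp) (by simp)]
  simp only [relax, Program.run, Test.Holds, ← hs₁, e16, e17, en ZERO (by simp) (by simp) (by simp),
    hz]
  by_cases h1 : 0 < s.narr (fam fFlag c.σ₁.code) (s.nreg 9)
  swap
  · simp only [h1, if_false, tabOf, skip_run]
    exact hacc _ (fun x hx hx' => by simp [hx]; exact en x hx (by omega) (by omega))
      (fun x _ _ => by simp [er]) τ
  by_cases h2 : 0 < s.narr (fam fFlag c.σ₂.code) (s.nreg 10)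
  swap
  · simp only [h1, h2, if_true, if_false, tabOf, skip_run]
    exact hacc _ (fun x hx hx' => by simp [hx]; exact en x hx (by omega) (by omega))
      (fun x _ _ => by simp [er]) τ
  simp only [h1, h2, if_true, tabOf]
  set s₂ := (candidate l c).run s₁ with hs₂
  obtain ⟨c1, c2⟩ := candidate_run (l := l) (c := c) s₁
  rw [← hs₂] at c1 c2
  have ha₂ := (candidate_loopFree (l := l) (c := c)).agree s₁
  rw [← hs₂] at ha₂
  have en₂ : ∀ x, x ≠ 6 → x < 16 ∨ 20 ≤ x → s₂.nreg x = s.nreg x := fun x h6 hx => by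
    rw [ha₂.n x (fun h => by have := candidate_wN x h; omega), en x h6 (by omega) (by omega)]
  have er₂ : ∀ x, x ≠ 1 → x ≠ 2 → s₂.rreg x = s.rreg x := fun x h6 hx => by
    rw [ha₂.r x (fun h => by have := candidate_wR x h; omega), er]
  obtain ⟨d1, d2, d3⟩ := compareWith_run (l.target c) s₂ (by rw [en₂ _ (by simp) (by simp), hz])
  set s₃ := (compareWith (l.target c)).run s₂
  have en₃ : ∀ x, x ≠ 6 → x < 16 ∨ 20 ≤ x → s₃.nreg x = s.nreg x := fun x h6 hx => by
    rw [d2 x h6 (by omega), en₂ x h6 hx]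
  have hw : (toLex (s₂.rreg 1, s₂.nreg 17) : Val) =
      toLex (s.rarr (fam fVal c.σ₁.code) (s.nreg 9), s.narr (fam fCount c.σ₁.code) (s.nreg 9)) +
      toLex (s.rarr (fam fVal c.σ₂.code) (s.nreg 10), s.narr (fam fCount c.σ₂.code) (s.nreg 10)) +
      regWeight l s c := by
    rw [c1, c2, era, ena, er, en 9 (by simp) (by simp) (by simp), en 10 (by simp) (by simp)
      (by simp)]
    rfl
  rw [← hw]
  rw [en₃ ZERO (by simp) (by simp), hz]
  have hacc₂ := hacc s₂ en₂ er₂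
  have hacc₃ := hacc s₃ en₃ (by rw [d3]; exact er₂)
  by_cases hlt : 0 < s₃.nreg 19
  · rw [if_pos hlt, replaceBy_run _ _ _ (by rw [en₃ ZERO (by simp) (by simp), hz])
      (by rw [d3, er₂ 3 (by simp) (by simp), hr]), d3, d2 17 (by simp) (by simp), hacc₃]
    have := d1.1 hlt
    rw [hacc₂] at this
    by_cases hτ : τ = l.target c
    · subst hτ
      rw [if_pos rfl, if_pos ⟨rfl, this⟩]
    · simp [hτ]
  · rw [if_neg hlt, skip_run]
    have h' : accOf (s₃.setN 6 0) τ = accOf s τ := by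
      rw [← hacc₃]; simp [accOf]
    rw [h']
    rw [d1, hacc₂] at hlt
    by_cases hτ : τ = l.target c
    · subst hτ
      simp only [true_and, if_neg hlt]
    · simp [hτ]

end relax

/-! ### The dynamic program on the machine: elimination of one position -/

/-- Forget the candidates for `τ`. -/
noncomputable def clear (τ : St K) : Program :=
  .instr (.natConst (fam fFlag τ.code) 0)

/-- Copy the best candidate for `τ` to the table of the parent. -/
noncomputable def writeBack (τ : St K) : Program :=
  block [.natStore (fam fFlag τ.code) 10 (fam fFlag τ.code),
    .natStore (fam fCount τ.code) 10 (fam fCount τ.code),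
    .natStore (fam fChoice τ.code) 9 (fam fChoice τ.code),
    .realStore (fam fVal τ.code) 10 (fam fVal τ.code)]

open Classical in
/-- All admissible choices. -/
noncomputable def Local.choices (l : Local K) : List (Choice K) :=
  (univ.filter fun c => l.Valid c).toList

@[simp] theorem Local.mem_choices {l : Local K} {c : Choice K} : c ∈ l.choices ↔ l.Valid c := by
  simp [choices]

theorem Local.length_choices (l : Local K) : l.choices.length ≤ Fintype.card (Choice K) := by
  classical
  simpa [choices] using card_le_univ (univ.filter fun c : Choice K => l.Valid c)

/-- All states. -/
noncomputable def allStates (K : ℕ) : List (St K) := univ.toList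

@[simp] theorem mem_allStates (σ : St K) : σ ∈ allStates K := by simp [allStates]

/-- Join the table of a position with local data `l` into the table of its parent. -/
noncomputable def joinTables (l : Local K) : Program :=
  .seq (.instr (.realZero 3)) (.seq (seqs ((allStates K).map clear))
    (.seq (seqs (l.choices.map (relax l))) (seqs ((allStates K).map writeBack))))

section joinTables

variable {l : Local K}

theorem joinTables_loopFree : (joinTables l).LoopFree := by
  simp [joinTables, clear, writeBack, relax_loopFree]

theorem joinTables_wN (x : ℕ) (h : (joinTables l).wN x) :
    x = 6 ∨ (16 ≤ x ∧ x < 20) ∨ ∃ a σ, 2 ≤ a ∧ a < 5 ∧ x = fam a (St.code (K := K) σ) := by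
  simp [joinTables, clear, writeBack] at h
  rcases h with (h | ⟨σ, h⟩) | (h | ⟨c, -, h⟩) | h
  · exact .inl h
  · exact .inr (.inr ⟨2, σ, by omega, by omega, h⟩)
  · exact .inl h
  · exact relax_wN x h
  · exact .inl (h.elim id And.right)
theorem joinTables_wNA (x : ℕ) (h : (joinTables l).wNA x) :
    ∃ a σ, 2 ≤ a ∧ a < 5 ∧ x = fam a (St.code (K := K) σ) := by
  simp [joinTables, clear, writeBack, relax_wNA] at h
  obtain ⟨σ, h | h | h⟩ := h
  · exact ⟨_, σ, by omega, by omega, h⟩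
  · exact ⟨_, σ, by omega, by omega, h⟩
  · exact ⟨_, σ, by omega, by omega, h⟩
theorem joinTables_wRA (x : ℕ) (h : (joinTables l).wRA x) :
    ∃ σ, x = fam fVal (St.code (K := K) σ) := by
  simpa [joinTables, clear, writeBack, relax_wRA] using h
theorem joinTables_len : (joinTables l).len ≤
    Fintype.card (Choice K) * (K + 40) + 6 * Fintype.card (St K) + 4 := by
  have h1 := seqs_map_len_le (l := allStates K) (f := clear) (c := 1) (by simp [clear])
  have h2 := seqs_map_len_le (l := l.choices) (f := relax l) (c := K + 40)
    (fun c _ => relax_len)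
  have h3 := seqs_map_len_le (l := allStates K) (f := writeBack) (c := 5) (by simp [writeBack])
  have h4 : l.choices.length * (K + 40) ≤ Fintype.card (Choice K) * (K + 40) :=
    Nat.mul_le_mul_right _ l.length_choices
  have h5 : (allStates K).length = Fintype.card (St K) := by simp [allStates]
  rw [h5] at h1 h3
  simp only [joinTables, Program.len]
  omega

/-- What is known after the choices in `L` have been taken into account, starting from `s`. -/
structure Relaxed (l : Local K) (s : State) (L : List (Choice K)) (s' : State) : Prop where
  narr : s'.narr = s.narr
  rarr : s'.rarr = s.rarr
  reg9 : s'.nreg 9 = s.nreg 9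
  reg10 : s'.nreg 10 = s.nreg 10
  zero : s'.nreg ZERO = 0
  rzero : s'.rreg 3 = 0
  rreg0 : s'.rreg 0 = s.rreg 0
  cost : ∀ a, s'.rreg (fam fCost a) = s.rreg (fam fCost a)
  exact : ∀ τ w k, accOf s' τ = some (w, k) → ∃ c ∈ L, c.code = k ∧ l.target c = τ ∧ ∃ a b,
    tabOf s (s.nreg 9) c.σ₁ = some a ∧ tabOf s (s.nreg 10) c.σ₂ = some b ∧
      w = a + b + regWeight l s c
  best : ∀ c ∈ L, ∀ a b, tabOf s (s.nreg 9) c.σ₁ = some a →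
    tabOf s (s.nreg 10) c.σ₂ = some b → ∃ w k, accOf s' (l.target c) = some (w, k) ∧
      w ≤ a + b + regWeight l s c

theorem Relaxed.step {s s' : State} {L : List (Choice K)} (h : Relaxed l s L s')
    (c : Choice K) : Relaxed l s (L ++ [c]) ((relax l c).run s') := by
  have ha := (relax_loopFree (l := l) (c := c)).agree s'
  have hn : ∀ x < 16, x ≠ 6 → ((relax l c).run s').nreg x = s'.nreg x := fun x hx h6 =>
    ha.n x fun h => by
      rcases relax_wN x h with h | h | ⟨a, σ, -, -, h⟩
      · omega
      · omega
      · have := le_fam a σ.code; omega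
  have hr : ∀ x, x ≠ 1 → x ≠ 2 → (∀ c, x ≠ fam fVal c) →
      ((relax l c).run s').rreg x = s'.rreg x := fun x h1 h2 h3 => ha.r x fun h => by
    rcases relax_wR x h with h | h | ⟨σ, h⟩
    · exact h1 h
    · exact h2 h
    · exact h3 _ h
  have htab : ∀ u (σ : St K), tabOf s' u σ = tabOf s u σ := by
    simp [tabOf, h.narr, h.rarr]
  have hrun := fun τ => relax_run (l := l) (c := c) s' h.zero h.rzero τ
  have hw : regWeight l s' c = regWeight l s c := by simp only [regWeight, h.cost, h.rreg0]
  simp only [htab, h.reg9, h.reg10] at hrun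
  refine ⟨?_, ?_, ?_, ?_, ?_, ?_, ?_, ?_, ?_, ?_⟩
  · rw [← h.narr]; funext x; exact ha.na x (relax_wNA x)
  · rw [← h.rarr]; funext x; exact ha.ra x (relax_wRA x)
  · rw [hn _ (by simp) (by simp), h.reg9]
  · rw [hn _ (by simp) (by simp), h.reg10]
  · rw [hn _ (by simp) (by simp), h.zero]
  · rw [hr _ (by simp) (by simp) (by simp), h.rzero]
  · rw [hr _ (by simp) (by simp) (by simp), h.rreg0]
  · intro a; rw [hr _ (by simp) (by simp) (by simp), h.cost]
  · intro τ w k hacc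
    have hold : accOf s' τ = some (w, k) → ∃ c' ∈ L ++ [c], c'.code = k ∧ l.target c' = τ ∧
        ∃ a b, tabOf s (s.nreg 9) c'.σ₁ = some a ∧ tabOf s (s.nreg 10) c'.σ₂ = some b ∧
          w = a + b + regWeight l s c' := fun h' => by
      obtain ⟨c', hc', h'⟩ := h.exact τ w k h'
      exact ⟨c', by simp [hc'], h'⟩
    rw [hrun] at hacc
    rcases h1 : tabOf s (s.nreg 9) c.σ₁ with _ | a
    · simp only [h1] at hacc; exact hold hacc
    rcases h2 : tabOf s (s.nreg 10) c.σ₂ with _ | b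
    · simp only [h1, h2] at hacc; exact hold hacc
    simp only [h1, h2] at hacc
    split_ifs at hacc with hif
    · simp only [Option.some.injEq, Prod.mk.injEq] at hacc
      exact ⟨c, by simp, hacc.2, hif.1.symm, a, b, h1, h2, by rw [← hw]; exact hacc.1.symm⟩
    · exact hold hacc
  · intro c' hc' a b h1 h2
    -- the best candidate never gets worse
    have hmono : ∀ (τ : St K) w k, accOf s' τ = some (w, k) →
        ∃ w' k', accOf ((relax l c).run s') τ = some (w', k') ∧ w' ≤ w := by
      intro τ w k hw
      rw [hrun, hw]
      split
      · split_ifs with hif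
        · exact ⟨_, _, rfl, (hif.2 w k rfl).le⟩
        · exact ⟨w, k, rfl, le_rfl⟩
      · exact ⟨w, k, rfl, le_rfl⟩
    simp only [List.mem_append, List.mem_singleton] at hc'
    rcases hc' with hc' | rfl
    · obtain ⟨w, k, hw, hle⟩ := h.best c' hc' a b h1 h2
      obtain ⟨w', k', hw', hle'⟩ := hmono _ _ _ hw
      exact ⟨w', k', hw', hle'.trans hle⟩
    · rw [hrun, h1, h2]
      simp only [true_and, ← hw]
      split_ifs with hif
      · exact ⟨_, _, rfl, le_rfl⟩
      · push Not at hif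
        obtain ⟨w', k, hw', hle⟩ := hif rfl
        exact ⟨w', k, hw', hle⟩

theorem Relaxed.setN {s s' : State} {L : List (Choice K)} (h : Relaxed l s L s') :
    Relaxed l s L (s'.setN 6 0) := by
  have hacc : ∀ τ : St K, accOf (s'.setN 6 0) τ = accOf s' τ := fun τ => by simp [accOf]
  exact ⟨h.narr, h.rarr, by simp [h.reg9], by simp [h.reg10], by simp [h.zero], h.rzero, h.rreg0,
    h.cost, fun τ w k => by rw [hacc]; exact h.exact τ w k,
    fun c hc a b => by rw [hacc]; exact h.best c hc a b⟩

theorem writeBack_run (L : List (St K)) (s : State) :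
    (∀ a τ u, a = 2 ∨ a = 3 → ((seqs (L.map writeBack)).run s).narr (fam a (St.code (K := K) τ)) u =
      if τ ∈ L ∧ u = s.nreg 10 then s.nreg (fam a τ.code) else s.narr (fam a τ.code) u) ∧
    (∀ τ u, ((seqs (L.map writeBack)).run s).narr (fam fChoice (St.code (K := K) τ)) u =
      if τ ∈ L ∧ u = s.nreg 9 then s.nreg (fam fChoice τ.code)
      else s.narr (fam fChoice τ.code) u) ∧
    (∀ τ u, ((seqs (L.map writeBack)).run s).rarr (fam fVal (St.code (K := K) τ)) u =
      if τ ∈ L ∧ u = s.nreg 10 then s.rreg (fam fVal τ.code)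
      else s.rarr (fam fVal τ.code) u) := by
  have := run_seqs_induction L (writeBack (K := K)) (fun l' s' =>
    (∀ x, x ≠ 6 → s'.nreg x = s.nreg x) ∧ s'.rreg = s.rreg ∧
    (∀ a τ u, a = 2 ∨ a = 3 → s'.narr (fam a (St.code (K := K) τ)) u =
      if τ ∈ l' ∧ u = s.nreg 10 then s.nreg (fam a τ.code) else s.narr (fam a τ.code) u) ∧
    (∀ τ u, s'.narr (fam fChoice (St.code (K := K) τ)) u =
      if τ ∈ l' ∧ u = s.nreg 9 then s.nreg (fam fChoice τ.code)
      else s.narr (fam fChoice τ.code) u) ∧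
    (∀ τ u, s'.rarr (fam fVal (St.code (K := K) τ)) u =
      if τ ∈ l' ∧ u = s.nreg 10 then s.rreg (fam fVal τ.code)
      else s.rarr (fam fVal τ.code) u)) s (by simp)
      (fun l' s' h => ⟨fun x hx => by simp [hx, h.1 x hx], h.2⟩) ?_
  · exact this.2.2
  rintro l' τ s' - - ⟨h1, h2, h3, h4, h5⟩
  have e9 : s'.nreg 9 = s.nreg 9 := h1 9 (by simp)
  have e10 : s'.nreg 10 = s.nreg 10 := h1 10 (by simp)
  refine ⟨fun x hx => ?_, ?_, ?_, ?_, ?_⟩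
  · simp [writeBack, hx, h1]
  · simp [writeBack, h2]
  · intro a τ' u ha
    have h6 : s'.nreg (fam a τ.code) = s.nreg (fam a τ.code) := h1 _ (by simp)
    have h3' := h3 a τ' u ha
    by_cases hτ : τ' = τ
    · subst hτ
      by_cases hu : u = s.nreg 10
      · rcases ha with rfl | rfl <;>
          simp [writeBack, hu, e10, h6]
      · rcases ha with rfl | rfl <;>
          simp [writeBack, hu, e10, h3']
    · rcases ha with rfl | rfl <;>
        simp [writeBack, h3', hτ]
  · intro τ' u
    have h6 : s'.nreg (fam fChoice τ.code) = s.nreg (fam fChoice τ.code) := h1 _ (by simp)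
    have h4' := h4 τ' u
    by_cases hτ : τ' = τ
    · subst hτ
      by_cases hu : u = s.nreg 9
      · simp [writeBack, hu, e9, h6]
      · simp [writeBack, hu, e9, h4']
    · simp [writeBack, h4', hτ]
  · intro τ' u
    have h5' := h5 τ' u
    by_cases hτ : τ' = τ
    · subst hτ
      by_cases hu : u = s.nreg 10
      · simp [writeBack, hu, e10, h2]
      · simp [writeBack, hu, e10, h5']
    · simp [writeBack, h5', hτ]

theorem clear_run (s : State) (τ : St K) :
    accOf ((seqs ((allStates K).map clear)).run s) τ = none := by
  have := run_seqs_induction (allStates K) clear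
    (fun l' s' => ∀ τ ∈ l', accOf s' τ = none) s (by simp)
    (fun l' s' h τ hτ => by simpa [accOf] using h τ hτ) (by
      intro l' a s' _ _ h τ hτ
      have := fun h' => h τ h'
      by_cases hτa : τ = a
      · subst hτa; simp [accOf, clear]
      · simp only [List.mem_append, List.mem_singleton, hτa, or_false] at hτ
        simpa [accOf, clear, update_apply, hτa] using h τ hτ)
  exact this τ (mem_allStates τ)

/-- The effect of `joinTables` on the tables: what is written is the optimum over all admissible
choices, together with a choice attaining it. -/
theorem joinTables_run (s : State) (hz : s.nreg ZERO = 0) :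
    (∀ τ w, tabOf ((joinTables l).run s) (s.nreg 10) τ = some w →
      ∃ c a b, recorded ((joinTables l).run s) (s.nreg 9) τ c ∧ l.Valid c ∧ l.target c = τ ∧
        tabOf s (s.nreg 9) c.σ₁ = some a ∧ tabOf s (s.nreg 10) c.σ₂ = some b ∧
        w = a + b + regWeight l s c) ∧
    (∀ c a b, l.Valid c → tabOf s (s.nreg 9) c.σ₁ = some a →
      tabOf s (s.nreg 10) c.σ₂ = some b →
      ∃ w, tabOf ((joinTables l).run s) (s.nreg 10) (l.target c) = some w ∧
        w ≤ a + b + regWeight l s c) ∧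
    (∀ u ≠ s.nreg 10, ∀ τ : St K, tabOf ((joinTables l).run s) u τ = tabOf s u τ) ∧
    ∀ u ≠ s.nreg 9, ∀ τ : St K, recorded ((joinTables l).run s) u τ = recorded s u τ := by
  set s₁ := (Instr.realZero 3).apply s with hs₁
  set s₂ := (seqs ((allStates K).map clear)).run s₁ with hs₂
  have ha₂ := Program.LoopFree.agree (p := seqs ((allStates K).map clear)) (by simp [clear]) s₁
  rw [← hs₂] at ha₂
  have hclear := clear_run (K := K) s₁
  rw [← hs₂] at hclear
  have en : ∀ x < 64, x ≠ 6 → s₂.nreg x = s.nreg x := fun x hx h6 => by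
    rw [ha₂.n x (by simp [clear, hx, h6])]; simp [hs₁]
  have er : ∀ x, x ≠ 3 → s₂.rreg x = s.rreg x := fun x hx => by
    rw [ha₂.r x (by simp [clear])]; simp [hs₁, hx]
  have er3 : s₂.rreg 3 = 0 := by
    rw [ha₂.r 3 (by simp [clear])]; simp [hs₁]
  have ena : s₂.narr = s.narr := by
    funext x; rw [ha₂.na x (by simp [clear])]; simp [hs₁]
  have era : s₂.rarr = s.rarr := by
    funext x; rw [ha₂.ra x (by simp [clear])]; simp [hs₁]
  have h0 : Relaxed l s [] s₂ := ⟨ena, era, en _ (by simp) (by simp), en _ (by simp) (by simp),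
    by rw [en _ (by simp) (by simp), hz], er3, er _ (by simp), fun a => er _ (by simp),
    fun τ w k h => by simp [hclear] at h, by simp⟩
  have h3 : Relaxed l s l.choices ((seqs (l.choices.map (relax l))).run s₂) :=
    run_seqs_induction l.choices (relax l) (Relaxed l s) s₂ h0 (fun _ _ h => h.setN)
      fun _ c _ _ _ h => h.step c
  set s₃ := (seqs (l.choices.map (relax l))).run s₂
  have hrun : (joinTables l).run s = (seqs ((allStates K).map writeBack)).run s₃ := rfl
  obtain ⟨w1, w2, w3⟩ := writeBack_run (allStates K) s₃
  rw [← hrun] at w1 w2 w3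
  simp only [mem_allStates, true_and, h3.reg9, h3.reg10, h3.narr, h3.rarr] at w1 w2 w3
  have htab : ∀ τ : St K, tabOf ((joinTables l).run s) (s.nreg 10) τ =
      (accOf s₃ τ).map Prod.fst := by
    intro τ
    simp only [tabOf, accOf, w1 2 τ _ (.inl rfl), w1 3 τ _ (.inr rfl), w3, if_true]
    split_ifs <;> rfl
  refine ⟨fun τ w h => ?_, fun c a b hc h1 h2 => ?_, fun u hu τ => ?_, fun u hu τ => ?_⟩
  · rw [htab, Option.map_eq_some_iff] at h
    obtain ⟨⟨w, k⟩, h, rfl⟩ := h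
    obtain ⟨c, hc, hk, hτ, a, b, h1, h2, hw⟩ := h3.exact τ w k h
    refine ⟨c, a, b, ?_, Local.mem_choices.1 hc, hτ, h1, h2, hw⟩
    rw [recorded, w2, if_pos rfl, hk]
    simp only [accOf] at h
    split_ifs at h
    simp only [Option.some.injEq, Prod.mk.injEq] at h
    exact h.2
  · obtain ⟨w, k, hw, hle⟩ := h3.best c (Local.mem_choices.2 hc) a b h1 h2
    exact ⟨w, by rw [htab, hw]; rfl, hle⟩
  · simp only [tabOf, w1 2 τ _ (.inl rfl), w1 3 τ _ (.inr rfl), w3, hu, if_false]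
  · funext c
    simp only [recorded, w2, hu, if_false]

end joinTables

/-! ### The dynamic program on the machine: the main loop -/

/-- Load the data of the position in register `9` that concern the colour `c`. -/
noncomputable def loadSlot (c : Fin K) : Program :=
  block [.natLoad (fam 0 c) (fam fSlot c) 9, .natLoad (fam 1 c) (fam fEdge c) 9,
    .natSub 13 (fam 1 c) ONE, .realLoad (fam fCost c) 0 13]

/-- Load the data of the next position to be eliminated. -/
noncomputable def loadLocal (K : ℕ) : Program :=
  .seq (block [.natSub 9 15 8, .natLoad 10 aPar 9, .natLoad 11 aVert 9, .realLoad 0 1 11,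
    .natLoad 12 aCol 9]) (seqs ((List.finRange K).map loadSlot))

/-- Eliminate one position. The program dispatches on its local data. -/
noncomputable def eliminate (K : ℕ) : Program :=
  .seq (loadLocal K) (switchN 12 K fun q => switchSet 0 (List.finRange K) fun O =>
    switchSet 1 (List.finRange K) fun E =>
      if h : q < K then joinTables ⟨⟨q, h⟩, O, E⟩ else skip)

theorem loadLocal_loopFree : (loadLocal K).LoopFree := by
  simp [loadLocal, loadSlot]

theorem eliminate_loopFree : (eliminate K).LoopFree := by
  simp only [eliminate, Program.LoopFree, loadLocal_loopFree, switchN_loopFree, true_and]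
  intro q hq
  refine switchSet_loopFree fun O => switchSet_loopFree fun E => ?_
  rw [dif_pos hq]
  exact joinTables_loopFree

theorem eliminate_len : (eliminate K).len ≤
    Fintype.card (Choice K) * (K + 40) + 6 * Fintype.card (St K) + 10 * K + 20 := by
  have h1 := seqs_map_len_le (l := List.finRange K) (f := loadSlot) (c := 5) (by simp [loadSlot])
  have h2 := switchN_len (x := 12) (m := K) (f := fun q => switchSet 0 (List.finRange K) fun O =>
    switchSet 1 (List.finRange K) fun E =>
      if h : q < K then joinTables ⟨⟨q, h⟩, O, E⟩ else skip)
    (c := Fintype.card (Choice K) * (K + 40) + 6 * Fintype.card (St K) + 4 + K + K) (by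
      intro q hq
      refine (switchSet_len fun O => switchSet_len (m := _) fun E => ?_).trans (by simp; rfl)
      rw [dif_pos hq]
      exact joinTables_len)
  simp only [eliminate, loadLocal, Program.len, block_len, List.length_finRange] at *
  simp only [List.length_cons, List.length_nil]
  omega

theorem loadLocal_wN (x : ℕ) (h : (loadLocal K).wN x) :
    x = 6 ∨ (9 ≤ x ∧ x < 15) ∨ ∃ c, x = fam 0 c ∨ x = fam 1 c := by
  simp [loadLocal, loadSlot] at h
  rcases h with h | h | ⟨c, h | h | h | h⟩
  any_goals omega
  · exact .inr (.inr ⟨c, .inl h⟩)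
  · exact .inr (.inr ⟨c, .inr h⟩)

theorem eliminate_wN (x : ℕ) (h : (eliminate K).wN x) :
    x = 6 ∨ x = 7 ∨ (9 ≤ x ∧ x < 15) ∨ (16 ≤ x ∧ x < 20) ∨ 64 ≤ x := by
  simp only [eliminate, Program.wN, switchN_wN] at h
  rcases h with h | h | h | ⟨q, hq, h⟩
  · rcases loadLocal_wN x h with h | h | ⟨c, h | h⟩
    · omega
    · omega
    · have := le_fam 0 c; omega
    · have := le_fam 1 c; omega
  · omega
  · omega
  · obtain ⟨O, h⟩ := switchSet_wN h
    obtain ⟨E, h⟩ := switchSet_wN h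
    rw [dif_pos hq] at h
    rcases joinTables_wN x h with h | h | ⟨a, σ, -, -, h⟩
    · omega
    · omega
    · have := le_fam a σ.code; omega

theorem eliminate_wNA (x : ℕ) (h : (eliminate K).wNA x) : ∃ a k, 2 ≤ a ∧ a < 5 ∧ x = fam a k := by
  simp only [eliminate, Program.wNA, switchN_wNA] at h
  rcases h with h | ⟨q, hq, h⟩
  · simp [loadLocal, loadSlot] at h
  · obtain ⟨O, h⟩ := switchSet_wNA h
    obtain ⟨E, h⟩ := switchSet_wNA h
    rw [dif_pos hq] at h
    obtain ⟨a, σ, h⟩ := joinTables_wNA x h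
    exact ⟨a, _, h⟩

theorem eliminate_not_wNA_lt {x : ℕ} (hx : x < 64) : ¬ (eliminate K).wNA x := fun h => by
  obtain ⟨a, k, -, -, h⟩ := eliminate_wNA x h
  have := le_fam a k; omega

theorem eliminate_not_wNA_fam {a c : ℕ} (ha : a < 2) : ¬ (eliminate K).wNA (fam a c) := fun h => by
  obtain ⟨b, k, hb, -, h⟩ := eliminate_wNA _ h
  simp at h; omega

theorem eliminate_not_wRA_lt {x : ℕ} (hx : x < 64) : ¬ (eliminate K).wRA x := by
  intro h
  simp only [eliminate, Program.wRA, switchN_wRA] at h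
  rcases h with h | ⟨q, hq, h⟩
  · simp [loadLocal, loadSlot] at h
  · obtain ⟨O, h⟩ := switchSet_wRA h
    obtain ⟨E, h⟩ := switchSet_wRA h
    rw [dif_pos hq] at h
    obtain ⟨σ, h⟩ := joinTables_wRA x h
    have := le_fam 1 σ.code; omega

theorem loadSlots_run (s : State) (hone : s.nreg ONE = 1) :
    let s' := (seqs ((List.finRange K).map loadSlot)).run s
    (∀ c : Fin K, s'.nreg (fam 0 c) = s.narr (fam fSlot c) (s.nreg 9) ∧
      s'.nreg (fam 1 c) = s.narr (fam fEdge c) (s.nreg 9) ∧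
      s'.rreg (fam fCost c) = s.rarr 0 (s.narr (fam fEdge c) (s.nreg 9) - 1)) ∧
    (∀ x < 64, x ≠ 6 → x ≠ 13 → s'.nreg x = s.nreg x) ∧ s'.rreg 0 = s.rreg 0 ∧
    s'.narr = s.narr ∧ s'.rarr = s.rarr := by
  have := run_seqs_induction (List.finRange K) loadSlot (fun l' s' =>
    (∀ c ∈ l', s'.nreg (fam 0 c) = s.narr (fam fSlot c) (s.nreg 9) ∧
      s'.nreg (fam 1 c) = s.narr (fam fEdge c) (s.nreg 9) ∧
      s'.rreg (fam fCost c) = s.rarr 0 (s.narr (fam fEdge c) (s.nreg 9) - 1)) ∧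
    (∀ x < 64, x ≠ 6 → x ≠ 13 → s'.nreg x = s.nreg x) ∧ s'.rreg 0 = s.rreg 0 ∧
    s'.narr = s.narr ∧ s'.rarr = s.rarr) s (by simp) ?_ ?_
  · exact ⟨fun c => this.1 c (List.mem_finRange c), this.2⟩
  · rintro l' s' ⟨h1, h2, h3⟩
    refine ⟨fun c hc => by simpa using h1 c hc, fun x hx h6 h13 => ?_, h3⟩
    simpa [h6] using h2 x hx h6 h13
  · rintro l' c s' - - ⟨h1, h2, h3, h4, h5⟩
    have e9 := h2 9 (by simp) (by simp) (by simp)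
    have e4 := h2 4 (by simp) (by simp) (by simp)
    refine ⟨fun d hd => ?_, fun x hx h6 h13 => ?_, ?_, ?_, ?_⟩
    · by_cases hdc : d = c
      · subst hdc
        simp [loadSlot, h4, h5, e9, e4, hone]
      · simp only [List.mem_append, List.mem_singleton, hdc, or_false] at hd
        have hdc' : (d : ℕ) ≠ c := fun h => hdc (Fin.ext h)
        obtain ⟨k1, k2, k3⟩ := h1 d hd
        simp [loadSlot, hdc', k1, k2, k3]
    · simp [loadSlot, hx, h6, h13, h2]
    · simp [loadSlot, h3]
    · simp [loadSlot, h4]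
    · simp [loadSlot, h5]

section

variable {S : Scheme P.G P.root K} {es : List P.G.Dart} {s : State}

/-- The local data as read off the memory. -/
theorem loc_eq_of_mem (hes : IsEdgeList es) (hS : SchemeMem S s)
    (hE : EdgeMem S es es.length s) {t : ℕ} (ht : t < P.n) {s' : State}
    (h0 : ∀ c : Fin K, s'.nreg (fam 0 c) = s.narr (fam fSlot c) t)
    (h1 : ∀ c : Fin K, s'.nreg (fam 1 c) = s.narr (fam fEdge c) t) :
    (⟨S.col t, (List.finRange K).toFinset.filter fun c : Fin K => 0 < s'.nreg (fam 0 c),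
      (List.finRange K).toFinset.filter fun c : Fin K => 0 < s'.nreg (fam 1 c)⟩ : Local K) =
        S.loc t := by
  have hocc : ((List.finRange K).toFinset.filter fun c : Fin K => 0 < s'.nreg (fam 0 c)) =
      (S.loc t).occ := by
    ext c
    simp only [mem_filter, List.mem_toFinset, List.mem_finRange, true_and, h0, S.mem_occ]
    constructor
    · intro h
      obtain ⟨u, hu⟩ : ∃ u, s.narr (fam fSlot c) t = u + 1 := ⟨_, (Nat.succ_pred_eq_of_pos h).symm⟩
      exact ⟨u, (hS.slot t ht c u).1 hu⟩
    · rintro ⟨u, hu⟩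
      rw [(hS.slot t ht c u).2 hu]; omega
  have hedg : ((List.finRange K).toFinset.filter fun c : Fin K => 0 < s'.nreg (fam 1 c)) =
      (S.loc t).edg := by
    ext c
    simp only [mem_filter, List.mem_toFinset, List.mem_finRange, true_and, h1, S.mem_edg]
    constructor
    · intro h
      obtain ⟨e, he⟩ : ∃ e, s.narr (fam fEdge c) t = e + 1 := ⟨_, (Nat.succ_pred_eq_of_pos h).symm⟩
      obtain ⟨-, u, hu, hc, he⟩ := (hE t ht c e).1 he
      refine ⟨u, hu, ?_, hc⟩
      obtain ⟨d, -, hd⟩ := List.mem_map.1 (List.mem_of_getElem? he)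
      have := d.edge_mem
      rwa [hd] at this
    · rintro ⟨u, hu, hadj, hc⟩
      obtain ⟨d, hd, he⟩ := hes.2 s(S.vert t, S.vert u) hadj
      obtain ⟨e, hel, hde⟩ := List.getElem_of_mem hd
      rw [(hE t ht c e).2 ⟨hel, u, hu, hc, by
        rw [List.getElem?_map, List.getElem?_eq_getElem hel, hde, Option.map_some, he]⟩]
      omega
  rw [hocc, hedg]
  rfl

theorem regWeight_eq (hI : InstanceMem P es s) (hE : EdgeMem S es es.length s) {t : ℕ}
    (ht : t < P.n) (hes : IsEdgeList es) {s' : State}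
    (h0 : s'.rreg 0 = P.penalty (S.vert t))
    (h1 : ∀ c : Fin K, s'.rreg (fam fCost c) = s.rarr 0 (s.narr (fam fEdge c) t - 1))
    {c : Choice K} (hc : (S.loc t).Valid c) : regWeight (S.loc t) s' c = weight S t c := by
  have : ∀ a ∈ c.A, s'.rreg (fam fCost a) = P.cost s(S.vert t, S.vert (S.slot t a)) := by
    intro a ha
    obtain ⟨u, hu, hadj, rfl⟩ := S.mem_edg.1 (hc.sub ha)
    obtain ⟨d, hd, he⟩ := hes.2 s(S.vert t, S.vert u) hadj
    obtain ⟨e, hel, hde⟩ := List.getElem_of_mem hd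
    rw [h1, (hE t ht (S.col u) e).2 ⟨hel, u, hu, rfl, by
        rw [List.getElem?_map, List.getElem?_eq_getElem hel, hde, Option.map_some, he]⟩,
      S.slot_col ht hu]
    simp only [Nat.add_sub_cancel]
    rw [hI.cost e hel, hde, he]
  simp only [regWeight, weight]
  rw [sum_congr rfl this, h0]
  rfl

/-- The main loop: `15` holds `n - 1`. -/
theorem eliminate_runs (hes : IsEdgeList es) (hI : InstanceMem P es s) (hS : SchemeMem S s)
    (hE : EdgeMem S es es.length s) (hpar : ∀ t < P.n, s.narr aPar t = S.par t)
    (h15 : s.nreg 15 = P.n - 1)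
    (hc : Complete P.n S.par S.loc (weight S) P.n (tabOf s))
    (hs : Sound P.n S.par S.loc (weight S) P.n (tabOf s) (recorded s)) :
    Runs (forUp 8 15 (eliminate K)) s
      ((P.n - 1) * (Fintype.card (Choice K) * (K + 40) + 6 * Fintype.card (St K) + 10 * K + 22) + 2)
      fun s' => Complete P.n S.par S.loc (weight S) 1 (tabOf s') ∧
        Sound P.n S.par S.loc (weight S) 1 (tabOf s') (recorded s') := by
  have hn := n_pos P
  have := Runs.forUp (i := 8) (b := 15) (p := eliminate K) (s := s)
    (Fintype.card (Choice K) * (K + 40) + 6 * Fintype.card (St K) + 10 * K + 20)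
    (fun j s' => Complete P.n S.par S.loc (weight S) (P.n - j) (tabOf s') ∧
      Sound P.n S.par S.loc (weight S) (P.n - j) (tabOf s') (recorded s'))
    (fun h => by have := eliminate_wN _ h; omega) (fun h => by have := eliminate_wN _ h; omega)
    (fun h => by have := eliminate_wN _ h; omega) (by decide) (by decide) hI.one
    (by exact ⟨hc, hs⟩) ?_
  · rw [h15] at this
    refine this.mono (by ring_nf; omega) fun s' _ h => ?_
    rwa [Nat.sub_sub_self hn] at h
  rintro j s' hj hj8 ha ⟨hc', hs'⟩
  rw [h15] at hj
  have hna : ∀ x < 64, s'.narr x = s.narr x := fun x hx =>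
    ha.na x (by simpa using eliminate_not_wNA_lt hx)
  have hI' := hI.of_agree ha (fun x hx h => by
      rcases forUp_wN.1 h with h | h
      · omega
      · have := eliminate_wN _ h; omega)
    (by simpa using eliminate_not_wNA_lt (by simp)) (by simpa using eliminate_not_wNA_lt (by simp))
    (by simpa using eliminate_not_wRA_lt (by simp)) (by simpa using eliminate_not_wRA_lt (by simp))
  have hS' := hS.of_agree ha (by simpa using eliminate_not_wNA_lt (by simp))
    (by simpa using eliminate_not_wNA_lt (by simp)) (by simpa using eliminate_not_wNA_lt (by simp))
    (fun c => by simpa using eliminate_not_wNA_fam (by simp))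
  have hE' : EdgeMem S es es.length s' := fun t ht c e => by
    rw [ha.na _ (by simpa using eliminate_not_wNA_fam (by simp))]; exact hE t ht c e
  have h15' : s'.nreg 15 = P.n - 1 := by
    rw [ha.n 15 (fun h => by
      rcases forUp_wN.1 h with h | h
      · omega
      · have := eliminate_wN _ h; omega), h15]
  have hpar' : ∀ t < P.n, s'.narr aPar t = S.par t := by
    rw [hna _ (by simp)]; exact hpar
  refine Runs.of_run_le eliminate_loopFree eliminate_len ?_
  obtain ⟨t, ht⟩ : ∃ t, t = P.n - 1 - j := ⟨_, rfl⟩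
  have ht0 : 0 < t := by omega
  have htn : t < P.n := by omega
  have hpt := S.par_lt htn ht0
  -- the state after loading
  set s₁ := (block [.natSub 9 15 8, .natLoad 10 aPar 9, .natLoad 11 aVert 9, .realLoad 0 1 11,
    .natLoad 12 aCol 9]).run s' with hs₁
  have a9 : s₁.nreg 9 = t := by simp [hs₁, h15', hj8, ht]
  have a10 : s₁.nreg 10 = S.par t := by
    simp [hs₁, h15', hj8, ← ht, hpar' t htn]
  have a12 : s₁.nreg 12 = S.col t := by
    simp [hs₁, h15', hj8, ← ht, hS'.col t htn]
  have a0 : s₁.rreg 0 = P.penalty (S.vert t) := by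
    simp [hs₁, h15', hj8, ← ht, hS'.vert t htn, hI'.penalty]
  have az : s₁.nreg ZERO = 0 := by
    simp [hs₁, hI'.zero]
  have aone : s₁.nreg ONE = 1 := by
    simp [hs₁, hI'.one]
  have ana : s₁.narr = s'.narr := by simp [hs₁]
  have ara : s₁.rarr = s'.rarr := by simp [hs₁]
  obtain ⟨b1, b2, b3, b4, b5⟩ := loadSlots_run (K := K) s₁ aone
  set s₂ := (seqs ((List.finRange K).map loadSlot)).run s₁ with hs₂
  rw [a9, ana, ara] at b1
  rw [ana] at b4
  rw [ara] at b5
  set s₃ := s₂.setN 7 (S.col t) with hs₃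
  have hrun : (eliminate K).run s' = (joinTables (S.loc t)).run s₃ := by
    have e12 : s₂.nreg 12 = S.col t := by rw [b2 _ (by simp) (by simp) (by simp), a12]
    have hz : s₃.nreg ZERO = 0 := by
      simp only [hs₃, State.setN_nreg]; rw [if_neg (by decide), b2 _ (by simp) (by simp) (by simp),
        az]
    simp only [eliminate, loadLocal, Program.run, ← hs₁, ← hs₂]
    rw [switchN_run _ _ (by decide) (by rw [e12]; exact (S.col t).2), e12, ← hs₃,
      switchSet_run _ _ _ hz, switchSet_run _ _ _ hz, dif_pos (S.col t).2]
    congr 2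
    rw [← loc_eq_of_mem hes hS' hE' htn (s' := s₃) (fun c => by simp [hs₃, b1])
      (fun c => by simp [hs₃, b1])]
  have c9 : s₃.nreg 9 = t := by
    simp only [hs₃, State.setN_nreg]; rw [if_neg (by decide), b2 _ (by simp) (by simp) (by simp),
      a9]
  have c10 : s₃.nreg 10 = S.par t := by
    simp only [hs₃, State.setN_nreg]; rw [if_neg (by decide), b2 _ (by simp) (by simp) (by simp),
      a10]
  obtain ⟨j1, j2, j3, j4⟩ := joinTables_run (l := S.loc t) s₃ (by
    simp only [hs₃, State.setN_nreg]; rw [if_neg (by decide), b2 _ (by simp) (by simp) (by simp),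
      az])
  have htab : ∀ u (σ : St K), tabOf s₃ u σ = tabOf s' u σ := by
    intro u σ; simp [tabOf, hs₃, b4, b5]
  have hrec : ∀ u (σ : St K), recorded s₃ u σ = recorded s' u σ := by
    intro u σ; funext c; simp [recorded, hs₃, b4]
  simp only [← hrun, c9, c10, htab, hrec] at j1 j2 j3 j4
  have hw : ∀ c, (S.loc t).Valid c → regWeight (S.loc t) s₃ c = weight S t c := fun c hc =>
    regWeight_eq hI' hE' htn hes (by simp [hs₃, b3, a0]) (fun c => by simp [hs₃, b1]) hc
  have hsucc : P.n - j = t + 1 := by omega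
  have hsucc' : P.n - (j + 1) = t := by omega
  rw [hsucc] at hc' hs'
  rw [hsucc']
  have htab' : tabOf (((eliminate K).run s').setN 8 (j + 1)) =
      tabOf (K := K) ((eliminate K).run s') := rfl
  have hrec' : recorded (((eliminate K).run s').setN 8 (j + 1)) =
      recorded (K := K) ((eliminate K).run s') := rfl
  rw [htab', hrec']
  refine ⟨complete_step htn hpt hc' ?_ fun u _ hu => funext (j3 u hu),
    sound_step htn (fun i hi hin => S.par_lt hin (by omega)) hs' ?_
      (fun u _ hu => funext (j3 u hu)) fun i hi _ => funext (j4 i (by omega))⟩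
  · intro c a b hv h1 h2
    obtain ⟨w, h, hle⟩ := j2 c a b hv h1 h2
    exact ⟨w, h, by rwa [← hw c hv]⟩
  · intro τ w h
    obtain ⟨c, a, b, hr, hv, hτ, h1, h2, hwt⟩ := j1 τ w h
    exact ⟨c, a, b, hr, hv, hτ, h1, h2, by rw [← hw c hv, hwt]⟩

end

/-! ### The dynamic program on the machine: parents and initial tables -/

open Classical in
/-- All states without proper connections. -/
noncomputable def discStates (K : ℕ) : List (St K) :=
  (univ.filter fun σ : St K => σ.IsDisc).toList

@[simp] theorem mem_discStates {σ : St K} : σ ∈ discStates K ↔ σ.IsDisc := by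
  simp [discStates]

theorem length_discStates : (discStates K).length ≤ Fintype.card (St K) := by
  classical
  simpa [discStates] using card_le_univ (univ.filter fun σ : St K => σ.IsDisc)

/-- Update the maximum in register `9` by the entry for the colour `c`. -/
@[simp] noncomputable def maxSlot (c : Fin K) : Program :=
  .seq (.instr (.natLoad 10 (fam fSlot c) 8))
    (.ite (.natLt 9 10) (.instr (.natAdd 9 10 ZERO)) skip)

/-- Compute the parent of the position in register `8` and initialize its table. -/
@[simp] noncomputable def initPosition (K : ℕ) : Program :=
  .seq (.instr (.natConst 9 0)) (.seq (seqs ((List.finRange K).map maxSlot))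
    (.seq (block [.natSub 9 9 ONE, .natStore aPar 8 9])
      (seqs ((discStates K).map fun σ => .instr (.natStore (fam fFlag σ.code) 8 ONE)))))

theorem initPosition_loopFree : (initPosition K).LoopFree := by
  simp

theorem initPosition_len : (initPosition K).len ≤ 3 * K + Fintype.card (St K) + 6 := by
  have h1 := seqs_map_len_le (l := List.finRange K) (f := maxSlot) (c := 3) (by simp)
  have h2 := seqs_map_len_le (l := discStates K)
    (f := fun σ => .instr (.natStore (fam fFlag σ.code) 8 ONE)) (c := 1) (by simp)
  have h3 := length_discStates (K := K)
  simp only [initPosition, Program.len, block_len, List.length_finRange, List.length_cons,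
    List.length_nil] at *
  omega

theorem maxSlots_run (s : State) (hz : s.nreg ZERO = 0) (h9 : s.nreg 9 = 0) :
    let s' := (seqs ((List.finRange K).map maxSlot)).run s
    ((∀ c : Fin K, s.narr (fam fSlot c) (s.nreg 8) ≤ s'.nreg 9) ∧
      (s'.nreg 9 = 0 ∨ ∃ c : Fin K, s'.nreg 9 = s.narr (fam fSlot c) (s.nreg 8))) := by
  have := run_seqs_induction (List.finRange K) maxSlot (fun l' s' =>
    ((∀ c ∈ l', s.narr (fam fSlot c) (s.nreg 8) ≤ s'.nreg 9) ∧
      (s'.nreg 9 = 0 ∨ ∃ c : Fin K, s'.nreg 9 = s.narr (fam fSlot c) (s.nreg 8))) ∧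
      s'.narr = s.narr ∧ s'.nreg 8 = s.nreg 8 ∧ s'.nreg ZERO = 0) s (by simp [h9, hz])
      (fun l' s' h => by simpa using h) ?_
  · exact ⟨fun c => this.1.1 c (List.mem_finRange c), this.1.2⟩
  · rintro l' c s' - - ⟨⟨h1, h2⟩, h3, h4, h5⟩
    by_cases hlt : s'.nreg 9 < s.narr (fam fSlot c) (s.nreg 8)
    · simp [h3, h4, h5, hlt]
      refine ⟨fun d hd => ?_, .inr ⟨c, rfl⟩⟩
      rcases hd with hd | rfl
      · exact (h1 d hd).trans hlt.le
      · exact le_rfl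
    · simp [h3, h4, h5, hlt]
      refine ⟨fun d hd => ?_, h2⟩
      rcases hd with hd | rfl
      · exact h1 d hd
      · omega

theorem initFlags_run (L : List (St K)) (s : State) (hone : s.nreg ONE = 1) :
    let s' := (seqs (L.map fun σ => .instr (.natStore (fam fFlag σ.code) 8 ONE))).run s
    ∀ (σ : St K) u, s'.narr (fam fFlag σ.code) u =
      if σ ∈ L ∧ u = s.nreg 8 then 1 else s.narr (fam fFlag σ.code) u := by
  have := run_seqs_induction L (fun σ => .instr (.natStore (fam fFlag σ.code) 8 ONE))
    (fun l' s' => (∀ (σ : St K) u, s'.narr (fam fFlag σ.code) u =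
      if σ ∈ l' ∧ u = s.nreg 8 then 1 else s.narr (fam fFlag σ.code) u) ∧
      s'.nreg 8 = s.nreg 8 ∧ s'.nreg ONE = 1) s (by simp [hone])
      (fun l' s' h => by simpa using h) ?_
  · exact this.1
  · rintro l' τ s' - - ⟨h1, h2, h3⟩
    refine ⟨fun σ u => ?_, by simp [h2], by simp [h3]⟩
    have h1' := h1 σ u
    by_cases hσ : σ = τ
    · subst hσ
      by_cases hu : u = s.nreg 8
      · simp [hu, h2, h3]
      · simp [hu, h2, h1']
    · simp [hσ, h1']

section

variable {S : Scheme P.G P.root K} {es : List P.G.Dart} {s : State}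

theorem par_eq_of_max {t m : ℕ} (ht : t < P.n) (hS : SchemeMem S s)
    (h1 : ∀ c : Fin K, s.narr (fam fSlot c) t ≤ m)
    (h2 : m = 0 ∨ ∃ c : Fin K, m = s.narr (fam fSlot c) t) : m - 1 = S.par t := by
  apply le_antisymm
  · rcases Nat.eq_zero_or_pos m with rfl | hm
    · simp
    · obtain ⟨c, hc⟩ := h2.resolve_left (by omega)
      obtain ⟨u, rfl⟩ : ∃ u, m = u + 1 := ⟨m - 1, by omega⟩
      exact S.le_par ((hS.slot t ht c u).1 hc.symm).1
  · rcases Nat.eq_zero_or_pos (S.par t) with h | h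
    · omega
    · have h0 : 0 < t := by
        by_contra h'
        obtain rfl : t = 0 := by omega
        have : S.bag 0 = ∅ := Finset.eq_empty_of_forall_notMem fun u hu => by
          have := S.bag_lt 0 ht u hu; omega
        simp [Scheme.par, this] at h
      have := h1 (S.col (S.par t))
      rw [(hS.slot t ht _ _).2 ⟨S.par_mem ht h0, rfl⟩] at this
      omega

/-- Initially, the tables describe the selections without edges. -/
def InitMem (S : Scheme P.G P.root K) (j : ℕ) (s : State) : Prop :=
  (∀ t < j, s.narr aPar t = S.par t) ∧
    ∀ t (σ : St K), (t < j ∧ σ.IsDisc → s.narr (fam fFlag σ.code) t = 1) ∧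
      (¬ (t < j ∧ σ.IsDisc) → s.narr (fam fFlag σ.code) t = 0)

theorem initTables_runs (hI : InstanceMem P es s) (hS : SchemeMem S s)
    (h0 : ∀ (σ : St K) t, s.narr (fam fFlag σ.code) t = 0) :
    Runs (forUp 8 0 (initPosition K)) s (P.n * (3 * K + Fintype.card (St K) + 8) + 2)
      (InitMem S P.n) := by
  have := Runs.forUp (i := 8) (b := 0) (p := initPosition K) (s := s)
    (3 * K + Fintype.card (St K) + 6) (InitMem S)
    (by simp) (by simp)
    (by simp) (by decide) (by decide) hI.one
    (by simp [InitMem, h0]) ?_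
  · rw [hI.n] at this; exact this
  intro j s' hj hj8 ha ⟨hp, hf⟩
  rw [hI.n] at hj
  have hS' := hS.of_agree ha (by simp) (by simp)
    (by simp) (by simp)
  have hI' := hI.of_agree ha (by intro x hx h; simp at h; grind)
    (by simp) (by simp)
    (by simp) (by simp)
  refine Runs.of_run_le initPosition_loopFree initPosition_len ?_
  set s₁ := (Instr.natConst 9 0).apply s' with hs₁
  obtain ⟨m1, m2⟩ := maxSlots_run (K := K) s₁ (by simp [hs₁, hI'.zero])
    (by simp [hs₁])
  have ha₂ := Program.LoopFree.agree (p := seqs ((List.finRange K).map maxSlot))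
    (by simp) s₁
  set s₂ := (seqs ((List.finRange K).map maxSlot)).run s₁ with hs₂
  have e8 : s₂.nreg 8 = j := by
    rw [ha₂.n 8 (by simp)]; simp [hs₁, hj8]
  have e4 : s₂.nreg ONE = 1 := by
    rw [ha₂.n ONE (by simp)]; simp [hs₁, hI'.one]
  have ena : s₂.narr = s'.narr := by
    funext x; rw [ha₂.na x (by simp)]; simp [hs₁]
  simp only [hs₁, Instr.apply, update_apply] at m1 m2
  simp only [show (8 : ℕ) ≠ 9 by decide, if_false, hj8] at m1 m2
  have hpar := par_eq_of_max hj hS' m1 m2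
  set s₃ := (block [.natSub 9 9 ONE, .natStore aPar 8 9]).run s₂ with hs₃
  have f4 : s₃.nreg ONE = 1 := by simp [hs₃, e4]
  have f8 : s₃.nreg 8 = j := by simp [hs₃, e8]
  have fp : ∀ t, s₃.narr aPar t = if t = j then S.par j else s'.narr aPar t := by
    intro t
    simp [hs₃, update_apply, e8, e4, ena, hpar]
  have ff : ∀ (σ : St K) t, s₃.narr (fam fFlag σ.code) t = s'.narr (fam fFlag σ.code) t := by
    intro σ t; simp [hs₃, ena]
  have hfl := initFlags_run (discStates K) s₃ f4
  have ha₄ := Program.LoopFree.agree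
    (p := seqs ((discStates K).map fun σ => .instr (.natStore (fam fFlag σ.code) 8 ONE)))
    (by simp) s₃
  have hrun : (initPosition K).run s' = (seqs ((discStates K).map
    fun σ => .instr (.natStore (fam fFlag σ.code) 8 ONE))).run s₃ := rfl
  rw [hrun]
  refine ⟨fun t ht => ?_, fun t σ => ?_⟩
  · rw [State.setN_narr, ha₄.na aPar (by simp), fp]
    split_ifs with h
    · rw [h]
    · exact hp t (by omega)
  · rw [State.setN_narr, hfl, f8, ff]
    have := hf t σ
    by_cases hd : σ.IsDisc <;> by_cases ht : t = j
    · simp [hd, ht]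
    · simp [hd, ht] at this ⊢
      exact ⟨fun h => this.1 (by omega), fun h => this.2 (by omega)⟩
    · simp [hd] at this ⊢; exact this
    · simp [hd] at this ⊢; exact this

/-! ### The dynamic program on the machine: reconstruction of the solution -/

/-- Select the edge at the position in register `9` that leads to the colour `a`. -/
noncomputable def selectEdge (a : Fin K) : Program :=
  block [.natLoad 18 (fam fEdge a) 9, .natSub 18 18 ONE, .natStore 7 18 ONE]

open Classical in
/-- Follow the choice `c` backwards at the position in register `9`. -/
noncomputable def followChoice (c : Choice K) : Program :=
  .seq (block [.natConst 18 c.σ₂.code, .natStore aCur 10 18, .natConst 18 c.σ₁.code,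
      .natStore aCur 9 18])
    (.seq (switchN 12 K fun q => if ∃ h : q < K, c.σ₁.Rel ⟨q, h⟩ ⟨q, h⟩ then
        .instr (.natStore 6 11 ONE) else skip)
      (seqs (c.A.toList.map selectEdge)))

/-- One step of the reconstruction. -/
noncomputable def traceBack (K : ℕ) : Program :=
  .seq (block [.natAdd 9 8 ONE, .natLoad 10 aPar 9, .natLoad 11 aVert 9, .natLoad 12 aCol 9,
      .natLoad 16 aCur 10])
    (.seq (switchN 16 (Fintype.card (St K)) fun q => .instr (.natLoad 17 (fam fChoice q) 9))
      (switchN 17 (Fintype.card (Choice K)) fun q => followChoice (Choice.ofCode (K := K) q)))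

theorem followChoice_loopFree (c : Choice K) : (followChoice c).LoopFree := by
  simp only [followChoice, Program.LoopFree, block_loopFree, switchN_loopFree, true_and,
    seqs_loopFree]
  refine ⟨fun q _ => ?_, by simp [selectEdge]⟩
  split_ifs <;> simp

theorem traceBack_loopFree : (traceBack K).LoopFree := by
  simp [traceBack, followChoice_loopFree]

theorem followChoice_len (c : Choice K) : (followChoice c).len ≤ 7 * K + 10 := by
  classical
  have h1 := seqs_map_len_le (l := c.A.toList) (f := selectEdge) (c := 4) (by simp [selectEdge])
  have h1' : c.A.toList.length ≤ K := by simpa using card_le_univ c.A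
  have h2 := switchN_len (x := 12) (m := K) (f := fun q =>
    if ∃ h : q < K, c.σ₁.Rel ⟨q, h⟩ ⟨q, h⟩ then .instr (.natStore 6 11 ONE) else skip) (c := 1)
    (by intro q _; split_ifs <;> simp)
  simp only [followChoice, Program.len, block_len, List.length_cons, List.length_nil]
  have : (switchN 12 K fun q => if ∃ h : q < K, c.σ₁.Rel ⟨q, h⟩ ⟨q, h⟩ then
      Program.instr (.natStore 6 11 ONE) else skip).len ≤ 1 + 3 * K + 1 := by convert h2
  have h3 : (switchN 12 K fun q => @ite _ (∃ h : q < K, c.σ₁.Rel ⟨q, h⟩ ⟨q, h⟩)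
      (Classical.propDecidable _) (Program.instr (.natStore 6 11 ONE)) skip).len ≤
      1 + 3 * K + 1 := by convert h2
  omega

theorem traceBack_len : (traceBack K).len ≤
    3 * Fintype.card (St K) + 3 * Fintype.card (Choice K) + 7 * K + 20 := by
  have h1 := switchN_len (x := 16) (m := Fintype.card (St K))
    (f := fun q => .instr (.natLoad 17 (fam fChoice q) 9)) (c := 1) (by simp)
  have h2 := switchN_len (x := 17) (m := Fintype.card (Choice K))
    (f := fun q => followChoice (Choice.ofCode (K := K) q)) (c := 7 * K + 10)
    (fun q _ => followChoice_len _)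
  simp only [traceBack, Program.len, block_len, List.length_cons, List.length_nil]
  omega

theorem followChoice_wN (c : Choice K) (x : ℕ) (h : (followChoice c).wN x) :
    x = 6 ∨ x = 7 ∨ x = 18 := by
  simp only [followChoice, Program.wN, switchN_wN, block_wN, seqs_wN] at h
  rcases h with h | (h | h | ⟨q, -, h⟩) | h
  · simp at h; omega
  · omega
  · omega
  · split_ifs at h
    · simp at h
    · simp at h; omega
  · simp [selectEdge] at h; omega

theorem followChoice_wNA (c : Choice K) (x : ℕ) (h : (followChoice c).wNA x) :
    x = 6 ∨ x = 7 ∨ x = aCur := by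
  simp only [followChoice, Program.wNA, switchN_wNA, block_wNA, seqs_wNA] at h
  rcases h with h | ⟨q, -, h⟩ | h
  · simp at h; omega
  · split_ifs at h
    · simp at h; omega
    · simp at h
  · simp [selectEdge] at h; omega

theorem traceBack_wN (x : ℕ) (h : (traceBack K).wN x) :
    x = 6 ∨ x = 7 ∨ (9 ≤ x ∧ x < 13) ∨ (16 ≤ x ∧ x < 20) := by
  simp only [traceBack, Program.wN, switchN_wN, block_wN] at h
  rcases h with h | (h | h | ⟨q, -, h⟩) | h | h | ⟨q, -, h⟩
  · simp at h; omega
  any_goals omega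
  · simp at h; omega
  · have := followChoice_wN _ x h; omega

theorem traceBack_wNA (x : ℕ) (h : (traceBack K).wNA x) : x = 6 ∨ x = 7 ∨ x = aCur := by
  simp only [traceBack, Program.wNA, switchN_wNA, block_wNA] at h
  rcases h with h | ⟨q, -, h⟩ | ⟨q, -, h⟩
  · simp at h
  · simp at h
  · exact followChoice_wNA _ x h

theorem traceBack_wRA (x : ℕ) : ¬ (traceBack K).wRA x := by
  simp only [traceBack, Program.wRA, switchN_wRA, block_wRA, followChoice, seqs_wRA]
  rintro (h | ⟨q, -, h⟩ | ⟨q, -, h | ⟨q', -, h⟩ | h⟩)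
  · simp at h
  · simp at h
  · simp at h
  · split_ifs at h <;> simp at h
  · simp [selectEdge] at h

theorem selectEdges_run (L : List (Fin K)) (s : State) (hone : s.nreg ONE = 1) (e : ℕ) :
    let s' := (seqs (L.map selectEdge)).run s
    ((∃ a ∈ L, s.narr (fam fEdge a) (s.nreg 9) - 1 = e) → s'.narr 7 e = 1) ∧
      ((∀ a ∈ L, s.narr (fam fEdge a) (s.nreg 9) - 1 ≠ e) → s'.narr 7 e = s.narr 7 e) ∧
      ∀ x, x ≠ 7 → s'.narr x = s.narr x := by
  have := run_seqs_induction L selectEdge (fun l' s' =>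
    (((∃ a ∈ l', s.narr (fam fEdge a) (s.nreg 9) - 1 = e) → s'.narr 7 e = 1) ∧
      ((∀ a ∈ l', s.narr (fam fEdge a) (s.nreg 9) - 1 ≠ e) → s'.narr 7 e = s.narr 7 e) ∧
      ∀ x, x ≠ 7 → s'.narr x = s.narr x) ∧ s'.nreg 9 = s.nreg 9 ∧ s'.nreg ONE = 1)
      s (by simp [hone]) (fun l' s' h => by simpa using h) ?_
  · exact this.1
  · rintro l' b s' - - ⟨⟨h1, h2, h3⟩, h4, h5⟩
    have e7 := h3 (fam fEdge b) (by simp)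
    refine ⟨⟨?_, ?_, ?_⟩, by simp [selectEdge, h4],
      by simp [selectEdge, h5]⟩
    · rintro ⟨a, ha, hae⟩
      simp only [List.mem_append, List.mem_singleton] at ha
      rcases ha with ha | rfl
      · simp [selectEdge, update_apply, h5, h1 ⟨a, ha, hae⟩]
      · simp [selectEdge, h4, h5, e7, hae]
    · intro ha
      have hb : e ≠ s.narr (fam fEdge b) (s.nreg 9) - 1 := (ha b (by simp)).symm
      simp [selectEdge, h4, h5, e7, hb]
      exact h2 fun a hal => ha a (by simp [hal])
    · intro x hx
      simp [selectEdge, hx, h3]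

open Classical in
theorem followChoice_run (c : Choice K) (s : State) (hone : s.nreg ONE = 1) (q : Fin K)
    (h12 : s.nreg 12 = q) :
    let s' := (followChoice c).run s
    (∀ u, s'.narr aCur u = if u = s.nreg 9 then c.σ₁.code else if u = s.nreg 10 then c.σ₂.code
      else s.narr aCur u) ∧
    (∀ v, s'.narr 6 v = if v = s.nreg 11 ∧ c.σ₁.Rel q q then 1 else s.narr 6 v) ∧
    ∀ e, ((∃ a ∈ c.A, s.narr (fam fEdge a) (s.nreg 9) - 1 = e) → s'.narr 7 e = 1) ∧
      ((∀ a ∈ c.A, s.narr (fam fEdge a) (s.nreg 9) - 1 ≠ e) → s'.narr 7 e = s.narr 7 e) := by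
  set s₁ := (block [.natConst 18 c.σ₂.code, .natStore aCur 10 18, .natConst 18 c.σ₁.code,
      .natStore aCur 9 18]).run s with hs₁
  have e1 : ∀ x, x ≠ 6 → x ≠ 18 → s₁.nreg x = s.nreg x := fun x h h' => by
    simp [hs₁, h, h']
  have e2 : ∀ u, s₁.narr aCur u = if u = s.nreg 9 then c.σ₁.code else
      if u = s.nreg 10 then c.σ₂.code else s.narr aCur u := fun u => by
    simp [hs₁, update_apply]
  have e3 : ∀ x, x ≠ aCur → s₁.narr x = s.narr x := fun x h => by
    simp [hs₁, h]
  set p₂ : Program := if ∃ h : (q : ℕ) < K, c.σ₁.Rel ⟨q, h⟩ ⟨q, h⟩ then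
        .instr (.natStore 6 11 ONE) else skip with hp₂
  set s₂ := p₂.run (s₁.setN 7 q) with hs₂
  have f0 : (switchN 12 K fun q => if ∃ h : q < K, c.σ₁.Rel ⟨q, h⟩ ⟨q, h⟩ then
        Program.instr (.natStore 6 11 ONE) else skip).run s₁ = s₂ := by
    rw [switchN_run _ _ (by decide) (by rw [e1 _ (by simp) (by simp), h12]; exact q.2)]
    rw [e1 _ (by simp) (by simp), h12]
  have f1 : ∀ x, x ≠ 6 → x ≠ 7 → x ≠ 18 → s₂.nreg x = s.nreg x := fun x h h' h'' => by
    rw [hs₂, hp₂]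
    split_ifs <;> simp [h, h', e1 x h h'']
  have f2 : ∀ x, x ≠ 6 → s₂.narr x = s₁.narr x := fun x h => by
    rw [hs₂, hp₂]
    split_ifs <;> simp [h]
  have f3 : ∀ v, s₂.narr 6 v = if v = s.nreg 11 ∧ c.σ₁.Rel q q then 1 else s.narr 6 v := by
    intro v
    rw [hs₂, hp₂]
    have hq : (∃ h : (q : ℕ) < K, c.σ₁.Rel ⟨q, h⟩ ⟨q, h⟩) ↔ c.σ₁.Rel q q :=
      ⟨fun ⟨_, h⟩ => h, fun h => ⟨q.2, h⟩⟩
    simp only [hq]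
    split_ifs with h1 h2 h2
    · simp [h2.1, e1, hone]
    · have : v ≠ s.nreg 11 := fun h => h2 ⟨h, h1⟩
      simp [e1, e3, this]
    · exact (h1 h2.2).elim
    · simp [e3]
  have hrun : (followChoice c).run s = (seqs (c.A.toList.map selectEdge)).run s₂ := by
    simp only [followChoice, Program.run, ← hs₁]
    rw [f0]
  have hsel := fun e => selectEdges_run c.A.toList s₂ (by rw [f1 _ (by simp) (by simp) (by simp),
    hone]) e
  simp only [← hrun, f1 9 (by simp) (by simp) (by simp)] at hsel
  have g : ∀ a : Fin K, s₂.narr (fam fEdge a) = s.narr (fam fEdge a) := fun a => by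
    rw [f2 _ (by simp), e3 _ (by simp)]
  simp only [g, Finset.mem_toList, f2 7 (by simp), e3 7 (by simp)] at hsel
  refine ⟨fun u => ?_, fun v => ?_, fun e => ⟨(hsel e).1, (hsel e).2.1⟩⟩
  · rw [(hsel 0).2.2 _ (by simp), f2 _ (by simp), e2]
  · rw [(hsel 0).2.2 _ (by simp), f3]

end

section

variable {S : Scheme P.G P.root K} {es : List P.G.Dart} {s : State} {sts : ℕ → ℕ → St K}
  {C : ℕ → Choice K}

/-- The edge `e` is selected at one of the positions `1, …, j` of a run. -/
def SelectedBy (S : Scheme P.G P.root K) (C : ℕ → Choice K) (j : ℕ) (e : Sym2 (Fin P.n)) : Prop :=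
  ∃ t, 1 ≤ t ∧ t ≤ j ∧ ∃ u ∈ S.bag t, S.col u ∈ (C t).A ∧ e = s(S.vert t, S.vert u)

theorem selectedBy_last (hr : IsRun P.n S.par S.loc 1 sts C) {e : Sym2 (Fin P.n)} :
    SelectedBy S C (P.n - 1) e ↔ e ∈ (S.runSubgraph sts C).edgeSet := by
  constructor
  · rintro ⟨t, h1, ht, u, hu, hc, rfl⟩
    exact Scheme.runSubgraph_adj hr (by omega) hu hc
  · have key : ∀ x y : Fin P.n, S.pos y < S.pos x → P.G.Adj x y →
        S.col (S.pos y) ∈ (C (S.pos x)).A → SelectedBy S C (P.n - 1) s(x, y) := by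
      intro x y hlt hadj hc
      have := S.pos_lt x
      refine ⟨S.pos x, by omega, by omega, S.pos y, S.adj _ this _ hlt ?_, hc, ?_⟩
      · simpa [S.vert_pos] using hadj
      · simp [S.vert_pos]
    induction e using Sym2.ind with
    | _ x y =>
      rintro ⟨hadj, -, -, h | h⟩
      · exact key x y h.1 hadj h.2
      · rw [Sym2.eq_swap]; exact key y x h.1 hadj.symm h.2

/-- The reconstruction is complete up to position `j`. -/
structure TraceMem (S : Scheme P.G P.root K) (es : List P.G.Dart) (sts : ℕ → ℕ → St K)
    (C : ℕ → Choice K) (j : ℕ) (s : State) : Prop where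
  cur : ∀ u < j + 1, s.narr aCur u = (sts (j + 1) u).code
  verts : ∀ v : Fin P.n, (S.pos v ≤ j ∧ v ∈ (S.runSubgraph sts C).verts → s.narr 6 v = 1) ∧
    (¬ (S.pos v ≤ j ∧ v ∈ (S.runSubgraph sts C).verts) → s.narr 6 v = 0)
  edges : ∀ e (h : e < es.length), (SelectedBy S C j es[e].edge → s.narr 7 e = 1) ∧
    (¬ SelectedBy S C j es[e].edge → s.narr 7 e = 0)

theorem TraceMem.step (hes : IsEdgeList es) (hI : InstanceMem P es s) (hS : SchemeMem S s)
    (hE : EdgeMem S es es.length s) (hpar : ∀ t < P.n, s.narr aPar t = S.par t)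
    (hr : IsRun P.n S.par S.loc 1 sts C)
    (hch : ∀ i, 1 ≤ i → i < P.n → recorded s i (sts i (S.par i)) (C i))
    {j : ℕ} (hj : j + 1 < P.n) (h8 : s.nreg 8 = j) (h : TraceMem S es sts C j s) :
    TraceMem S es sts C (j + 1) ((traceBack K).run s) := by
  have hp := S.par_lt hj (by omega)
  set s₁ := (block [.natAdd 9 8 ONE, .natLoad 10 aPar 9, .natLoad 11 aVert 9, .natLoad 12 aCol 9,
      .natLoad 16 aCur 10]).run s with hs₁
  have a9 : s₁.nreg 9 = j + 1 := by simp [hs₁, h8, hI.one]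
  have a10 : s₁.nreg 10 = S.par (j + 1) := by
    simp [hs₁, h8, hI.one, hpar _ hj]
  have a11 : s₁.nreg 11 = S.vert (j + 1) := by
    simp [hs₁, h8, hI.one, hS.vert _ hj]
  have a12 : s₁.nreg 12 = S.col (j + 1) := by
    simp [hs₁, h8, hI.one, hS.col _ hj]
  have a16 : s₁.nreg 16 = (sts (j + 1) (S.par (j + 1))).code := by
    simp [hs₁, h8, hI.one, hpar _ hj, h.cur _ hp]
  have a4 : s₁.nreg ONE = 1 := by simp [hs₁, hI.one]
  have ana : s₁.narr = s.narr := by simp [hs₁]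
  set s₂ := (switchN 16 (Fintype.card (St K)) fun q => .instr (.natLoad 17
    (fam fChoice q) 9)).run s₁
    with hs₂
  have hs₂' : s₂ = ((s₁.setN 7 (sts (j + 1) (S.par (j + 1))).code).setN 17 (C (j + 1)).code) := by
    rw [hs₂, switchN_run _ _ (by decide) (by rw [a16]; exact St.code_lt _), a16]
    have := hch (j + 1) (by omega) hj
    rw [recorded] at this
    simp [a9, ana, this, State.setN]
  have hrun : (traceBack K).run s = (followChoice (C (j + 1))).run
      (s₂.setN 7 (C (j + 1)).code) := by
    have e17 : s₂.nreg 17 = (C (j + 1)).code := by simp [hs₂']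
    simp only [traceBack, Program.run, ← hs₁, ← hs₂]
    rw [switchN_run _ _ (by decide) (by rw [e17]; exact Choice.code_lt _), e17,
      Choice.ofCode_code]
  set s₃ := s₂.setN 7 (C (j + 1)).code with hs₃
  have b : ∀ x, x ≠ 7 → x ≠ 17 → s₃.nreg x = s₁.nreg x := fun x h1 h2 => by
    simp [hs₃, hs₂', h1, h2]
  have bna : s₃.narr = s.narr := by simp [hs₃, hs₂', ana]
  have key := followChoice_run (C (j + 1)) s₃ (by rw [b _ (by simp) (by simp), a4])
    (S.col (j + 1)) (by rw [b _ (by simp) (by simp), a12])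
  simp only [← hrun, b 9 (by simp) (by simp), b 10 (by simp) (by simp),
    a9, a10, bna] at key
  obtain ⟨k1, k2, k3⟩ := key
  have b11 : s₃.nreg 11 = S.vert (j + 1) := by rw [b 11 (by simp) (by simp), a11]
  have hv := hr.valid (j + 1) (by omega) hj
  refine ⟨fun u hu => ?_, fun v => ?_, fun e he => ?_⟩
  · rw [k1]
    split_ifs with h1 h2
    · rw [h1, hr.fst _ (by omega) hj]
    · rw [h2, hr.snd _ (by omega) hj]
    · rw [h.cur u (by omega), hr.rest (j + 1) (by omega) hj u (by omega) h2]
  · have hmem : S.vert (j + 1) ∈ (S.runSubgraph sts C).verts ↔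
        (C (j + 1)).σ₁.Rel (S.col (j + 1)) (S.col (j + 1)) := by
      rw [← hr.fst _ (by omega) hj, Scheme.run_dom hr (by omega) (by omega) (by omega)]
      simp only [Scheme.runSubgraph, Set.mem_ofPred_eq, S.pos_vert _ hj]
    rw [k2]
    by_cases hvt : v = S.vert (j + 1)
    · subst hvt
      have h0 := (h.verts (S.vert (j + 1))).2 (by rw [S.pos_vert _ hj]; omega)
      simp only [S.pos_vert _ hj, le_refl, true_and, hmem]
      exact ⟨fun h => if_pos ⟨b11.symm, h⟩, fun h => by rw [if_neg fun h' => h h'.2, h0]⟩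
    · have hne : ¬ ((v : ℕ) = S.vert (j + 1)) := fun h => hvt (Fin.ext h)
      have hpos : S.pos v ≤ j + 1 ↔ S.pos v ≤ j := by
        refine ⟨fun hle => ?_, fun h => by omega⟩
        rcases Nat.le_succ_iff.1 hle with h' | h'
        · exact h'
        · exact (hvt (by rw [← S.vert_pos v, h'])).elim
      rw [if_neg fun h' => hne (h'.1.trans b11), hpos]
      exact h.verts v
  · have hsel : (∃ a ∈ (C (j + 1)).A, s.narr (fam fEdge a) (j + 1) - 1 = e) ↔
        ∃ u ∈ S.bag (j + 1), S.col u ∈ (C (j + 1)).A ∧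
          es[e].edge = s(S.vert (j + 1), S.vert u) := by
      have hex : ∀ a ∈ (C (j + 1)).A, ∃ e', s.narr (fam fEdge a) (j + 1) = e' + 1 := by
        intro a ha
        obtain ⟨u, hu, hadj, rfl⟩ := S.mem_edg.1 (hv.sub ha)
        obtain ⟨d, hd, he⟩ := hes.2 s(S.vert (j + 1), S.vert u) hadj
        obtain ⟨e', hel, hde⟩ := List.getElem_of_mem hd
        exact ⟨e', (hE _ hj (S.col u) e').2 ⟨hel, u, hu, rfl, by
          rw [List.getElem?_map, List.getElem?_eq_getElem hel, hde, Option.map_some, he]⟩⟩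
      constructor
      · rintro ⟨a, ha, hae⟩
        obtain ⟨e', he'⟩ := hex a ha
        obtain ⟨-, u, hu, rfl, hed⟩ := (hE _ hj a e').1 he'
        rw [he', Nat.add_sub_cancel] at hae
        subst hae
        refine ⟨u, hu, ha, ?_⟩
        rw [List.getElem?_map, List.getElem?_eq_getElem he, Option.map_some] at hed
        exact Option.some.inj hed
      · rintro ⟨u, hu, ha, hed⟩
        refine ⟨S.col u, ha, ?_⟩
        rw [(hE _ hj (S.col u) e).2 ⟨he, u, hu, rfl, by
          rw [List.getElem?_map, List.getElem?_eq_getElem he, Option.map_some, hed]⟩]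
        omega
    have hsucc : SelectedBy S C (j + 1) es[e].edge ↔ SelectedBy S C j es[e].edge ∨
        ∃ a ∈ (C (j + 1)).A, s.narr (fam fEdge a) (j + 1) - 1 = e := by
      rw [hsel]
      constructor
      · rintro ⟨t, h1, ht, hu⟩
        rcases Nat.le_succ_iff.1 ht with ht | rfl
        · exact .inl ⟨t, h1, ht, hu⟩
        · exact .inr hu
      · rintro (⟨t, h1, ht, hu⟩ | hu)
        · exact ⟨t, h1, by omega, hu⟩
        · exact ⟨j + 1, by omega, le_rfl, hu⟩
    by_cases hx : ∃ a ∈ (C (j + 1)).A, s.narr (fam fEdge a) (j + 1) - 1 = e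
    · exact ⟨fun _ => (k3 e).1 hx, fun hn => (hn (hsucc.2 (.inr hx))).elim⟩
    · rw [(k3 e).2 (by push Not at hx; exact hx), hsucc]
      simp only [hx, or_false]
      exact h.edges e he

/-- The reconstruction of an optimal solution from the recorded choices. -/
noncomputable def traceBackAll (K : ℕ) (σ : St K) : Program :=
  .seq (block [.natConst 20 0, .natConst 21 σ.code, .natStore aCur 20 21, .natStore 6 2 ONE])
    (forUp 8 15 (traceBack K))

theorem traceBackAll_runs (hes : IsEdgeList es) (hI : InstanceMem P es s) (hS : SchemeMem S s)
    (hE : EdgeMem S es es.length s) (hpar : ∀ t < P.n, s.narr aPar t = S.par t)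
    (h15 : s.nreg 15 = P.n - 1) (h6 : ∀ v : Fin P.n, s.narr 6 v = 0)
    (h7 : ∀ e < es.length, s.narr 7 e = 0)
    (hr : IsRun P.n S.par S.loc 1 sts C) (h1 : sts 1 0 = St.disc {S.col 0})
    (hch : ∀ i, 1 ≤ i → i < P.n → recorded s i (sts i (S.par i)) (C i))
    (hopt : P.IsOptimal (S.runSubgraph sts C)) :
    Runs (traceBackAll K (St.disc {S.col 0})) s
      (5 + ((P.n - 1) * (3 * Fintype.card (St K) + 3 * Fintype.card (Choice K) + 7 * K + 22) + 2))
      (P.IsOutput es) := by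
  have hn := n_pos P
  refine Runs.seq (Runs.of_run_le (by simp) (by simp) fun ha => ?_)
  set s₁ := (block [.natConst 20 0, .natConst 21 (St.disc {S.col 0} : St K).code,
    .natStore aCur 20 21, .natStore 6 2 ONE]).run s with hs₁
  have hI₁ := hI.of_agree ha (by intro x hx h; simp at h; omega) (by simp) (by simp) (by simp)
    (by simp)
  have hS₁ := hS.of_agree ha (by simp) (by simp) (by simp) (by simp)
  have hE₁ : EdgeMem S es es.length s₁ := fun t ht c e => by
    rw [ha.na _ (by simp)]; exact hE t ht c e
  have hpar₁ : ∀ t < P.n, s₁.narr aPar t = S.par t := by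
    rw [ha.na _ (by simp)]; exact hpar
  have hch₁ : ∀ i, 1 ≤ i → i < P.n → recorded s₁ i (sts i (S.par i)) (C i) := by
    intro i hi hin
    rw [recorded, ha.na _ (by simp)]; exact hch i hi hin
  have h15₁ : s₁.nreg 15 = P.n - 1 := by rw [ha.n _ (by simp), h15]
  have hvroot : P.root ∈ (S.runSubgraph sts C).verts := hopt.1.1
  have := Runs.forUp (i := 8) (b := 15) (p := traceBack K) (s := s₁)
    (3 * Fintype.card (St K) + 3 * Fintype.card (Choice K) + 7 * K + 20) (TraceMem S es sts C)
    (fun h => by have := traceBack_wN _ h; omega) (fun h => by have := traceBack_wN _ h; omega)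
    (fun h => by have := traceBack_wN _ h; omega) (by decide) (by decide) hI₁.one
    ⟨?_, ?_, ?_⟩ ?_
  · rw [h15₁] at this
    refine this.mono (by ring_nf; omega) fun s' _ ht => ⟨_, hopt, fun v => ?_, fun e => ?_⟩
    · have := S.pos_lt v
      by_cases hv : v ∈ (S.runSubgraph sts C).verts
      · exact .inl ⟨(ht.verts v).1 ⟨by omega, hv⟩, hv⟩
      · exact .inr ⟨(ht.verts v).2 (by tauto), hv⟩
    · have h := ht.edges e e.2
      rw [selectedBy_last hr] at h
      by_cases hv : (es.get e).edge ∈ (S.runSubgraph sts C).edgeSet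
      · exact .inl ⟨h.1 hv, hv⟩
      · exact .inr ⟨h.2 hv, hv⟩
  · intro u hu
    obtain rfl : u = 0 := by omega
    simp [hs₁, h1]
  · intro v
    have e : (s₁.setN 8 0).narr 6 v = if v = P.root then 1 else 0 := by
      simp only [State.setN_narr]
      simp [hs₁, hI.one, hI.root, update_apply, h6, Fin.val_inj]
    rw [e]
    by_cases hv : v = P.root
    · subst hv
      simp [S.pos_root, hvroot]
    · have : ¬ S.pos v ≤ 0 := fun h => hv (by
        rw [← S.vert_pos v, Nat.le_zero.1 h, S.vert_zero hn])
      simp [hv, this]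
  · intro e he
    have : ¬ SelectedBy S C 0 es[e].edge := by
      rintro ⟨t, h1, h2, -⟩; omega
    have e7 : (s₁.setN 8 0).narr 7 e = 0 := by
      rw [State.setN_narr, ha.na _ (by simp), h7 e he]
    exact ⟨fun h => (this h).elim, fun _ => e7⟩
  · intro j s' hj hj8 ha' ht
    rw [h15₁] at hj
    have hw : ∀ x, x ≠ 6 ∧ x ≠ 7 ∧ x ≠ aCur →
        ¬ (forUp 8 15 (traceBack K)).wNA x := fun x hx h => by
      have := traceBack_wNA _ (forUp_wNA.1 h); omega
    have hI' := hI₁.of_agree ha' (fun x hx h => by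
        rcases forUp_wN.1 h with h | h
        · omega
        · have := traceBack_wN _ h; omega)
      (hw _ (by simp)) (hw _ (by simp))
      (by simpa using traceBack_wRA _) (by simpa using traceBack_wRA _)
    have hna : ∀ x, x ≠ 6 → x ≠ 7 → x ≠ aCur → s'.narr x = s₁.narr x := fun x h1 h2 h3 =>
      ha'.na x (hw x (by omega))
    have hS' := hS₁.of_agree ha'
      (hw _ (by simp)) (hw _ (by simp)) (hw _ (by simp))
      (fun c => hw _ (by have := le_fam fSlot c; omega))
    refine Runs.of_run_le traceBack_loopFree traceBack_len ?_
    have := TraceMem.step hes hI' hS' (fun t ht c e => by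
        rw [hna _ (by simp) (by simp) (by simp)]; exact hE₁ t ht c e)
      (by rw [hna _ (by simp) (by simp) (by simp)]; exact hpar₁) hr
      (fun i hi hin => by
        rw [recorded, hna _ (by simp) (by simp) (by simp)]; exact hch₁ i hi hin)
      (by omega) hj8 ht
    exact ⟨this.cur, this.verts, this.edges⟩

/-! ### The dynamic program on the machine: the whole algorithm -/

/-- The dynamic program. The colour of the root is `0`. -/
noncomputable def solve (K : ℕ) (h : 0 < K) : Program :=
  .seq (edgeSlots K) (.seq (block [.natSub 15 0 ONE]) (.seq (forUp 8 0 (initPosition K))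
    (.seq (forUp 8 15 (eliminate K)) (traceBackAll K (St.disc {⟨0, h⟩})))))

/-- The memory that the dynamic program uses for itself is empty. -/
structure Fresh (K : ℕ) (s : State) : Prop where
  verts : ∀ v, s.narr 6 v = 0
  edges : ∀ e, s.narr 7 e = 0
  fam : ∀ a k t, 1 ≤ a → s.narr (fam a k) t = 0
  val : ∀ k t, s.rarr (RAM.fam 1 k) t = 0

theorem card_St_le_card_Choice : Fintype.card (St K) ≤ Fintype.card (Choice K) :=
  Fintype.card_le_of_injective (fun σ => (⟨σ, ∅, σ⟩ : Choice K)) fun σ τ h => by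
    injection h

theorem initPosition_wN (x : ℕ) (h : (initPosition K).wN x) : x = 6 ∨ (9 ≤ x ∧ x < 11) := by
  simp at h
  grind

theorem initPosition_wNA (x : ℕ) (h : (initPosition K).wNA x) :
    x = aPar ∨ ∃ k, x = RAM.fam fFlag k := by
  simp at h
  rcases h with h | ⟨σ, -, h⟩
  · exact .inl h
  · exact .inr ⟨_, h⟩

theorem solve_runs (hK : 0 < K) (hes : IsEdgeList es) (hI : InstanceMem P es s)
    (hS : SchemeMem S s) (hF : Fresh K s) (hcol : S.col 0 = ⟨0, hK⟩) :
    Runs (solve K hK) s (Fintype.card (Choice K) * (P.n * (21 * K + 120) + es.length *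
      (3 * K + 22)))
      (P.IsOutput es) := by
  have hn := n_pos P
  have hc1 : 1 ≤ Fintype.card (Choice K) := Fintype.card_pos_iff.2 ⟨⟨St.disc ∅, ∅, St.disc ∅⟩⟩
  have hc2 := card_St_le_card_Choice (K := K)
  set c := Fintype.card (Choice K) with hcdef
  set q := Fintype.card (St K) with hqdef
  obtain ⟨n', hn'⟩ : ∃ n', P.n = n' + 1 := ⟨P.n - 1, by omega⟩
  have hmain : Runs (solve K hK) s ((es.length * (3 * K + 22) + 2) + (2 + ((P.n *
    (3 * K + q + 8) + 2)
      + (((P.n - 1) * (c * (K + 40) + 6 * q + 10 * K + 22) + 2) +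
        (5 + ((P.n - 1) * (3 * q + 3 * c + 7 * K + 22) + 2))))))
      (P.IsOutput es) := by
    refine Runs.seq ((edgeSlots_runs S hes hI hS fun c t => hF.fam 1 c t le_rfl).mono le_rfl
      fun s₁ _ hE₁ ha₁ => ?_)
    have hI₁ := hI.of_agree ha₁ (by simp; omega)
      (by simp) (by simp)
      (by simp) (by simp)
    have hS₁ := hS.of_agree ha₁ (by simp) (by simp)
      (by simp) (by simp)
    have hf₁ : ∀ a k t, 2 ≤ a → s₁.narr (RAM.fam a k) t = 0 := fun a k t ha => by
      rw [ha₁.na _ (by simp; omega), hF.fam a k t (by omega)]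
    have hv₁ : ∀ k t, s₁.rarr (RAM.fam 1 k) t = 0 := fun k t => by
      rw [ha₁.ra _ (by simp), hF.val k t]
    have h6₁ : ∀ v, s₁.narr 6 v = 0 := fun v => by
      rw [ha₁.na _ (by simp), hF.verts]
    have h7₁ : ∀ v, s₁.narr 7 v = 0 := fun v => by
      rw [ha₁.na _ (by simp), hF.edges]
    clear hF
    refine Runs.seq (Runs.of_run_le (by simp) (by simp) fun ha₂ => ?_)
    set s₂ := (block [.natSub 15 0 ONE]).run s₁ with hs₂
    have hI₂ := hI₁.of_agree ha₂ (by simp; omega) (by simp) (by simp) (by simp) (by simp)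
    have hS₂ := hS₁.of_agree ha₂ (by simp) (by simp) (by simp) (by simp)
    have hna₂ : s₂.narr = s₁.narr := funext fun x => ha₂.na x (by simp)
    have hra₂ : s₂.rarr = s₁.rarr := funext fun x => ha₂.ra x (by simp)
    have h15₂ : s₂.nreg 15 = P.n - 1 := by simp [hs₂, hI₁.n, hI₁.one]
    refine Runs.seq ((initTables_runs hI₂ hS₂ fun σ t => by rw [hna₂, hf₁ _ _ _ le_rfl]).mono le_rfl
      fun s₃ _ hT₃ ha₃ => ?_)
    have hna₃ : ∀ x, x ≠ aPar → (∀ k, x ≠ RAM.fam fFlag k) → s₃.narr x = s₁.narr x := by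
      intro x h1 h2
      rw [ha₃.na x, hna₂]
      rw [forUp_wNA]
      intro h
      rcases initPosition_wNA x h with h | ⟨k, h⟩
      · exact h1 h
      · exact h2 k h
    have hra₃ : s₃.rarr = s₁.rarr := by
      rw [← hra₂]
      exact funext fun x => ha₃.ra x (by simp)
    have hN₃ : ∀ x, x ≠ 6 → x ≠ 8 → x ≠ 9 → x ≠ 10 → s₃.nreg x = s₂.nreg x := by
      intro x h1 h2 h3 h4
      refine ha₃.n x fun h => ?_
      rcases forUp_wN.1 h with h | h
      · omega
      · have := initPosition_wN x h; omega
    have hnot : ∀ x < 64, x ≠ aPar → ¬ (forUp 8 0 (initPosition K)).wNA x := by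
      intro x hx hp h
      rw [forUp_wNA] at h
      rcases initPosition_wNA x h with h | ⟨k, h⟩
      · omega
      · have := le_fam fFlag k; omega
    have hnot' : ∀ a k, a ≠ fFlag → ¬ (forUp 8 0 (initPosition K)).wNA (RAM.fam a k) := by
      intro a k hk h
      rw [forUp_wNA] at h
      rcases initPosition_wNA _ h with h | ⟨k', h⟩
      · simp at h
      · simp at h; exact hk h.1
    have hI₃ := hI₂.of_agree ha₃ (fun x hx h => by
        rcases forUp_wN.1 h with h | h
        · omega
        · have := initPosition_wN x h; omega) (hnot _ (by simp) (by simp))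
      (hnot _ (by simp) (by simp)) (by simp) (by simp [initPosition,
        maxSlot])
    have hS₃ := hS₂.of_agree ha₃ (hnot _ (by simp) (by simp)) (hnot _ (by simp) (by simp))
      (hnot _ (by simp) (by simp)) fun c => hnot' _ _ (by simp)
    have hE₃ : EdgeMem S es es.length s₃ := fun t ht c e => by
      rw [hna₃ _ (by simp) (by simp)]; exact hE₁ t ht c e
    have h15₃ : s₃.nreg 15 = P.n - 1 := by
      rw [hN₃ _ (by simp) (by simp) (by simp) (by simp), h15₂]
    have htab : ∀ t (σ : St K), (t < P.n ∧ σ.IsDisc → tabOf s₃ t σ = some 0) ∧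
        (¬ (t < P.n ∧ σ.IsDisc) → tabOf s₃ t σ = none) := by
      intro t σ
      have h := hT₃.2 t σ
      refine ⟨fun hd => ?_, fun hd => ?_⟩
      · rw [tabOf, if_pos (by rw [h.1 hd]; omega), hra₃, hv₁, hna₃ _ (by simp) (by simp),
          hf₁ _ _ _ (by omega)]
        rfl
      · rw [tabOf, if_neg (by rw [h.2 hd]; omega)]
    refine Runs.seq ((eliminate_runs hes hI₃ hS₃ hE₃ hT₃.1 h15₃
      (complete_init fun u hu σ hσ => (htab u σ).1 ⟨hu, hσ⟩)
      (sound_init fun u hu σ w hw => ?_)).mono le_rfl fun s₄ _ hT₄ ha₄ => ?_)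
    · by_cases hd : u < P.n ∧ σ.IsDisc
      · rw [(htab u σ).1 hd] at hw
        exact ⟨(Option.some.inj hw).symm, hd.2⟩
      · rw [(htab u σ).2 hd] at hw
        cases hw
    · have hna₄ : ∀ x < 64, s₄.narr x = s₃.narr x := fun x hx =>
        ha₄.na x (by simpa using eliminate_not_wNA_lt hx)
      have hI₄ := hI₃.of_agree ha₄ (fun x hx h => by
          rcases forUp_wN.1 h with h | h
          · omega
          · have := eliminate_wN _ h; omega)
        (by simpa using eliminate_not_wNA_lt (by simp))
        (by simpa using eliminate_not_wNA_lt (by simp))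
        (by simpa using eliminate_not_wRA_lt (by simp))
        (by simpa using eliminate_not_wRA_lt (by simp))
      have hS₄ := hS₃.of_agree ha₄ (by simpa using eliminate_not_wNA_lt (by simp))
        (by simpa using eliminate_not_wNA_lt (by simp))
        (by simpa using eliminate_not_wNA_lt (by simp))
        (fun c => by simpa using eliminate_not_wNA_fam (by simp))
      have hE₄ : EdgeMem S es es.length s₄ := fun t ht c e => by
        rw [ha₄.na _ (by simpa using eliminate_not_wNA_fam (by simp))]; exact hE₃ t ht c e
      have h15₄ : s₄.nreg 15 = P.n - 1 := by
        rw [ha₄.n 15 (fun h => by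
          rcases forUp_wN.1 h with h | h
          · omega
          · have := eliminate_wN _ h; omega), h15₃]
      obtain ⟨sts, C, hr, h1, hch, hopt⟩ := exists_optimal_run S hT₄.1 hT₄.2
      rw [← hcol]
      exact traceBackAll_runs hes hI₄ hS₄ hE₄ (by rw [hna₄ _ (by simp)]; exact hT₃.1) h15₄
        (fun v => by rw [hna₄ _ (by simp), hna₃ _ (by simp) (by simp), h6₁])
        (fun e _ => by rw [hna₄ _ (by simp), hna₃ _ (by simp) (by simp), h7₁])
        hr h1 hch hopt
  refine hmain.mono ?_ fun _ _ h => h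
  generalize es.length = m
  rw [hn', Nat.add_sub_cancel]
  obtain ⟨d, hd⟩ := Nat.exists_eq_add_of_le hc1
  have e1 : 1 * (m * (3 * K + 22)) ≤ c * (m * (3 * K + 22)) :=
    Nat.mul_le_mul_right _ hc1
  have e2 : (n' + 1) * q ≤ (n' + 1) * c := Nat.mul_le_mul_left _ hc2
  have e3 : 1 * ((n' + 1) * (20 * K + 52)) ≤ c * ((n' + 1) * (20 * K + 52)) :=
    Nat.mul_le_mul_right _ hc1
  have e4 : 1 * 15 ≤ c * ((n' + 1) * 15) := Nat.mul_le_mul hc1 (by omega)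
  have e5 : n' * q ≤ n' * c := Nat.mul_le_mul_left _ hc2
  have e6 : 0 ≤ c * K := Nat.zero_le _
  linarith [e1, e2, e3, e4, e5, e6]

end

theorem run_ite_pos {b : Test} {p q : Program} {s : State} (h : b.Holds s) :
    (Program.ite b p q).run s = p.run s := if_pos h

theorem run_ite_neg {b : Test} {p q : Program} {s : State} (h : ¬ b.Holds s) :
    (Program.ite b p q).run s = q.run s := if_neg h

theorem run_ite_or (b : Test) (p q : Program) (s : State) :
    (Program.ite b p q).run s = p.run s ∨ (Program.ite b p q).run s = q.run s :=
  (em (b.Holds s)).imp run_ite_pos run_ite_neg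

/-! ### Building an elimination scheme vertex by vertex -/

section

variable {n : ℕ} {G : SimpleGraph (Fin n)} {r : Fin n} {vert : ℕ → Fin n} {bag : ℕ → Finset ℕ}
  {col : ℕ → Fin K} {c : ℕ}

/-- The first `c` positions of an elimination scheme. -/
structure IsPartial (G : SimpleGraph (Fin n)) (r : Fin n) (c : ℕ) (vert : ℕ → Fin n)
    (bag : ℕ → Finset ℕ) (col : ℕ → Fin K) : Prop where
  inj : ∀ t < c, ∀ u < c, vert t = vert u → t = u
  root : 0 < c → vert 0 = r
  bag_lt : ∀ t < c, ∀ u ∈ bag t, u < t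
  zero_mem : ∀ t < c, 0 < t → 0 ∈ bag t
  adj : ∀ t < c, ∀ u < t, G.Adj (vert t) (vert u) → u ∈ bag t
  closed : ∀ t < c, ∀ u ∈ bag t, ∀ w ∈ bag t, w < u → w ∈ bag u
  col_ne : ∀ t < c, ∀ u ∈ bag t, col u ≠ col t

theorem isPartial_one (v : ℕ → Fin n) (col : ℕ → Fin K) (hv : v 0 = r) :
    IsPartial G r 1 v (fun _ => ∅) col := by
  constructor <;> intros
  · omega
  · exact hv
  any_goals simp_all

/-- A vertex can be placed next at the bag `B` with the colour `k`. -/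
theorem IsPartial.place (h : IsPartial G r c vert bag col) (hc : 0 < c) {v : Fin n}
    (hv : ∀ t < c, vert t ≠ v) {B : Finset ℕ} (hB : ∀ u ∈ B, u < c) (h0 : 0 ∈ B)
    (hadj : ∀ u < c, G.Adj v (vert u) → u ∈ B) (hcl : ∀ u ∈ B, ∀ w ∈ B, w < u → w ∈ bag u)
    {k : Fin K} (hk : ∀ u ∈ B, col u ≠ k) :
    IsPartial G r (c + 1) (update vert c v) (update bag c B)
      (update col c k) := by
  have hne : ∀ t, t < c + 1 → t = c ∨ t < c := fun t ht => by omega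
  constructor
  · intro t ht u hu
    rcases hne t ht with rfl | ht <;> rcases hne u hu with rfl | hu
    · simp
    · simp only [update_self, update_of_ne hu.ne]
      exact fun h => (hv u hu h.symm).elim
    · simp only [update_self, update_of_ne ht.ne]
      exact fun h => (hv t ht h).elim
    · simp only [update_of_ne hu.ne, update_of_ne ht.ne]
      exact h.inj t ht u hu
  · intro _
    rw [update_of_ne hc.ne, h.root hc]
  · intro t ht u hu
    rcases hne t ht with rfl | ht
    · exact hB u (by simpa using hu)
    · exact h.bag_lt t ht u (by simpa [ht.ne] using hu)
  · intro t ht h0'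
    rcases hne t ht with rfl | ht
    · simpa using h0
    · simpa [ht.ne] using h.zero_mem t ht h0'
  · intro t ht u hu
    rcases hne t ht with rfl | ht
    · simpa [hu.ne] using hadj u hu
    · simpa [ht.ne, (hu.trans ht).ne] using h.adj t ht u hu
  · intro t ht u hu w hw hwu
    rcases hne t ht with rfl | ht
    · simp only [update_self] at hu hw
      rw [update_of_ne (hB u hu).ne]
      exact hcl u hu w hw hwu
    · simp only [update_of_ne ht.ne] at hu hw
      have := h.bag_lt t ht u hu
      rw [update_of_ne (by omega)]
      exact h.closed t ht u hu w hw hwu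
  · intro t ht u hu
    rcases hne t ht with rfl | ht
    · simp only [update_self] at hu ⊢
      rw [update_of_ne (hB u hu).ne]
      exact hk u hu
    · simp only [update_of_ne ht.ne] at hu ⊢
      have := h.bag_lt t ht u hu
      rw [update_of_ne (by omega)]
      exact h.col_ne t ht u hu

/-- The colouring is injective on closed sets of positions. -/
theorem IsPartial.col_inj (h : IsPartial G r c vert bag col) {B : Finset ℕ}
    (hB : ∀ u ∈ B, u < c) (hcl : ∀ u ∈ B, ∀ w ∈ B, w < u → w ∈ bag u) {u w : ℕ} (hu : u ∈ B)
    (hw : w ∈ B) (hc : col u = col w) : u = w := by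
  rcases lt_trichotomy u w with h' | h' | h'
  · exact (h.col_ne w (hB w hw) u (hcl w hw u hu h') hc).elim
  · exact h'
  · exact (h.col_ne u (hB u hu) w (hcl u hu w hw h') hc.symm).elim

/-- When all vertices have been placed, the scheme is complete. -/
noncomputable def IsPartial.scheme (h : IsPartial G r n vert bag col) : Scheme G r K :=
  have hsurj : ∀ v, ∃ t < n, vert t = v := fun v => by
    have hinj : Function.Injective fun t : Fin n => vert t := fun t u htu =>
      Fin.ext (h.inj t t.2 u u.2 htu)
    obtain ⟨t, ht⟩ := Finite.surjective_of_injective hinj v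
    exact ⟨t, t.2, ht⟩
  { vert := vert
    pos := fun v => (hsurj v).choose
    pos_lt := fun v => (hsurj v).choose_spec.1
    vert_pos := fun v => (hsurj v).choose_spec.2
    pos_vert := fun t ht => h.inj _ (hsurj (vert t)).choose_spec.1 t ht
      (hsurj (vert t)).choose_spec.2
    pos_root := h.inj _ (hsurj r).choose_spec.1 0 r.pos
      ((hsurj r).choose_spec.2.trans (h.root r.pos).symm)
    bag := bag
    bag_lt := h.bag_lt
    zero_mem := h.zero_mem
    adj := h.adj
    closed := h.closed
    col := col
    col_ne := h.col_ne }

end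

section

variable {vert : ℕ → Fin P.n} {bag : ℕ → Finset ℕ} {col : ℕ → Fin K} {c : ℕ} {s s' : State}
  {es : List P.G.Dart}

/-- The memory describes the first `c` positions of an elimination scheme; register `22` holds
the number `c`. -/
structure PartialMem (c : ℕ) (vert : ℕ → Fin P.n) (bag : ℕ → Finset ℕ) (col : ℕ → Fin K)
    (s : State) : Prop where
  isPartial : IsPartial P.G P.root c vert bag col
  count : s.nreg 22 = c
  vert_eq : ∀ t < c, s.narr aVert t = vert t
  pos_eq : ∀ t < c, s.narr aPos (vert t) = t + 1
  pos_zero : ∀ v : Fin P.n, (∀ t < c, vert t ≠ v) → s.narr aPos v = 0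
  col_eq : ∀ t < c, s.narr aCol t = col t
  slot : ∀ t < c, ∀ k : Fin K, ∀ u, s.narr (fam fSlot k) t = u + 1 ↔ u ∈ bag t ∧ col u = k

theorem PartialMem.of_eq (h : PartialMem c vert bag col s) (h22 : s'.nreg 22 = s.nreg 22)
    (h8 : s'.narr aVert = s.narr aVert) (h9 : s'.narr aPos = s.narr aPos)
    (h10 : s'.narr aCol = s.narr aCol)
    (hs : ∀ k : Fin K, s'.narr (fam fSlot k) = s.narr (fam fSlot k)) :
    PartialMem c vert bag col s' where
  isPartial := h.isPartial
  count := by rw [h22, h.count]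
  vert_eq := by rw [h8]; exact h.vert_eq
  pos_eq := by rw [h9]; exact h.pos_eq
  pos_zero := by rw [h9]; exact h.pos_zero
  col_eq := by rw [h10]; exact h.col_eq
  slot t ht k := by rw [hs]; exact h.slot t ht k

theorem PartialMem.of_agree (h : PartialMem c vert bag col s) {p : Program} (ha : Agree p s s')
    (h22 : ¬ p.wN 22) (h8 : ¬ p.wNA aVert) (h9 : ¬ p.wNA aPos) (h10 : ¬ p.wNA aCol)
    (hs : ∀ k : Fin K, ¬ p.wNA (fam fSlot k)) : PartialMem c vert bag col s' :=
  h.of_eq (ha.n _ h22) (ha.na _ h8) (ha.na _ h9) (ha.na _ h10) fun k => ha.na _ (hs k)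

theorem PartialMem.lt (h : PartialMem c vert bag col s) {v : Fin P.n}
    (hv : s.narr aPos v = 0) : ∀ t < c, vert t ≠ v := fun t ht hvt => by
  have := h.pos_eq t ht
  rw [hvt, hv] at this
  omega

theorem PartialMem.pos_cases (h : PartialMem c vert bag col s) (v : Fin P.n) :
    (s.narr aPos v = 0 ∧ ∀ t < c, vert t ≠ v) ∨ ∃ t < c, vert t = v ∧ s.narr aPos v = t + 1 := by
  by_cases hv : ∃ t < c, vert t = v
  · obtain ⟨t, ht, rfl⟩ := hv
    exact .inr ⟨t, ht, rfl, h.pos_eq t ht⟩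
  · push Not at hv
    exact .inl ⟨h.pos_zero v hv, hv⟩

theorem PartialMem.schemeMem (h : PartialMem P.n vert bag col s) :
    ∃ S : Scheme P.G P.root K, S.col = col ∧ SchemeMem S s := by
  refine ⟨h.isPartial.scheme, rfl, h.vert_eq, fun v => ?_, h.col_eq, h.slot⟩
  conv_lhs => rw [← h.isPartial.scheme.vert_pos v]
  exact h.pos_eq _ (h.isPartial.scheme.pos_lt v)

/-- The registers `fam 5 k` describe the set `B` of positions, whose colours are distinct. -/
def SlotRegs (col : ℕ → Fin K) (B : Finset ℕ) (s : State) : Prop :=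
  ∀ (k : Fin K) u, s.nreg (fam 5 k) = u + 1 ↔ u ∈ B ∧ col u = k

theorem SlotRegs.of_eq {B : Finset ℕ} (h : SlotRegs col B s)
    (hs : ∀ k : Fin K, s'.nreg (fam 5 k) = s.nreg (fam 5 k)) : SlotRegs col B s' := by
  intro k u; rw [hs]; exact h k u

/-- Empty the registers `fam 5 k`. -/
def clearSlots (K : ℕ) : Program :=
  block ((List.finRange K).map fun k : Fin K => .natConst (fam 5 k) 0)

/-- If the vertex in register `23` has a position, enter it into the registers `fam 5 k`. -/
def addSlot (K : ℕ) : Program :=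
  .seq (.instr (.natLoad 24 aPos 23))
    (.ite (.natLt ZERO 24)
      (.seq (block [.natSub 25 24 ONE, .natLoad 25 aCol 25])
        (switchN 25 K fun k => .instr (.natAdd (fam 5 k) 24 ZERO))) skip)

/-- Place the vertex in register `23` at the bag described by the registers `fam 5 k`, with a
colour that does not occur there. -/
def placeVertex (K : ℕ) : Program :=
  .seq (seqs ((List.finRange K).map fun k : Fin K => .seq (.instr (.natStore (fam fSlot k) 22
    (fam 5 k)))
      (.ite (.natLt ZERO (fam 5 k)) skip (.instr (.natConst 26 k)))))
    (block [.natStore aVert 22 23, .natStore aCol 22 26, .natAdd 22 22 ONE, .natStore aPos 23 22])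

theorem clearSlots_loopFree : (clearSlots K).LoopFree := by simp [clearSlots]
theorem addSlot_loopFree : (addSlot K).LoopFree := by simp [addSlot]
theorem placeVertex_loopFree : (placeVertex K).LoopFree := by simp [placeVertex]

theorem clearSlots_len : (clearSlots K).len = K + 1 := by simp [clearSlots]
theorem addSlot_len : (addSlot K).len ≤ 3 * K + 7 := by
  have := switchN_len (x := 25) (m := K) (f := fun k => .instr (.natAdd (fam 5 k) 24 ZERO))
    (c := 1) (by simp)
  simp [addSlot]; omega
theorem placeVertex_len : (placeVertex K).len ≤ 3 * K + 6 := by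
  have := seqs_map_len_le (l := List.finRange K) (f := fun k : Fin K => .seq
    (.instr (.natStore (fam fSlot k) 22 (fam 5 k)))
      (.ite (.natLt ZERO (fam 5 k)) skip (.instr (.natConst 26 k)))) (c := 3) (by simp)
  simp [placeVertex] at this ⊢; omega

theorem clearSlots_wN (x : ℕ) (h : (clearSlots K).wN x) : x = 6 ∨ ∃ k, x = fam 5 k := by
  simp [clearSlots] at h
  rcases h with h | ⟨k, h⟩
  · exact .inl h
  · exact .inr ⟨k, h⟩
theorem addSlot_wN (x : ℕ) (h : (addSlot K).wN x) :
    x = 6 ∨ x = 7 ∨ x = 24 ∨ x = 25 ∨ ∃ k, x = fam 5 k := by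
  simp [addSlot] at h
  grind
theorem placeVertex_wN (x : ℕ) (h : (placeVertex K).wN x) : x = 6 ∨ x = 22 ∨ x = 26 := by
  simp [placeVertex] at h
  grind
@[simp] theorem clearSlots_wNA (x : ℕ) : ¬ (clearSlots K).wNA x := by simp [clearSlots]
@[simp] theorem addSlot_wNA (x : ℕ) : ¬ (addSlot K).wNA x := by simp [addSlot]
theorem placeVertex_wNA (x : ℕ) (h : (placeVertex K).wNA x) :
    x = aVert ∨ x = aPos ∨ x = aCol ∨ ∃ k, x = fam fSlot k := by
  simp [placeVertex] at h
  grind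
@[simp] theorem clearSlots_wRA (x : ℕ) : ¬ (clearSlots K).wRA x := by simp [clearSlots]
@[simp] theorem addSlot_wRA (x : ℕ) : ¬ (addSlot K).wRA x := by simp [addSlot]
@[simp] theorem placeVertex_wRA (x : ℕ) : ¬ (placeVertex K).wRA x := by simp [placeVertex]

theorem clearSlots_run (s : State) : SlotRegs col ∅ ((clearSlots K).run s) := by
  have h := run_seqs_induction (List.finRange K) (fun k : Fin K => .instr (.natConst (fam 5 k) 0))
    (fun l s' => ∀ k ∈ l, s'.nreg (fam 5 (k : ℕ)) = 0) s (by simp) (by simp) (by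
      rintro l a s' - - h k hk
      by_cases hka : k = a
      · simp [hka]
      · have : (k : ℕ) ≠ a := fun h => hka (Fin.ext h)
        simp [this]
        exact h k (by simpa [hka] using hk))
  intro k u
  have e : (clearSlots K).run s = (seqs ((List.finRange K).map
      fun k : Fin K => .instr (.natConst (fam 5 k) 0))).run s := by
    simp [clearSlots, block]; rfl
  rw [e, h k (List.mem_finRange k)]
  simp

theorem addSlot_run_unplaced (h1 : s.nreg ZERO = 0) (hv : s.narr aPos (s.nreg 23) = 0)
    {B : Finset ℕ} (hB : SlotRegs col B s) : SlotRegs col B ((addSlot K).run s) := by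
  intro k u
  rw [← hB k u]
  simp [addSlot, h1, hv]

theorem addSlot_run_placed (hp : PartialMem c vert bag col s) (h0 : s.nreg ZERO = 0)
    (h1 : s.nreg ONE = 1) {t : ℕ} (ht : t < c) (hv : s.nreg 23 = vert t) {B : Finset ℕ}
    (hB : SlotRegs col B s) (hinj : ∀ u ∈ B, col u = col t → u = t) :
    SlotRegs col (insert t B) ((addSlot K).run s) := by
  intro k u
  have e : ((addSlot K).run s).nreg (fam 5 k) = if k = col t then t + 1 else s.nreg (fam 5 k) := by
    have hpos : (Test.natLt ZERO 24).Holds ((Instr.natLoad 24 aPos 23).apply s) := by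
      simp [h0, hv, hp.pos_eq t ht]
    rw [addSlot, Program.run, Program.run, run_ite_pos hpos, Program.run]
    rw [switchN_run _ _ (by decide) (by
      simp [h1, hv, hp.pos_eq t ht, hp.col_eq t ht])]
    by_cases hk : k = col t
    · simp [h0, h1, hv, hp.pos_eq t ht, hp.col_eq t ht, hk]
    · have : (k : ℕ) ≠ col t := fun h => hk (Fin.ext h)
      simp [h1, hv, hp.pos_eq t ht, hp.col_eq t ht, hk, this]
  rw [e]
  split_ifs with hk
  · subst hk
    constructor
    · intro h
      obtain rfl : t = u := by omega
      simp
    · rintro ⟨hu, hc⟩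
      rcases mem_insert.1 hu with rfl | hu
      · rfl
      · rw [hinj u hu hc]
  · rw [hB k u]
    constructor
    · exact fun h => ⟨mem_insert_of_mem h.1, h.2⟩
    · rintro ⟨hu, hc⟩
      rcases mem_insert.1 hu with rfl | hu
      · exact (hk hc.symm).elim
      · exact ⟨hu, hc⟩

theorem placeVertex_run (hp : PartialMem c vert bag col s) (hc : 0 < c) (h0 : s.nreg ZERO = 0)
    (h1 : s.nreg ONE = 1) {v : Fin P.n} (h23 : s.nreg 23 = v) (hv : ∀ t < c, vert t ≠ v)
    {B : Finset ℕ} (hR : SlotRegs col B s) (hcard : B.card < K)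
    (hB : ∀ u ∈ B, u < c) (hB0 : 0 ∈ B)
    (hadj : ∀ u < c, P.G.Adj v (vert u) → u ∈ B) (hcl : ∀ u ∈ B, ∀ w ∈ B, w < u → w ∈ bag u) :
    ∃ k : Fin K, PartialMem (c + 1) (update vert c v) (update bag c B)
      (update col c k) ((placeVertex K).run s) := by
  classical
  -- the part that stores the bag and searches for a colour
  obtain ⟨⟨h26, hst⟩, ho, hn, hz⟩ := run_seqs_induction (List.finRange K) (fun k : Fin K => .seq
      (.instr (.natStore (fam fSlot k) 22 (fam 5 k)))
      (.ite (.natLt ZERO (fam 5 k)) skip (.instr (.natConst 26 k))))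
    (fun l s' => (((∃ k ∈ l, s.nreg (fam 5 (k : ℕ)) = 0) →
        ∃ k : Fin K, s'.nreg 26 = k ∧ s.nreg (fam 5 (k : ℕ)) = 0) ∧
      ∀ (k : Fin K) t, s'.narr (fam fSlot k) t =
        if k ∈ l ∧ t = c then s.nreg (fam 5 k) else s.narr (fam fSlot k) t) ∧
      (∀ x < 64, s'.narr x = s.narr x) ∧ (∀ x, x ≠ 6 → x ≠ 26 → s'.nreg x = s.nreg x)
        ∧ s'.nreg ZERO = 0) s
    (by simp [h0]) (fun l s' ⟨⟨h, h'⟩, h2, h3, h4⟩ => ⟨⟨by simpa using h, by simpa using h'⟩,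
      by simpa using h2, fun x hx hx' => by simpa [hx] using h3 x hx hx', by simpa using h4⟩) (by
      rintro l a s' - - ⟨⟨h, h'⟩, h2, h3, h4⟩
      have e22 := h3 22 (by simp) (by simp)
      have ea := h3 (fam 5 a) (by simp) (by simp)
      rw [hp.count] at e22
      refine ⟨⟨?_, fun k t => ?_⟩, fun x hx => ?_, fun x h6 h26 => ?_, ?_⟩
      · rintro ⟨k, hk, hk0⟩
        by_cases ha : s.nreg (fam 5 (a : ℕ)) = 0
        · exact ⟨a, by simp [h4, ea, ha], ha⟩
        · obtain ⟨k', h1, h2⟩ := h ⟨k, by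
            simp only [List.mem_append, List.mem_singleton] at hk
            rcases hk with hk | rfl
            · exact hk
            · exact (ha hk0).elim, hk0⟩
          refine ⟨k', ?_, h2⟩
          have : 0 < s.nreg (fam 5 (a : ℕ)) := by omega
          simp [h4, ea, this, h1]
      · have := h' k t
        have e : ((Program.seq (.instr (.natStore (fam fSlot a) 22 (fam 5 a)))
          (.ite (.natLt ZERO (fam 5 a)) skip (.instr (.natConst 26 a)))).run s').narr =
            ((Instr.natStore (fam fSlot a) 22 (fam 5 a)).apply s').narr := by
          rw [Program.run, Program.run]
          rcases run_ite_or (.natLt ZERO (fam 5 (a : ℕ))) skip (.instr (.natConst 26 a))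
            ((Instr.natStore (fam fSlot a) 22 (fam 5 a)).apply s') with h | h <;> rw [h] <;> rfl
        rw [e]
        by_cases hk : k = a
        · subst hk
          by_cases ht : t = c
          · simp [ht, e22, ea]
          · simp [ht, e22, this]
        · have hk' : (k : ℕ) ≠ a := fun h => hk (Fin.ext h)
          simp [hk, hk', this]
      · have e : ((Program.seq (.instr (.natStore (fam fSlot a) 22 (fam 5 a)))
          (.ite (.natLt ZERO (fam 5 a)) skip (.instr (.natConst 26 a)))).run s').narr =
            ((Instr.natStore (fam fSlot a) 22 (fam 5 a)).apply s').narr := by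
          rw [Program.run, Program.run]
          rcases run_ite_or (.natLt ZERO (fam 5 (a : ℕ))) skip (.instr (.natConst 26 a))
            ((Instr.natStore (fam fSlot a) 22 (fam 5 a)).apply s') with h | h <;> rw [h] <;> rfl
        rw [e]
        simp [hx, h2 x hx]
      · rw [Program.run, Program.run]
        rcases run_ite_or (.natLt ZERO (fam 5 (a : ℕ))) skip (.instr (.natConst 26 a))
            ((Instr.natStore (fam fSlot a) 22 (fam 5 a)).apply s') with h | h <;> rw [h] <;>
          simp [h6, h26, h3]
      · rw [Program.run, Program.run]
        rcases run_ite_or (.natLt ZERO (fam 5 (a : ℕ))) skip (.instr (.natConst 26 a))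
            ((Instr.natStore (fam fSlot a) 22 (fam 5 a)).apply s') with h | h <;> rw [h] <;>
          simp [h4])
  set s₁ := (seqs ((List.finRange K).map fun k : Fin K => .seq
      (.instr (.natStore (fam fSlot k) 22 (fam 5 k)))
      (.ite (.natLt ZERO (fam 5 k)) skip (.instr (.natConst 26 k))))).run s with hs₁
  obtain ⟨k, hk, hk0⟩ := h26 (by
    by_contra hcon
    push Not at hcon
    have : univ ⊆ B.image col := by
      intro k _
      obtain ⟨u, hu⟩ : ∃ u, s.nreg (fam 5 (k : ℕ)) = u + 1 :=
        ⟨_, (Nat.succ_pred_eq_of_pos (Nat.pos_of_ne_zero (hcon k (List.mem_finRange k)))).symm⟩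
      exact mem_image.2 ⟨u, (hR k u).1 hu⟩
    have := (card_le_card this).trans Finset.card_image_le
    simp at this
    omega)
  have hkB : ∀ u ∈ B, col u ≠ k := fun u hu hc => by
    have := (hR k u).2 ⟨hu, hc⟩
    omega
  have e22 : s₁.nreg 22 = c := by rw [hn _ (by simp) (by simp), hp.count]
  have e23 : s₁.nreg 23 = v := by rw [hn _ (by simp) (by simp), h23]
  have e4 : s₁.nreg ONE = 1 := by rw [hn _ (by simp) (by simp), h1]
  have hrun : (placeVertex K).run s = (block [.natStore aVert 22 23, .natStore aCol 22 26,
    .natAdd 22 22 ONE, .natStore aPos 23 22]).run s₁ := rfl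
  have hne : ∀ t, t < c + 1 → t = c ∨ t < c := fun t ht => by omega
  have fp : ∀ i, ((placeVertex K).run s).narr aPos i =
      if i = v then c + 1 else s.narr aPos i := fun i => by
    rw [hrun]; simp [update_apply, e22, e23, e4, ho]
  have fs : ∀ (k : Fin K) t, ((placeVertex K).run s).narr (fam fSlot k) t =
      if t = c then s.nreg (fam 5 k) else s.narr (fam fSlot k) t := fun k t => by
    rw [hrun]; simp [hst]
  refine ⟨k, hp.isPartial.place hc hv hB hB0 hadj hcl hkB, ?_, ?_, ?_, ?_, ?_, ?_⟩
  · rw [hrun]; simp [e22, e4]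
  · intro t ht
    rw [hrun]
    rcases hne t ht with rfl | ht
    · simp [e22, e23]
    · simp [e22, ht.ne, ho, hp.vert_eq t ht]
  · intro t ht
    rw [fp]
    rcases hne t ht with rfl | ht
    · simp
    · have := hv t ht
      rw [update_of_ne ht.ne, if_neg (fun h => this (Fin.ext h)), hp.pos_eq t ht]
  · intro w hw
    have hwv := hw c (by omega)
    rw [fp, if_neg (fun h => hwv (by simpa using (Fin.ext h).symm)), hp.pos_zero]
    intro t ht
    have := hw t (by omega)
    rwa [update_of_ne ht.ne] at this
  · intro t ht
    rw [hrun]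
    rcases hne t ht with rfl | ht
    · simp [e22, hk]
    · simp [e22, ht.ne, ho, hp.col_eq t ht]
  · intro t ht q u
    rw [fs]
    rcases hne t ht with rfl | ht
    · simp only [if_true, update_self]
      rw [hR q u]
      constructor
      · rintro ⟨hu, hc⟩
        exact ⟨hu, by rwa [update_of_ne (hB u hu).ne]⟩
      · rintro ⟨hu, hc⟩
        exact ⟨hu, by rwa [update_of_ne (hB u hu).ne] at hc⟩
    · rw [if_neg ht.ne, hp.slot t ht, update_of_ne ht.ne]
      constructor
      · rintro ⟨hu, hc⟩
        have := hp.isPartial.bag_lt t ht u hu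
        exact ⟨hu, by rwa [update_of_ne (by omega)]⟩
      · rintro ⟨hu, hc⟩
        have := hp.isPartial.bag_lt t ht u hu
        exact ⟨hu, by rwa [update_of_ne (by omega)] at hc⟩

/-- Set the constant `1` and place the root at position `0`. -/
@[simp] def placeRoot : Program :=
  block [.natConst ONE 1, .natConst 22 1, .natStore aVert ZERO 2, .natStore aPos 2 ONE]

theorem placeRoot_run (hz : s.nreg ZERO = 0) (h2 : s.nreg 2 = P.root) (hK : 0 < K)
    (h9 : ∀ v, s.narr aPos v = 0) (h10 : s.narr aCol 0 = 0)
    (hs : ∀ (k : Fin K) t, s.narr (fam fSlot k) t = 0) :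
    PartialMem (P := P) 1 (fun _ => P.root) (fun _ => ∅) (fun _ => (⟨0, hK⟩ : Fin K))
      (placeRoot.run s) := by
  refine ⟨isPartial_one _ _ rfl, ?_, ?_, ?_, ?_, ?_, ?_⟩
  · simp
  · intro t ht
    obtain rfl : t = 0 := by omega
    simp [hz, h2]
  · intro t ht
    obtain rfl : t = 0 := by omega
    simp [h2]
  · intro v hv
    have : (v : ℕ) ≠ P.root := fun h => hv 0 (by omega) (Fin.ext h.symm)
    simp [h2, this, h9]
  · intro t ht
    obtain rfl : t = 0 := by omega
    simp [h10]
  · intro t ht k u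
    simp [hs]

end

/-! ### Elimination schemes from tree decompositions -/

local notation "aOrd" => (15 : ℕ)
local notation "aOff" => (16 : ℕ)

section

variable {I : Type*} {T : SimpleGraph I} {N : ℕ} {o : ℕ → I}

/-- An enumeration of the nodes of a tree in which every node has at most one earlier neighbour. -/
structure IsTreeOrder (T : SimpleGraph I) (N : ℕ) (o : ℕ → I) : Prop where
  inj : ∀ i < N, ∀ j < N, o i = o j → i = j
  surj : ∀ x, ∃ i < N, o i = x
  uniq : ∀ h < N, ∀ i < h, ∀ j < h, T.Adj (o h) (o i) → T.Adj (o h) (o j) → i = j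

/-- In a connected set of nodes, every node except the first has an earlier neighbour. -/
theorem IsTreeOrder.exists_earlier (ho : IsTreeOrder T N o) {S : Set I}
    (hS : (T.induce S).Connected) {h a : ℕ} (hN : h < N) (hh : o h ∈ S) (hah : a < h)
    (ha : o a ∈ S) : ∃ i < h, o i ∈ S ∧ T.Adj (o h) (o i) := by
  set Par : ℕ → ℕ → Prop := fun x y => y < x ∧ T.Adj (o x) (o y) with hPar
  obtain ⟨p⟩ := hS.preconnected ⟨o h, hh⟩ ⟨o a, ha⟩
  -- leave the set of the nodes below `o h`
  obtain ⟨d, -, ⟨x, hx, hdx, hD⟩, hd2⟩ := p.exists_boundary_dart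
    {x | ∃ j < N, o j = x ∧ ReflTransGen Par j h} ⟨h, hN, rfl, .refl⟩ (by
      rintro ⟨j, hj, hja, hD⟩
      obtain rfl := ho.inj j hj a (by omega) hja
      have hle : ∀ i, ReflTransGen Par i h → h ≤ i := by
        intro i hi
        induction hi using ReflTransGen.head_induction_on with
        | refl => exact le_rfl
        | head h' _ ih => exact ih.trans h'.1.le
      have := hle _ hD
      omega)
  obtain ⟨y, hy, hdy⟩ := ho.surj d.snd
  have hadj : T.Adj (o x) (o y) := by
    have := d.adj
    rw [hdx, hdy]; exact this
  have hDy : ¬ ReflTransGen Par y h := fun h' => hd2 ⟨y, hy, hdy, h'⟩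
  have hyS : o y ∈ S := hdy ▸ d.snd.2
  rcases lt_trichotomy x y with hlt | rfl | hlt
  · exact (hDy (.head ⟨hlt, hadj.symm⟩ hD)).elim
  · exact (hadj.ne rfl).elim
  · rcases hD.cases_head with rfl | ⟨z, hz, hD'⟩
    · exact ⟨y, hlt, hyS, hadj⟩
    · obtain rfl := ho.uniq x hx y hlt z hz.1 hadj hz.2
      exact (hDy hD').elim

/-- If two connected sets of nodes meet and the second one starts no later than the first one, then
the second one contains the first node of the first one. -/
theorem IsTreeOrder.first_mem (ho : IsTreeOrder T N o) {S S' : Set I}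
    (hS : (T.induce S).Connected) (hS' : (T.induce S').Connected) {h a b : ℕ} (hN : h < N)
    (hh : o h ∈ S) (hh' : o h ∈ S') (ha : o a ∈ S) (hmin : ∀ i < N, o i ∈ S → a ≤ i)
    (hb : o b ∈ S') (hba : b ≤ a) : o a ∈ S' := by
  induction h using Nat.strong_induction_on with
  | _ h ih =>
    rcases (hmin h hN hh).eq_or_lt with rfl | hlt
    · exact hh'
    · obtain ⟨i, hi, hiS, hadj⟩ := ho.exists_earlier hS hN hh hlt ha
      obtain ⟨j, hj, hjS, hadj'⟩ := ho.exists_earlier hS' hN hh' (by omega) hb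
      obtain rfl := ho.uniq h hN i hi j hj hadj hadj'
      exact ih i hi (by omega) hiS hjS

end

section

variable {N : ℕ} {D : TreeDecomposition P.G (Fin N)} {o : ℕ → Fin N}
  {bags : Fin N → List (Fin P.n)} {vert : ℕ → Fin P.n} {bag : ℕ → Finset ℕ} {col : ℕ → Fin K}
  {c : ℕ} {s s' : State}

open Classical in
/-- The index of the first node whose bag contains `v`. -/
noncomputable def firstNode (D : TreeDecomposition P.G (Fin N)) (o : ℕ → Fin N) (v : Fin P.n) : ℕ :=
  if h : ∃ i, i < N ∧ v ∈ D.bag (o i) then Nat.find h else 0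

theorem firstNode_spec (ho : IsTreeOrder D.tree N o) (v : Fin P.n) :
    firstNode D o v < N ∧ v ∈ D.bag (o (firstNode D o v)) := by
  classical
  have h : ∃ i, i < N ∧ v ∈ D.bag (o i) := by
    obtain ⟨x, hx⟩ := D.exists_mem_bag v
    obtain ⟨i, hi, rfl⟩ := ho.surj x
    exact ⟨i, hi, hx⟩
  rw [firstNode, dif_pos h]
  exact Nat.find_spec h

theorem firstNode_le {v : Fin P.n} {i : ℕ} (hi : i < N) (hv : v ∈ D.bag (o i)) :
    firstNode D o v ≤ i := by
  classical
  have h : ∃ i, i < N ∧ v ∈ D.bag (o i) := ⟨i, hi, hv⟩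
  rw [firstNode, dif_pos h]
  exact Nat.find_min' h ⟨hi, hv⟩

theorem mem_bag_firstNode (ho : IsTreeOrder D.tree N o) {v w : Fin P.n} {h : ℕ} (hN : h < N)
    (hv : v ∈ D.bag (o h)) (hw : w ∈ D.bag (o h)) (hle : firstNode D o w ≤ firstNode D o v) :
    w ∈ D.bag (o (firstNode D o v)) :=
  ho.first_mem (S := {i | v ∈ D.bag i}) (S' := {i | w ∈ D.bag i}) (D.connected_nodes v)
    (D.connected_nodes w) hN hv hw (firstNode_spec ho v).2 (fun _ hi h => firstNode_le hi h)
    (firstNode_spec ho w).2 hle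

/-- The vertices are placed in the order of the first nodes whose bags contain them; the bag of a
position consists of the earlier members of this node and of the root. Those of the nodes before
`h`, and the vertices in `L`, have been placed. -/
structure PlacedUpTo (D : TreeDecomposition P.G (Fin N)) (o : ℕ → Fin N) (h : ℕ)
    (L : List (Fin P.n)) (c : ℕ) (vert : ℕ → Fin P.n) (bag : ℕ → Finset ℕ) : Prop where
  pos : 0 < c
  mem_bag : ∀ t < c, 0 < t → ∀ u, u ∈ bag t ↔
    u < t ∧ (u = 0 ∨ vert u ∈ D.bag (o (firstNode D o (vert t))))
  mono : ∀ t < c, ∀ u < t, 0 < u → firstNode D o (vert u) ≤ firstNode D o (vert t)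
  le : ∀ t < c, 0 < t → firstNode D o (vert t) ≤ h
  placed : ∀ v, (∃ t < c, vert t = v) ↔ v = P.root ∨ firstNode D o v < h ∨ v ∈ L

theorem PlacedUpTo.skip {h : ℕ} {L : List (Fin P.n)} (hp : PlacedUpTo D o h L c vert bag)
    {v : Fin P.n} (hv : ∃ t < c, vert t = v) : PlacedUpTo D o h (L ++ [v]) c vert bag := by
  refine ⟨hp.pos, hp.mem_bag, hp.mono, hp.le, fun w => ?_⟩
  rw [hp.placed w]
  constructor
  · rintro (h | h | h)
    · exact .inl h
    · exact .inr (.inl h)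
    · exact .inr (.inr (by simp [h]))
  · rintro (h | h | h)
    · exact .inl h
    · exact .inr (.inl h)
    · rcases List.mem_append.1 h with h | h
      · exact .inr (.inr h)
      · obtain rfl := List.mem_singleton.1 h
        exact (hp.placed w).1 hv

theorem PlacedUpTo.next (ho : IsTreeOrder D.tree N o) {h : ℕ} (hN : h < N) {L : List (Fin P.n)}
    (hp : PlacedUpTo D o h L c vert bag) (hL : ∀ v, v ∈ L ↔ v ∈ D.bag (o h)) :
    PlacedUpTo D o (h + 1) [] c vert bag := by
  refine ⟨hp.pos, hp.mem_bag, hp.mono, fun t ht h0 => (hp.le t ht h0).trans h.le_succ,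
    fun v => ?_⟩
  rw [hp.placed v]
  constructor
  · rintro (h' | h' | h')
    · exact .inl h'
    · exact .inr (.inl (by omega))
    · exact .inr (.inl (Nat.lt_succ_of_le (firstNode_le hN ((hL v).1 h'))))
  · rintro (h' | h' | h')
    · exact .inl h'
    · rcases Nat.lt_succ_iff_lt_or_eq.1 h' with h' | h'
      · exact .inr (.inl h')
      · exact .inr (.inr ((hL v).2 (h' ▸ (firstNode_spec ho v).2)))
    · simp at h'

theorem PlacedUpTo.count_eq (ho : IsTreeOrder D.tree N o) (h : PlacedUpTo D o N [] c vert bag)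
    (hi : IsPartial P.G P.root c vert bag col) : c = P.n := by
  classical
  have h1 : (range c).image vert = univ := by
    ext v
    simp only [mem_image, mem_range, mem_univ, iff_true]
    exact (h.placed v).2 (.inr (.inl (firstNode_spec ho v).1))
  have h2 : ((range c).image vert).card = c := by
    rw [card_image_of_injOn, Finset.card_range]
    intro t ht u hu
    exact hi.inj t (by simpa using ht) u (by simpa using hu)
  rw [← h2, h1]; simp

open Classical in
/-- The bag at which a member of the bag of the node `o h` is placed. -/
noncomputable def nextBag (D : TreeDecomposition P.G (Fin N)) (o : ℕ → Fin N) (h c : ℕ)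
    (vert : ℕ → Fin P.n) : Finset ℕ :=
  (range c).filter fun u => u = 0 ∨ vert u ∈ D.bag (o h)

theorem mem_nextBag {h u : ℕ} :
    u ∈ nextBag D o h c vert ↔ u < c ∧ (u = 0 ∨ vert u ∈ D.bag (o h)) := by
  simp [nextBag]

theorem nextBag_closed (ho : IsTreeOrder D.tree N o) {h : ℕ} (hN : h < N) {L : List (Fin P.n)}
    (hp : PlacedUpTo D o h L c vert bag) :
    ∀ u ∈ nextBag D o h c vert, ∀ w ∈ nextBag D o h c vert, w < u → w ∈ bag u := by
  intro u hu w hw hwu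
  rw [mem_nextBag] at hu hw
  rw [hp.mem_bag u hu.1 (by omega)]
  refine ⟨hwu, or_iff_not_imp_left.2 fun hw0 => ?_⟩
  exact mem_bag_firstNode ho hN (hu.2.resolve_left (by omega)) (hw.2.resolve_left hw0)
    (hp.mono u hu.1 w hwu (by omega))

theorem nextBag_adj (ho : IsTreeOrder D.tree N o) {h : ℕ} {L : List (Fin P.n)}
    (hp : PlacedUpTo D o h L c vert bag) {v : Fin P.n} (hv : firstNode D o v = h) :
    ∀ u < c, P.G.Adj v (vert u) → u ∈ nextBag D o h c vert := by
  intro u hu hadj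
  rw [mem_nextBag]
  refine ⟨hu, or_iff_not_imp_left.2 fun hu0 => ?_⟩
  obtain ⟨x, hx, hx'⟩ := D.exists_edge_bag _ _ hadj
  obtain ⟨i, hi, rfl⟩ := ho.surj x
  rw [← hv]
  exact mem_bag_firstNode ho hi hx hx' (by rw [hv]; exact hp.le u hu (by omega))

theorem nextBag_card {h k : ℕ} (hi : IsPartial P.G P.root c vert bag col)
    {v : Fin P.n} (hv : v ∈ D.bag (o h)) (hvp : ∀ t < c, vert t ≠ v) (hk : (D.bag (o h)).card ≤ k) :
    (nextBag D o h c vert).card < k + 1 := by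
  classical
  have h1 : ((nextBag D o h c vert).image vert).card = (nextBag D o h c vert).card := by
    refine card_image_of_injOn fun t ht u hu => ?_
    exact hi.inj t (mem_nextBag.1 ht).1 u (mem_nextBag.1 hu).1
  have h2 : (nextBag D o h c vert).image vert ⊆ insert P.root ((D.bag (o h)).erase v) := by
    intro w hw
    obtain ⟨u, hu, rfl⟩ := mem_image.1 hw
    obtain ⟨huc, hu⟩ := mem_nextBag.1 hu
    rcases hu with rfl | hu
    · rw [hi.root huc]; simp
    · exact mem_insert_of_mem (Finset.mem_erase.2 ⟨hvp u huc, hu⟩)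
  have h3 := (card_le_card h2).trans (card_insert_le _ _)
  have h4 := Finset.card_erase_add_one hv
  omega

theorem PlacedUpTo.place {h : ℕ} (hN : h < N) {L : List (Fin P.n)}
    (hp : PlacedUpTo D o h L c vert bag) {v : Fin P.n} (hv : v ∈ D.bag (o h))
    (hvp : ∀ t < c, vert t ≠ v) : firstNode D o v = h ∧
      PlacedUpTo D o h (L ++ [v]) (c + 1) (update vert c v)
        (update bag c (nextBag D o h c vert)) := by
  have hf : firstNode D o v = h := by
    refine le_antisymm (firstNode_le hN hv) (not_lt.1 fun hlt => ?_)
    obtain ⟨t, ht, htv⟩ := (hp.placed v).2 (.inr (.inl hlt))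
    exact hvp t ht htv
  have hne : ∀ t, t < c + 1 → t = c ∨ t < c := fun t ht => by omega
  refine ⟨hf, by omega, ?_, ?_, ?_, fun w => ?_⟩
  · intro t ht h0 u
    rcases hne t ht with rfl | ht
    · simp only [update_self, mem_nextBag, hf]
      refine and_congr_right fun hu => ?_
      rw [update_of_ne hu.ne]
    · simp only [update_of_ne ht.ne]
      rw [hp.mem_bag t ht h0]
      refine and_congr_right fun hu => ?_
      rw [update_of_ne (by omega)]
  · intro t ht u hu h0
    rcases hne t ht with rfl | ht
    · simp only [update_self, hf, update_of_ne hu.ne]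
      exact hp.le u hu h0
    · rw [update_of_ne ht.ne, update_of_ne (by omega)]
      exact hp.mono t ht u hu h0
  · intro t ht h0
    rcases hne t ht with rfl | ht
    · simp [hf]
    · rw [update_of_ne ht.ne]
      exact hp.le t ht h0
  · have : (∃ t < c + 1, update vert c v t = w) ↔ (∃ t < c, vert t = w) ∨ w = v := by
      constructor
      · rintro ⟨t, ht, h⟩
        rcases hne t ht with rfl | ht
        · right; simpa using h.symm
        · left; exact ⟨t, ht, by simpa [ht.ne] using h⟩
      · rintro (⟨t, ht, h⟩ | rfl)
        · exact ⟨t, by omega, by simpa [ht.ne] using h⟩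
        · exact ⟨c, by omega, by simp⟩
    rw [this, hp.placed w]
    simp only [List.mem_append, List.mem_singleton]
    tauto

/-! ### Elimination schemes from tree decompositions, on the machine -/

/-- The memory describes the decomposition, the order `o` of its nodes (in reverse) and the offsets
of the bags in the array `5`. -/
structure BagMem (o : ℕ → Fin N) (bags : Fin N → List (Fin P.n)) (s : State) : Prop where
  root : s.nreg 2 = P.root
  nodes : s.nreg 3 = N
  one : s.nreg ONE = 1
  zero : s.nreg ZERO = 0
  ord : ∀ h < N, s.narr aOrd (N - 1 - h) = o h
  size : ∀ i : Fin N, s.narr 4 i = (bags i).length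
  elem : ∀ i : Fin N, ∀ j (hj : j < (bags i).length),
    s.narr 5 (s.narr aOff i + j) = (bags i)[j]

theorem BagMem.of_agree (h : BagMem o bags s) {p : Program} (ha : Agree p s s')
    (hn : ∀ x < 6, ¬ p.wN x) (h4 : ¬ p.wNA 4) (h5 : ¬ p.wNA 5) (h15 : ¬ p.wNA aOrd)
    (h16 : ¬ p.wNA aOff) : BagMem o bags s' where
  root := by rw [ha.n _ (hn _ (by omega)), h.root]
  nodes := by rw [ha.n _ (hn _ (by omega)), h.nodes]
  one := by rw [ha.n _ (hn _ (by omega)), h.one]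
  zero := by rw [ha.n _ (hn _ (by omega)), h.zero]
  ord := by rw [ha.na _ h15]; exact h.ord
  size := by rw [ha.na _ h4]; exact h.size
  elem := by rw [ha.na _ h5, ha.na _ h16]; exact h.elem

/-- Collect the placed members of the bag with offset and size in the registers `32` and `33`. -/
def gatherBag (K : ℕ) : Program :=
  .seq (clearSlots K) (.seq (forUp 37 33 (.seq (block [.natAdd 23 32 37, .natLoad 23 5 23])
    (addSlot K))) (.seq (block [.natAdd 23 2 ZERO]) (addSlot K)))

/-- Place the `j`-th member of the bag, where register `34` holds `j`. -/
def placeMember (K : ℕ) : Program :=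
  .seq (block [.natAdd 35 32 34, .natLoad 35 5 35, .natLoad 36 aPos 35])
    (.ite (.natLt ZERO 36) skip (.seq (gatherBag K) (.seq (block [.natAdd 23 35 ZERO])
      (placeVertex K))))

/-- Place the members of the bag of the node whose index is in register `30`. -/
def placeNode (K : ℕ) : Program :=
  .seq (block [.natSub 31 3 30, .natSub 31 31 ONE, .natLoad 31 aOrd 31, .natLoad 32 aOff 31,
    .natLoad 33 4 31]) (forUp 34 33 (placeMember K))

theorem gatherBag_wN (x : ℕ) (h : (gatherBag K).wN x) :
    x = 6 ∨ x = 7 ∨ x = 23 ∨ x = 24 ∨ x = 25 ∨ x = 37 ∨ ∃ k, x = fam 5 k := by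
  simp only [gatherBag, Program.wN, forUp_wN, block_wN] at h
  rcases h with h | (h | h | h) | h | h
  · have := clearSlots_wN x h; tauto
  · tauto
  · simp at h; omega
  · have := addSlot_wN x h; tauto
  · simp at h; omega
  · have := addSlot_wN x h; tauto

theorem placeMember_wN (x : ℕ) (h : (placeMember K).wN x) :
    x = 6 ∨ x = 7 ∨ (22 ≤ x ∧ x < 27) ∨ (35 ≤ x ∧ x < 38) ∨ ∃ k, x = fam 5 k := by
  simp only [placeMember, Program.wN, block_wN, skip_wN] at h
  rcases h with h | h | h | h | h
  · simp at h; omega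
  · omega
  · rcases gatherBag_wN x h with h | h | h | h | h | h | ⟨k, h⟩
    any_goals omega
    exact .inr (.inr (.inr (.inr ⟨k, h⟩)))
  · simp at h; omega
  · have := placeVertex_wN x h; omega

@[simp] theorem gatherBag_wNA (x : ℕ) : ¬ (gatherBag K).wNA x := by simp [gatherBag]

theorem placeMember_wNA (x : ℕ) (h : (placeMember K).wNA x) :
    x = aVert ∨ x = aPos ∨ x = aCol ∨ ∃ k, x = fam fSlot k := by
  simp only [placeMember, Program.wNA, block_wNA, skip_wNA, gatherBag_wNA, false_or] at h
  rcases h with h | h | h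
  · simp at h
  · simp at h
  · exact placeVertex_wNA x h

@[simp] theorem placeMember_wRA (x : ℕ) : ¬ (placeMember K).wRA x := by
  simp [placeMember, gatherBag]

theorem placeNode_wN (x : ℕ) (h : (placeNode K).wN x) :
    x = 6 ∨ x = 7 ∨ (22 ≤ x ∧ x < 27) ∨ (31 ≤ x ∧ x < 38) ∨ ∃ k, x = fam 5 k := by
  simp only [placeNode, Program.wN, forUp_wN, block_wN] at h
  rcases h with h | h | h
  · simp at h; omega
  · omega
  · have := placeMember_wN x h; grind

theorem placeNode_wNA (x : ℕ) (h : (placeNode K).wNA x) :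
    x = aVert ∨ x = aPos ∨ x = aCol ∨ ∃ k, x = fam fSlot k := by
  simp only [placeNode, Program.wNA, forUp_wNA, block_wNA] at h
  rcases h with h | h
  · simp at h
  · exact placeMember_wNA x h

@[simp] theorem placeNode_wRA (x : ℕ) : ¬ (placeNode K).wRA x := by
  simp [placeNode]

theorem gatherBag_runs (hB : BagMem o bags s) (hbl : IsBagList D bags)
    (ho : IsTreeOrder D.tree N o) {h : ℕ} (hN : h < N) {L : List (Fin P.n)}
    (hm : PartialMem c vert bag col s) (hp : PlacedUpTo D o h L c vert bag)
    (h32 : s.nreg 32 = s.narr aOff (o h)) (h33 : s.nreg 33 = (bags (o h)).length) :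
    Runs (gatherBag K) s ((bags (o h)).length * (3 * K + 12) + 4 * K + 12)
      (SlotRegs col (nextBag D o h c vert)) := by
  classical
  have hcl := nextBag_closed ho hN hp
  have hinj : ∀ t ∈ nextBag D o h c vert, ∀ u ∈ nextBag D o h c vert, col u = col t → u = t :=
    fun t ht u hu hc => hm.isPartial.col_inj (fun u hu => (mem_nextBag.1 hu).1) hcl hu ht hc
  set l := bags (o h) with hl
  have hlm : ∀ v, v ∈ l ↔ v ∈ D.bag (o h) := fun v => by
    rw [← (hbl (o h)).2, List.mem_toFinset]
  refine (Runs.seq (t₁ := K + 1) (t₂ := (l.length * ((3 * K + 10) + 2) + 2) + (2 + (3 * K + 7)))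
    (Runs.of_run_le clearSlots_loopFree clearSlots_len.le fun ha₁ => ?_)).mono
      (by ring_nf; omega) fun _ _ h => h
  have hR₁ := clearSlots_run (K := K) (col := col) s
  set s₁ := (clearSlots K).run s with hs₁
  have hw₁ : ∀ x < 64, x ≠ 6 → ¬ (clearSlots K).wN x := fun x hx h6 h => by
    rcases clearSlots_wN x h with h | ⟨k, h⟩
    · exact h6 h
    · have := le_fam 5 k; omega
  have hB₁ := hB.of_agree ha₁ (fun x hx => hw₁ x (by omega) (by omega)) (by simp) (by simp)
    (by simp) (by simp)
  have hm₁ := hm.of_agree ha₁ (hw₁ _ (by simp) (by simp)) (by simp) (by simp) (by simp) (by simp)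
  have h32₁ : s₁.nreg 32 = s₁.narr aOff (o h) := by
    rw [ha₁.n _ (hw₁ _ (by simp) (by simp)), ha₁.na _ (by simp), h32]
  have h33₁ : s₁.nreg 33 = l.length := by rw [ha₁.n _ (hw₁ _ (by simp) (by simp)), h33]
  have hbody : ∀ x, x < 64 ∧ x ≠ 6 ∧ x ≠ 7 ∧ ¬ (22 < x ∧ x < 26) →
      ¬ (Program.seq (block [.natAdd 23 32 37, .natLoad 23 5 23]) (addSlot K)).wN x := by
    intro x hx h
    simp only [Program.wN, block_wN] at h
    rcases h with h | h
    · simp at h; omega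
    · rcases addSlot_wN x h with h | h | h | h | ⟨k, h⟩
      any_goals omega
      have := le_fam 5 k; omega
  have hloop := Runs.forUp (i := 37) (b := 33)
    (p := .seq (block [.natAdd 23 32 37, .natLoad 23 5 23]) (addSlot K)) (s := s₁) (3 * K + 10)
    (fun j => SlotRegs col ((range c).filter fun u => vert u ∈ l.take j))
    (hbody _ (by simp)) (hbody _ (by simp)) (hbody _ (by simp)) (by decide) (by decide)
    hB₁.one (by
      simp only [List.take_zero, List.not_mem_nil, Finset.filter_false]
      exact hR₁.of_eq (by simp)) ?_
  · rw [h33₁] at hloop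
    refine Runs.seq (hloop.mono le_rfl fun s₂ ha₂ hR₂ _ => ?_)
    have hw₂ : ∀ x, x < 64 ∧ x ≠ 6 ∧ x ≠ 7 ∧ ¬ (22 < x ∧ x < 26) ∧ x ≠ 37 →
        s₂.nreg x = s₁.nreg x := fun x hx => ha₂.n x (by
      rw [forUp_wN]; rintro (h | h)
      · omega
      · exact hbody x (by omega) h)
    have hm₂ := hm₁.of_eq (hw₂ _ (by simp))
      (ha₂.na _ (by simp)) (ha₂.na _ (by simp)) (ha₂.na _ (by simp)) fun k => ha₂.na _ (by simp)
    have g : ∀ x < 6, s₂.nreg x = s₁.nreg x := fun x hx => hw₂ x (by omega)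
    rw [List.take_length] at hR₂
    refine Runs.of_run_le (by simp [addSlot_loopFree]) (by
      have := addSlot_len (K := K); simp; omega) ?_
    set s₃ := (block [.natAdd 23 2 ZERO]).run s₂ with hs₃
    have hR₃ : SlotRegs col ((range c).filter fun u => vert u ∈ l) s₃ :=
      hR₂.of_eq (by simp [hs₃])
    have hm₃ : PartialMem c vert bag col s₃ := hm₂.of_eq (by simp [hs₃])
      (by simp [hs₃]) (by simp [hs₃]) (by simp [hs₃])
      (by simp [hs₃])
    have h0mem : 0 ∈ nextBag D o h c vert := mem_nextBag.2 ⟨hp.pos, .inl rfl⟩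
    have hsub : ∀ u ∈ (range c).filter (fun u => vert u ∈ l), u ∈ nextBag D o h c vert := by
      intro u hu
      simp only [mem_filter, mem_range, hlm] at hu
      exact mem_nextBag.2 ⟨hu.1, .inr hu.2⟩
    have := addSlot_run_placed hm₃ (by simp [hs₃, g, hB₁.zero])
      (by simp [hs₃, g, hB₁.one]) hp.pos
      (by rw [hm₃.isPartial.root hp.pos]; simp [hs₃, g, hB₁.zero, hB₁.root]) hR₃
      (fun u hu hc => hinj 0 h0mem u (hsub u hu) hc)
    have heq : insert 0 ((range c).filter fun u => vert u ∈ l) = nextBag D o h c vert := by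
      ext u
      simp only [mem_insert, mem_filter, mem_range, hlm, mem_nextBag]
      constructor
      · rintro (rfl | hu)
        · exact ⟨hp.pos, .inl rfl⟩
        · exact ⟨hu.1, .inr hu.2⟩
      · rintro ⟨huc, rfl | hu⟩
        · exact .inl rfl
        · exact .inr ⟨huc, hu⟩
    rw [heq] at this
    exact this
  · intro j s₂ hj hj37 ha₂ hR₂
    rw [h33₁] at hj
    have hw₂ : ∀ x, x < 64 ∧ x ≠ 6 ∧ x ≠ 7 ∧ ¬ (22 < x ∧ x < 26) ∧ x ≠ 37 →
        s₂.nreg x = s₁.nreg x := fun x hx => ha₂.n x (by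
      rw [forUp_wN]; rintro (h | h)
      · omega
      · exact hbody x (by omega) h)
    have hm₂ := hm₁.of_eq (hw₂ _ (by simp))
      (ha₂.na _ (by simp)) (ha₂.na _ (by simp)) (ha₂.na _ (by simp)) fun k => ha₂.na _ (by simp)
    have g : ∀ x < 6, s₂.nreg x = s₁.nreg x := fun x hx => hw₂ x (by omega)
    have g32 : s₂.nreg 32 = s₁.narr aOff (o h) := by
      rw [hw₂ _ (by simp), h32₁]
    have gna : s₂.narr = s₁.narr := funext fun x => ha₂.na x (by simp)
    refine Runs.of_run_le (by simp [addSlot_loopFree]) (by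
      have := addSlot_len (K := K); simp; omega) ?_
    rw [Program.run]
    set s₃ := (block [.natAdd 23 32 37, .natLoad 23 5 23]).run s₂ with hs₃
    have h23 : s₃.nreg 23 = l[j] := by
      have := hB₁.elem (o h) j hj
      simp [hs₃, g32, hj37, gna, this, hl]
    have hR₃ : SlotRegs col ((range c).filter fun u => vert u ∈ l.take j) s₃ :=
      hR₂.of_eq (by simp [hs₃])
    have hm₃ : PartialMem c vert bag col s₃ := hm₂.of_eq (by simp [hs₃])
      (by simp [hs₃]) (by simp [hs₃]) (by simp [hs₃])
      (by simp [hs₃])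
    have hsub : ∀ u ∈ (range c).filter (fun u => vert u ∈ l.take j),
        u ∈ nextBag D o h c vert := by
      intro u hu
      simp only [mem_filter, mem_range] at hu
      exact mem_nextBag.2 ⟨hu.1, .inr ((hlm _).1 (List.mem_of_mem_take hu.2))⟩
    have hz₃ : s₃.nreg ZERO = 0 := by simp [hs₃, g, hB₁.zero]
    have ho₃ : s₃.nreg ONE = 1 := by simp [hs₃, g, hB₁.one]
    have htake : l.take (j + 1) = l.take j ++ [l[j]] := by
      rw [List.take_add_one, List.getElem?_eq_getElem hj]; rfl
    refine SlotRegs.of_eq (s := (addSlot K).run s₃) ?_ (by simp)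
    rcases hm₃.pos_cases l[j] with ⟨h1, h2⟩ | ⟨t, ht, htv, h1⟩
    · have heq : ((range c).filter fun u => vert u ∈ l.take (j + 1)) =
          (range c).filter fun u => vert u ∈ l.take j := by
        refine Finset.filter_congr fun u hu => ?_
        rw [htake, List.mem_append, List.mem_singleton]
        exact or_iff_left (h2 u (by simpa using hu))
      rw [heq]
      exact addSlot_run_unplaced hz₃ (by rw [h23]; exact h1) hR₃
    · have heq : ((range c).filter fun u => vert u ∈ l.take (j + 1)) =
          insert t ((range c).filter fun u => vert u ∈ l.take j) := by
        ext u
        rw [htake]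
        simp only [mem_filter, mem_range, List.mem_append, List.mem_singleton,
          mem_insert]
        constructor
        · rintro ⟨hu, h | h⟩
          · exact .inr ⟨hu, h⟩
          · exact .inl (hm₃.isPartial.inj u hu t ht (h.trans htv.symm))
        · rintro (rfl | ⟨hu, h⟩)
          · exact ⟨ht, .inr htv⟩
          · exact ⟨hu, .inl h⟩
      rw [heq]
      have htm : t ∈ nextBag D o h c vert := mem_nextBag.2 ⟨ht, .inr (by
        rw [htv]; exact (hlm _).1 (List.getElem_mem _))⟩
      exact addSlot_run_placed hm₃ hz₃ ho₃ ht (by rw [h23, htv]) hR₃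
        fun u hu hc => hinj t htm u (hsub u hu) hc

/-- The scheme is built up to the members `L` of the node `o h`; the root has colour `k₀`. -/
def Built (D : TreeDecomposition P.G (Fin N)) (o : ℕ → Fin N) (k₀ : Fin K) (h : ℕ)
    (L : List (Fin P.n)) (s : State) : Prop :=
  ∃ c vert bag, ∃ col : ℕ → Fin K, PartialMem c vert bag col s ∧ PlacedUpTo D o h L c vert bag ∧
    col 0 = k₀

theorem Built.of_eq {k₀ : Fin K} {h : ℕ} {L : List (Fin P.n)} (hb : Built D o k₀ h L s)
    (h22 : s'.nreg 22 = s.nreg 22) (hna : s'.narr = s.narr) : Built D o k₀ h L s' :=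
  have ⟨c, vert, bag, col, h1, h2⟩ := hb
  ⟨c, vert, bag, col, h1.of_eq h22 (by rw [hna]) (by rw [hna]) (by rw [hna]) (by simp [hna]), h2⟩

theorem placeMember_runs (hB : BagMem o bags s) (hbl : IsBagList D bags)
    (ho : IsTreeOrder D.tree N o) {h j k : ℕ} (hN : h < N) (hj : j < (bags (o h)).length)
    (hk : (bags (o h)).length ≤ k) {k₀ : Fin (k + 1)}
    (hb : Built D o k₀ h ((bags (o h)).take j) s)
    (h32 : s.nreg 32 = s.narr aOff (o h)) (h33 : s.nreg 33 = (bags (o h)).length)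
    (h34 : s.nreg 34 = j) :
    Runs (placeMember (k + 1)) s (k * (3 * k + 15) + 7 * k + 40)
      (Built D o k₀ h ((bags (o h)).take (j + 1))) := by
  obtain ⟨c, vert, bag, col, hm, hp, h0⟩ := hb
  set l := bags (o h) with hl
  have htake : l.take (j + 1) = l.take j ++ [l[j]] := by
    rw [List.take_add_one, List.getElem?_eq_getElem hj]; rfl
  have hcard : (D.bag (o h)).card = l.length := by
    rw [← (hbl (o h)).2, List.toFinset_card_of_nodup (hbl (o h)).1]
  have hlj : l[j] ∈ D.bag (o h) := by
    rw [← (hbl (o h)).2, List.mem_toFinset]; exact List.getElem_mem _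
  refine (Runs.seq (t₁ := 4) (t₂ := (k * (3 * k + 15) + 4 * k + 16 + (2 + (3 * k + 9))) + 1)
    (Runs.of_run_le (by simp) (by simp) fun ha₁ => ?_)).mono (by omega) fun _ _ h => h
  set s₁ := (block [.natAdd 35 32 34, .natLoad 35 5 35, .natLoad 36 aPos 35]).run s with hs₁
  have e35 : s₁.nreg 35 = l[j] := by
    have := hB.elem (o h) j hj
    simp [hs₁, h32, h34, this, hl]
  have e36 : s₁.nreg 36 = s.narr aPos l[j] := by
    have := hB.elem (o h) j hj
    simp [hs₁, h32, h34, this, hl]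
  have hna₁ : s₁.narr = s.narr := by simp [hs₁]
  have hB₁ := hB.of_agree ha₁ (by simp; omega) (by simp) (by simp) (by simp) (by simp)
  have hm₁ := hm.of_agree ha₁ (by simp) (by simp) (by simp) (by simp) (by simp)
  rw [htake]
  refine Runs.ite (fun ht => ?_) fun ht => ?_
  · refine Runs.of_run_le (by simp) (by simp; omega) ?_
    refine ⟨c, vert, bag, col, hm₁.of_eq (by simp) (by simp) (by simp) (by simp) (by simp), ?_, h0⟩
    rcases hm.pos_cases l[j] with ⟨h1, h2⟩ | ⟨t, ht, htv, -⟩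
    · simp [hB₁.zero, e36, h1] at ht
    · exact hp.skip ⟨t, ht, htv⟩
  · have hpos : s.narr aPos l[j] = 0 := by
      simp [hB₁.zero, e36] at ht; exact ht
    have hvp := hm.lt hpos
    refine Runs.seq ((gatherBag_runs (K := k + 1) hB₁ hbl ho hN hm₁ hp
      (by rw [hna₁, ← h32]; simp [hs₁]) (by rw [← h33]; simp [hs₁])).mono
        ?_ fun s₂ ha₂ hR₂ _ => ?_)
    · have := Nat.mul_le_mul_right (3 * (k + 1) + 12) hk
      rw [← hl]
      ring_nf at this ⊢
      omega
    have hw₂ : ∀ x, x < 64 ∧ x ≠ 6 ∧ x ≠ 7 ∧ ¬ (22 < x ∧ x < 26) ∧ x ≠ 37 →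
        s₂.nreg x = s₁.nreg x := fun x hx => ha₂.n x fun h => by
      rcases gatherBag_wN x h with h | h | h | h | h | h | ⟨k, h⟩
      any_goals omega
      have := le_fam 5 k; omega
    have hm₂ := hm₁.of_eq (hw₂ _ (by simp))
      (ha₂.na _ (by simp)) (ha₂.na _ (by simp)) (ha₂.na _ (by simp)) fun k => ha₂.na _ (by simp)
    have g : ∀ x < 6, s₂.nreg x = s₁.nreg x := fun x hx => hw₂ x (by omega)
    refine Runs.of_run_le (by simp [placeVertex_loopFree]) (by
      have := placeVertex_len (K := k + 1); simp; omega) ?_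
    rw [Program.run]
    set s₃ := (block [.natAdd 23 35 ZERO]).run s₂ with hs₃
    have hm₃ : PartialMem c vert bag col s₃ := hm₂.of_eq (by simp [hs₃])
      (by simp [hs₃]) (by simp [hs₃]) (by simp [hs₃])
      (by simp [hs₃])
    obtain ⟨hf, hp'⟩ := hp.place hN hlj hvp
    obtain ⟨q, hq⟩ := placeVertex_run hm₃ hp.pos (by simp [hs₃, g, hB₁.zero])
      (by simp [hs₃, g, hB₁.one]) (v := l[j])
      (by simp [hs₃, g, hB₁.zero, hw₂ 35, e35]) hvp
      (B := nextBag D o h c vert) (hR₂.of_eq (by simp [hs₃]))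
      (nextBag_card hm.isPartial hlj hvp (by omega)) (fun u hu => (mem_nextBag.1 hu).1)
      (mem_nextBag.2 ⟨hp.pos, .inl rfl⟩) (nextBag_adj ho hp hf) (nextBag_closed ho hN hp)
    exact ⟨_, _, _, _, hq, hp', by rw [update_of_ne hp.pos.ne, h0]⟩

theorem placeNode_runs (hB : BagMem o bags s) (hbl : IsBagList D bags)
    (ho : IsTreeOrder D.tree N o) {h k : ℕ} (hN : h < N)
    (hk : (bags (o h)).length ≤ k) {k₀ : Fin (k + 1)} (hb : Built D o k₀ h [] s)
    (h30 : s.nreg 30 = h) :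
    Runs (placeNode (k + 1)) s (k * (k * (3 * k + 15) + 7 * k + 42) + 8)
      (Built D o k₀ (h + 1) []) := by
  set l := bags (o h) with hl
  refine (Runs.seq (t₁ := 6) (t₂ := k * (k * (3 * k + 15) + 7 * k + 42) + 2)
    (Runs.of_run_le (by simp) (by simp) fun ha₁ => ?_)).mono (by omega) fun _ _ h => h
  set s₁ := (block [.natSub 31 3 30, .natSub 31 31 ONE, .natLoad 31 aOrd 31, .natLoad 32 aOff 31,
    .natLoad 33 4 31]).run s with hs₁
  have hord : s.narr aOrd (N - h - 1) = o h := by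
    rw [show N - h - 1 = N - 1 - h by omega]; exact hB.ord h hN
  have e32 : s₁.nreg 32 = s.narr aOff (o h) := by
    simp [hs₁, hB.nodes, h30, hB.one, hord]
  have e33 : s₁.nreg 33 = l.length := by
    simp [hs₁, hB.nodes, h30, hB.one, hord, hB.size, hl]
  have hna₁ : s₁.narr = s.narr := by simp [hs₁]
  have hB₁ := hB.of_agree ha₁ (by simp; omega) (by simp) (by simp) (by simp) (by simp)
  have hb₁ : Built D o k₀ h [] s₁ := hb.of_eq (by simp [hs₁]) hna₁
  have hw : ∀ x, x < 64 ∧ x ≠ 6 ∧ x ≠ 7 ∧ ¬ (22 ≤ x ∧ x < 27) ∧ ¬ (35 ≤ x ∧ x < 38) →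
      ¬ (placeMember (k + 1)).wN x := by
    intro x hx h
    rcases placeMember_wN x h with h | h | h | h | ⟨k, h⟩
    any_goals omega
    have := le_fam 5 k; omega
  have hwa : ∀ x, x < 64 ∧ x ≠ aVert ∧ x ≠ aPos ∧ x ≠ aCol → ¬ (placeMember (k + 1)).wNA x := by
    intro x hx h
    rcases placeMember_wNA x h with h | h | h | ⟨k, h⟩
    any_goals omega
    have := le_fam fSlot k; omega
  have := Runs.forUp (i := 34) (b := 33) (p := placeMember (k + 1)) (s := s₁)
    (k * (3 * k + 15) + 7 * k + 40) (fun j => Built D o k₀ h (l.take j))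
    (hw _ (by simp)) (hw _ (by simp)) (hw _ (by simp))
    (by decide) (by decide) hB₁.one
    (by rw [List.take_zero]; exact hb₁.of_eq (by simp) (by simp)) ?_
  · rw [e33] at this
    refine this.mono ?_ fun s' _ hs' => ?_
    · have := Nat.mul_le_mul_right (k * (3 * k + 15) + 7 * k + 40 + 2) hk
      exact Nat.add_le_add_right this 2
    · rw [List.take_length] at hs'
      obtain ⟨c, vert, bag, col, hm, hp, h0⟩ := hs'
      refine ⟨c, vert, bag, col, hm, hp.next ho hN fun v => ?_, h0⟩
      rw [← (hbl (o h)).2, List.mem_toFinset]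
  · intro j s' hj hj34 ha' hb'
    rw [e33] at hj
    have hf : ∀ x, x < 64 ∧ x ≠ 6 ∧ x ≠ 7 ∧ ¬ (22 ≤ x ∧ x < 27) ∧ ¬ (34 ≤ x ∧ x < 38) →
        s'.nreg x = s₁.nreg x := fun x hx => ha'.n x (by
      rw [forUp_wN]; rintro (h | h)
      · omega
      · exact hw x (by omega) h)
    have hfa : ∀ x, x < 64 ∧ x ≠ aVert ∧ x ≠ aPos ∧ x ≠ aCol →
        ¬ (forUp 34 33 (placeMember (k + 1))).wNA x := fun x hx => by
      rw [forUp_wNA]; exact hwa x hx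
    have hB' := hB₁.of_agree ha' (fun x hx => by
        rw [forUp_wN]; rintro (h | h)
        · omega
        · exact hw x (by omega) h)
      (hfa _ (by simp)) (hfa _ (by simp)) (hfa _ (by simp)) (hfa _ (by simp))
    refine (placeMember_runs hB' hbl ho hN hj hk hb' ?_ ?_ hj34).mono le_rfl
      fun s'' _ hb'' => hb''.of_eq (by simp) (by simp)
    · rw [hf _ (by simp), e32,
        ha'.na _ (hfa _ (by simp)), hna₁]
    · rw [hf _ (by simp), e33]

/-- Build the elimination scheme from the ordered decomposition. -/
theorem placeNodes_runs (hB : BagMem o bags s) (hbl : IsBagList D bags)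
    (ho : IsTreeOrder D.tree N o) {k : ℕ} (hk : ∀ i, (bags i).length ≤ k)
    {k₀ : Fin (k + 1)} (hb : Built D o k₀ 0 [] s) :
    Runs (forUp 30 3 (placeNode (k + 1))) s (N * (k * (k * (3 * k + 15) + 7 * k + 42) + 10) + 2)
      fun s' => ∃ S : Scheme P.G P.root (k + 1), S.col 0 = k₀ ∧ SchemeMem S s' := by
  have hw : ∀ x, x < 64 ∧ x ≠ 6 ∧ x ≠ 7 ∧ ¬ (22 ≤ x ∧ x < 27) ∧ ¬ (31 ≤ x ∧ x < 38) →
      ¬ (placeNode (k + 1)).wN x := by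
    intro x hx h
    rcases placeNode_wN x h with h | h | h | h | ⟨k, h⟩
    any_goals omega
    have := le_fam 5 k; omega
  have hwa : ∀ x, x < 64 ∧ x ≠ aVert ∧ x ≠ aPos ∧ x ≠ aCol →
      ¬ (forUp 30 3 (placeNode (k + 1))).wNA x := by
    intro x hx h
    rw [forUp_wNA] at h
    rcases placeNode_wNA x h with h | h | h | ⟨k, h⟩
    any_goals omega
    have := le_fam fSlot k; omega
  have := Runs.forUp (i := 30) (b := 3) (p := placeNode (k + 1)) (s := s)
    (k * (k * (3 * k + 15) + 7 * k + 42) + 8) (fun h => Built D o k₀ h [])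
    (hw _ (by simp)) (hw _ (by simp)) (hw _ (by simp))
    (by decide) (by decide) hB.one (hb.of_eq (by simp) (by simp)) ?_
  · rw [hB.nodes] at this
    refine this.mono le_rfl fun s' _ ⟨c, vert, bag, col, hm, hp, h0⟩ => ?_
    obtain rfl := hp.count_eq ho hm.isPartial
    obtain ⟨S, hS, hmem⟩ := hm.schemeMem
    exact ⟨S, by rw [hS, h0], hmem⟩
  · intro h s' hh hh30 ha' hb'
    rw [hB.nodes] at hh
    have hB' := hB.of_agree ha' (fun x hx => by
        rw [forUp_wN]; rintro (h | h)
        · omega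
        · exact hw x (by omega) h)
      (hwa _ (by simp)) (hwa _ (by simp)) (hwa _ (by simp)) (hwa _ (by simp))
    exact (placeNode_runs hB' hbl ho hh (hk _) hb' hh30).mono le_rfl
      fun s'' _ hb'' => hb''.of_eq (by simp) (by simp)

theorem built_zero {k₀ : Fin K}
    (hm : PartialMem (P := P) 1 (fun _ => P.root) (fun _ => ∅) (fun _ => k₀) s) :
    Built D o k₀ 0 [] s := by
  refine ⟨_, _, _, _, hm, ⟨by omega, fun t ht h0 => by omega, fun t ht u hu h0 => by omega,
    fun t ht h0 => by omega, fun v => ?_⟩, rfl⟩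
  simp only [Nat.not_lt_zero, List.not_mem_nil, or_false]
  exact ⟨fun ⟨_, _, h⟩ => h.symm, fun h => ⟨0, by omega, h.symm⟩⟩

end

/-! ### Ordering the nodes of a tree -/

theorem _root_.SimpleGraph.IsTree.exists_leaf {I : Type*} {T : SimpleGraph I} (hT : T.IsTree)
    {A : Finset I} (hA : A.Nonempty) :
    ∃ v ∈ A, ∀ w ∈ A, ∀ w' ∈ A, T.Adj v w → T.Adj v w' → w = w' := by
  -- a member of `A` that is farthest from a fixed node
  obtain ⟨ρ, -⟩ := id hA
  obtain ⟨v, hv, hmax⟩ := A.exists_max_image (fun v => T.dist ρ v) hA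
  obtain ⟨p, hp, hp'⟩ := (hT.connected ρ v).exists_path_of_dist
  have key : ∀ w ∈ A, T.Adj v w → w = p.penultimate := by
    intro w hw hadj
    classical
    obtain ⟨q, hq, hq'⟩ := (hT.connected ρ w).exists_path_of_dist
    have hne := hT.dist_ne_of_adj ρ hadj
    have hle := hmax w hw
    refine hT.isAcyclic.eq_penultimate_of_adj_end hp hadj
      (hT.isAcyclic.mem_support_of_ne_mem_support_of_adj_of_isPath hp hq hadj fun hvq => ?_)
    have h1 := SimpleGraph.dist_le (q.takeUntil v hvq)
    have h2 := q.length_takeUntil_le_length hvq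
    omega
  exact ⟨v, hv, fun w hw w' hw' h h' => (key w hw h).trans (key w' hw' h').symm⟩

section

local notation "aDeg" => (13 : ℕ)
local notation "aSum" => (14 : ℕ)

variable {N : ℕ} {T : SimpleGraph (Fin N)} {s s' : State}

/-- The arrays `aDeg` and `aSum` hold the numbers and the sums of the neighbours in `nb v`, for the
nodes `v` in `A`. -/
def NbMem (A : Set (Fin N)) (nb : Fin N → Finset (Fin N)) (s : State) : Prop :=
  ∀ v ∈ A, s.narr aDeg v = (nb v).card ∧ s.narr aSum v = ∑ w ∈ nb v, (w : ℕ)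

/-- The list `q` is stored in the array `aOrd`, and its length in register `35`. -/
def QueueMem (q : List (Fin N)) (s : State) : Prop :=
  s.nreg 35 = q.length ∧ ∀ i (h : i < q.length), s.narr aOrd i = q[i]

theorem QueueMem.push {q : List (Fin N)} (h : QueueMem q s) {v : Fin N}
    (h35 : s'.nreg 35 = q.length + 1)
    (ha : ∀ i, s'.narr aOrd i = if i = q.length then (v : ℕ) else s.narr aOrd i) :
    QueueMem (q ++ [v]) s' := by
  refine ⟨by simp [h35], fun i hi => ?_⟩
  rw [ha]
  split_ifs with hiq
  · subst hiq; simp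
  · have : i < q.length := by simp at hi; omega
    rw [h.2 i this, List.getElem_append_left this]

/-- Count the neighbours. -/
def countNeighbours : Program :=
  .seq (block [.natSub 31 3 ONE]) (forUp 30 31 (block [.natLoad 32 2 30, .natLoad 33 3 30,
    .natLoad 34 aDeg 32, .natAdd 34 34 ONE, .natStore aDeg 32 34,
    .natLoad 34 aSum 32, .natAdd 34 34 33, .natStore aSum 32 34,
    .natLoad 34 aDeg 33, .natAdd 34 34 ONE, .natStore aDeg 33 34,
    .natLoad 34 aSum 33, .natAdd 34 34 32, .natStore aSum 33 34]))

open Classical in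
/-- The neighbours along the first `j` edges of a list. -/
noncomputable def nbFirst (ts : List T.Dart) (j : ℕ) (v : Fin N) : Finset (Fin N) :=
  univ.filter fun w => s(v, w) ∈ (ts.take j).map fun d => d.edge

theorem length_edgeList {ts : List T.Dart} (hT : T.IsTree) (hts : IsEdgeList ts) :
    ts.length = N - 1 := by
  classical
  have h1 := hT.card_edgeFinset
  have h2 : (ts.map fun d => d.edge).toFinset = T.edgeFinset := by
    ext e
    simp only [List.mem_toFinset, List.mem_map, SimpleGraph.mem_edgeFinset]
    exact ⟨fun ⟨d, _, h⟩ => h ▸ d.edge_mem, fun h => hts.2 e h⟩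
  rw [← h2, List.toFinset_card_of_nodup hts.1] at h1
  simp at h1
  omega

theorem countNeighbours_runs {ts : List T.Dart} (hT : T.IsTree) (hts : IsEdgeList ts)
    (h3 : s.nreg 3 = N) (h1 : s.nreg ONE = 1)
    (hfst : ∀ i (h : i < ts.length), s.narr 2 i = (ts[i].fst : ℕ))
    (hsnd : ∀ i (h : i < ts.length), s.narr 3 i = (ts[i].snd : ℕ))
    (hdeg : ∀ v, s.narr aDeg v = 0) (hsum : ∀ v, s.narr aSum v = 0) :
    Runs countNeighbours s (N * 17 + 4)
      (NbMem Set.univ (nbFirst ts ts.length)) := by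
  have hlen := length_edgeList hT hts
  refine (Runs.seq (t₁ := 2) (t₂ := (N - 1) * 17 + 2) (Runs.of_run_le (by simp) (by simp)
    fun ha₁ => ?_)).mono (by omega) fun _ _ h => h
  set s₁ := (block [.natSub 31 3 ONE]).run s with hs₁
  have h31 : s₁.nreg 31 = N - 1 := by simp [hs₁, h3, h1]
  have hna : s₁.narr = s.narr := by simp [hs₁]
  have := Runs.forUp (i := 30) (b := 31) (p := block [.natLoad 32 2 30, .natLoad 33 3 30,
    .natLoad 34 aDeg 32, .natAdd 34 34 ONE, .natStore aDeg 32 34,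
    .natLoad 34 aSum 32, .natAdd 34 34 33, .natStore aSum 32 34,
    .natLoad 34 aDeg 33, .natAdd 34 34 ONE, .natStore aDeg 33 34,
    .natLoad 34 aSum 33, .natAdd 34 34 32, .natStore aSum 33 34]) (s := s₁) 15
    (fun j => NbMem Set.univ (nbFirst ts j)) (by simp) (by simp) (by simp) (by decide) (by decide)
    (by rw [ha₁.n _ (by simp), h1])
    (by
      intro v _
      simp [nbFirst, hna, hdeg, hsum]) ?_
  · rw [h31, ← hlen] at this
    rw [← hlen]; exact this
  intro j s₂ hj hj30 ha₂ hI
  rw [h31, ← hlen] at hj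
  refine Runs.of_run_le (by simp) (by simp) ?_
  set x := ts[j].fst with hx
  set y := ts[j].snd with hy
  have hxy : T.Adj x y := ts[j].adj
  have hne : (x : ℕ) ≠ y := fun h => hxy.ne (Fin.ext h)
  have e2 : s₂.narr 2 j = x := by rw [ha₂.na _ (by simp), hna]; exact hfst j hj
  have e3 : s₂.narr 3 j = y := by rw [ha₂.na _ (by simp), hna]; exact hsnd j hj
  have e4 : s₂.nreg ONE = 1 := by rw [ha₂.n _ (by simp), ha₁.n _ (by simp), h1]
  have hedge : ts[j].edge = s(x, y) := by simp [hx, hy, SimpleGraph.Dart.edge]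
  have htake : (ts.take (j + 1)).map (fun d => d.edge) =
      (ts.take j).map (fun d => d.edge) ++ [s(x, y)] := by
    rw [List.take_add_one, List.getElem?_eq_getElem hj, List.map_append, ← hedge]; rfl
  have hnew : s(x, y) ∉ (ts.take j).map fun d => d.edge := by
    intro hmem
    have hnd : ((ts.take (j + 1)).map fun d => d.edge).Nodup :=
      hts.1.sublist ((List.take_sublist _ _).map _)
    rw [htake, List.nodup_append] at hnd
    exact hnd.2.2 _ hmem _ (by simp) rfl
  have hnbx : nbFirst ts (j + 1) x = insert y (nbFirst ts j x) := by
    ext w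
    simp only [nbFirst, htake, mem_filter, mem_univ, true_and, List.mem_append,
      List.mem_singleton, mem_insert, Sym2.congr_right]
    tauto
  have hnby : nbFirst ts (j + 1) y = insert x (nbFirst ts j y) := by
    ext w
    simp only [nbFirst, htake, mem_filter, mem_univ, true_and, List.mem_append,
      List.mem_singleton, mem_insert]
    rw [Sym2.eq_swap (a := x), Sym2.congr_right]
    tauto
  have hnbo : ∀ v, v ≠ x → v ≠ y → nbFirst ts (j + 1) v = nbFirst ts j v := by
    intro v hvx hvy
    ext w
    simp only [nbFirst, htake, mem_filter, mem_univ, true_and, List.mem_append,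
      List.mem_singleton, or_iff_left_iff_imp, Sym2.eq_iff]
    rintro (⟨h, -⟩ | ⟨h, -⟩)
    · exact (hvx h).elim
    · exact (hvy h).elim
  have hyx : y ∉ nbFirst ts j x := by simpa [nbFirst] using hnew
  have hxy' : x ∉ nbFirst ts j y := by simpa [nbFirst, Sym2.eq_swap (a := y)] using hnew
  intro v _
  have hIv := hI v trivial
  have hIx := hI x trivial
  have hIy := hI y trivial
  by_cases hvx : v = x
  · subst hvx
    rw [hnbx, card_insert_of_notMem hyx, sum_insert hyx]
    simp [update_apply, hj30, e2, e3, e4, hne, hIx, add_comm]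
  · by_cases hvy : v = y
    · subst hvy
      rw [hnby, card_insert_of_notMem hxy', sum_insert hxy']
      simp [hj30, e2, e3, e4, hne.symm, hIy, add_comm]
    · rw [hnbo v hvx hvy]
      have h1 : (v : ℕ) ≠ x := fun h => hvx (Fin.ext h)
      have h2 : (v : ℕ) ≠ y := fun h => hvy (Fin.ext h)
      simp [update_apply, hj30, e2, e3, e4, h1, h2, hIv]

/-- Collect the nodes with at most one neighbour. -/
def collectLeaves : Program :=
  .seq (block [.natConst 33 2, .natConst 35 0]) (forUp 30 3 (.seq (block [.natLoad 32 aDeg 30])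
    (.ite (.natLt 32 33) (block [.natStore aOrd 35 30, .natAdd 35 35 ONE]) skip)))

theorem collectLeaves_runs {nb : Fin N → Finset (Fin N)} (h3 : s.nreg 3 = N) (h1 : s.nreg ONE = 1)
    (hnb : NbMem Set.univ nb s) :
    Runs collectLeaves s (N * 8 + 5) fun s' => ∃ q : List (Fin N), QueueMem q s' ∧ q.Nodup ∧
      (∀ v, v ∈ q ↔ (nb v).card ≤ 1) ∧ NbMem Set.univ nb s' := by
  refine (Runs.seq (t₁ := 3) (t₂ := N * 8 + 2) (Runs.of_run_le (by simp) (by simp)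
    fun ha₁ => ?_)).mono (by omega) fun _ _ h => h
  set s₁ := (block [.natConst 33 2, .natConst 35 0]).run s with hs₁
  have hna₁ : s₁.narr = s.narr := by simp [hs₁]
  have := Runs.forUp (i := 30) (b := 3) (p := .seq (block [.natLoad 32 aDeg 30])
    (.ite (.natLt 32 33) (block [.natStore aOrd 35 30, .natAdd 35 35 ONE]) skip)) (s := s₁) 6
    (fun j s' => ∃ q : List (Fin N), QueueMem q s' ∧ q.Nodup ∧
      (∀ v : Fin N, v ∈ q ↔ v < j ∧ (nb v).card ≤ 1))
    (by simp) (by simp) (by simp) (by decide) (by decide) (by rw [ha₁.n _ (by simp), h1])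
    ⟨[], ⟨by simp [hs₁], by simp⟩, by simp, by simp⟩ ?_
  · rw [ha₁.n 3 (by simp), h3] at this
    refine this.mono le_rfl fun s' ha' ⟨q, h1, h2, h3⟩ => ⟨q, h1, h2, fun v => ?_, fun v _ => ?_⟩
    · rw [h3 v]; exact and_iff_right v.2
    · rw [ha'.na _ (by simp), ha'.na _ (by simp), hna₁]
      exact hnb v trivial
  rintro j s' hj hj30 ha' ⟨q, hq, hnd, hmem⟩
  rw [ha₁.n 3 (by simp), h3] at hj
  refine Runs.of_run_le (by simp) (by simp) ?_
  have e13 : s'.narr aDeg j = (nb ⟨j, hj⟩).card := by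
    rw [ha'.na _ (by simp), hna₁]; exact (hnb ⟨j, hj⟩ trivial).1
  have e33 : s'.nreg 33 = 2 := by rw [ha'.n _ (by simp)]; simp [hs₁]
  have e4 : s'.nreg ONE = 1 := by rw [ha'.n _ (by simp), ha₁.n _ (by simp), h1]
  rw [Program.run]
  set s₂ := (block [.natLoad 32 aDeg 30]).run s' with hs₂
  have e32 : s₂.nreg 32 = (nb ⟨j, hj⟩).card := by simp [hs₂, hj30, e13]
  have e33' : s₂.nreg 33 = 2 := by simp [hs₂, e33]
  have hlt : ∀ v : Fin N, (v : ℕ) < j + 1 ↔ v = ⟨j, hj⟩ ∨ (v : ℕ) < j := fun v => by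
    rw [Fin.ext_iff]; simp only; omega
  by_cases hd : (nb ⟨j, hj⟩).card ≤ 1
  · rw [run_ite_pos (by simp [e32, e33']; omega)]
    refine ⟨q ++ [⟨j, hj⟩], hq.push ?_ ?_, ?_, fun v => ?_⟩
    · simp [hs₂, hq.1, e4]
    · intro i
      simp [hs₂, update_apply, hq.1, hj30]
    · rw [List.nodup_append]
      refine ⟨hnd, by simp, ?_⟩
      rintro a ha b hb rfl
      have := (hmem a).1 ha
      simp only [List.mem_singleton] at hb
      subst hb
      simp at this
    · rw [List.mem_append, hmem v, List.mem_singleton, hlt]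
      constructor
      · rintro (h | rfl)
        · exact ⟨.inr h.1, h.2⟩
        · exact ⟨.inl rfl, hd⟩
      · rintro ⟨rfl | h, h'⟩
        · exact .inr rfl
        · exact .inl ⟨h, h'⟩
  · rw [run_ite_neg (by simp [e32, e33']; omega)]
    refine ⟨q, ⟨by simp [hs₂, hq.1], by simpa [hs₂] using hq.2⟩, hnd,
      fun v => ?_⟩
    rw [hmem v, hlt]
    constructor
    · exact fun h => ⟨.inr h.1, h.2⟩
    · rintro ⟨rfl | h, h'⟩
      · exact (hd h').elim
      · exact ⟨h, h'⟩

/-- Strip the leaf at the front of the queue. -/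
def stripLeaf : Program :=
  .seq (block [.natLoad 31 aOrd 30, .natLoad 32 aDeg 31])
    (.ite (.natLt ZERO 32) (.seq (block [.natLoad 33 aSum 31, .natLoad 34 aDeg 33,
        .natSub 34 34 ONE, .natStore aDeg 33 34, .natLoad 36 aSum 33, .natSub 36 36 31,
        .natStore aSum 33 36])
      (ifEq 34 1 (block [.natStore aOrd 35 33, .natAdd 35 35 ONE]) skip)) skip)

open Classical in
/-- The neighbours that are not among the first `h` members of the queue. -/
noncomputable def alive (T : SimpleGraph (Fin N)) (q : List (Fin N)) (h : ℕ) (v : Fin N) :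
    Finset (Fin N) :=
  univ.filter fun w => T.Adj v w ∧ w ∉ q.take h

theorem mem_alive {q : List (Fin N)} {h : ℕ} {v w : Fin N} :
    w ∈ alive T q h v ↔ T.Adj v w ∧ w ∉ q.take h := by simp [alive]

/-- The first `h` members of the queue have been stripped; those that have at most one neighbour
left are in the queue. -/
structure Stripped (T : SimpleGraph (Fin N)) (h : ℕ) (q : List (Fin N)) : Prop where
  le : h ≤ q.length
  nodup : q.Nodup
  mem : ∀ v, v ∉ q.take h → (v ∈ q ↔ (alive T q h v).card ≤ 1)
  uniq : ∀ i (hi : i < q.length), i < h → (alive T q i q[i]).card ≤ 1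

theorem Stripped.lt (hT : T.IsTree) {h : ℕ} {q : List (Fin N)} (hs : Stripped T h q) (hN : h < N) :
    h < q.length := by
  classical
  by_contra hcon
  have hq : q.take h = q := List.take_of_length_le (by omega)
  have hA : (univ.filter fun v => v ∉ q).Nonempty := by
    by_contra hemp
    rw [Finset.not_nonempty_iff_eq_empty, Finset.filter_eq_empty_iff] at hemp
    have : univ ⊆ q.toFinset := fun v _ => by simpa using hemp (mem_univ v)
    have := (card_le_card this).trans q.toFinset_card_le
    simp at this
    omega
  obtain ⟨v, hv, huniq⟩ := hT.exists_leaf hA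
  simp only [mem_filter, mem_univ, true_and] at hv huniq
  refine hv ((hs.mem v (by rwa [hq])).2 (Finset.card_le_one.2 fun a ha b hb => ?_))
  rw [mem_alive, hq] at ha hb
  exact huniq a ha.2 b hb.2 ha.1 hb.1

theorem alive_take_append {h : ℕ} {q l : List (Fin N)} (hl : h ≤ q.length) (v : Fin N) :
    alive T (q ++ l) h v = alive T q h v := by
  ext w; rw [mem_alive, mem_alive, List.take_append_of_le_length hl]

theorem mem_take_succ {h : ℕ} {q : List (Fin N)} (hl : h < q.length) (v : Fin N) :
    v ∈ q.take (h + 1) ↔ v ∈ q.take h ∨ v = q[h] := by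
  rw [show q.take (h + 1) = q.take h ++ [q[h]] by
    rw [List.take_add_one, List.getElem?_eq_getElem hl]; rfl, List.mem_append, List.mem_singleton]

theorem alive_succ {h : ℕ} {q : List (Fin N)} (hl : h < q.length) (v : Fin N) :
    alive T q (h + 1) v = (alive T q h v).erase q[h] := by
  ext w; rw [Finset.mem_erase, mem_alive, mem_alive, mem_take_succ hl]; tauto

/-- Stripping the next member `v` of the queue. If it has a neighbour `w` left, and this becomes a
leaf, then `w` is appended to the queue. -/
theorem Stripped.succ {h : ℕ} {q l : List (Fin N)} (hs : Stripped T h q) (hl : h < q.length)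
    (hnd : (q ++ l).Nodup)
    (hmem : ∀ v, v ∈ l ↔ T.Adj q[h] v ∧ v ∉ q.take h ∧ (alive T q h v).card = 2) :
    Stripped T (h + 1) (q ++ l) := by
  have hqh : q[h] ∉ q.take h := by
    intro hmem
    obtain ⟨i, hi, he⟩ := List.getElem_of_mem hmem
    simp only [List.getElem_take] at he
    have := (hs.nodup.getElem_inj_iff).1 he
    simp at hi; omega
  refine ⟨by simp; omega, hnd, fun v hv => ?_, fun i hi hih => ?_⟩
  · rw [alive_take_append (by omega), alive_succ hl]
    rw [List.take_append_of_le_length (by omega), mem_take_succ hl] at hv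
    push Not at hv
    rw [List.mem_append, hs.mem v hv.1, hmem v]
    by_cases hadj : T.Adj q[h] v
    · have : q[h] ∈ alive T q h v := mem_alive.2 ⟨hadj.symm, hqh⟩
      rw [Finset.card_erase_of_mem this]
      simp only [hadj, hv.1, true_and, not_false_eq_true]
      have := Finset.card_pos.2 ⟨_, this⟩
      omega
    · rw [Finset.erase_eq_of_notMem fun hm => hadj (mem_alive.1 hm).1.symm]
      simp [hadj]
  · rw [List.getElem_append_left (by omega), alive_take_append (by omega)]
    rcases Nat.lt_succ_iff_lt_or_eq.1 hih with hih | rfl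
    · exact hs.uniq i (by omega) hih
    · exact (hs.mem _ hqh).1 (List.getElem_mem _)

/-- What is known between two rounds of the stripping of leaves. -/
def StripInv (T : SimpleGraph (Fin N)) (h : ℕ) (s : State) : Prop :=
  ∃ q : List (Fin N), QueueMem q s ∧ Stripped T h q ∧
    NbMem {v | v ∉ q.take h} (alive T q h) s

theorem stripLeaf_run (hT : T.IsTree) (h1 : s.nreg ONE = 1) (h0 : s.nreg ZERO = 0) {h : ℕ}
    (hN : h < N) (hs : StripInv T h s) (h30 : s.nreg 30 = h) :
    StripInv T (h + 1) (stripLeaf.run s) := by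
  obtain ⟨q, hq, hst, hnb⟩ := hs
  have hl := hst.lt hT hN
  have hqh : q[h] ∉ q.take h := by
    intro hmem
    obtain ⟨i, hi, he⟩ := List.getElem_of_mem hmem
    simp only [List.getElem_take] at he
    have := (hst.nodup.getElem_inj_iff).1 he
    simp at hi; omega
  have hle : (alive T q h q[h]).card ≤ 1 := (hst.mem _ hqh).1 (List.getElem_mem _)
  set v := q[h] with hv
  have hnbv := hnb v hqh
  have e15 := hq.2 h hl
  rw [← hv] at e15
  rw [stripLeaf, Program.run]
  set s₁ := (block [.natLoad 31 aOrd 30, .natLoad 32 aDeg 31]).run s with hs₁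
  have e31 : s₁.nreg 31 = v := by simp [hs₁, h30, e15]
  have e32 : s₁.nreg 32 = (alive T q h v).card := by simp [hs₁, h30, e15, hnbv.1]
  have e0 : s₁.nreg ZERO = 0 := by simp [hs₁, h0]
  have e1 : s₁.nreg ONE = 1 := by simp [hs₁, h1]
  have e35 : s₁.nreg 35 = q.length := by simp [hs₁, hq.1]
  have ena : s₁.narr = s.narr := by simp [hs₁]
  rcases Nat.lt_or_ge 0 (alive T q h v).card with hpos | hzero
  · rw [run_ite_pos (by simp [e0, e32, hpos])]
    obtain ⟨w, hw⟩ := Finset.card_eq_one.1 (le_antisymm hle hpos)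
    have hwm : T.Adj v w ∧ w ∉ q.take h := mem_alive.1 (hw ▸ Finset.mem_singleton_self w)
    have hwv : (w : ℕ) ≠ v := fun h => hwm.1.ne (Fin.ext h.symm)
    have esum : s.narr aSum v = w := by rw [hnbv.2, hw]; simp
    have hnbw := hnb w hwm.2
    have hvw : v ∈ alive T q h w := mem_alive.2 ⟨hwm.1.symm, hqh⟩
    have hcw := Finset.card_erase_of_mem hvw
    have hsw := Finset.sum_erase_add (alive T q h w) (fun x => (x : ℕ)) hvw
    have hadj : ∀ u, u ∉ q.take h → (T.Adj v u ↔ u = w) := by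
      intro u hu
      constructor
      · intro h'
        have : u ∈ alive T q h v := mem_alive.2 ⟨h', hu⟩
        rwa [hw, mem_singleton] at this
      · rintro rfl; exact hwm.1
    rw [Program.run]
    set s₂ := (block [.natLoad 33 aSum 31, .natLoad 34 aDeg 33,
        .natSub 34 34 ONE, .natStore aDeg 33 34, .natLoad 36 aSum 33, .natSub 36 36 31,
        .natStore aSum 33 36]).run s₁ with hs₂
    have f33 : s₂.nreg 33 = w := by simp [hs₂, e31, ena, esum]
    have f34 : s₂.nreg 34 = (alive T q h w).card - 1 := by
      simp [hs₂, e31, ena, esum, e1, hnbw.1]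
    have f35 : s₂.nreg 35 = q.length := by simp [hs₂, e35]
    have f1 : s₂.nreg ONE = 1 := by simp [hs₂, e1]
    have f13 : ∀ i, s₂.narr aDeg i = if i = w then (alive T q h w).card - 1 else s.narr aDeg i := by
      intro i
      simp [hs₂, update_apply, e31, ena, esum, e1, hnbw.1]
    have f14 : ∀ i, s₂.narr aSum i = if i = w then ∑ x ∈ (alive T q h w).erase v, (x : ℕ)
        else s.narr aSum i := by
      intro i
      simp [hs₂, update_apply, e31, ena, esum, hnbw.2]
      split_ifs
      · omega
      · rfl
    have f15 : s₂.narr aOrd = s.narr aOrd := by simp [hs₂, ena]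
    -- the numbers and sums of the remaining neighbours
    have hnb₂ : ∀ u, u ∉ q.take h → u ≠ v → s₂.narr aDeg u = (alive T q (h + 1) u).card ∧
        s₂.narr aSum u = ∑ x ∈ alive T q (h + 1) u, (x : ℕ) := by
      intro u hu huv
      rw [alive_succ hl, f13, f14]
      by_cases huw : u = w
      · subst huw
        rw [if_pos rfl, if_pos rfl, ← hv, hcw]
        exact ⟨rfl, rfl⟩
      · have : (u : ℕ) ≠ w := fun h => huw (Fin.ext h)
        rw [if_neg this, if_neg this, Finset.erase_eq_of_notMem fun hm =>
          huw ((hadj u hu).1 (mem_alive.1 hm).1.symm)]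
        exact hnb u hu
    by_cases htwo : (alive T q h w).card = 2
    · have hwq : w ∉ q := fun hwq => by have := (hst.mem w hwm.2).1 hwq; omega
      rw [ifEq_run _ _ _ _ _ (by decide), if_pos (by rw [f34]; omega)]
      refine ⟨q ++ [w], hq.push ?_ ?_, hst.succ hl ?_ ?_, ?_⟩
      · simp [f35, f1]
      · intro i
        simp [update_apply, f35, f33, f15]
      · rw [List.nodup_append]
        refine ⟨hst.nodup, by simp, ?_⟩
        rintro a ha b hb rfl
        rw [List.mem_singleton] at hb
        exact hwq (hb ▸ ha)
      · intro u
        rw [List.mem_singleton, ← hv]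
        constructor
        · rintro rfl; exact ⟨hwm.1, hwm.2, htwo⟩
        · rintro ⟨h1, h2, -⟩; exact (hadj u h2).1 h1
      · intro u hu
        rw [Set.mem_ofPred_eq, List.take_append_of_le_length (by omega), mem_take_succ hl] at hu
        push Not at hu
        have := alive_take_append (T := T) (q := q) (l := [w]) (h := h + 1) (by omega) u
        rw [this]
        simpa using hnb₂ u hu.1 hu.2
    · rw [ifEq_run _ _ _ _ _ (by decide), if_neg (by rw [f34]; omega)]
      refine ⟨q ++ [], ?_, hst.succ hl (by simpa using hst.nodup) ?_, ?_⟩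
      · rw [List.append_nil]
        exact ⟨by simp [f35], by simpa [f15] using hq.2⟩
      · intro u
        simp only [List.not_mem_nil, false_iff, ← hv]
        rintro ⟨h1, h2, h3⟩
        rw [(hadj u h2).1 h1] at h3
        exact htwo h3
      · intro u hu
        rw [List.append_nil] at hu ⊢
        rw [Set.mem_ofPred_eq, mem_take_succ hl] at hu
        push Not at hu
        simpa using hnb₂ u hu.1 hu.2
  · rw [run_ite_neg (by simp only [Test.Holds, e0, e32]; omega)]
    have hemp : alive T q h v = ∅ := Finset.card_eq_zero.1 (by omega)
    have hadj : ∀ u, u ∉ q.take h → ¬ T.Adj v u := fun u hu h' => by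
      have : u ∈ alive T q h v := mem_alive.2 ⟨h', hu⟩
      rw [hemp] at this
      simp at this
    refine ⟨q ++ [], ?_, hst.succ hl (by simpa using hst.nodup) ?_, ?_⟩
    · rw [List.append_nil]
      exact ⟨by simp [e35], by simpa [ena] using hq.2⟩
    · intro u
      simp only [List.not_mem_nil, false_iff, ← hv]
      rintro ⟨h1, h2, -⟩
      exact hadj u h2 h1
    · intro u hu
      rw [List.append_nil] at hu ⊢
      rw [Set.mem_ofPred_eq, mem_take_succ hl] at hu
      push Not at hu
      rw [alive_succ hl, Finset.erase_eq_of_notMem fun hm =>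
        hadj u hu.1 (mem_alive.1 hm).1.symm]
      simpa [ena] using hnb u hu.1

end

section

variable {N : ℕ} {T : SimpleGraph (Fin N)} {s : State}

@[simp] theorem stripLeaf_loopFree : stripLeaf.LoopFree := by simp [stripLeaf]

theorem stripLeaf_wN (x : ℕ) (h : stripLeaf.wN x) : x = 6 ∨ x = 7 ∨ (31 ≤ x ∧ x < 37) := by
  simp [stripLeaf] at h; omega

/-- Order the nodes by stripping leaves. -/
def orderNodes : Program :=
  .seq countNeighbours (.seq collectLeaves (forUp 30 3 stripLeaf))

theorem orderNodes_runs {ts : List T.Dart} (hT : T.IsTree) (hts : IsEdgeList ts)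
    (h3 : s.nreg 3 = N) (h1 : s.nreg ONE = 1) (h0 : s.nreg ZERO = 0)
    (hfst : ∀ i (h : i < ts.length), s.narr 2 i = (ts[i].fst : ℕ))
    (hsnd : ∀ i (h : i < ts.length), s.narr 3 i = (ts[i].snd : ℕ))
    (hdeg : ∀ v, s.narr 13 v = 0) (hsum : ∀ v, s.narr 14 v = 0) :
    Runs orderNodes s (N * 48 + 11) fun s' => ∃ o : ℕ → Fin N, IsTreeOrder T N o ∧
      ∀ h < N, s'.narr aOrd (N - 1 - h) = o h := by
  refine (Runs.seq (t₁ := N * 17 + 4) (t₂ := N * 8 + 5 + (N * 22 + 2))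
    ((countNeighbours_runs hT hts h3 h1 hfst hsnd hdeg hsum).mono le_rfl
    fun s₁ ha₁ hn₁ _ => Runs.seq ((collectLeaves_runs (N := N)
      (by rw [ha₁.n _ (by simp [countNeighbours]), h3])
      (by rw [ha₁.n _ (by simp [countNeighbours]), h1]) hn₁).mono le_rfl
    fun s₂ ha₂ ⟨q, hq, hnd, hmem, hn₂⟩ _ => ?_))).mono (by omega) fun _ _ h => h
  have e3 : s₂.nreg 3 = N := by
    rw [ha₂.n _ (by simp [collectLeaves]), ha₁.n _ (by simp [countNeighbours]), h3]
  have e1 : s₂.nreg ONE = 1 := by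
    rw [ha₂.n _ (by simp [collectLeaves]), ha₁.n _ (by simp [countNeighbours]), h1]
  have e0 : s₂.nreg ZERO = 0 := by
    rw [ha₂.n _ (by simp [collectLeaves]), ha₁.n _ (by simp [countNeighbours]), h0]
  have halive : ∀ v, nbFirst ts ts.length v = alive T q 0 v := by
    intro v
    ext w
    simp only [nbFirst, List.take_length, mem_filter, mem_univ, true_and, mem_alive,
      List.take_zero, List.not_mem_nil, not_false_eq_true, and_true, List.mem_map]
    constructor
    · rintro ⟨d, -, h⟩
      have := d.edge_mem
      rw [h] at this
      exact this
    · exact fun h => hts.2 s(v, w) h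
  have hw : ∀ x < 6, ¬ stripLeaf.wN x := fun x hx h => by have := stripLeaf_wN x h; omega
  have := Runs.forUp (i := 30) (b := 3) (p := stripLeaf) (s := s₂) 20 (StripInv T)
    (fun h => by have := stripLeaf_wN _ h; omega) (hw _ (by omega)) (hw _ (by omega)) (by decide)
    (by decide) e1 ⟨q, hq, ⟨by simp, hnd, fun v _ => (hmem v).trans (halive v ▸ Iff.rfl), by simp⟩,
      fun v _ => by
      rw [← halive]; exact hn₂ v trivial⟩ ?_
  · rw [e3] at this
    refine this.mono le_rfl fun s' _ ⟨q, hq, hst, _⟩ => ?_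
    have hlen : q.length = N := by
      have := hst.nodup.length_le_card
      rw [Fintype.card_fin] at this
      exact le_antisymm this hst.le
    have hpos : 0 < N := by
      obtain ⟨v⟩ := hT.connected.nonempty
      exact v.pos
    have hget : ∀ h < N, ∃ hh : N - 1 - h < q.length,
        q.getD (N - 1 - h) ⟨0, hpos⟩ = q[N - 1 - h] := fun h hh =>
      ⟨by omega, List.getD_eq_getElem _ _ (by omega)⟩
    refine ⟨fun h => q.getD (N - 1 - h) ⟨0, hpos⟩, ⟨?_, ?_, ?_⟩, ?_⟩
    · intro i hi j hj h
      obtain ⟨hi', ei⟩ := hget i hi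
      obtain ⟨hj', ej⟩ := hget j hj
      simp only [ei, ej] at h
      have := hst.nodup.getElem_inj_iff.1 h
      omega
    · intro x
      have hx : x ∈ q := by
        have h1 : q.toFinset = univ := Finset.eq_univ_of_card _ (by
          rw [List.toFinset_card_of_nodup hst.nodup, hlen, Fintype.card_fin])
        rw [← List.mem_toFinset, h1]
        exact mem_univ x
      obtain ⟨i, hi, rfl⟩ := List.getElem_of_mem hx
      refine ⟨N - 1 - i, by omega, ?_⟩
      obtain ⟨hi', ei⟩ := hget (N - 1 - i) (by omega)
      simp only [ei]
      congr 1
      omega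
    · intro h hh i hi j hj h1 h2
      obtain ⟨hh', eh⟩ := hget h hh
      obtain ⟨hi', ei⟩ := hget i (by omega)
      obtain ⟨hj', ej⟩ := hget j (by omega)
      simp only [eh, ei, ej] at h1 h2
      have hmem : ∀ (a b : ℕ) (hb : b < q.length), a < b → q[b] ∉ q.take a := by
        intro a b hb hab hm
        obtain ⟨c, hc, he⟩ := List.getElem_of_mem hm
        simp only [List.getElem_take] at he
        have := hst.nodup.getElem_inj_iff.1 he
        simp at hc; omega
      have := Finset.card_le_one.1 (hst.uniq _ hh' (by omega)) _
        (mem_alive.2 ⟨h1, hmem _ _ hi' (by omega)⟩) _ (mem_alive.2 ⟨h2, hmem _ _ hj' (by omega)⟩)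
      have := hst.nodup.getElem_inj_iff.1 this
      omega
    · intro h hh
      obtain ⟨hh', eh⟩ := hget h hh
      simp only [eh]
      exact hq.2 _ hh'
  · intro h s' hh hh30 ha' hI
    rw [e3] at hh
    refine Runs.of_run_le (by simp) (by simp [stripLeaf, ifEq]) ?_
    have hw' : ∀ x < 6, s'.nreg x = s₂.nreg x := fun x hx => ha'.n _ fun h => by
      rw [forUp_wN] at h
      rcases h with h | h
      · omega
      · exact hw x hx h
    exact stripLeaf_run hT (by rw [hw' _ (by omega), e1]) (by rw [hw' _ (by omega), e0]) hh hI hh30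

/-! ### Preparation from a tree decomposition -/

theorem _root_.List.getElem?_flatten_add {α : Type*} (L : List (List α)) (i j : ℕ)
    (hi : i < L.length) (hj : j < L[i].length) :
    L.flatten[((L.take i).map List.length).sum + j]? = some L[i][j] := by
  induction L generalizing i with
  | nil => simp at hi
  | cons a L ih =>
    cases i with
    | zero =>
      simp only [List.getElem_cons_zero] at hj
      simp [List.getElem?_append_left hj]
    | succ i =>
      simp only [List.length_cons, Nat.add_lt_add_iff_right] at hi
      simp only [List.getElem_cons_succ] at hj
      have := ih i hi hj
      simp only [List.flatten_cons, List.take_succ_cons, List.map_cons, List.sum_cons,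
        List.getElem_cons_succ]
      rw [List.getElem?_append_right (by omega), ← this]
      congr 1
      omega

/-- Compute the offsets of the bags. -/
def offsets : Program :=
  .seq (block [.natConst 31 0])
    (forUp 30 3 (block [.natStore aOff 30 31, .natLoad 32 4 30, .natAdd 31 31 32]))

theorem offsets_runs {V : Type*} {bags : Fin N → List V} (h3 : s.nreg 3 = N)
    (h1 : s.nreg ONE = 1) (h4 : ∀ i : Fin N, s.narr 4 i = (bags i).length) :
    Runs offsets s (N * 6 + 4) fun s' => ∀ i : Fin N,
      s'.narr aOff i = (((List.ofFn bags).take i).map List.length).sum := by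
  refine (Runs.seq (t₁ := 2) (t₂ := N * 6 + 2) (Runs.of_run_le (by simp) (by simp)
    fun ha₁ => ?_)).mono (by omega) fun _ _ h => h
  set s₁ := (block [.natConst 31 0]).run s with hs₁
  have hna : s₁.narr = s.narr := by simp [hs₁]
  have := Runs.forUp (i := 30) (b := 3)
    (p := block [.natStore aOff 30 31, .natLoad 32 4 30, .natAdd 31 31 32]) (s := s₁) 4
    (fun j s' => s'.nreg 31 = (((List.ofFn bags).take j).map List.length).sum ∧
      ∀ i < j, s'.narr aOff i = (((List.ofFn bags).take i).map List.length).sum)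
    (by simp) (by simp) (by simp) (by decide) (by decide) (by rw [ha₁.n _ (by simp), h1])
    ⟨by simp [hs₁], by simp⟩ ?_
  · rw [ha₁.n 3 (by simp), h3] at this
    exact this.mono le_rfl fun s' _ h i => h.2 i i.2
  rintro j s' hj hj30 ha' ⟨h31, hoff⟩
  rw [ha₁.n 3 (by simp), h3] at hj
  refine Runs.of_run_le (by simp) (by simp) ⟨?_, fun i hi => ?_⟩
  · have e4 : s'.narr 4 j = (bags ⟨j, hj⟩).length := by
      rw [ha'.na _ (by simp), hna]; exact h4 ⟨j, hj⟩
    rw [List.take_add_one, List.getElem?_eq_getElem (by simpa using hj)]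
    simp [hj30, e4, h31]
  · simp only [State.setN_narr]
    have : ((block [.natStore aOff 30 31, .natLoad 32 4 30, .natAdd 31 31 32]).run s').narr aOff i =
        if i = j then s'.nreg 31 else s'.narr aOff i := by
      simp [update_apply, hj30]
    rw [this]
    split_ifs with h
    · rw [h, h31]
    · exact hoff i (by omega)

end

section

variable {N : ℕ} {s : State}

/-- Compute an elimination scheme from a tree decomposition. -/
def prepare (K : ℕ) : Program :=
  .seq placeRoot (.seq orderNodes (.seq offsets (forUp 30 3 (placeNode K))))

theorem orderNodes_wN (x : ℕ) (h : orderNodes.wN x) : x = 6 ∨ x = 7 ∨ (30 ≤ x ∧ x < 37) := by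
  simp [orderNodes, countNeighbours, collectLeaves, stripLeaf] at h; omega

theorem orderNodes_wNA (x : ℕ) (h : orderNodes.wNA x) : 13 ≤ x ∧ x < 16 := by
  simp [orderNodes, countNeighbours, collectLeaves, stripLeaf] at h; omega

@[simp] theorem orderNodes_wRA (x : ℕ) : ¬ orderNodes.wRA x := by
  simp [orderNodes, countNeighbours, collectLeaves, stripLeaf]

theorem offsets_wN (x : ℕ) (h : offsets.wN x) : x = 6 ∨ (30 ≤ x ∧ x < 33) := by
  simp [offsets] at h; omega

theorem offsets_wNA (x : ℕ) (h : offsets.wNA x) : x = 16 := by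
  simp [offsets] at h; omega

@[simp] theorem offsets_wRA (x : ℕ) : ¬ offsets.wRA x := by simp [offsets]

theorem prepare_runs {es : List P.G.Dart} {D : TreeDecomposition P.G (Fin N)}
    {ts : List D.tree.Dart} {bags : Fin N → List (Fin P.n)} (hts : IsEdgeList ts)
    (hbl : IsBagList D bags) {k : ℕ} (hk : ∀ i, (bags i).length ≤ k) :
    Runs (prepare (k + 1)) (P.inputWithDecomposition es D ts bags)
      (N * (k * (k * (3 * k + 15) + 7 * k + 42) + 64) + 22)
      fun s' => InstanceMem P es s' ∧ Fresh (k + 1) s' ∧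
        ∃ S : Scheme P.G P.root (k + 1), S.col 0 = ⟨0, by omega⟩ ∧ SchemeMem S s' := by
  set s := P.inputWithDecomposition es D ts bags with hs
  have hz : ∀ a, 6 ≤ a → s.narr a = fun _ => 0 := by
    intro a ha
    obtain ⟨b, rfl⟩ := Nat.exists_eq_add_of_le' ha
    rfl
  have hzr : ∀ a, 2 ≤ a → s.rarr a = fun _ => 0 := by
    intro a ha
    obtain ⟨b, rfl⟩ := Nat.exists_eq_add_of_le' ha
    rfl
  have hP : PartialMem (P := P) 1 (fun _ => P.root) (fun _ => ∅)
      (fun _ => (⟨0, by omega⟩ : Fin (k + 1))) (placeRoot.run s) :=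
    placeRoot_run rfl rfl (by omega) (fun v => by rw [hz _ (by omega)]) (by rw [hz _ (by omega)])
      (fun c t => by rw [hz _ (by have := le_fam 0 (c : ℕ); omega)])
  refine (Runs.seq (Q := fun s' => ∃ S : Scheme P.G P.root (k + 1),
    (S.col 0 = ⟨0, by omega⟩ ∧ SchemeMem S s') ∧ s'.nreg ONE = 1) (t₁ := 5) (t₂ := N * 48 + 11 +
      (N * 6 + 4 +
    (N * (k * (k * (3 * k + 15) + 7 * k + 42) + 10) + 2))) (Runs.of_run_le (by simp)
    (by simp) fun ha₁ => ?_)).agree.mono (by ring_nf; omega) ?_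
  · set s₁ := placeRoot.run s with hs₁
    have e3 : s₁.nreg 3 = N := ha₁.n _ (by simp)
    have e1 : s₁.nreg ONE = 1 := by simp [hs₁]
    have e0 : s₁.nreg ZERO = 0 := ha₁.n _ (by simp)
    have e2 : s₁.nreg 2 = P.root := ha₁.n _ (by simp)
    have hna : ∀ a, a ≠ aVert → a ≠ aPos → s₁.narr a = s.narr a := fun a h h' =>
      ha₁.na _ (by simp; omega)
    refine Runs.seq ((orderNodes_runs D.isTree hts e3 e1 e0
      (fun i hi => by rw [hna 2 (by decide) (by decide)]; simp [hs,
        PCSTInstance.inputWithDecomposition, hi])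
      (fun i hi => by rw [hna 3 (by decide) (by decide)]; simp [hs,
        PCSTInstance.inputWithDecomposition, hi])
      (fun v => by rw [hna _ (by decide) (by decide), hz _ (by omega)])
      (fun v => by rw [hna _ (by decide) (by decide), hz _ (by omega)])).mono le_rfl
      fun s₂ ha₂ ⟨o, ho, hord⟩ _ => ?_)
    have hn₂ : ∀ x < 30, x ≠ 6 → x ≠ 7 → s₂.nreg x = s₁.nreg x := fun x h h6 h7 =>
      ha₂.n _ fun h' => by have := orderNodes_wN x h'; omega
    have hna₂ : ∀ x, ¬ (13 ≤ x ∧ x < 16) → s₂.narr x = s₁.narr x := fun x h =>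
      ha₂.na _ fun h' => h (orderNodes_wNA x h')
    have h4 : ∀ i : Fin N, s₂.narr 4 i = (bags i).length := fun i => by
      rw [hna₂ _ (by omega), hna _ (by decide) (by decide)]
      simp [hs, PCSTInstance.inputWithDecomposition]
    refine Runs.seq ((offsets_runs (bags := bags) (by rw [hn₂ _ (by omega) (by omega) (by omega),
      e3])
      (by rw [hn₂ _ (by omega) (by omega) (by omega), e1]) h4).mono le_rfl fun s₃ ha₃ hoff _ => ?_)
    have hn₃ : ∀ x < 30, x ≠ 6 → x ≠ 7 → s₃.nreg x = s₁.nreg x := fun x h h6 h7 =>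
      (ha₃.n _ fun h' => by have := offsets_wN x h'; omega).trans (hn₂ x h h6 h7)
    have hna₃ : ∀ x, x ≠ 16 → s₃.narr x = s₂.narr x := fun x h =>
      ha₃.na _ fun h' => h (offsets_wNA x h')
    have hna₃' : ∀ x, ¬ (13 ≤ x ∧ x < 17) → s₃.narr x = s₁.narr x := fun x h => by
      rw [hna₃ _ (by omega), hna₂ _ (by omega)]
    have hB : BagMem o bags s₃ := by
      refine ⟨?_, ?_, ?_, ?_, ?_, ?_, ?_⟩
      · rw [hn₃ _ (by omega) (by omega) (by omega), e2]
      · rw [hn₃ _ (by omega) (by omega) (by omega), e3]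
      · rw [hn₃ _ (by omega) (by omega) (by omega), e1]
      · rw [hn₃ _ (by omega) (by omega) (by omega), e0]
      · rw [hna₃ _ (by omega)]; exact hord
      · rw [hna₃ _ (by omega)]; exact h4
      · intro i j hj
        rw [hoff, hna₃' _ (by omega), hna _ (by decide) (by decide)]
        have hfl := List.getElem?_flatten_add (List.ofFn bags) i j (by simp) (by simpa using hj)
        have he : s.narr 5 = fun i => (((List.ofFn bags).flatten.map Fin.val).getD i 0) := by
          funext i
          simp only [hs, PCSTInstance.inputWithDecomposition, List.pure_def, List.bind_eq_flatMap,
            ← List.map_eq_flatMap, List.map_id']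
        rw [he]
        simp only [List.getD_eq_getElem?_getD, List.getElem?_map, hfl]
        simp
    have hP₃ := hP.of_eq (s' := s₃) (by
      rw [hn₃ _ (by omega) (by omega) (by omega)]) (hna₃' _ (by omega)) (hna₃' _ (by omega))
      (hna₃' _ (by omega)) fun c => hna₃' _ (by have := le_fam 0 (c : ℕ); omega)
    refine (placeNodes_runs hB hbl ho hk (built_zero hP₃)).mono le_rfl
      fun s₄ ha₄ ⟨S, h⟩ => ⟨S, h, ?_⟩
    rw [ha₄.n _ fun h => ?_, hB.one]
    rcases forUp_wN.1 h with h | h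
    · omega
    · rcases placeNode_wN _ h with h | h | h | h | ⟨c, h⟩
      any_goals omega
      have := le_fam 5 c; omega
  · rintro s' - ⟨⟨S, ⟨hS, hmem⟩, hone⟩, ha⟩
    have hwN : ∀ x < 6, x ≠ ONE → s'.nreg x = s.nreg x := fun x hx h4 => ha.n _ fun h => by
      simp only [Program.wN, forUp_wN] at h
      rcases h with h | h | h | h | h
      · simp at h; omega
      · have := orderNodes_wN x h; omega
      · have := offsets_wN x h; omega
      · omega
      · rcases placeNode_wN x h with h | h | h | h | ⟨c, h⟩
        any_goals omega
        have := le_fam 5 c; omega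
    have hwNA : ∀ x, x < 8 ∨ (∃ a c, 1 ≤ a ∧ x = fam a c) → s'.narr x = s.narr x := by
      intro x hx
      have hx' : x < 8 ∨ 17 ≤ x := by
        rcases hx with h | ⟨a, c, -, rfl⟩
        · omega
        · have := le_fam a c; omega
      refine ha.na _ fun h => ?_
      simp only [Program.wNA, forUp_wNA] at h
      rcases h with h | h | h | h
      · simp at h; omega
      · have := orderNodes_wNA x h; omega
      · have := offsets_wNA x h; omega
      · rcases placeNode_wNA x h with h | h | h | ⟨c, h⟩
        any_goals omega
        subst h
        rcases hx with h | ⟨a, c', ha, h⟩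
        · have := le_fam 0 c; omega
        · rw [fam_inj] at h; omega
    have hwRA : s'.rarr = s.rarr := funext fun x => ha.ra _ (by
      simp)
    refine ⟨?_, ?_, S, hS, hmem⟩
    · refine ⟨hwN 0 (by omega) (by omega), hwN 1 (by omega) (by omega), hwN 2 (by omega) (by omega),
        hone, hwN 5 (by omega) (by omega), ?_, ?_, ?_, ?_⟩
      · intro i hi
        rw [hwNA 0 (.inl (by omega))]
        simp [hs, PCSTInstance.inputWithDecomposition, PCSTInstance.input, hi]
      · intro i hi
        rw [hwNA 1 (.inl (by omega))]
        simp [hs, PCSTInstance.inputWithDecomposition, PCSTInstance.input, hi]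
      · intro i hi
        rw [hwRA]
        simp [hs, PCSTInstance.inputWithDecomposition, PCSTInstance.input, hi]
      · intro v
        rw [hwRA]
        simp [hs, PCSTInstance.inputWithDecomposition, PCSTInstance.input]
    · refine ⟨fun v => ?_, fun e => ?_, fun a c t h => ?_, fun c t => ?_⟩
      · rw [hwNA 6 (.inl (by omega)), hz _ (by omega)]
      · rw [hwNA 7 (.inl (by omega)), hz _ (by omega)]
      · rw [hwNA _ (.inr ⟨a, c, h, rfl⟩), hz _ (by have := le_fam a c; omega)]
      · rw [hwRA, hzr _ (by have := le_fam 1 c; omega)]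

end

/-! ### Counting states -/

instance {α : Type*} [Finite α] : Finite (Setoid α) :=
  Finite.of_injective (fun R : Setoid α => (R : α → α → Prop)) fun _ _ h =>
    Setoid.ext fun a b => iff_of_eq (congrFun (congrFun h a) b)

theorem card_St_le (K : ℕ) : Fintype.card (St K) ≤ 2 ^ K * Nat.card (Setoid (Fin K)) := by
  rw [← Nat.card_eq_fintype_card]
  have hf : Function.Injective (fun σ : St K => (({a | σ.Rel a a}, ⟨fun a b => a = b ∨ σ.Rel a b,
      fun a => .inl rfl, fun {a b} h => h.imp Eq.symm σ.symm, fun {a b c} h h' => by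
        rcases h with rfl | h
        · exact h'
        · rcases h' with rfl | h'
          · exact .inr h
          · exact .inr (σ.trans h h')⟩) : Set (Fin K) × Setoid (Fin K))) := by
    intro σ τ h
    rw [Prod.mk.injEq] at h
    obtain ⟨h1, h2⟩ := h
    refine St.ext fun a b => ?_
    by_cases hab : a = b
    · subst hab; exact (Set.ext_iff.1 h1 a : σ.Rel a a ↔ τ.Rel a a)
    · have := Setoid.ext_iff.1 h2 a b
      change (a = b ∨ σ.Rel a b) ↔ (a = b ∨ τ.Rel a b) at this
      simpa [hab] using this
  refine (Nat.card_le_card_of_injective _ hf).trans_eq ?_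
  rw [Nat.card_prod]
  simp

theorem card_setoid_succ_le (k : ℕ) :
    Nat.card (Setoid (Fin (k + 1))) ≤ 2 ^ k * Nat.card (Setoid (Fin k)) := by
  have hf : Function.Injective (fun R : Setoid (Fin (k + 1)) =>
      (({a | R (Fin.castSucc a) (Fin.last k)}, R.comap Fin.castSucc) :
        Set (Fin k) × Setoid (Fin k))) := by
    intro R S h
    rw [Prod.mk.injEq] at h
    obtain ⟨h1, h2⟩ := h
    have h1' : ∀ a : Fin k, R a.castSucc (Fin.last k) ↔ S a.castSucc (Fin.last k) :=
      fun a => Set.ext_iff.1 h1 a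
    have h2' : ∀ a b : Fin k, R a.castSucc b.castSucc ↔ S a.castSucc b.castSucc :=
      fun a b => Setoid.ext_iff.1 h2 a b
    refine Setoid.ext fun a b => ?_
    induction a using Fin.lastCases with
    | last =>
      induction b using Fin.lastCases with
      | last => exact iff_of_true (R.refl _) (S.refl _)
      | cast b => rw [R.comm', S.comm']; exact h1' b
    | cast a =>
      induction b using Fin.lastCases with
      | last => exact h1' a
      | cast b => exact h2' a b
  refine (Nat.card_le_card_of_injective _ hf).trans_eq ?_
  rw [Nat.card_prod]
  simp

theorem card_setoid_le_bellNum (k : ℕ) : Nat.card (Setoid (Fin k)) ≤ bellNum k := by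
  classical
  refine Nat.card_le_card_of_injective (fun R : Setoid (Fin k) => Finpartition.ofSetoid R)
    fun R S h => Setoid.ext fun a b => ?_
  rw [← Finpartition.mem_part_ofSetoid_iff_rel, ← Finpartition.mem_part_ofSetoid_iff_rel]
  simp only at h
  rw [h]

theorem two_pow_choose_le_subgraphNum (k : ℕ) : 2 ^ k.choose 2 ≤ subgraphNum k := by
  classical
  have hf : Function.Injective (fun E : Finset (⊤ : SimpleGraph (Fin k)).edgeFinset =>
      SimpleGraph.toSubgraph (SimpleGraph.fromEdgeSet
        (((E.map (.subtype _) : Finset (Sym2 (Fin k)))) : Set (Sym2 (Fin k))))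
        (le_top (a := SimpleGraph.fromEdgeSet _))) := by
    intro E F h
    have h' := congrArg SimpleGraph.Subgraph.edgeSet h
    have key : ∀ E : Finset (⊤ : SimpleGraph (Fin k)).edgeFinset, ∀ e,
        e ∈ (SimpleGraph.toSubgraph (SimpleGraph.fromEdgeSet
        (((E.map (.subtype _) : Finset (Sym2 (Fin k)))) : Set (Sym2 (Fin k))))
        (le_top (a := SimpleGraph.fromEdgeSet _))).edgeSet ↔
          e ∈ E.map (.subtype _) := by
      intro E e
      induction e using Sym2.ind with
      | _ a b =>
        simp only [SimpleGraph.Subgraph.mem_edgeSet, SimpleGraph.toSubgraph_adj,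
          SimpleGraph.fromEdgeSet_adj, Finset.mem_coe, and_iff_left_iff_imp]
        intro hm
        obtain ⟨⟨e, he⟩, -, rfl⟩ := Finset.mem_map.1 hm
        simpa using he
    refine Finset.map_injective (.subtype _) (Finset.ext fun e => ?_)
    rw [← key, ← key]
    exact Set.ext_iff.1 h' e
  refine le_trans (le_of_eq ?_) (Nat.card_le_card_of_injective _ hf)
  rw [Nat.card_eq_fintype_card, Fintype.card_finset, Fintype.card_coe,
    SimpleGraph.card_edgeFinset_top_eq_card_choose_two, Fintype.card_fin]

theorem card_Choice_le (k : ℕ) :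
    Fintype.card (Choice (k + 1)) ≤ bellNum k ^ 2 * 2 ^ (5 * k + 3) := by
  rw [Fintype.card_congr Choice.equiv, Fintype.card_prod, Fintype.card_prod, Fintype.card_finset,
    Fintype.card_fin]
  have h1 : Fintype.card (St (k + 1)) ≤ 2 ^ (k + 1) * (2 ^ k * bellNum k) :=
    (card_St_le _).trans (Nat.mul_le_mul_left _ ((card_setoid_succ_le k).trans
      (Nat.mul_le_mul_left _ (card_setoid_le_bellNum k))))
  calc _ ≤ (2 ^ (k + 1) * (2 ^ k * bellNum k)) * (2 ^ (k + 1) * (2 ^ (k + 1) *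
    (2 ^ k * bellNum k))) :=
        Nat.mul_le_mul h1 (Nat.mul_le_mul_left _ h1)
    _ = _ := by ring

/-- Exponential and polynomial factors are absorbed by the number of subgraphs. -/
theorem pow_le_subgraphNum (k : ℕ) :
    (k + 1) ^ 3 * 2 ^ (5 * k + 3) ≤ 2 ^ 39 * subgraphNum k := by
  refine le_trans ?_ (Nat.mul_le_mul_left _ (two_pow_choose_le_subgraphNum k))
  have h1 : k + 1 ≤ 2 ^ k := Nat.lt_two_pow_self
  calc (k + 1) ^ 3 * 2 ^ (5 * k + 3) ≤ (2 ^ k) ^ 3 * 2 ^ (5 * k + 3) :=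
        Nat.mul_le_mul_right _ (Nat.pow_le_pow_left h1 3)
    _ = 2 ^ (8 * k + 3) := by rw [← pow_mul, ← pow_add]; congr 1; ring
    _ ≤ 2 ^ (39 + k.choose 2) := by
        refine Nat.pow_le_pow_right (by omega) ?_
        have h2 : 2 * k.choose 2 = k * (k - 1) := by
          rw [Nat.choose_two_right]
          exact Nat.mul_div_cancel' (Nat.even_mul_pred_self k).two_dvd
        -- `8 * k - k * (k - 1) / 2` is at most `36`, attained at `k = 8, 9`
        have h3 : 16 * k ≤ k * (k - 1) + 72 := by
          rcases Nat.lt_or_ge k 10 with h | h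
          · interval_cases k <;> omega
          · rcases Nat.lt_or_ge k 17 with h' | h'
            · interval_cases k <;> omega
            · have := Nat.mul_le_mul_left k (show 16 ≤ k - 1 by omega)
              omega
        omega
    _ = _ := pow_add _ _ _

theorem bellNum_pos (k : ℕ) : 0 < bellNum k := by
  have : Nonempty (Finpartition (univ : Finset (Fin k))) := ⟨⊥⟩
  exact Nat.card_pos

/-! ### Instances with a tree decomposition -/

/-- A graph with an elimination scheme is sparse. -/
theorem Scheme.length_edgeList_le {n : ℕ} {G : SimpleGraph (Fin n)} {r : Fin n}
    (S : Scheme G r K) {es : List G.Dart} (hes : IsEdgeList es) : es.length ≤ n * K := by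
  classical
  -- an edge is determined by its later end and the colour of its earlier end
  let lo : Sym2 (Fin n) → ℕ := fun e => (e.map S.pos).inf
  let hi : Sym2 (Fin n) → ℕ := fun e => (e.map S.pos).sup
  have hinj : Set.InjOn (fun e => (hi e, S.col (lo e)))
      ((es.map fun d => d.edge).toFinset : Set (Sym2 (Fin n))) := by
    have key : ∀ e ∈ ((es.map fun d => d.edge).toFinset : Set (Sym2 (Fin n))),
        hi e < n ∧ lo e ∈ S.bag (hi e) ∧ e = s(S.vert (hi e), S.vert (lo e)) := by
      intro e he
      simp only [Finset.mem_coe, List.mem_toFinset, List.mem_map] at he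
      obtain ⟨d, -, rfl⟩ := he
      have had := d.edge_mem
      generalize d.edge = e at had
      induction e using Sym2.ind with
      | _ a b =>
        rw [SimpleGraph.mem_edgeSet] at had
        wlog hab : S.pos b ≤ S.pos a generalizing a b
        · have := this b a had.symm (by omega)
          rwa [Sym2.eq_swap] at this
        have hne : S.pos b ≠ S.pos a := fun h => had.ne (by rw [← S.vert_pos a, ← h, S.vert_pos])
        simp only [hi, lo, Sym2.map_mk, Sym2.sup_mk, Sym2.inf_mk, sup_eq_left.2 hab,
          inf_eq_right.2 hab, S.vert_pos]
        exact ⟨S.pos_lt a, S.adj _ (S.pos_lt a) _ (by omega) (by simpa [S.vert_pos] using had),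
          trivial⟩
    intro e he e' he' h
    simp only [Prod.mk.injEq] at h
    obtain ⟨h1, h2, h3⟩ := key e he
    obtain ⟨h1', h2', h3'⟩ := key e' he'
    have : lo e = lo e' := S.col_inj h1 h2 (by rw [h.1]; exact h2') h.2
    rw [h3, h3', h.1, this]
  have hmaps : ∀ e ∈ (es.map fun d => d.edge).toFinset,
      (hi e, S.col (lo e)) ∈ range n ×ˢ (univ : Finset (Fin K)) := by
    intro e _
    simp only [Finset.mem_product, mem_range, mem_univ, and_true, hi]
    induction e using Sym2.ind with
    | _ a b => simp [S.pos_lt]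
  have := Finset.card_le_card_of_injOn _ hmaps hinj
  rw [List.toFinset_card_of_nodup hes.1] at this
  simpa using this

theorem TreeDecomposition.length_bag_le {N : ℕ} {G : SimpleGraph (Fin P.n)}
    {D : TreeDecomposition G (Fin N)} {bags : Fin N → List (Fin P.n)} (hbl : IsBagList D bags)
    {k : ℕ} (hw : D.width < k) (i : Fin N) : (bags i).length ≤ k := by
  have h1 := (hbl i).1
  rw [← List.toFinset_card_of_nodup h1, (hbl i).2]
  have h2 : (D.bag i).card ≤ univ.sup fun i => (D.bag i).card :=
    Finset.le_sup (f := fun i => (D.bag i).card) (mem_univ i)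
  unfold TreeDecomposition.width at hw
  omega

/-- Given a tree decomposition, preparation and dynamic program together take the time claimed. -/
theorem solvedBy_inputWithDecomposition {es : List P.G.Dart} {N : ℕ}
    {D : TreeDecomposition P.G (Fin N)} {ts : List D.tree.Dart} {bags : Fin N → List (Fin P.n)}
    (hes : IsEdgeList es) (hts : IsEdgeList ts) (hbl : IsBagList D bags) {k : ℕ}
    (hw : D.width < k) :
    P.SolvedBy es (.seq (prepare (k + 1)) (solve (k + 1) (by omega)))
      (P.inputWithDecomposition es D ts bags)
      (2 ^ 50 * (bellNum k ^ 3 * subgraphNum k * (P.n + N))) := by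
  have hpre := prepare_runs (es := es) hts hbl (TreeDecomposition.length_bag_le hbl hw)
  have hm : es.length ≤ P.n * (k + 1) := by
    obtain ⟨-, -, -, -, -, -, S, -⟩ := hpre
    exact S.length_edgeList_le hes
  have hrun := Runs.seq (q := solve (k + 1) (by omega)) (Q := P.IsOutput es)
    (t₂ := Fintype.card (Choice (k + 1)) * (P.n * (21 * (k + 1) + 120) +
      es.length * (3 * (k + 1) + 22))) (hpre.mono le_rfl fun s' _ ⟨hI, hF, S, hcol, hS⟩ _ =>
    solve_runs (by omega) hes hI hS hF hcol)
  refine hrun.mono ?_ fun _ _ h => h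
  have hc := card_Choice_le k
  have hc1 : 1 ≤ Fintype.card (Choice (k + 1)) :=
    Fintype.card_pos_iff.2 ⟨⟨St.disc ∅, ∅, St.disc ∅⟩⟩
  have hN : 1 ≤ N := by
    obtain ⟨v⟩ := D.isTree.connected.nonempty
    exact v.pos
  have h1 : k * (k * (3 * k + 15) + 7 * k + 42) + 64 ≤ 100 * (k + 1) ^ 3 := by
    nlinarith [Nat.zero_le (k ^ 3), Nat.zero_le (k ^ 2)]
  have h2 : 21 * (k + 1) + 120 + (k + 1) * (3 * (k + 1) + 22) ≤ 200 * (k + 1) ^ 3 := by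
    nlinarith [Nat.zero_le (k ^ 3), Nat.zero_le (k ^ 2)]
  have h3 : N * (k * (k * (3 * k + 15) + 7 * k + 42) + 64) + 22 ≤
      Fintype.card (Choice (k + 1)) * (N * (122 * (k + 1) ^ 3)) := by
    refine le_trans ?_ (Nat.le_mul_of_pos_left _ hc1)
    have := Nat.mul_le_mul_left N h1
    have h4 : 1 ≤ N * (k + 1) ^ 3 := Nat.mul_pos hN (by positivity)
    linarith
  have h4 : P.n * (21 * (k + 1) + 120) + es.length * (3 * (k + 1) + 22) ≤
      P.n * (200 * (k + 1) ^ 3) := by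
    have := Nat.mul_le_mul_right (3 * (k + 1) + 22) hm
    have := Nat.mul_le_mul_left P.n h2
    linarith
  calc _ ≤ Fintype.card (Choice (k + 1)) * (N * (122 * (k + 1) ^ 3)) +
        Fintype.card (Choice (k + 1)) * (P.n * (200 * (k + 1) ^ 3)) :=
        Nat.add_le_add h3 (Nat.mul_le_mul_left _ h4)
    _ ≤ Fintype.card (Choice (k + 1)) * (200 * (k + 1) ^ 3 * (P.n + N)) := by
        rw [← Nat.mul_add]
        refine Nat.mul_le_mul_left _ ?_
        nlinarith [Nat.zero_le (N * (k + 1) ^ 3)]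
    _ ≤ bellNum k ^ 2 * 2 ^ (5 * k + 3) * (200 * (k + 1) ^ 3 * (P.n + N)) :=
        Nat.mul_le_mul_right _ hc
    _ = 200 * bellNum k ^ 2 * ((k + 1) ^ 3 * 2 ^ (5 * k + 3)) * (P.n + N) := by ring
    _ ≤ 200 * bellNum k ^ 2 * (2 ^ 39 * subgraphNum k) * (P.n + N) :=
        Nat.mul_le_mul_right _ (Nat.mul_le_mul_left _ (pow_le_subgraphNum k))
    _ ≤ 200 * bellNum k ^ 3 * (2 ^ 39 * subgraphNum k) * (P.n + N) := by
        refine Nat.mul_le_mul_right _ (Nat.mul_le_mul_right _ (Nat.mul_le_mul_left _ ?_))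
        exact Nat.pow_le_pow_right (bellNum_pos k) (by omega)
    _ = (200 * 2 ^ 39) * (bellNum k ^ 3 * subgraphNum k * (P.n + N)) := by ring
    _ ≤ _ := Nat.mul_le_mul_right _ (by norm_num)

theorem exists_edgeList {V : Type*} [Fintype V] (G : SimpleGraph V) :
    ∃ es : List G.Dart, IsEdgeList es := by
  classical
  have hd : ∀ e : G.edgeFinset, ∃ d : G.Dart, d.edge = e := by
    rintro ⟨e, he⟩
    rw [SimpleGraph.mem_edgeFinset] at he
    induction e using Sym2.ind with
    | _ a b => exact ⟨⟨(a, b), he⟩, rfl⟩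
  choose f hf using hd
  refine ⟨G.edgeFinset.attach.toList.map f, ?_, fun e he => ⟨f ⟨e, by simpa using he⟩, ?_, hf _⟩⟩
  · rw [List.map_map]
    refine (Finset.nodup_toList _).map fun a b h => Subtype.ext ?_
    simpa [hf] using h
  · exact List.mem_map_of_mem (Finset.mem_toList.2 (Finset.mem_attach _ _))

/-- A tree decomposition of width at most `k` yields an elimination scheme with `k + 2` colours. -/
theorem exists_scheme_of_treewidth_le {k : ℕ} (hk : treewidth P.G ≤ k) :
    Nonempty (Scheme P.G P.root (k + 2)) := by
  classical
  have hne : {w : ℕ | ∃ (N : ℕ) (D : TreeDecomposition P.G (Fin N)), D.width = w}.Nonempty := by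
    refine ⟨_, 1, ⟨⊥, ?_, fun _ => univ, fun v => ⟨0, mem_univ _⟩, fun u v _ =>
      ⟨0, mem_univ _, mem_univ _⟩, fun v => ?_⟩, rfl⟩
    · exact SimpleGraph.IsTree.of_subsingleton
    · have : Nonempty {i : Fin 1 | v ∈ (univ : Finset (Fin P.n))} := ⟨⟨0, mem_univ v⟩⟩
      exact ⟨SimpleGraph.Preconnected.of_subsingleton⟩
  obtain ⟨N, D, hD⟩ := Nat.sInf_mem hne
  have hw : D.width < k + 1 := by
    have : D.width = treewidth P.G := hD
    omega
  obtain ⟨ts, hts⟩ := exists_edgeList D.tree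
  have hbl : IsBagList D fun i => (D.bag i).toList := fun i => by simp [Finset.nodup_toList]
  -- a scheme exists because the preparation computes one
  obtain ⟨-, -, -, -, -, -, S, -⟩ := prepare_runs (es := []) hts hbl
    (TreeDecomposition.length_bag_le hbl hw)
  exact ⟨S⟩

/-! ### Balanced separators -/

section

variable {n : ℕ} {G : SimpleGraph (Fin n)} {r : Fin n} {F X B : Finset (Fin n)} {u v w : Fin n}

/-- `v` can be reached from `u` on a path that meets the set `B` of blocked vertices at most in its
last vertex `v`. -/
def Reach (G : SimpleGraph (Fin n)) (B : Finset (Fin n)) : Fin n → Fin n → Prop :=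
  ReflTransGen fun x y => x ∉ B ∧ G.Adj x y

theorem Reach.mono {B' : Finset (Fin n)} (h : Reach G B u v) (hB : B' ⊆ B) : Reach G B' u v :=
  ReflTransGen.mono (fun _ _ h => ⟨fun h' => h.1 (hB h'), h.2⟩) _ _ h

theorem Reach.eq_of_mem (h : Reach G B u v) (hu : u ∈ B) : v = u := by
  rcases h.cases_head with h | ⟨x, h, -⟩
  · exact h.symm
  · exact (h.1 hu).elim

theorem Reach.reverse (h : Reach G B u v) {B' : Finset (Fin n)} (hB : B' ⊆ B) (hv : v ∉ B') :
    Reach G B' v u := by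
  induction h using ReflTransGen.head_induction_on with
  | refl => exact .refl
  | @head x y hxy h ih =>
    refine ih.tail ⟨?_, hxy.2.symm⟩
    rcases h.cases_head with h | ⟨z, h, -⟩
    · rwa [h]
    · exact fun h' => h.1 (hB h')

open Classical in
/-- The members of `F` that can be reached from `u`: if `u ∉ F`, the neighbours of the component
of `u` in the graph without `F`. -/
noncomputable def border (G : SimpleGraph (Fin n)) (F : Finset (Fin n)) (u : Fin n) :
    Finset (Fin n) := F.filter (Reach G F u)

theorem mem_border : v ∈ border G F u ↔ v ∈ F ∧ Reach G F u v := by simp [border]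

/-- Every component of the graph without `F` has at most `c` neighbours. -/
def Bordered (G : SimpleGraph (Fin n)) (F : Finset (Fin n)) (c : ℕ) : Prop :=
  ∀ u, (border G F u).card ≤ c

theorem border_union_subset (G : SimpleGraph (Fin n)) (F X : Finset (Fin n)) (u : Fin n) :
    border G (F ∪ X) u ⊆ border G F u ∪ X := by
  intro v hv
  rw [mem_border, mem_union] at hv
  rw [mem_union, mem_border]
  rcases hv.1 with h | h
  · exact .inl ⟨h, hv.2.mono subset_union_left⟩
  · exact .inr h

theorem bordered_singleton (G : SimpleGraph (Fin n)) (v : Fin n) {c : ℕ} (hc : 1 ≤ c) :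
    Bordered G {v} c := fun u =>
  (card_le_card fun w hw => (mem_border.1 hw).1).trans (by simpa using hc)

namespace Scheme

variable {q : ℕ} (S : Scheme G r q)

/-- The position `t` is reached from `x` by going to parents. -/
def Desc (t x : ℕ) : Prop := ReflTransGen (fun a b => (0 < a ∧ a < n) ∧ S.par a = b) x t

variable {S}

theorem desc_zero {x : ℕ} (hx : x < n) : S.Desc 0 x := by
  induction x using Nat.strong_induction_on with
  | _ x ih =>
    rcases Nat.eq_zero_or_pos x with rfl | h0
    · exact .refl
    · have := S.par_lt hx h0
      exact .head ⟨⟨h0, hx⟩, rfl⟩ (ih _ this (by omega))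

/-- A member of the bag of a descendant `x` of `t` is a descendant of `t` or in the bag of `t`. -/
theorem Desc.bag {t x y : ℕ} (h : S.Desc t x) (hx : x < n) (hy : y ∈ S.bag x) :
    S.Desc t y ∨ y ∈ S.bag t := by
  induction h using ReflTransGen.head_induction_on with
  | refl => exact .inr hy
  | @head a b hab hb ih =>
    obtain ⟨⟨ha0, han⟩, rfl⟩ := hab
    by_cases hyp : y = S.par a
    · exact .inl (hyp ▸ hb)
    · exact ih ((S.par_lt han ha0).trans han) (S.mem_bag_par han ha0 hy hyp)

/-- A position is a descendant of the members of its bag. -/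
theorem desc_of_mem_bag {x y : ℕ} (hx : x < n) (hy : y ∈ S.bag x) : S.Desc y x := by
  induction x using Nat.strong_induction_on with
  | _ x ih =>
    have hyx := S.bag_lt x hx y hy
    by_cases hyp : y = S.par x
    · exact .single ⟨⟨by omega, hx⟩, hyp.symm⟩
    · have hp := S.par_lt hx (by omega)
      exact .head ⟨⟨by omega, hx⟩, rfl⟩
        (ih _ hp (by omega) (S.mem_bag_par hx (by omega) hy hyp))

/-- The descendants of `t` are adjacent to descendants of `t` and members of the bag of `t` only. -/
theorem Desc.adj {t : ℕ} (h : S.Desc t (S.pos u)) (hadj : G.Adj u v) :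
    S.Desc t (S.pos v) ∨ S.pos v ∈ S.bag t := by
  have hne : S.pos u ≠ S.pos v := fun h => hadj.ne (by rw [← S.vert_pos u, h, S.vert_pos])
  rcases lt_or_gt_of_ne hne with hlt | hlt
  · have := S.adj _ (S.pos_lt v) _ hlt (by simpa [S.vert_pos] using hadj.symm)
    exact .inl ((desc_of_mem_bag (S.pos_lt v) this).trans h)
  · exact h.bag (S.pos_lt u) (S.adj _ (S.pos_lt u) _ hlt (by simpa [S.vert_pos] using hadj))

theorem card_bag_lt (S : Scheme G r q) {t : ℕ} (ht : t < n) : (S.bag t).card < q := by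
  have : (insert (S.col t) ((S.bag t).image S.col)).card ≤ q := by
    simpa using card_le_univ (insert (S.col t) ((S.bag t).image S.col))
  rw [card_insert_of_notMem (by
      simp only [mem_image, not_exists, not_and]
      exact fun u hu => S.col_ne t ht u hu),
    card_image_of_injOn fun a ha b hb h => S.col_inj ht ha hb h] at this
  omega

/-- For every set `W` of vertices, the graph without some bag and its owner falls into parts that
contain at most half of `W`: parts closed under adjacency outside the bag. -/
theorem exists_balanced (S : Scheme G r q) (W : Finset (Fin n)) : ∃ X : Finset (Fin n), X.card ≤ q ∧
    ∀ u, u ∉ X → ∃ A : Set (Fin n), u ∈ A ∧ (∀ x ∈ A, ∀ y, x ∉ X → G.Adj x y → y ∈ A ∨ y ∈ X) ∧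
      ∀ W' ⊆ W, (∀ w ∈ W', w ∈ A) → 2 * W'.card ≤ W.card := by
  classical
  have hn : 0 < n := r.pos
  let D : ℕ → Finset (Fin n) := fun t => W.filter fun v => S.Desc t (S.pos v)
  -- the latest position with at least half of `W` among its descendants
  obtain ⟨t, ht, hmax⟩ := ((range n).filter fun t => W.card ≤ 2 * (D t).card).exists_max_image
    id ⟨0, by
      have : D 0 = W := Finset.filter_true_of_mem fun v _ => desc_zero (S.pos_lt v)
      simp [this, hn]; omega⟩
  simp only [mem_filter, mem_range, id] at ht hmax
  obtain ⟨htn, hbig⟩ := ht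
  have hpX : ∀ v, S.pos v = t ∨ S.pos v ∈ S.bag t → v ∈ insert (S.vert t)
      ((S.bag t).image S.vert) := by
    rintro v (h | h)
    · rw [← h, S.vert_pos]; exact mem_insert_self _ _
    · exact mem_insert_of_mem (mem_image.2 ⟨_, h, S.vert_pos v⟩)
  have hXp : ∀ v, v ∈ insert (S.vert t) ((S.bag t).image S.vert) →
      S.pos v = t ∨ S.pos v ∈ S.bag t := by
    intro v hv
    rcases mem_insert.1 hv with rfl | hv
    · exact .inl (S.pos_vert t htn)
    · obtain ⟨i, hi, rfl⟩ := mem_image.1 hv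
      exact .inr (by rwa [S.pos_vert i ((S.bag_lt t htn i hi).trans htn)])
  refine ⟨insert (S.vert t) ((S.bag t).image S.vert), ?_, fun u hu => ?_⟩
  · have h1 := card_insert_le (S.vert t) ((S.bag t).image S.vert)
    have h2 : ((S.bag t).image S.vert).card ≤ _ := Finset.card_image_le
    have h3 := S.card_bag_lt htn
    omega
  by_cases hut : S.Desc t (S.pos u)
  · -- `u` is a descendant of a child `s` of `t`
    rcases hut.cases_tail with h | ⟨s, hs, ⟨⟨hs0, hsn⟩, hst⟩⟩
    · exact (hu (hpX u (.inl h.symm))).elim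
    refine ⟨{v | S.Desc s (S.pos v)}, hs, fun x hx y _ hxy => ?_, fun W' hW hW' => ?_⟩
    · rcases Desc.adj hx hxy with h | h
      · exact .inl h
      · refine .inr (hpX y ?_)
        by_cases hy : S.pos y = S.par s
        · exact .inl (hy.trans hst)
        · exact .inr (hst ▸ S.mem_bag_par hsn hs0 h hy)
    · have hts : t < s := hst ▸ S.par_lt hsn hs0
      have h1 : ¬ W.card ≤ 2 * (D s).card := fun h => by
        have := hmax s ⟨hsn, h⟩; omega
      have h2 : W'.card ≤ (D s).card :=
        card_le_card fun w hw => mem_filter.2 ⟨hW hw, hW' w hw⟩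
      omega
  · -- the vertices that are not descendants of `t` form the remaining part
    refine ⟨{v | ¬ S.Desc t (S.pos v)}, hut, fun x hx y hxX hxy => ?_, fun W' hW hW' => ?_⟩
    · by_contra hcon
      push Not at hcon
      simp only [Set.mem_ofPred_eq, not_not] at hcon
      rcases Desc.adj hcon.1 hxy.symm with h | h
      · exact hx h
      · exact hxX (hpX x (.inr h))
    · have h1 : W'.card + (D t).card ≤ W.card := by
        rw [← Finset.card_union_of_disjoint]
        · exact card_le_card (Finset.union_subset hW (Finset.filter_subset _ _))
        · exact Finset.disjoint_left.2 fun w hw hw' => hW' w hw (mem_filter.1 hw').2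
      omega

/-- If not all vertices have been placed, then at most `q + 1` vertices, one of them new, can be
placed so that the components of the rest still have at most `2 * q + 1` neighbours: a balanced
separator of the neighbours of a component, and one vertex of the component. -/
theorem exists_extension (S : Scheme G r q) (hF : Bordered G F (2 * q + 1)) {u₀ : Fin n}
    (hu₀ : u₀ ∉ F) :
    ∃ X : Finset (Fin n), X.card ≤ q + 1 ∧ u₀ ∈ X ∧ Bordered G (F ∪ X) (2 * q + 1) := by
  classical
  obtain ⟨Y, hY, hsep⟩ := S.exists_balanced (border G F u₀)
  set X := insert u₀ (Y.filter fun v => v ∉ F ∧ Reach G F u₀ v) with hX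
  have hXC : ∀ v ∈ X, v ∉ F ∧ Reach G F u₀ v := by
    intro v hv
    rcases mem_insert.1 hv with rfl | hv
    · exact ⟨hu₀, .refl⟩
    · exact (mem_filter.1 hv).2
  refine ⟨X, ?_, mem_insert_self _ _, fun u => ?_⟩
  · have h1 : X.card ≤ _ := card_insert_le u₀ (Y.filter fun v => v ∉ F ∧ Reach G F u₀ v)
    have h2 := Finset.card_filter_le Y fun v => v ∉ F ∧ Reach G F u₀ v
    omega
  by_cases huX : u ∈ F ∪ X
  · have : border G (F ∪ X) u ⊆ {u} := fun v hv =>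
      mem_singleton.2 ((mem_border.1 hv).2.eq_of_mem huX)
    have := card_le_card this
    rw [Finset.card_singleton] at this
    omega
  rw [mem_union, not_or] at huX
  -- a component of the rest lies in the old component of `u₀` or is an old component
  by_cases huC : Reach G F u₀ u
  · have huY : u ∉ Y := fun h => huX.2 (mem_insert_of_mem
      (mem_filter.2 ⟨h, huX.1, huC⟩))
    obtain ⟨A, huA, hA, hW⟩ := hsep u huY
    have hreach : ∀ v, Reach G (F ∪ X) u v → Reach G F u₀ v ∧ (v ∈ A ∨ v ∈ Y) := by
      intro v hv
      induction hv with
      | refl => exact ⟨huC, .inl huA⟩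
      | @tail x y _ hxy ih =>
        have hx := hxy.1
        rw [mem_union, not_or] at hx
        have hxY : x ∉ Y := fun h => hx.2 (mem_insert_of_mem
          (mem_filter.2 ⟨h, hx.1, ih.1⟩))
        exact ⟨ih.1.tail ⟨hx.1, hxy.2⟩, hA x (ih.2.resolve_right hxY) y hxY hxy.2⟩
    set W' := (border G F u₀).filter (· ∈ A) with hW'
    -- at most `1 + (2 * q + 1) / 2 + q` neighbours
    have hsub : border G (F ∪ X) u ⊆ insert u₀ (W' ∪ Y) := by
      intro v hv
      rw [mem_border] at hv
      obtain ⟨h1, h2⟩ := hreach v hv.2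
      rw [mem_insert, mem_union]
      rcases mem_union.1 hv.1 with h | h
      · exact .inr (h2.imp (fun h' => mem_filter.2 ⟨mem_border.2 ⟨h, h1⟩, h'⟩) id)
      · rcases mem_insert.1 h with h | h
        · exact .inl h
        · exact .inr (.inr (mem_filter.1 h).1)
    have h1 := card_le_card hsub
    have h2 := card_insert_le u₀ (W' ∪ Y)
    have h3 := Finset.card_union_le W' Y
    have h4 := hW W' (Finset.filter_subset _ _) fun w hw => (mem_filter.1 hw).2
    have h5 := hF u₀
    omega
  · refine (card_le_card fun v hv => ?_).trans (hF u)
    rw [mem_border] at hv ⊢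
    have hr := hv.2.mono subset_union_left
    refine ⟨(mem_union.1 hv.1).resolve_right fun h => huC ?_, hr⟩
    obtain ⟨h1, h2⟩ := hXC v h
    exact h2.trans (hr.reverse subset_rfl h1)

end Scheme

/-! ### Placing a vertex at the border -/

variable {c : ℕ} {vert : ℕ → Fin n} {bag : ℕ → Finset ℕ} {col : ℕ → Fin K}

/-- The vertices placed at the first `c` positions. -/
def placed (c : ℕ) (vert : ℕ → Fin n) : Finset (Fin n) := (range c).image vert

theorem mem_placed : v ∈ placed c vert ↔ ∃ t < c, vert t = v := by simp [placed]

/-- The bags contain the root and all earlier vertices that can be reached through later ones. -/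
def FullBags (G : SimpleGraph (Fin n)) (c : ℕ) (vert : ℕ → Fin n) (bag : ℕ → Finset ℕ) : Prop :=
  ∀ t < c, ∀ i < t, (i = 0 ∨ Reach G (placed t vert) (vert t) (vert i)) → i ∈ bag t

open Classical in
/-- The bag at which `v` will be placed. -/
noncomputable def borderBag (G : SimpleGraph (Fin n)) (c : ℕ) (vert : ℕ → Fin n) (v : Fin n) :
    Finset ℕ :=
  (range c).filter fun i => i = 0 ∨ Reach G (placed c vert) v (vert i)

theorem mem_borderBag {i : ℕ} : i ∈ borderBag G c vert v ↔
    i < c ∧ (i = 0 ∨ Reach G (placed c vert) v (vert i)) := by simp [borderBag]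

theorem placed_update (v : Fin n) : placed (c + 1) (update vert c v) =
    placed c vert ∪ {v} := by
  ext w
  rw [mem_union, mem_placed, mem_placed, mem_singleton]
  constructor
  · rintro ⟨t, ht, rfl⟩
    by_cases htc : t = c
    · subst htc; exact .inr (by simp)
    · exact .inl ⟨t, by omega, by simp [htc]⟩
  · rintro (⟨t, ht, rfl⟩ | rfl)
    · exact ⟨t, by omega, by simp [ht.ne]⟩
    · exact ⟨c, by omega, by simp⟩

theorem FullBags.closed (h : FullBags G c vert bag) (hp : IsPartial G r c vert bag col) :
    ∀ u ∈ borderBag G c vert v, ∀ w ∈ borderBag G c vert v, w < u →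
      w ∈ bag u := by
  intro u hu w hw hwu
  rw [mem_borderBag] at hu hw
  refine h u hu.1 w hwu (hw.2.imp id fun hw' => ?_)
  have hsub : placed u vert ⊆ placed c vert := by
    intro x hx
    obtain ⟨t, ht, hx⟩ := mem_placed.1 hx
    exact mem_placed.2 ⟨t, ht.trans hu.1, hx⟩
  have hr := hu.2.resolve_left (by omega)
  refine (hr.reverse hsub fun hm => ?_).trans (hw'.mono hsub)
  obtain ⟨t, ht, he⟩ := mem_placed.1 hm
  have := hp.inj t (ht.trans hu.1) u hu.1 he
  omega

theorem FullBags.place (h : FullBags G c vert bag) (v : Fin n) :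
    FullBags G (c + 1) (update vert c v)
      (update bag c (borderBag G c vert v)) := by
  have hp : ∀ t ≤ c, placed t (update vert c v) = placed t vert := fun t ht =>
    Finset.image_congr fun i hi => by
      have : i < t := by simpa using hi
      simp [(show i ≠ c by omega)]
  intro t ht i hi hr
  rw [hp t (by omega), update_of_ne (show i ≠ c by omega)] at hr
  by_cases htc : t = c
  · subst htc
    rw [update_self] at hr ⊢
    exact mem_borderBag.2 ⟨hi, hr⟩
  · rw [update_of_ne htc] at hr ⊢
    exact h t (by omega) i hi hr

theorem card_borderBag_le (hp : IsPartial G r c vert bag col) :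
    (borderBag G c vert v).card ≤ (border G (placed c vert) v).card + 1 := by
  classical
  rw [← card_image_of_injOn (s := borderBag G c vert v) (f := vert) fun a ha b hb h =>
    hp.inj a (mem_borderBag.1 ha).1 b (mem_borderBag.1 hb).1 h]
  refine (card_le_card (t := insert (vert 0) (border G (placed c vert) v)) fun w hw => ?_).trans
    (card_insert_le _ _)
  obtain ⟨i, hi, rfl⟩ := mem_image.1 hw
  rw [mem_borderBag] at hi
  rcases hi.2 with rfl | h
  · exact mem_insert_self _ _
  · exact mem_insert_of_mem (mem_border.2 ⟨mem_placed.2 ⟨i, hi.1, rfl⟩, h⟩)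

end

/-! ### Searching for components on the machine -/

local notation "aBlk" => (17 : ℕ)
local notation "aMark" => (18 : ℕ)

section

variable {s s' : State} {es : List P.G.Dart} {B M : Finset (Fin P.n)} {u v : Fin P.n}

/-- The array `aBlk` is zero outside `B` and positive on `B`. -/
def BlkMem (B : Finset (Fin P.n)) (s : State) : Prop :=
  ∀ v : Fin P.n, s.narr aBlk v = 0 ↔ v ∉ B

/-- The array `aMark` is the indicator of `M`. -/
def MarkMem (M : Finset (Fin P.n)) (s : State) : Prop :=
  ∀ v : Fin P.n, s.narr aMark v = if v ∈ M then 1 else 0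

theorem MarkMem.insert (h : MarkMem M s) (ha : s'.narr aMark = update (s.narr aMark) v 1) :
    MarkMem (insert v M) s' := by
  intro w
  rw [ha, update_apply, h w]
  by_cases hwv : w = v
  · simp [hwv]
  · have : (w : ℕ) ≠ v := fun h => hwv (Fin.ext h)
    simp [hwv, this]

/-- Spread the marks along the edge whose number is in register `44`, in both directions, starting
at ends that are not blocked. -/
def spreadEdge : Program :=
  .seq (block [.natLoad 45 0 44, .natLoad 46 1 44, .natLoad 47 aMark 45, .natLoad 48 aBlk 45,
    .natLoad 49 aMark 46, .natLoad 50 aBlk 46])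
    (.seq (.ite (.natLt 48 47) (block [.natStore aMark 46 ONE]) skip)
      (.ite (.natLt 50 49) (block [.natStore aMark 45 ONE]) skip))

/-- Mark the vertices that can be reached from the vertex in register `42`. -/
def markReach : Program :=
  .seq (forUp 40 0 (block [.natStore aMark 40 ZERO])) (.seq (block [.natStore aMark 42 ONE])
    (forUp 43 0 (forUp 44 1 spreadEdge)))

attribute [local simp] spreadEdge

theorem spreadEdge_run (hI : InstanceMem P es s) (hB : BlkMem B s) (hM : MarkMem M s) {e : ℕ}
    (he : e < es.length) (h44 : s.nreg 44 = e) :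
    ∃ M', MarkMem M' (spreadEdge.run s) ∧ M ⊆ M' ∧
      (∀ v ∈ M', v ∈ M ∨ ∃ w ∈ M, w ∉ B ∧ P.G.Adj w v) ∧
      (es[e].fst ∈ M → es[e].fst ∉ B → es[e].snd ∈ M') ∧
      (es[e].snd ∈ M → es[e].snd ∉ B → es[e].fst ∈ M') := by
  have hadj : P.G.Adj es[e].fst es[e].snd := es[e].adj
  have ex := hI.fst e he
  have ey := hI.snd e he
  set x := es[e].fst
  set y := es[e].snd
  have htest : ∀ v : Fin P.n, (s.narr aBlk v < s.narr aMark v) ↔ v ∈ M ∧ v ∉ B := by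
    intro v
    rw [hM v, ← hB v]
    split_ifs with h <;> simp [h]
  rw [spreadEdge, Program.run]
  set s₁ := (block [.natLoad 45 0 44, .natLoad 46 1 44, .natLoad 47 aMark 45, .natLoad 48 aBlk 45,
    .natLoad 49 aMark 46, .natLoad 50 aBlk 46]).run s with hs₁
  have e45 : s₁.nreg 45 = x := by simp [hs₁, h44, ex]
  have e46 : s₁.nreg 46 = y := by simp [hs₁, h44, ey]
  have e1 : s₁.nreg ONE = 1 := by simp [hs₁, hI.one]
  have t1 : (Test.natLt 48 47).Holds s₁ ↔ x ∈ M ∧ x ∉ B := by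
    rw [← htest]; simp [hs₁, h44, ex]
  have t2 : s₁.nreg 50 < s₁.nreg 49 ↔ y ∈ M ∧ y ∉ B := by
    rw [← htest]; simp [hs₁, h44, ey]
  have hM₁ : MarkMem M s₁ := by intro v; simpa [hs₁] using hM v
  rw [Program.run]
  obtain ⟨M₂, hM₂, hM₂', hn⟩ : ∃ M₂, MarkMem M₂
      ((Program.ite (.natLt 48 47) (block [.natStore aMark 46 ONE]) skip).run s₁) ∧
      (M₂ = if x ∈ M ∧ x ∉ B then insert y M else M) ∧
      ∀ z, z ≠ 6 → ((Program.ite (.natLt 48 47) (block [.natStore aMark 46 ONE]) skip).run s₁).nreg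
        z =
        s₁.nreg z := by
    by_cases h : x ∈ M ∧ x ∉ B
    · rw [run_ite_pos (t1.2 h), if_pos h]
      exact ⟨_, hM₁.insert (by simp [e46, e1]), rfl, fun z hz => by simp [hz]⟩
    · rw [run_ite_neg (mt t1.1 h), if_neg h]
      exact ⟨_, by simpa [MarkMem] using hM₁, rfl, fun z hz => by simp [hz]⟩
  set s₂ := (Program.ite (.natLt 48 47) (block [.natStore aMark 46 ONE]) skip).run s₁
  have t2' : (Test.natLt 50 49).Holds s₂ ↔ y ∈ M ∧ y ∉ B := by
    rw [← t2, Test.Holds, hn 50 (by decide), hn 49 (by decide)]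
  have hMM : M ⊆ M₂ := by rw [hM₂']; split_ifs; exacts [Finset.subset_insert _ _, subset_rfl]
  have hy : x ∈ M → x ∉ B → y ∈ M₂ := fun h h' => by rw [hM₂', if_pos ⟨h, h'⟩]; simp
  have hor : ∀ v ∈ M₂, v ∈ M ∨ ∃ w ∈ M, w ∉ B ∧ P.G.Adj w v := by
    intro v hv
    rw [hM₂'] at hv
    split_ifs at hv with h
    · rcases mem_insert.1 hv with rfl | hv
      · exact .inr ⟨x, h.1, h.2, hadj⟩
      · exact .inl hv
    · exact .inl hv
  by_cases h : y ∈ M ∧ y ∉ B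
  · rw [run_ite_pos (t2'.2 h)]
    refine ⟨insert x M₂, hM₂.insert (by
      simp [hn 45 (by decide), hn 4 (by decide), e45, e1]), hMM.trans (Finset.subset_insert _ _),
        ?_,
      fun h1 h2 => mem_insert_of_mem (hy h1 h2), fun _ _ => mem_insert_self _ _⟩
    intro v hv
    rcases mem_insert.1 hv with rfl | hv
    · exact .inr ⟨y, h.1, h.2, hadj.symm⟩
    · exact hor v hv
  · rw [run_ite_neg (mt t2'.1 h)]
    exact ⟨M₂, by simpa [MarkMem] using hM₂, hMM, hor, hy, fun h1 h2 => (h ⟨h1, h2⟩).elim⟩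

theorem markReach_wN (x : ℕ) (h : markReach.wN x) : x = 6 ∨ (40 ≤ x ∧ x < 51 ∧ x ≠ 42) := by
  simp [markReach, spreadEdge] at h; omega

theorem markReach_wNA (x : ℕ) (h : markReach.wNA x) : x = aMark := by
  simp [markReach, spreadEdge] at h; omega

@[simp] theorem markReach_wRA (x : ℕ) : ¬ markReach.wRA x := by simp [markReach, spreadEdge]

theorem BlkMem.of_eq (hB : BlkMem B s) (h : s'.narr aBlk = s.narr aBlk) : BlkMem B s' := by
  intro v; rw [h]; exact hB v

theorem markReach_runs (hI : InstanceMem P es s) (hes : IsEdgeList es) (hB : BlkMem B s)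
    (h42 : s.nreg 42 = u) : Runs markReach s (P.n * (es.length * 15 + 8) + 6) fun s' =>
      ∀ v : Fin P.n, (Reach P.G B u v → s'.narr aMark v = 1) ∧
        (¬ Reach P.G B u v → s'.narr aMark v = 0) := by
  classical
  have hedge : ∀ x y, P.G.Adj x y → ∃ e, ∃ h : e < es.length,
      (es[e].fst = x ∧ es[e].snd = y) ∨ (es[e].fst = y ∧ es[e].snd = x) := by
    intro x y hxy
    obtain ⟨d, hd, he⟩ := hes.2 s(x, y) hxy
    obtain ⟨e, h, rfl⟩ := List.getElem_of_mem hd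
    refine ⟨e, h, ?_⟩
    rw [SimpleGraph.Dart.edge, Sym2.mk, Sym2.eq_iff] at he
    exact he
  refine (Runs.seq (t₁ := P.n * 4 + 2) (t₂ := 2 + (P.n * (es.length * 15 + 4) + 2)) ?_).mono
    (by ring_nf; omega) fun _ _ h => h
  -- all marks are removed
  have hclear := Runs.forUp (i := 40) (b := 0) (p := block [.natStore aMark 40 ZERO]) (s := s) 2
    (fun j s' => ∀ i < j, s'.narr aMark i = 0) (by simp) (by simp) (by simp) (by decide) (by decide)
    hI.one (by simp) (fun j s' _ hj40 ha' hI' => Runs.of_run_le (by simp) (by simp) fun i hi => by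
      have h0 : s'.nreg ZERO = 0 := by rw [ha'.n _ (by simp), hI.zero]
      by_cases hij : i = j
      · simp [hj40, h0, hij]
      · simpa [hj40, h0, hij] using hI' i (by omega))
  rw [hI.n] at hclear
  refine hclear.mono le_rfl fun s₁ ha₁ h0 _ => Runs.seq (Runs.of_run_le (by simp) (by simp)
    fun ha₂ => ?_)
  have hI₁ : InstanceMem P es s₁ := hI.of_agree ha₁ (by simp; omega) (by simp) (by simp) (by simp)
    (by simp)
  have e42 : s₁.nreg 42 = u := by rw [ha₁.n _ (by simp), h42]
  set s₂ := (block [.natStore aMark 42 ONE]).run s₁ with hs₂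
  have hI₂ : InstanceMem P es s₂ := hI₁.of_agree ha₂ (by simp; omega) (by simp) (by simp) (by simp)
    (by simp)
  have hB₂ : BlkMem B s₂ := hB.of_eq (by rw [ha₂.na _ (by simp), ha₁.na _ (by simp)])
  have hM₂ : MarkMem {u} s₂ := by
    intro v
    by_cases hvu : v = u
    · simp [hs₂, e42, hI₁.one, hvu]
    · have : (v : ℕ) ≠ u := fun h => hvu (Fin.ext h)
      simp [hs₂, e42, hvu, this, h0 v v.2]
  have hloop := Runs.forUp (i := 43) (b := 0) (p := forUp 44 1 spreadEdge) (s := s₂)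
    (es.length * 15 + 2) (fun j s' => ∃ M, MarkMem M s' ∧ u ∈ M ∧ (∀ v ∈ M, Reach P.G B u v) ∧
      ((∀ v, Reach P.G B u v → v ∈ M) ∨ j < M.card)) (by simp) (by simp)
    (by simp) (by decide) (by decide) hI₂.one ⟨{u}, by simpa [MarkMem] using hM₂,
      by simp,
      fun v hv => by rw [mem_singleton.1 hv]; exact .refl, .inr (by simp)⟩ ?_
  · rw [hI₂.n] at hloop
    refine hloop.mono le_rfl fun s' _ ⟨M, hM, _, hsound, hcompl⟩ v => ?_
    have hcompl := hcompl.resolve_right (by simpa using card_le_univ M)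
    exact ⟨fun h => by rw [hM v, if_pos (hcompl v h)],
      fun h => by rw [hM v, if_neg fun h' => h (hsound v h')]⟩
  rintro j s₃ hj - ha₃ ⟨M, hM, huM, hsound, hcompl⟩
  have hI₃ : InstanceMem P es s₃ := hI₂.of_agree ha₃ (by simp [spreadEdge]; omega)
    (by simp) (by simp) (by simp) (by simp)
  have hB₃ : BlkMem B s₃ := hB₂.of_eq (ha₃.na _ (by simp))
  have hinner := Runs.forUp (i := 44) (b := 1) (p := spreadEdge) (s := s₃) 13
    (fun k s' => ∃ M', MarkMem M' s' ∧ M ⊆ M' ∧ (∀ v ∈ M', Reach P.G B u v) ∧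
      ∀ e (h : e < es.length), e < k → (es[e].fst ∈ M → es[e].fst ∉ B → es[e].snd ∈ M') ∧
      (es[e].snd ∈ M → es[e].snd ∉ B → es[e].fst ∈ M')) (by simp)
        (by simp)
    (by simp) (by decide) (by decide) hI₃.one ⟨M, by simpa [MarkMem] using hM,
      subset_rfl,
      hsound, fun e _ h => by omega⟩ ?_
  · rw [hI₃.m] at hinner
    refine hinner.mono (by omega) fun s' _ ⟨M', hM', hsub, hsound', hstep⟩ => ?_
    refine ⟨M', by simpa [MarkMem] using hM', hsub huM, hsound', ?_⟩
    rcases hcompl with h | h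
    · exact .inl fun v hv => hsub (h v hv)
    · by_cases heq : M' = M
      · -- nothing has changed, hence all reachable vertices are marked
        refine .inl fun v hv => ?_
        rw [heq]
        induction hv with
        | refl => exact huM
        | @tail x y _ hxy ih =>
          obtain ⟨e, he, h | h⟩ := hedge x y hxy.2
          · have := (hstep e he he).1 (h.1 ▸ ih) (h.1 ▸ hxy.1)
            rwa [h.2, heq] at this
          · have := (hstep e he he).2 (h.2 ▸ ih) (h.2 ▸ hxy.1)
            rwa [h.1, heq] at this
      · have := Finset.card_lt_card (hsub.ssubset_of_ne (Ne.symm heq))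
        exact .inr (by omega)
  rintro k s₄ hk hk44 ha₄ ⟨M', hM', hsub, hsound', hstep⟩
  rw [hI₃.m] at hk
  have hI₄ : InstanceMem P es s₄ := hI₃.of_agree ha₄ (by simp [spreadEdge]; omega)
    (by simp) (by simp) (by simp) (by simp)
  have hB₄ : BlkMem B s₄ := hB₃.of_eq (ha₄.na _ (by simp))
  refine Runs.of_run_le (by simp) (by simp) ?_
  obtain ⟨M'', hM'', hsub', hor, h1, h2⟩ := spreadEdge_run hI₄ hB₄ hM' hk hk44
  refine ⟨M'', by simpa [MarkMem] using hM'', hsub.trans hsub', fun v hv => ?_, fun e he hek => ?_⟩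
  · rcases hor v hv with h | ⟨w, hw, hwB, hadj⟩
    · exact hsound' v h
    · exact (hsound' w hw).tail ⟨hwB, hadj⟩
  · by_cases hek' : e = k
    · subst hek'
      exact ⟨fun h h' => h1 (hsub h) h', fun h h' => h2 (hsub h) h'⟩
    · have := hstep e he (by omega)
      exact ⟨fun h h' => hsub' (this.1 h h'), fun h h' => hsub' (this.2 h h')⟩

/-- Count the marked vertices that are blocked. -/
def countBorder : Program :=
  .seq (block [.natConst 51 0]) (forUp 40 0 (.seq (block [.natLoad 47 aMark 40,
    .natLoad 48 aBlk 40])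
    (.ite (.natLt ZERO 47) (.ite (.natLt ZERO 48) (block [.natAdd 51 51 ONE]) skip) skip)))

theorem countBorder_runs (hI : InstanceMem P es s) (hB : BlkMem B s)
    (hM : ∀ v : Fin P.n, (Reach P.G B u v → s.narr aMark v = 1) ∧
        (¬ Reach P.G B u v → s.narr aMark v = 0)) :
    Runs countBorder s (P.n * 9 + 4) fun s' => s'.nreg 51 = (border P.G B u).card := by
  classical
  refine (Runs.seq (t₁ := 2) (t₂ := P.n * 9 + 2) (Runs.of_run_le (by simp) (by simp)
    fun ha₁ => ?_)).mono (by omega) fun _ _ h => h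
  set s₁ := (block [.natConst 51 0]).run s with hs₁
  have hI₁ : InstanceMem P es s₁ := hI.of_agree ha₁ (by simp; omega) (by simp) (by simp) (by simp)
    (by simp)
  have := Runs.forUp (i := 40) (b := 0) (p := .seq (block [.natLoad 47 aMark 40,
    .natLoad 48 aBlk 40])
    (.ite (.natLt ZERO 47) (.ite (.natLt ZERO 48) (block [.natAdd 51 51 ONE]) skip) skip))
      (s := s₁) 7
    (fun j s' => s'.nreg 51 = ((border P.G B u).filter fun v : Fin P.n => (v : ℕ) < j).card)
      (by simp)
    (by simp) (by simp) (by decide) (by decide) hI₁.one (by simp [hs₁]) ?_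
  · rw [hI₁.n] at this
    refine this.mono le_rfl fun s' _ h => h.trans ?_
    rw [Finset.filter_true_of_mem fun v _ => v.2]
  intro j s₂ hj hj40 ha₂ h51
  rw [hI₁.n] at hj
  refine Runs.of_run_le (by simp) (by simp) ?_
  have hna : s₂.narr = s.narr := funext fun a => by rw [ha₂.na _ (by simp), ha₁.na _ (by simp)]
  have e0 : s₂.nreg ZERO = 0 := by rw [ha₂.n _ (by simp), hI₁.zero]
  have e1 : s₂.nreg ONE = 1 := by rw [ha₂.n _ (by simp), hI₁.one]
  have hBj := hB ⟨j, hj⟩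
  have hMj := hM ⟨j, hj⟩
  simp only at hBj hMj
  have hsucc : (border P.G B u).filter (fun v : Fin P.n => (v : ℕ) < j + 1) =
      if ⟨j, hj⟩ ∈ border P.G B u then
        insert ⟨j, hj⟩ ((border P.G B u).filter fun v : Fin P.n => (v : ℕ) < j)
      else (border P.G B u).filter fun v : Fin P.n => (v : ℕ) < j := by
    ext w
    have hlt : (w : ℕ) < j + 1 ↔ w = ⟨j, hj⟩ ∨ (w : ℕ) < j := by rw [Fin.ext_iff]; simp only; omega
    split_ifs with h
    · rw [mem_insert, mem_filter, mem_filter, hlt]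
      constructor
      · rintro ⟨h1, h2 | h2⟩
        exacts [.inl h2, .inr ⟨h1, h2⟩]
      · rintro (rfl | h2)
        exacts [⟨h, .inl rfl⟩, ⟨h2.1, .inr h2.2⟩]
    · rw [mem_filter, mem_filter, hlt]
      refine and_congr_right fun h1 => ⟨fun h2 => h2.resolve_left ?_, .inr⟩
      rintro rfl
      exact h h1
  have hrun : ((Program.seq (block [.natLoad 47 aMark 40, .natLoad 48 aBlk 40])
      (.ite (.natLt ZERO 47) (.ite (.natLt ZERO 48) (block [.natAdd 51 51 ONE]) skip) skip)).run
        s₂).nreg 51 = s₂.nreg 51 + if ⟨j, hj⟩ ∈ border P.G B u then 1 else 0 := by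
    rw [Program.run]
    set s₃ := (block [.natLoad 47 aMark 40, .natLoad 48 aBlk 40]).run s₂ with hs₃
    have e47 : s₃.nreg 47 = s.narr aMark j := by simp [hs₃, hj40, hna]
    have e48 : s₃.nreg 48 = s.narr aBlk j := by simp [hs₃, hj40, hna]
    have e0' : s₃.nreg ZERO = 0 := by simp [hs₃, e0]
    have e1' : s₃.nreg ONE = 1 := by simp [hs₃, e1]
    have e51 : s₃.nreg 51 = s₂.nreg 51 := by simp [hs₃]
    by_cases hr : Reach P.G B u ⟨j, hj⟩
    · rw [run_ite_pos (by simp [e0', e47, hMj.1 hr])]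
      by_cases hb : (⟨j, hj⟩ : Fin P.n) ∈ B
      · have : s.narr aBlk j ≠ 0 := fun h => hBj.1 h hb
        rw [run_ite_pos (by simp [e0', e48]; omega), if_pos (mem_border.2 ⟨hb, hr⟩)]
        simp [e51, e1']
      · rw [run_ite_neg (by simp [e0', e48, hBj.2 hb]), if_neg fun h => hb
          (mem_border.1 h).1]
        simp [e51]
    · rw [run_ite_neg (by simp [e0', e47, hMj.2 hr]), if_neg fun h => hr
        (mem_border.1 h).2]
      simp [e51]
  simp only [State.setN_nreg]
  rw [if_neg (by decide), hrun, h51, hsucc]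
  split_ifs
  · rw [card_insert_of_notMem (by simp)]
  · rfl

/-- Register `53` becomes `1` if every component of the graph without the blocked vertices has at
most `c` neighbours, otherwise `0`. -/
def checkBorders (c : ℕ) : Program :=
  .seq (block [.natConst 52 c, .natConst 53 1]) (forUp 42 0 (.seq markReach (.seq countBorder
    (.ite (.natLt 52 51) (block [.natConst 53 0]) skip))))

theorem countBorder_wN (x : ℕ) (h : countBorder.wN x) :
    x = 6 ∨ x = 40 ∨ x = 47 ∨ x = 48 ∨ x = 51 := by
  simp [countBorder] at h; omega

@[simp] theorem countBorder_wNA (x : ℕ) : ¬ countBorder.wNA x := by simp [countBorder]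
@[simp] theorem countBorder_wRA (x : ℕ) : ¬ countBorder.wRA x := by simp [countBorder]

theorem checkBorders_wN {c : ℕ} (x : ℕ) (h : (checkBorders c).wN x) :
    x = 6 ∨ (40 ≤ x ∧ x < 54) := by
  simp only [checkBorders, Program.wN, forUp_wN, block_wN, skip_wN] at h
  rcases h with (h | h) | h | h | h | h
  · omega
  · simp at h; omega
  · omega
  · have := markReach_wN x h; omega
  · have := countBorder_wN x h; omega
  · simp at h; omega

theorem checkBorders_wNA {c : ℕ} (x : ℕ) (h : (checkBorders c).wNA x) : x = aMark := by
  simp [checkBorders] at h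
  exact markReach_wNA x h

@[simp] theorem checkBorders_wRA {c : ℕ} (x : ℕ) : ¬ (checkBorders c).wRA x := by
  simp [checkBorders]

theorem checkBorders_runs (hI : InstanceMem P es s) (hes : IsEdgeList es) (hB : BlkMem B s) (c :
    ℕ) :
    Runs (checkBorders c) s (P.n * (P.n * (es.length * 15 + 17) + 15) + 5) fun s' =>
      (Bordered P.G B c → s'.nreg 53 = 1) ∧ (¬ Bordered P.G B c → s'.nreg 53 = 0) := by
  refine (Runs.seq (t₁ := 3) (t₂ := P.n * ((P.n * (es.length * 15 + 17) + 13) + 2) + 2)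
    (Runs.of_run_le (by simp) (by simp) fun ha₁ => ?_)).mono (by ring_nf; omega) fun _ _ h => h
  set s₁ := (block [.natConst 52 c, .natConst 53 1]).run s with hs₁
  have hI₁ : InstanceMem P es s₁ := hI.of_agree ha₁ (by simp; omega) (by simp) (by simp) (by simp)
    (by simp)
  have hw : ∀ x, (Program.seq markReach (.seq countBorder
      (.ite (.natLt 52 51) (block [.natConst 53 0]) skip))).wN x →
        x = 6 ∨ (40 ≤ x ∧ x < 54 ∧ x ≠ 42 ∧ x ≠ 52) := by
    intro x h
    simp only [Program.wN, block_wN, skip_wN] at h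
    rcases h with h | h | h
    · have := markReach_wN x h; omega
    · have := countBorder_wN x h; omega
    · simp at h; omega
  have hwa : ∀ x, (Program.seq markReach (.seq countBorder
      (.ite (.natLt 52 51) (block [.natConst 53 0]) skip))).wNA x → x = aMark := by
    intro x h
    simp at h
    exact markReach_wNA x h
  have hloop := Runs.forUp (i := 42) (b := 0) (p := .seq markReach (.seq countBorder
    (.ite (.natLt 52 51) (block [.natConst 53 0]) skip))) (s := s₁) (P.n *
      (es.length * 15 + 17) + 13)
    (fun j s' => ((∀ u : Fin P.n, (u : ℕ) < j → (border P.G B u).card ≤ c) → s'.nreg 53 = 1) ∧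
      (¬ (∀ u : Fin P.n, (u : ℕ) < j → (border P.G B u).card ≤ c) → s'.nreg 53 = 0))
    (fun h => by have := hw _ h; omega) (fun h => by have := hw _ h; omega)
    (fun h => by have := hw _ h; omega) (by decide) (by decide) hI₁.one
    (by simp [hs₁]) ?_
  · rw [hI₁.n] at hloop
    refine hloop.mono le_rfl fun s' _ ⟨h1, h2⟩ => ⟨fun h => h1 fun u _ => h u,
      fun h => h2 fun h' => h fun u => h' u u.2⟩
  rintro j s₂ hj hj42 ha₂ hinv
  rw [hI₁.n] at hj
  have hI₂ : InstanceMem P es s₂ := hI₁.of_agree ha₂ (fun x hx h => by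
      rcases forUp_wN.1 h with h | h
      · omega
      · have := hw x h; omega) (fun h => by have := hwa _ (by simpa using h); omega)
      (fun h => by have := hwa _ (by simpa using h); omega) (by simp) (by simp)
  have hB₂ : BlkMem B s₂ := hB.of_eq (by
    rw [ha₂.na _ fun h => by have := hwa _ (by simpa using h); omega, ha₁.na _ (by simp)])
  have e52 : s₂.nreg 52 = c := by
    rw [ha₂.n _ fun h => by
      rcases forUp_wN.1 h with h | h
      · omega
      · have := hw _ h; omega]
    simp [hs₁]
  refine (Runs.seq (t₁ := P.n * (es.length * 15 + 8) + 6) (t₂ := P.n * 9 + 4 + 3)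
    ((markReach_runs hI₂ hes hB₂ (u := ⟨j, hj⟩) hj42).mono le_rfl fun s₃ ha₃ hM _ =>
    Runs.seq ((countBorder_runs (hI₂.of_agree ha₃ (fun x hx h => by have := markReach_wN x h; omega)
      (fun h => by have := markReach_wNA _ h; omega) (fun h => by have := markReach_wNA _ h; omega)
      (by simp) (by simp)) (hB₂.of_eq (ha₃.na _ fun h => by have := markReach_wNA _ h; omega))
      hM).mono le_rfl fun s₄ ha₄ h51 _ => ?_))).mono (by ring_nf; omega) fun _ _ h => h
  have f52 : s₄.nreg 52 = c := by
    rw [ha₄.n _ fun h => by have := countBorder_wN _ h; omega,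
      ha₃.n _ fun h => by have := markReach_wN _ h; omega, e52]
  have f53 : s₄.nreg 53 = s₂.nreg 53 := by
    rw [ha₄.n _ fun h => by have := countBorder_wN _ h; omega,
      ha₃.n _ fun h => by have := markReach_wN _ h; omega]
  have hsucc : (∀ u : Fin P.n, (u : ℕ) < j + 1 → (border P.G B u).card ≤ c) ↔
      (∀ u : Fin P.n, (u : ℕ) < j → (border P.G B u).card ≤ c) ∧
        (border P.G B ⟨j, hj⟩).card ≤ c := by
    constructor
    · exact fun h => ⟨fun u hu => h u (by omega), h ⟨j, hj⟩ (by simp)⟩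
    · rintro ⟨h1, h2⟩ u hu
      rcases Nat.lt_succ_iff_lt_or_eq.1 hu with h | h
      · exact h1 u h
      · rwa [show u = ⟨j, hj⟩ from Fin.ext h]
  refine Runs.of_run_le (by simp) (by simp) ?_
  simp only [hsucc, State.setN_nreg]
  by_cases hc : (border P.G B ⟨j, hj⟩).card ≤ c
  · rw [run_ite_neg (by simp [f52, h51]; omega)]
    simpa [hc, f53] using hinv
  · rw [run_ite_pos (by simp [f52, h51]; omega)]
    simp [hc]

end

/-! ### Placing a tuple of vertices on the machine -/

section

variable {s s' : State} {es : List P.G.Dart} {B F M : Finset (Fin P.n)} {u v : Fin P.n} {c : ℕ}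
  {vert : ℕ → Fin P.n} {bag : ℕ → Finset ℕ} {col : ℕ → Fin K}

/-- Block the placed vertices. -/
def blockPlaced : Program := forUp 40 0 (block [.natLoad 41 aPos 40, .natStore aBlk 40 41])

theorem blockPlaced_runs (hI : InstanceMem P es s) (hp : PartialMem c vert bag col s) :
    Runs blockPlaced s (P.n * 5 + 2) (BlkMem (placed c vert)) := by
  have := Runs.forUp (i := 40) (b := 0) (p := block [.natLoad 41 aPos 40, .natStore aBlk 40 41])
    (s := s) 3 (fun j s' => ∀ i < j, s'.narr aBlk i = s.narr aPos i) (by simp) (by simp) (by simp)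
    (by decide) (by decide) hI.one (by simp) (fun j s' _ hj40 ha' hI' =>
      Runs.of_run_le (by simp) (by simp) fun i hi => by
        have h9 : s'.narr aPos = s.narr aPos := ha'.na _ (by simp)
        by_cases hij : i = j
        · simp [hj40, h9, hij]
        · simpa [hj40, hij] using hI' i (by omega))
  rw [hI.n] at this
  refine this.mono le_rfl fun s' _ h v => ?_
  rw [h v v.2, mem_placed]
  rcases hp.pos_cases v with ⟨h1, h2⟩ | ⟨t, ht, h1, h2⟩
  · simpa [h1] using h2
  · simp only [h2, Nat.add_eq_zero_iff, one_ne_zero, and_false, false_iff, not_not]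
    exact ⟨t, ht, h1⟩

/-- Block the vertices in the registers `fam 6 i`. -/
def blockTuple (D : ℕ) : Program :=
  seqs ((List.finRange D).map fun i : Fin D => .instr (.natStore aBlk (fam 6 i) ONE))

theorem blockTuple_run {D : ℕ} {x : Fin D → Fin P.n} (h1 : s.nreg ONE = 1) (hB : BlkMem B s)
    (hx : ∀ i : Fin D, s.nreg (fam 6 i) = x i) :
    BlkMem (B ∪ univ.image x) ((blockTuple D).run s) := by
  have := run_seqs_induction (List.finRange D)
    (fun i : Fin D => .instr (.natStore aBlk (fam 6 i) ONE))
    (fun l s' => (∀ v : Fin P.n, s'.narr aBlk v = 0 ↔ v ∉ B ∧ ∀ i ∈ l, x i ≠ v) ∧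
      s'.nreg ONE = 1 ∧ ∀ i : Fin D, s'.nreg (fam 6 i) = x i) s ⟨by simpa [BlkMem] using hB, h1, hx⟩
    (fun l s' h => by simpa using h) (by
      rintro l a s' - - ⟨h, h1, hx⟩
      refine ⟨fun v => ?_, by simpa using h1, by simpa using hx⟩
      by_cases hv : x a = v
      · simp [hx, h1, ← hv]
      · have : (v : ℕ) ≠ x a := fun h => hv (Fin.ext h.symm)
        simp only [Program.run, Instr.apply, hx, h1, update_self,
          update_of_ne this, h v, List.mem_append, List.mem_singleton, ne_eq]
        constructor
        · rintro ⟨h1, h2⟩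
          exact ⟨h1, by rintro i (hi | rfl); exacts [h2 i hi, hv]⟩
        · exact fun h => ⟨h.1, fun i hi => h.2 i (.inl hi)⟩)
  intro v
  rw [blockTuple, this.1 v]
  simp

/-- Collect the placed vertices that are marked, and the root. -/
def gatherMarked (K : ℕ) : Program :=
  .seq (clearSlots K) (.seq (forUp 40 0 (.seq (block [.natLoad 47 aMark 40])
    (.ite (.natLt ZERO 47) (.seq (block [.natAdd 23 40 ZERO]) (addSlot K)) skip)))
    (.seq (block [.natAdd 23 2 ZERO]) (addSlot K)))

theorem gatherMarked_wN (x : ℕ) (h : (gatherMarked K).wN x) :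
    x = 6 ∨ x = 7 ∨ (22 < x ∧ x < 26) ∨ x = 40 ∨ x = 47 ∨ ∃ k, x = fam 5 k := by
  simp only [gatherMarked, Program.wN, forUp_wN, block_wN, skip_wN] at h
  rcases h with h | (h | h | (h | h) | h) | h | h
  · have := clearSlots_wN x h; tauto
  · omega
  · simp at h; omega
  · simp at h; omega
  · have := addSlot_wN x h; grind
  · omega
  · simp at h; omega
  · have := addSlot_wN x h; grind

@[simp] theorem gatherMarked_wNA (x : ℕ) : ¬ (gatherMarked K).wNA x := by simp [gatherMarked]
@[simp] theorem gatherMarked_wRA (x : ℕ) : ¬ (gatherMarked K).wRA x := by simp [gatherMarked]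

theorem gatherMarked_runs (hI : InstanceMem P es s) (hp : PartialMem c vert bag col s) (hc : 0 < c)
    (hfull : FullBags P.G c vert bag)
    (hM : ∀ w : Fin P.n, (Reach P.G (placed c vert) v w → s.narr aMark w = 1) ∧
        (¬ Reach P.G (placed c vert) v w → s.narr aMark w = 0)) :
    Runs (gatherMarked K) s (P.n * (3 * K + 14) + 4 * K + 12)
      (SlotRegs col (borderBag P.G c vert v)) := by
  classical
  have hinj : ∀ t ∈ borderBag P.G c vert v, ∀ u ∈ borderBag P.G c vert v, col u = col t → u = t :=
    fun t ht u hu hc => hp.isPartial.col_inj (fun u hu => (mem_borderBag.1 hu).1)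
      (hfull.closed hp.isPartial) hu ht hc
  refine (Runs.seq (t₁ := K + 1) (t₂ := (P.n * ((3 * K + 12) + 2) + 2) + (2 + (3 * K + 7)))
    (Runs.of_run_le clearSlots_loopFree clearSlots_len.le fun ha₁ => ?_)).mono
      (by ring_nf; omega) fun _ _ h => h
  have hR₁ := clearSlots_run (K := K) (col := col) s
  set s₁ := (clearSlots K).run s with hs₁
  have hw₁ : ∀ x < 64, x ≠ 6 → ¬ (clearSlots K).wN x := fun x hx h6 h => by
    rcases clearSlots_wN x h with h | ⟨k, h⟩
    · exact h6 h
    · have := le_fam 5 k; omega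
  have hI₁ := hI.of_agree ha₁ (fun x hx => hw₁ x (by omega) (by omega)) (by simp) (by simp)
    (by simp) (by simp)
  have hp₁ := hp.of_agree ha₁ (hw₁ _ (by simp) (by simp)) (by simp) (by simp) (by simp) (by simp)
  set body : Program := .seq (block [.natLoad 47 aMark 40])
    (.ite (.natLt ZERO 47) (.seq (block [.natAdd 23 40 ZERO]) (addSlot K)) skip) with hbody
  have hw : ∀ x, x < 64 ∧ x ≠ 6 ∧ x ≠ 7 ∧ ¬ (22 < x ∧ x < 26) ∧ x ≠ 47 → ¬ body.wN x := by
    intro x hx h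
    simp only [hbody, Program.wN, block_wN, skip_wN] at h
    rcases h with h | (h | h) | h
    · simp at h; omega
    · simp at h; omega
    · rcases addSlot_wN x h with h | h | h | h | ⟨k, h⟩
      any_goals omega
      have := le_fam 5 k; omega
    · omega
  have hw₂ : ∀ s₂, Agree (forUp 40 0 body) s₁ s₂ → ∀ x, x < 40 ∧ x ≠ 6 ∧ x ≠ 7 ∧
      ¬ (22 < x ∧ x < 26) → s₂.nreg x = s₁.nreg x := fun s₂ ha₂ x hx => ha₂.n x (by
    rw [forUp_wN]; rintro (h | h)
    · omega
    · exact hw x (by omega) h)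
  have hwa : ∀ x, ¬ body.wNA x := by simp [hbody]
  -- the part of the bag that has been collected before the `j`-th round
  let C : ℕ → Finset ℕ := fun j => (borderBag P.G c vert v).filter fun i =>
    Reach P.G (placed c vert) v (vert i) ∧ (vert i : ℕ) < j
  have hloop := Runs.forUp (i := 40) (b := 0) (p := body) (s := s₁) (3 * K + 12)
    (fun j => SlotRegs col (C j))
    (hw _ (by simp)) (hw _ (by simp)) (hw _ (by simp))
    (by decide) (by decide)
    hI₁.one (by
      simp only [C, Nat.not_lt_zero, and_false, Finset.filter_false]
      exact hR₁.of_eq (by simp)) ?_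
  · rw [hI₁.n] at hloop
    refine Runs.seq (hloop.mono le_rfl fun s₂ ha₂ hR₂ _ => ?_)
    have g : ∀ x < 6, s₂.nreg x = s₁.nreg x := fun x hx => hw₂ s₂ ha₂ x (by omega)
    have hp₂ := hp₁.of_eq (s' := s₂) (hw₂ s₂ ha₂ _ (by omega)) (ha₂.na _ (by simpa using hwa _))
      (ha₂.na _ (by simpa using hwa _))
      (ha₂.na _ (by simpa using hwa _)) fun k => ha₂.na _ (by simpa using hwa _)
    refine Runs.of_run_le (by simp [addSlot_loopFree]) (by
      have := addSlot_len (K := K); simp; omega) ?_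
    set s₃ := (block [.natAdd 23 2 ZERO]).run s₂ with hs₃
    have hR₃ : SlotRegs col (C P.n) s₃ := hR₂.of_eq (by simp [hs₃])
    have hp₃ : PartialMem c vert bag col s₃ := hp₂.of_eq (by simp [hs₃])
      (by simp [hs₃]) (by simp [hs₃]) (by simp [hs₃])
      (by simp [hs₃])
    have h0mem : 0 ∈ borderBag P.G c vert v := mem_borderBag.2 ⟨hc, .inl rfl⟩
    have := addSlot_run_placed hp₃ (by simp [hs₃, g, hI₁.zero])
      (by simp [hs₃, g, hI₁.one]) hc
      (by rw [hp₃.isPartial.root hc]; simp [hs₃, g, hI₁.zero, hI₁.root]) hR₃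
      (fun u hu hc => hinj 0 h0mem u (mem_filter.1 hu).1 hc)
    have heq : insert 0 (C P.n) = borderBag P.G c vert v := by
      ext u
      simp only [C, mem_insert, mem_filter, Fin.is_lt, and_true]
      constructor
      · rintro (rfl | hu)
        exacts [h0mem, hu.1]
      · intro hu
        rcases (mem_borderBag.1 hu).2 with rfl | h
        exacts [.inl rfl, .inr ⟨hu, h⟩]
    rw [heq] at this
    exact this
  · intro j s₂ hj hj40 ha₂ hR₂
    rw [hI₁.n] at hj
    have g : ∀ x < 6, s₂.nreg x = s₁.nreg x := fun x hx => hw₂ s₂ ha₂ x (by omega)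
    have hp₂ := hp₁.of_eq (s' := s₂) (hw₂ s₂ ha₂ _ (by omega)) (ha₂.na _ (by simpa using hwa _))
      (ha₂.na _ (by simpa using hwa _))
      (ha₂.na _ (by simpa using hwa _)) fun k => ha₂.na _ (by simpa using hwa _)
    have hMj := hM ⟨j, hj⟩
    have h18 : s₂.narr aMark = s.narr aMark := by
      rw [ha₂.na _ (by simpa using hwa _), ha₁.na _ (by simp)]
    refine Runs.of_run_le (by simp [hbody, addSlot_loopFree]) (by
      have := addSlot_len (K := K); simp [hbody]; omega) ?_
    suffices h : SlotRegs col (C (j + 1)) (body.run s₂) from h.of_eq (by simp)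
    -- nothing is added unless the vertex `j` is placed and marked
    have hsame : (∀ i ∈ borderBag P.G c vert v, Reach P.G (placed c vert) v (vert i) →
        (vert i : ℕ) ≠ j) → C (j + 1) = C j := fun h => by
      refine Finset.filter_congr fun i hi => and_congr_right fun hr => ?_
      have := h i hi hr
      omega
    rw [hbody, Program.run]
    set s₃ := (block [.natLoad 47 aMark 40]).run s₂ with hs₃
    have e47 : s₃.nreg 47 = s.narr aMark j := by simp [hs₃, hj40, h18]
    have e0 : s₃.nreg ZERO = 0 := by simp [hs₃, g, hI₁.zero]
    have hR₃ : SlotRegs col (C j) s₃ := hR₂.of_eq (by simp [hs₃])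
    by_cases hr : Reach P.G (placed c vert) v ⟨j, hj⟩
    · rw [run_ite_pos (by simp [e0, e47, (hMj.1 hr : s.narr aMark j = 1)]), Program.run]
      set s₄ := (block [.natAdd 23 40 ZERO]).run s₃ with hs₄
      have e23 : s₄.nreg 23 = j := by simp [hs₄, hs₃, hj40, g, hI₁.zero]
      have f0 : s₄.nreg ZERO = 0 := by simp [hs₄, e0]
      have f1 : s₄.nreg ONE = 1 := by simp [hs₄, hs₃, g, hI₁.one]
      have hR₄ : SlotRegs col (C j) s₄ := hR₃.of_eq (by simp [hs₄])
      have hp₄ : PartialMem c vert bag col s₄ := hp₂.of_eq (by simp [hs₄, hs₃])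
        (by simp [hs₄, hs₃]) (by simp [hs₄, hs₃])
        (by simp [hs₄, hs₃]) (by simp [hs₄, hs₃])
      rcases hp₄.pos_cases ⟨j, hj⟩ with ⟨hz, hne⟩ | ⟨t, ht, hvt, -⟩
      · rw [hsame fun i hi _ h => hne i (mem_borderBag.1 hi).1 (Fin.ext h)]
        exact addSlot_run_unplaced f0 (by rw [e23]; exact hz) hR₄
      · have htB : t ∈ borderBag P.G c vert v := mem_borderBag.2 ⟨ht, .inr (by rwa [hvt])⟩
        have := addSlot_run_placed hp₄ f0 f1 ht (by rw [e23, hvt]) hR₄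
          fun u hu hc => hinj t htB u (mem_filter.1 hu).1 hc
        have heq : insert t (C j) = C (j + 1) := by
          ext i
          simp only [C, mem_insert, mem_filter]
          constructor
          · rintro (rfl | h)
            · exact ⟨htB, by rwa [hvt], by rw [hvt]; simp⟩
            · exact ⟨h.1, h.2.1, by omega⟩
          · rintro ⟨h1, h2, h3⟩
            by_cases hij : (vert i : ℕ) = j
            · exact .inl (hp.isPartial.inj i (mem_borderBag.1 h1).1 t ht
                (Fin.ext (by rw [hij, hvt])))
            · exact .inr ⟨h1, h2, by omega⟩
        rwa [heq] at this
    · rw [run_ite_neg (by simp [e0, e47, (hMj.2 hr : s.narr aMark j = 0)])]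
      rw [hsame fun i _ h hi => hr (by rwa [show (⟨j, hj⟩ : Fin P.n) = vert i from Fin.ext
        hi.symm])]
      exact hR₃.of_eq (by simp)

/-- The memory describes a partial elimination scheme with full bags on the set `F` of vertices. -/
def Stage (K : ℕ) (es : List P.G.Dart) (F : Finset (Fin P.n)) (s : State) : Prop :=
  InstanceMem P es s ∧ ∃ (c : ℕ) (vert : ℕ → Fin P.n) (bag : ℕ → Finset ℕ) (col : ℕ → Fin K),
    PartialMem c vert bag col s ∧ 0 < c ∧ (col 0 : ℕ) = 0 ∧ FullBags P.G c vert bag ∧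
      placed c vert = F

theorem Stage.of_agree (h : Stage K es F s) {p : Program} (ha : Agree p s s')
    (hn : ∀ x < 40, p.wN x → x = 6 ∨ x = 7 ∨ (22 < x ∧ x < 27)) (hna : ∀ x,
      p.wNA x → 13 ≤ x ∧ x < 64)
    (hra : ∀ x, ¬ p.wRA x) : Stage K es F s' := by
  obtain ⟨hI, c, vert, bag, col, hp, h'⟩ := h
  refine ⟨hI.of_agree ha (fun x hx h => ?_) (fun h => ?_) (fun h => ?_) (hra _) (hra _),
    c, vert, bag, col, hp.of_agree ha (fun h => ?_) (fun h => ?_) (fun h => ?_) (fun h => ?_)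
      (fun k h => ?_), h'⟩
  any_goals have := hna _ h; omega
  · have := hn x (by omega) h; omega
  · have := hn _ (by omega) h; omega
  · have := hna _ h; have := le_fam 0 (k : ℕ); omega

/-- Place the vertex in register `x`, unless it has been placed already. -/
def placeFrom (K x : ℕ) : Program :=
  .seq (block [.natAdd 42 x ZERO, .natLoad 47 aPos 42]) (.ite (.natLt ZERO 47) skip
    (.seq blockPlaced (.seq markReach (.seq (gatherMarked K) (.seq (block [.natAdd 23 42 ZERO])
      (placeVertex K))))))

theorem placeFrom_wN {x : ℕ} (y : ℕ) (h : (placeFrom K x).wN y) :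
    y = 6 ∨ y = 7 ∨ (22 ≤ y ∧ y < 27) ∨ (40 ≤ y ∧ y < 54) ∨ ∃ k, y = fam 5 k := by
  simp only [placeFrom, blockPlaced, Program.wN, block_wN, skip_wN, forUp_wN] at h
  rcases h with h | h | (h | h) | h | h | h | h
  · simp at h; omega
  · omega
  · omega
  · simp at h; omega
  · have := markReach_wN y h; omega
  · have := gatherMarked_wN y h; grind
  · simp at h; omega
  · have := placeVertex_wN y h; omega

theorem placeFrom_wNA {x : ℕ} (y : ℕ) (h : (placeFrom K x).wNA y) :
    y = aVert ∨ y = aPos ∨ y = aCol ∨ y = aBlk ∨ y = aMark ∨ ∃ k, y = fam fSlot k := by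
  simp only [placeFrom, blockPlaced, Program.wNA, block_wNA, skip_wNA, forUp_wNA,
    gatherMarked_wNA] at h
  rcases h with h | h | h | h | h | h | h
  · simp at h
  · exact h.elim
  · simp at h; omega
  · have := markReach_wNA y h; omega
  · exact h.elim
  · simp at h
  · have := placeVertex_wNA y h; grind

@[simp] theorem placeFrom_wRA {x : ℕ} (y : ℕ) : ¬ (placeFrom K x).wRA y := by
  simp [placeFrom, blockPlaced]

theorem placeFrom_runs (hes : IsEdgeList es) (hS : Stage K es F s) {x : ℕ} (hx : s.nreg x = v)
    (hcard : v ∉ F → (border P.G F v).card + 1 < K) :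
    Runs (placeFrom K x) s (P.n * (es.length * 15 + 3 * K + 27) + 7 * K + 32)
      (Stage K es (F ∪ {v})) := by
  refine (Runs.seq (t₁ := 3) (t₂ := (P.n * 5 + 2 + ((P.n * (es.length * 15 + 8) + 6) +
    ((P.n * (3 * K + 14) + 4 * K + 12) + (2 + (3 * K + 6))))) + 1)
    (Runs.of_run_le (by simp) (by simp) fun ha₁ => ?_)).mono (by ring_nf; omega) fun _ _ h => h
  have hS₁ : Stage K es F ((block [.natAdd 42 x ZERO, .natLoad 47 aPos 42]).run s) :=
    hS.of_agree ha₁ (fun y _ h => by simp at h; omega) (by simp) (by simp)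
  obtain ⟨hI, -⟩ := hS
  set s₁ := (block [.natAdd 42 x ZERO, .natLoad 47 aPos 42]).run s with hs₁
  obtain ⟨hI₁, c, vert, bag, col, hp, hc, hcol, hfull, rfl⟩ := id hS₁
  have e42 : s₁.nreg 42 = v := by simp [hs₁, hx, hI.zero]
  have e47 : s₁.nreg 47 = s₁.narr aPos v := by simp [hs₁, hx, hI.zero]
  have e0 := hI₁.zero
  rcases hp.pos_cases v with ⟨hz, hne⟩ | ⟨t, ht, hvt, hpos⟩
  swap
  · refine Runs.ite (fun _ => Runs.of_run_le (by simp) (by simp; omega) ?_) fun h => ?_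
    · rw [Finset.union_eq_left.2 (Finset.singleton_subset_iff.2 (mem_placed.2 ⟨t, ht, hvt⟩))]
      exact hS₁.of_agree (p := skip) (Program.LoopFree.agree (by simp) _) (by simp; omega) (by simp)
        (by simp)
    · exact (h (by simp [e0, e47, hpos])).elim
  have hvF : v ∉ placed c vert := fun h => by
    obtain ⟨t, ht, h⟩ := mem_placed.1 h
    exact hne t ht h
  refine Runs.ite (fun h => ?_) fun _ => ?_
  · simp [e47, hz] at h
  refine Runs.seq ((blockPlaced_runs hI₁ hp).mono le_rfl fun s₂ ha₂ hB₂ _ => ?_)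
  have hS₂ : Stage K es (placed c vert) s₂ := hS₁.of_agree ha₂
    (fun y _ h => by simp [blockPlaced] at h; omega) (fun y h => by simp [blockPlaced] at h; omega)
    (by simp [blockPlaced])
  have f42 : s₂.nreg 42 = v := by rw [ha₂.n _ (by simp [blockPlaced]), e42]
  refine Runs.seq ((markReach_runs hS₂.1 hes hB₂ f42).mono le_rfl fun s₃ ha₃ hM₃ _ => ?_)
  have hw₃ : ∀ y < 40, y ≠ 6 → s₃.nreg y = s₁.nreg y := fun y hy h6 => by
    rw [ha₃.n _ fun h => by have := markReach_wN _ h; omega,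
      ha₂.n _ (by simp [blockPlaced]; omega)]
  have hwa₃ : ∀ y, y ≠ aBlk → y ≠ aMark → s₃.narr y = s₁.narr y := fun y h h' => by
    rw [ha₃.na _ fun h => by have := markReach_wNA _ h; omega,
      ha₂.na _ (by simp [blockPlaced]; omega)]
  have hS₃ : Stage K es (placed c vert) s₃ := hS₂.of_agree ha₃
    (fun y _ h => by have := markReach_wN y h; omega)
    (fun y h => by have := markReach_wNA y h; omega) (by simp)
  have hp₃ : PartialMem c vert bag col s₃ := hp.of_eq (hw₃ _ (by omega) (by omega))
    (hwa₃ _ (by omega) (by omega)) (hwa₃ _ (by omega) (by omega)) (hwa₃ _ (by omega) (by omega))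
    fun k => hwa₃ _ (by have := le_fam 0 (k : ℕ); omega) (by have := le_fam 0 (k : ℕ); omega)
  have g42 : s₃.nreg 42 = v := by
    rw [ha₃.n _ fun h => by have := markReach_wN _ h; omega, f42]
  refine Runs.seq ((gatherMarked_runs hS₃.1 hp₃ hc hfull hM₃).mono le_rfl
    fun s₄ ha₄ hR₄ _ => ?_)
  have hw₄ : ∀ y < 64, gatherMarked K |>.wN y → y = 6 ∨ y = 7 ∨
    (22 < y ∧ y < 26) ∨ y = 40 ∨ y = 47 := by
    intro y hy h
    rcases gatherMarked_wN y h with h | h | h | h | h | ⟨k, h⟩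
    any_goals omega
    have := le_fam 5 k; omega
  have hI₄ : InstanceMem P es s₄ := hS₃.1.of_agree ha₄ (fun y hy h => by
    have := hw₄ y (by omega) h; omega) (by simp) (by simp) (by simp) (by simp)
  have hp₄ : PartialMem c vert bag col s₄ := hp₃.of_agree ha₄ (fun h => by
    have := hw₄ _ (by omega) h; omega) (by simp) (by simp) (by simp) (by simp)
  have k42 : s₄.nreg 42 = v := by
    rw [ha₄.n _ fun h => by have := hw₄ _ (by omega) h; omega, g42]
  refine (Runs.of_run_le (by simp [placeVertex_loopFree]) (by
    have := placeVertex_len (K := K); simp; omega) ?_).mono le_rfl fun _ _ h => h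
  rw [Program.run]
  set s₅ := (block [.natAdd 23 42 ZERO]).run s₄ with hs₅
  have ha₅ : Agree (block [.natAdd 23 42 ZERO]) s₄ s₅ := Program.LoopFree.agree (by simp) _
  have hI₅ : InstanceMem P es s₅ := hI₄.of_agree ha₅ (by simp; omega) (by simp) (by simp) (by simp)
    (by simp)
  have hp₅ : PartialMem c vert bag col s₅ := hp₄.of_agree ha₅ (by simp) (by simp) (by simp)
    (by simp) (by simp)
  obtain ⟨k, hk⟩ := placeVertex_run hp₅ hc hI₅.zero hI₅.one (v := v)
    (by simp [hs₅, k42, hI₄.zero]) hne (hR₄.of_eq (by simp [hs₅]))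
    ((card_borderBag_le hp.isPartial).trans_lt (hcard hvF)) (fun u hu => (mem_borderBag.1 hu).1)
    (mem_borderBag.2 ⟨hc, .inl rfl⟩) (fun u hu hadj => mem_borderBag.2 ⟨hu, .inr
      (.single ⟨hvF, hadj⟩)⟩) (hfull.closed hp.isPartial)
  refine ⟨hI₅.of_agree (Program.LoopFree.agree placeVertex_loopFree _) (fun y hy h => by
    have := placeVertex_wN y h; omega) (fun h => ?_) (fun h => ?_) (by simp) (by simp),
    _, _, _, _, hk, by omega, ?_, hfull.place v, placed_update v⟩
  · rcases placeVertex_wNA _ h with h | h | h | ⟨k, h⟩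
    any_goals omega
    have := le_fam 0 k; omega
  · rcases placeVertex_wNA _ h with h | h | h | ⟨k, h⟩
    any_goals omega
    have := le_fam 0 k; omega
  · rw [update_of_ne (by omega)]; exact hcol

end

/-! ### The search for an elimination scheme -/

theorem _root_.RAM.Runs.seqs {α : Type*} (l : List α) (f : α → Program) (τ : ℕ)
    (I : List α → State → Prop) {s : State} (h0 : I [] s)
    (hskip : ∀ s', I l s' → I l (s'.setN 6 0))
    (hstep : ∀ l₁ a l₂ s', l₁ ++ a :: l₂ = l → I l₁ s' → Runs (f a) s' τ (I (l₁ ++ [a]))) :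
    Runs (RAM.seqs (l.map f)) s (l.length * τ + 1) (I l) := by
  suffices h : ∀ l₂ l₁ s, l₁ ++ l₂ = l → I l₁ s →
      Runs (RAM.seqs (l₂.map f)) s (l₂.length * τ + 1) (I l) from h l [] s rfl h0
  intro l₂
  induction l₂ with
  | nil =>
    intro l₁ s hl h
    rw [List.append_nil] at hl
    subst hl
    exact Runs.of_run_le (by simp [RAM.seqs]) (by simp [RAM.seqs]) (hskip s h)
  | cons a l₂ ih =>
    intro l₁ s hl h
    exact (Runs.seq ((hstep l₁ a l₂ s hl h).mono le_rfl fun s' _ h' _ =>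
      ih (l₁ ++ [a]) s' (by simpa using hl) h')).mono (by simp; ring_nf; omega) fun _ _ h => h

section

variable {s s' : State} {es : List P.G.Dart} {F : Finset (Fin P.n)} {q : ℕ}

/-- The number of colours that suffices for the search. -/
abbrev searchColours (q : ℕ) : ℕ := 3 * q + 3

/-- Place the vertices in the registers `fam 6 i`, if the components of the rest then have at most
`2 * q + 1` neighbours. -/
def tryTuple (q : ℕ) : Program :=
  .seq blockPlaced (.seq (blockTuple (q + 1)) (.seq (checkBorders (2 * q + 1))
    (.ite (.natLt ZERO 53) (seqs ((List.finRange (q + 1)).map fun i : Fin (q + 1) =>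
      placeFrom (searchColours q) (fam 6 i))) skip)))

theorem tryTuple_wN (x : ℕ) (h : (tryTuple q).wN x) :
    x = 6 ∨ x = 7 ∨ (22 ≤ x ∧ x < 27) ∨ (40 ≤ x ∧ x < 54) ∨ ∃ k, x = fam 5 k := by
  simp only [tryTuple, Program.wN, skip_wN, blockTuple, seqs_wN, List.mem_map] at h
  rcases h with h | (h | ⟨_, ⟨i, -, rfl⟩, h⟩) | h | (h | ⟨_, ⟨i, -, rfl⟩, h⟩) | h
  · simp [blockPlaced] at h; omega
  · omega
  · simp at h
  · have := checkBorders_wN x h; omega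
  · omega
  · exact placeFrom_wN x h
  · omega

theorem tryTuple_wNA (x : ℕ) (h : (tryTuple q).wNA x) :
    x = aVert ∨ x = aPos ∨ x = aCol ∨ x = aBlk ∨ x = aMark ∨ ∃ k, x = fam fSlot k := by
  simp only [tryTuple, Program.wNA, skip_wNA, blockTuple, seqs_wNA, List.mem_map] at h
  rcases h with h | ⟨_, ⟨i, -, rfl⟩, h⟩ | h | ⟨_, ⟨i, -, rfl⟩, h⟩ | h
  · simp [blockPlaced] at h; omega
  · simp at h; omega
  · have := checkBorders_wNA x h; omega
  · exact placeFrom_wNA x h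
  · exact h.elim

@[simp] theorem tryTuple_wRA (x : ℕ) : ¬ (tryTuple q).wRA x := by
  simp only [tryTuple, Program.wRA, skip_wRA, blockTuple, seqs_wRA, List.mem_map]
  rintro (h | ⟨_, ⟨i, -, rfl⟩, h⟩ | h | ⟨_, ⟨i, -, rfl⟩, h⟩ | h)
  · simp [blockPlaced] at h
  · simp at h
  · simp at h
  · simp at h
  · exact h

theorem tryTuple_runs (hes : IsEdgeList es) (hS : Stage (searchColours q) es F s)
    (hF : Bordered P.G F (2 * q + 1)) {x : Fin (q + 1) → Fin P.n}
    (hx : ∀ i : Fin (q + 1), s.nreg (fam 6 i) = x i) :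
    Runs (tryTuple q) s (P.n * (P.n * (es.length * 15 + 17) + 20) + q + 11 +
        (q + 1) * (P.n * (es.length * 15 + 9 * q + 36) + 21 * q + 53))
      fun s' => ∃ F', Stage (searchColours q) es F' s' ∧ Bordered P.G F' (2 * q + 1) ∧ F ⊆ F' ∧
        (Bordered P.G (F ∪ univ.image x) (2 * q + 1) → univ.image x ⊆ F') := by
  classical
  refine (Runs.seq (t₁ := P.n * 5 + 2) (t₂ := (q + 2) +
    ((P.n * (P.n * (es.length * 15 + 17) + 15) + 5) + (((q + 1) *
      (P.n * (es.length * 15 + 3 * searchColours q + 27) + 7 * searchColours q + 32) + 1) + 1)))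
        ?_).mono
    (by simp only [searchColours]; ring_nf; omega) fun _ _ h => h
  obtain ⟨hI, c, vert, bag, col, hp, hp'⟩ := id hS
  refine (blockPlaced_runs hI hp).mono le_rfl fun s₁ ha₁ hB₁ _ => Runs.seq (Runs.of_run_le
    (by simp [blockTuple]) ?_ fun ha₂ => ?_)
  · have := seqs_map_len_le (l := List.finRange (q + 1))
      (f := fun i : Fin (q + 1) => .instr (.natStore aBlk (fam 6 i) ONE)) (c := 1) (by simp)
    simp at this
    simp only [blockTuple]
    omega
  rw [hp'.2.2.2] at hB₁
  have hS₁ : Stage (searchColours q) es F s₁ := hS.of_agree ha₁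
    (fun y _ h => by simp [blockPlaced] at h; omega) (fun y h => by simp [blockPlaced] at h; omega)
    (by simp [blockPlaced])
  have hx₁ : ∀ i : Fin (q + 1), s₁.nreg (fam 6 i) = x i := fun i => by
    rw [ha₁.n _ (by simp [blockPlaced]), hx]
  have hB₂ := blockTuple_run hS₁.1.one hB₁ hx₁
  set s₂ := (blockTuple (q + 1)).run s₁ with hs₂
  have hS₂ : Stage (searchColours q) es F s₂ := hS₁.of_agree ha₂
    (fun y _ h => by simp [blockTuple] at h; omega) (fun y h => by simp [blockTuple] at h; omega)
    (by simp [blockTuple])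
  refine Runs.seq ((checkBorders_runs hS₂.1 hes hB₂ (2 * q + 1)).mono le_rfl fun s₃ ha₃ h53 _ => ?_)
  have hS₃ : Stage (searchColours q) es F s₃ := hS₂.of_agree ha₃
    (fun y _ h => by have := checkBorders_wN y h; omega)
    (fun y h => by have := checkBorders_wNA y h; omega) (by simp)
  have hx₃ : ∀ i : Fin (q + 1), s₃.nreg (fam 6 i) = x i := fun i => by
    rw [ha₃.n _ fun h => by have := checkBorders_wN _ h; have := le_fam 6 (i : ℕ); omega,
      ha₂.n _ (by simp [blockTuple]), hx₁]
  refine Runs.ite (fun h => ?_) fun h => ?_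
  swap
  · refine Runs.of_run_le (by simp) (by simp) ⟨F, ?_, hF, subset_rfl, fun hb => ?_⟩
    · exact hS₃.of_agree (p := skip) (Program.LoopFree.agree (by simp) _) (by simp; omega) (by simp)
        (by simp)
    · exact (h (by simp [h53.1 hb, hS₃.1.zero])).elim
  have hb : Bordered P.G (F ∪ univ.image x) (2 * q + 1) := by
    by_contra hcon
    simp [h53.2 hcon] at h
  have hrun := Runs.seqs (List.finRange (q + 1)) (fun i : Fin (q + 1) =>
      placeFrom (searchColours q) (fam 6 i))
    (P.n * (es.length * 15 + 3 * searchColours q + 27) + 7 * searchColours q + 32)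
    (fun l s' => Stage (searchColours q) es (F ∪ (l.map x).toFinset) s' ∧
      ∀ i : Fin (q + 1), s'.nreg (fam 6 i) = x i) (s := s₃) ⟨by simpa using hS₃, hx₃⟩
    (fun s' h => ⟨h.1.of_agree (agree_apply (.natConst 6 0) s') (by simp; omega) (by simp)
      (by simp),
      by simpa using h.2⟩) ?_
  · rw [List.length_finRange] at hrun
    refine hrun.mono (by omega) fun s' _ ⟨h, _⟩ => ⟨F ∪ univ.image x, ?_, hb,
      subset_union_left, fun _ => Finset.subset_union_right⟩
    have : ((List.finRange (q + 1)).map x).toFinset = univ.image x := by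
      ext v; simp
    rwa [this] at h
  · rintro l₁ a l₂ s' hl ⟨hS', hx'⟩
    have hlen : l₁.length ≤ q := by
      have := congrArg List.length hl
      simp at this
      omega
    refine (placeFrom_runs hes hS' (hx' a) fun _ => ?_).mono le_rfl fun s'' ha'' hS'' => ⟨?_,
      fun i => ?_⟩
    · have h1 := card_le_card (border_union_subset P.G F (l₁.map x).toFinset (x a))
      have h2 := Finset.card_union_le (border P.G F (x a)) (l₁.map x).toFinset
      have h3 := (l₁.map x).toFinset_card_le
      have h4 := hF (x a)
      rw [List.length_map] at h3
      simp only [searchColours]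
      omega
    · have : (List.map x (l₁ ++ [a])).toFinset = (l₁.map x).toFinset ∪ {x a} := by
        rw [List.map_append, List.toFinset_append]; rfl
      rw [this, ← Finset.union_assoc]
      exact hS''
    · rw [ha''.n _ fun h => ?_, hx']
      rcases placeFrom_wN _ h with h | h | h | h | ⟨k, h⟩
      any_goals have := le_fam 6 (i : ℕ); omega
      simp at h

/-- Run `p` for all values below the number in register `0` of the registers `fam 6 i`, `i < d`. -/
def tuples (p : Program) : ℕ → Program
  | 0 => p
  | d + 1 => forUp (fam 6 d) 0 (tuples p d)

/-- A bound for the running time of `tuples p d`, if that of `p` is `τ`. -/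
def tuplesTime (n τ : ℕ) : ℕ → ℕ
  | 0 => τ
  | d + 1 => n * (tuplesTime n τ d + 2) + 2

theorem tuples_wN {p : Program} {d : ℕ} (x : ℕ) (h : (tuples p d).wN x) :
    p.wN x ∨ ∃ i < d, x = fam 6 i := by
  induction d with
  | zero => exact .inl h
  | succ d ih =>
    rcases forUp_wN.1 h with h | h
    · exact .inr ⟨d, by omega, h⟩
    · rcases ih h with h | ⟨i, hi, h⟩
      exacts [.inl h, .inr ⟨i, by omega, h⟩]

theorem tuples_wNA {p : Program} {d : ℕ} (x : ℕ) : (tuples p d).wNA x ↔ p.wNA x := by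
  induction d with
  | zero => rfl
  | succ d ih => exact forUp_wNA.trans ih

theorem tuples_wRA {p : Program} {d : ℕ} (x : ℕ) : (tuples p d).wRA x ↔ p.wRA x := by
  induction d with
  | zero => rfl
  | succ d ih => exact forUp_wRA.trans ih

/-- If `p` keeps the invariants `J` and `A`, and establishes `A` for the tuple `x`, then so does the
loop over all tuples. -/
theorem tuples_runs {p : Program} {n τ D : ℕ} {J A : State → Prop} {x : ℕ → ℕ}
    (hx : ∀ i < D, x i < n) (hJ : ∀ s, J s → s.nreg 0 = n ∧ s.nreg ONE = 1)
    (hJset : ∀ s i v, J s → J (s.setN (fam 6 i) v)) (hAset : ∀ s i v, A s → A (s.setN (fam 6 i) v))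
    (hw : ∀ i, ¬ p.wN (fam 6 i)) (hw0 : ¬ p.wN 0) (hw1 : ¬ p.wN ONE)
    (hp : ∀ s, J s → (∀ i < D, s.nreg (fam 6 i) < n) → Runs p s τ fun s' => J s' ∧ (A s → A s') ∧
      ((∀ i < D, s.nreg (fam 6 i) = x i) → A s')) :
    ∀ d ≤ D, ∀ s, J s → (∀ i, d ≤ i → i < D → s.nreg (fam 6 i) < n) →
      Runs (tuples p d) s (tuplesTime n τ d) fun s' => J s' ∧ (A s → A s') ∧
        ((∀ i, d ≤ i → i < D → s.nreg (fam 6 i) = x i) → A s') := by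
  intro d
  induction d with
  | zero =>
    intro _ s hs hr
    exact (hp s hs fun i hi => hr i (by omega) hi).mono le_rfl fun s' _ ⟨h1, h2, h3⟩ =>
      ⟨h1, h2, fun h => h3 fun i hi => h i (by omega) hi⟩
  | succ d ih =>
    intro hd s hs hr
    have hwd : ∀ i, d ≤ i → ¬ (tuples p d).wN (fam 6 i) := fun i hi h => by
      rcases tuples_wN _ h with h | ⟨j, hj, h⟩
      · exact hw i h
      · rw [fam_inj] at h; omega
    have hwlt : ∀ y < 64, ¬ p.wN y → ¬ (tuples p d).wN y := fun y hy hpy h => by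
      rcases tuples_wN _ h with h | ⟨j, hj, h⟩
      · exact hpy h
      · have := le_fam 6 j; omega
    have := Runs.forUp (i := fam 6 d) (b := 0) (p := tuples p d) (s := s) (tuplesTime n τ d)
      (fun j s' => J s' ∧ (A s → A s') ∧
        ((∀ i, d + 1 ≤ i → i < D → s.nreg (fam 6 i) = x i) → x d < j → A s'))
      (hwd d le_rfl) (hwlt _ (by omega) hw0) (hwlt _ (by omega) hw1)
      (by have := le_fam 6 d; omega) (by have := le_fam 6 d; omega) (hJ s hs).2
      ⟨hJset _ _ _ hs, hAset _ _ _, fun _ h => by omega⟩ ?_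
    · rw [(hJ s hs).1] at this
      exact this.mono le_rfl fun s' _ ⟨h1, h2, h3⟩ => ⟨h1, h2, fun h => h3 h (hx d (by omega))⟩
    · rintro j s' hj hjr ha ⟨h1, h2, h3⟩
      rw [(hJ s hs).1] at hj
      have hreg : ∀ i, d + 1 ≤ i → s'.nreg (fam 6 i) = s.nreg
        (fam 6 i) := fun i hi => ha.n _ fun h => by
        rcases forUp_wN.1 h with h | h
        · rw [fam_inj] at h; omega
        · exact hwd i (by omega) h
      refine (ih (by omega) s' h1 fun i hdi hi => ?_).mono le_rfl fun s'' _ ⟨g1, g2, g3⟩ =>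
        ⟨hJset _ _ _ g1, fun h => hAset _ _ _ (g2 (h2 h)), fun h hxd => hAset _ _ _ ?_⟩
      · rcases hdi.eq_or_lt with rfl | hdi
        · omega
        · rw [hreg i hdi]; exact hr i hdi hi
      · rcases Nat.lt_succ_iff_lt_or_eq.1 hxd with hxd | hxd
        · exact g2 (h3 h hxd)
        · refine g3 fun i hdi hi => ?_
          rcases hdi.eq_or_lt with rfl | hdi
          · omega
          · rw [hreg i hdi]; exact h i hdi hi

theorem Stage.setN (h : Stage K es F s) {x : ℕ} (hx : 40 ≤ x) (v : ℕ) : Stage K es F (s.setN x v) :=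
  h.of_agree (agree_apply (.natConst x v) s) (by simp; omega) (by simp) (by simp)

/-- A round of the search places at least one vertex, if there is an elimination scheme with `q`
colours. -/
theorem tuples_tryTuple_runs (hes : IsEdgeList es) (S : Scheme P.G P.root q)
    (hS : Stage (searchColours q) es F s) (hF : Bordered P.G F (2 * q + 1)) :
    Runs (tuples (tryTuple q) (q + 1)) s
      (tuplesTime P.n (P.n * (P.n * (es.length * 15 + 17) + 20) + q + 11 +
        (q + 1) * (P.n * (es.length * 15 + 9 * q + 36) + 21 * q + 53)) (q + 1))
      fun s' => ∃ F', Stage (searchColours q) es F' s' ∧ Bordered P.G F' (2 * q + 1) ∧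
        (F' = univ ∨ F.card < F'.card) := by
  classical
  -- a tuple that can be placed and is not placed yet, unless all vertices are placed
  obtain ⟨x, hx⟩ : ∃ x : Fin (q + 1) → Fin P.n, F = univ ∨
      (Bordered P.G (F ∪ univ.image x) (2 * q + 1) ∧ ¬ univ.image x ⊆ F) := by
    by_cases hu : F = univ
    · exact ⟨fun _ => P.root, .inl hu⟩
    obtain ⟨u, hu⟩ : ∃ u, u ∉ F := by
      by_contra hcon
      push Not at hcon
      exact hu (Finset.eq_univ_iff_forall.2 hcon)
    obtain ⟨X, hX, huX, hb⟩ := S.exists_extension hF hu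
    refine ⟨fun i => X.toList.getD i u, .inr ?_⟩
    have him : (univ.image fun i : Fin (q + 1) => X.toList.getD i u) = X := by
      ext v
      simp only [mem_image, mem_univ, true_and]
      constructor
      · rintro ⟨i, rfl⟩
        by_cases hi : (i : ℕ) < X.toList.length
        · rw [List.getD_eq_getElem _ _ hi, ← Finset.mem_toList]; exact List.getElem_mem _
        · rwa [List.getD_eq_default _ _ (by omega)]
      · intro hv
        obtain ⟨i, hi, rfl⟩ := List.getElem_of_mem (Finset.mem_toList.2 hv)
        have hi' : i < q + 1 := by rw [Finset.length_toList] at hi; omega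
        exact ⟨⟨i, hi'⟩, List.getD_eq_getElem _ _ hi⟩
    rw [him]
    exact ⟨hb, fun h => hu (h huX)⟩
  have hwreg : ∀ y < 22, y ≠ 6 → y ≠ 7 → ¬ (tryTuple q).wN y := fun y hy h6 h7 h => by
    rcases tryTuple_wN y h with h | h | h | h | ⟨k, h⟩
    any_goals omega
    have := le_fam 5 k; omega
  have := tuples_runs (p := tryTuple q) (n := P.n) (D := q + 1)
    (τ := P.n * (P.n * (es.length * 15 + 17) + 20) + q + 11 +
        (q + 1) * (P.n * (es.length * 15 + 9 * q + 36) + 21 * q + 53))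
    (J := fun s => ∃ F', Stage (searchColours q) es F' s ∧ Bordered P.G F' (2 * q + 1) ∧ F ⊆ F')
    (A := fun s => ∃ F', Stage (searchColours q) es F' s ∧ Bordered P.G F' (2 * q + 1) ∧ F ⊆ F' ∧
      (F' = univ ∨ F.card < F'.card))
    (x := fun i => if h : i < q + 1 then x ⟨i, h⟩ else 0)
    (fun i hi => by simp [hi]) (fun s ⟨F', h, _⟩ => ⟨h.1.n, h.1.one⟩)
    (fun s i v ⟨F', h, h'⟩ => ⟨F', h.setN (by have := le_fam 6 i; omega) v, h'⟩)
    (fun s i v ⟨F', h, h'⟩ => ⟨F', h.setN (by have := le_fam 6 i; omega) v, h'⟩)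
    (fun i h => by
      rcases tryTuple_wN _ h with h | h | h | h | ⟨k, h⟩
      any_goals have := le_fam 6 i; omega
      simp at h)
    (hwreg _ (by omega) (by omega) (by omega)) (hwreg _ (by omega) (by omega) (by omega))
    ?_ (q + 1) le_rfl s ⟨F, hS, hF, subset_rfl⟩ (fun i h h' => by omega)
  · refine this.mono le_rfl fun s' _ ⟨_, _, h⟩ => ?_
    obtain ⟨F', h1, h2, -, h3⟩ := h fun i h h' => by omega
    exact ⟨F', h1, h2, h3⟩
  · rintro s' ⟨F₁, hS₁, hF₁, hFF₁⟩ hreg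
    refine (tryTuple_runs hes hS₁ hF₁ (x := fun i => ⟨s'.nreg (fam 6 i), hreg i i.2⟩)
      (fun i => rfl)).mono le_rfl ?_
    rintro s'' - ⟨F₂, hS₂, hF₂, hsub, himp⟩
    refine ⟨⟨F₂, hS₂, hF₂, hFF₁.trans hsub⟩, ?_, fun hxs => ?_⟩
    · -- the sets only grow
      rintro ⟨F₁', hS₁', hF₁', hFF₁', h⟩
      have heq : F₁' = F₁ := by
        obtain ⟨-, c, vert, bag, col, hp, -, -, -, rfl⟩ := hS₁
        obtain ⟨-, c', vert', bag', col', hp', -, -, -, rfl⟩ := hS₁'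
        ext v
        have e1 : v ∈ placed c vert ↔ s'.narr aPos v ≠ 0 := by
          rw [mem_placed]
          rcases hp.pos_cases v with ⟨h1, h2⟩ | ⟨t, ht, h1, h2⟩
          · simpa [h1] using h2
          · exact iff_of_true ⟨t, ht, h1⟩ (by omega)
        have e2 : v ∈ placed c' vert' ↔ s'.narr aPos v ≠ 0 := by
          rw [mem_placed]
          rcases hp'.pos_cases v with ⟨h1, h2⟩ | ⟨t, ht, h1, h2⟩
          · simpa [h1] using h2
          · exact iff_of_true ⟨t, ht, h1⟩ (by omega)
        rw [e1, e2]
      subst heq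
      refine ⟨F₂, hS₂, hF₂, hFF₁.trans hsub, h.imp (fun h => ?_) fun h =>
        h.trans_le (card_le_card hsub)⟩
      exact Finset.univ_subset_iff.1 (h ▸ hsub)
    · have hx' : (fun i : Fin (q + 1) => (⟨s'.nreg (fam 6 i), hreg i i.2⟩ : Fin P.n)) = x := by
        funext i
        refine Fin.ext ?_
        simp only [hxs i i.2, i.2, dif_pos]
      rw [hx'] at himp
      refine ⟨F₂, hS₂, hF₂, hFF₁.trans hsub, ?_⟩
      rcases hx with h | ⟨h1, h2⟩
      · exact .inl (Finset.univ_subset_iff.1 (h ▸ hFF₁.trans hsub))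
      · by_cases heq : F₁ = F
        · subst heq
          refine .inr (Finset.card_lt_card (hsub.ssubset_of_ne fun he => h2 ?_))
          rw [he]
          exact himp h1
        · exact .inr ((Finset.card_lt_card (hFF₁.ssubset_of_ne (Ne.symm heq))).trans_le
            (card_le_card hsub))

/-- Find an elimination scheme, if there is one with `q` colours. -/
def search (q : ℕ) : Program :=
  .seq placeRoot (forUp 54 0 (tuples (tryTuple q) (q + 1)))

theorem search_runs (hes : IsEdgeList es) (S₀ : Scheme P.G P.root q) :
    Runs (search q) (P.input es)
      (P.n * (tuplesTime P.n (P.n * (P.n * (es.length * 15 + 17) + 20) + q + 11 +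
        (q + 1) * (P.n * (es.length * 15 + 9 * q + 36) + 21 * q + 53)) (q + 1) + 2) + 7)
      fun s' => InstanceMem P es s' ∧ Fresh (searchColours q) s' ∧
        ∃ S : Scheme P.G P.root (searchColours q), S.col 0 = ⟨0, by simp⟩ ∧ SchemeMem S s' := by
  set τ := tuplesTime P.n (P.n * (P.n * (es.length * 15 + 17) + 20) + q + 11 +
        (q + 1) * (P.n * (es.length * 15 + 9 * q + 36) + 21 * q + 53)) (q + 1) with hτ
  set s := P.input es with hs
  have hz : ∀ a, 2 ≤ a → s.narr a = fun _ => 0 := by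
    intro a ha
    obtain ⟨b, rfl⟩ := Nat.exists_eq_add_of_le' ha
    rfl
  have hzr : ∀ a, 2 ≤ a → s.rarr a = fun _ => 0 := by
    intro a ha
    obtain ⟨b, rfl⟩ := Nat.exists_eq_add_of_le' ha
    rfl
  have hP : PartialMem (P := P) 1 (fun _ => P.root) (fun _ => ∅)
      (fun _ => (⟨0, by simp⟩ : Fin (searchColours q))) (placeRoot.run s) :=
    placeRoot_run rfl rfl (by simp) (fun v => by rw [hz _ (by omega)]) (by rw [hz _ (by omega)])
      (fun c t => by rw [hz _ (by have := le_fam 0 (c : ℕ); omega)])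
  have hwN : ∀ y < 40, (tuples (tryTuple q) (q + 1)).wN y → y = 6 ∨ y = 7 ∨ (22 ≤ y ∧ y < 27) := by
    intro y hy h
    rcases tuples_wN y h with h | ⟨i, -, h⟩
    · rcases tryTuple_wN y h with h | h | h | h | ⟨k, h⟩
      any_goals omega
      have := le_fam 5 k; omega
    · have := le_fam 6 i; omega
  have hw54 : ¬ (tuples (tryTuple q) (q + 1)).wN 54 := by
    intro h
    rcases tuples_wN _ h with h | ⟨i, -, h⟩
    · rcases tryTuple_wN _ h with h | h | h | h | ⟨k, h⟩
      any_goals omega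
      have := le_fam 5 k; omega
    · have := le_fam 6 i; omega
  refine ((Runs.seq (q := forUp 54 0 (tuples (tryTuple q) (q + 1))) (t₁ := 5)
    (t₂ := P.n * (τ + 2) + 2) (Q := fun s' => InstanceMem P es s' ∧
      ∃ S : Scheme P.G P.root (searchColours q), S.col 0 = ⟨0, by simp⟩ ∧ SchemeMem S s')
    (Runs.of_run_le (by simp) (by simp) fun ha₁ => ?_)).mono (by omega)
      fun s' ha h => ⟨h.1, ?_, h.2⟩)
  · set s₁ := placeRoot.run s with hs₁
    have hI₁ : InstanceMem P es s₁ := by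
      refine ⟨ha₁.n _ (by simp), ha₁.n _ (by simp),
        ha₁.n _ (by simp), by simp [hs₁],
        ha₁.n _ (by simp), fun i hi => ?_, fun i hi => ?_, fun i hi => ?_, fun v => ?_⟩
      · rw [ha₁.na _ (by simp)]; simp [hs, PCSTInstance.input, hi]
      · rw [ha₁.na _ (by simp)]; simp [hs, PCSTInstance.input, hi]
      · rw [ha₁.ra _ (by simp)]; simp [hs, PCSTInstance.input, hi]
      · rw [ha₁.ra _ (by simp)]; simp [hs, PCSTInstance.input]
    have hS₁ : Stage (searchColours q) es {P.root} s₁ := by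
      refine ⟨hI₁, 1, _, _, _, hP, by omega, rfl, fun t ht i hi _ => by omega, ?_⟩
      simp [placed]
    have := Runs.forUp (i := 54) (b := 0) (p := tuples (tryTuple q) (q + 1)) (s := s₁) τ
      (fun j s' => ∃ F, Stage (searchColours q) es F s' ∧ Bordered P.G F (2 * q + 1) ∧
        (F = univ ∨ j < F.card)) hw54
      (fun h => by have := hwN _ (by omega) h; omega)
      (fun h => by have := hwN _ (by omega) h; omega)
      (by decide) (by decide) hI₁.one ⟨{P.root}, hS₁.setN (by omega) 0,
        bordered_singleton _ _ (by omega), .inr (by simp)⟩ ?_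
    · rw [hI₁.n] at this
      refine this.mono le_rfl fun s' _ ⟨F, hS, _, hF⟩ => ?_
      obtain rfl := hF.resolve_right (by simpa using card_le_univ F)
      obtain ⟨hI, c, vert, bag, col, hp, hc, hcol, -, hpl⟩ := hS
      have hcn : c = P.n := by
        have h1 := congrArg Finset.card hpl
        rw [placed, card_image_of_injOn fun a ha b hb h => hp.isPartial.inj a (by simpa using ha)
          b (by simpa using hb) h] at h1
        simpa using h1
      subst hcn
      obtain ⟨S, hS, hmem⟩ := hp.schemeMem
      exact ⟨hI, S, by rw [hS]; exact Fin.ext hcol, hmem⟩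
    · rintro j s' hj - ha' ⟨F, hS, hF, hor⟩
      refine (tuples_tryTuple_runs hes S₀ hS hF).mono le_rfl ?_
      rintro s'' - ⟨F', hS', hF', hor'⟩
      refine ⟨F', hS'.setN (by omega) _, hF', ?_⟩
      rcases hor' with h | h
      · exact .inl h
      · rcases hor with rfl | h'
        · have := card_le_univ F'
          rw [Finset.card_univ] at h
          omega
        · exact .inr (by omega)
  · have hwNA : ∀ x, (x = 6 ∨ x = 7 ∨ ∃ a c, 1 ≤ a ∧ x = fam a c) → s'.narr x = fun _ => 0 := by
      intro x hx
      have hx' : x = 6 ∨ x = 7 ∨ 64 ≤ x := by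
        rcases hx with h | h | ⟨a, c, -, rfl⟩
        · omega
        · omega
        · have := le_fam a c; omega
      rw [← hz x (by omega)]
      refine ha.na _ fun h => ?_
      simp only [Program.wNA, forUp_wNA, tuples_wNA] at h
      rcases h with h | h
      · simp at h; omega
      · rcases tryTuple_wNA x h with h | h | h | h | h | ⟨k, h⟩
        any_goals omega
        subst h
        have := le_fam fSlot k
        rcases hx with h | h | ⟨a, c, h1, h2⟩
        · omega
        · omega
        · rw [fam_inj] at h2; omega
    have hwRA : s'.rarr = s.rarr := funext fun x => ha.ra _ (by
      simp [tuples_wRA])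
    refine ⟨fun v => ?_, fun e => ?_, fun a c t h => ?_, fun c t => ?_⟩
    · rw [hwNA 6 (.inl rfl)]
    · rw [hwNA 7 (.inr (.inl rfl))]
    · rw [hwNA _ (.inr (.inr ⟨a, c, h, rfl⟩))]
    · rw [hwRA, hzr _ (by have := le_fam 1 c; omega)]

end

/-! ### Instances of bounded treewidth -/

section

open Polynomial

theorem exists_polynomial_tuplesTime (p : ℕ[X]) (d : ℕ) :
    ∃ p' : ℕ[X], ∀ n, p'.eval n = tuplesTime n (p.eval n) d := by
  induction d with
  | zero => exact ⟨p, fun n => rfl⟩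
  | succ d ih =>
    obtain ⟨p', hp'⟩ := ih
    exact ⟨X * (p' + C 2) + C 2, fun n => by simp [tuplesTime, hp']⟩

theorem tuplesTime_mono {n τ τ' : ℕ} (h : τ ≤ τ') (d : ℕ) :
    tuplesTime n τ d ≤ tuplesTime n τ' d := by
  induction d with
  | zero => exact h
  | succ d ih =>
    simp only [tuplesTime]
    gcongr

/-- For bounded treewidth, the search for a scheme followed by the dynamic program takes polynomial
time. -/
theorem exists_solvedBy_input (k : ℕ) : ∃ (A : Program) (p : ℕ[X]), ∀ (P : PCSTInstance)
    (es : List P.G.Dart), IsEdgeList es → treewidth P.G ≤ k →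
      P.SolvedBy es A (P.input es) (p.eval P.n) := by
  set q := k + 2 with hq
  obtain ⟨p₁, hp₁⟩ := exists_polynomial_tuplesTime (X * (X * (X * C q * C 15 + C 17) + C 20) + C q +
    C 11 + C (q + 1) * (X * (X * C q * C 15 + C (9 * q) + C 36) + C (21 * q) + C 53)) (q + 1)
  set K := searchColours q with hK
  refine ⟨.seq (search q) (solve K (by simp [hK])), X * (p₁ + C 2) + C 7 +
    C (Fintype.card (Choice K)) * (X * C (21 * K + 120) + X * C q * C (3 * K + 22)),
    fun P es hes hw => ?_⟩
  obtain ⟨S₀⟩ := exists_scheme_of_treewidth_le hw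
  have hm := S₀.length_edgeList_le hes
  have hrun := Runs.seq (q := solve K (by simp [hK])) (Q := P.IsOutput es)
    (t₂ := Fintype.card (Choice K) * (P.n * (21 * K + 120) + es.length * (3 * K + 22)))
    ((search_runs hes S₀).mono le_rfl fun s' _ ⟨hI, hF, S, hcol, hS⟩ _ =>
      solve_runs (by simp [hK]) hes hI hS hF hcol)
  refine hrun.mono ?_ fun _ _ h => h
  simp only [eval_add, eval_mul, eval_X, eval_C, hp₁]
  refine Nat.add_le_add (Nat.add_le_add_right (Nat.mul_le_mul_left _ (Nat.add_le_add_right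
    (tuplesTime_mono ?_ _) _)) _) ?_
  · gcongr
  · gcongr

end

end SteinerDP

theorem theorem2 :
    -- for every fixed `k`, polynomial time on graphs of treewidth at most `k`
    (∀ k : ℕ, ∃ (A : RAM.Program) (p : Polynomial ℕ),
      ∀ (P : PCSTInstance) (es : List P.G.Dart), IsEdgeList es → treewidth P.G ≤ k →
        P.SolvedBy es A (P.input es) (p.eval P.n)) ∧
    -- given a tree decomposition of width at most `k - 1`: time `O(b_k ^ 3 * s_k * (|V| + |I|))`,
    -- with a constant that does not depend on `k`
    (∃ C : ℕ, ∀ k : ℕ, ∃ A : RAM.Program,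
      ∀ (P : PCSTInstance) (es : List P.G.Dart) (N : ℕ) (D : TreeDecomposition P.G (Fin N))
        (ts : List D.tree.Dart) (bags : Fin N → List (Fin P.n)),
        IsEdgeList es → IsEdgeList ts → IsBagList D bags → D.width < k →
          P.SolvedBy es A (P.inputWithDecomposition es D ts bags)
            (C * (bellNum k ^ 3 * subgraphNum k * (P.n + N)))) := by
  refine ⟨SteinerDP.exists_solvedBy_input, 2 ^ 50, fun k => ⟨.seq (SteinerDP.prepare (k + 1))
    (SteinerDP.solve (k + 1) (Nat.succ_pos k)), fun P es N D ts bags hes hts hbl hw =>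
    SteinerDP.solvedBy_inputWithDecomposition hes hts hbl hw⟩⟩
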